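/- **Conventions.** All functions are on $\mathbb R^2$ or on $\mathbb R_t\times\mathbb R^2_x$; $\langle\xi\rangle=(1+|\xi|^2)^{1/2}$, and $\langle D\rangle$, $e^{it\langle D\rangle}$ are the Fourier multipliers with symbols $\langle\xi\rangle$, $e^{it\langle\xi\rangle}$. Fix an even $\rho\in C_c^\infty(-2,2)$, non-increasing on $[0,\infty)$, with $0\le\rho\le1$ and $\rho=1$ on $[-1,1]$, and for $y\in\mathbb R$ or $y\in\mathbb R^2$ put $\chi_k(y)=\rho(2^{-k}|y|)-\rho(2^{1-k}|y|)$, $\tilde\chi_k=\chi_{k-1}+\chi_k+\chi_{k+1}$, $\chi_{\le n}=\sum_{i\le n}\chi_i$. For each integer $l\ge0$ let $\mathcal K_l$ be a finite collection of closed arcs $\kappa$ (caps) of the unit circle, each of Euclidean diameter $2^{-l}$, that covers the circle, is invariant under $\omega\mapsto-\omega$, and overlaps at most $N$-fold, $N$ independent of $l$. For $a>0$ let $a\Gamma_\kappa$ be the closed cone with vertex $0$ over the arc that has the same center $\omega(\kappa)$ as $\kappa$ and $a$ times its angle. Let $(\eta_\kappa)_{\kappa\in\mathcal K_l}$ be a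 partition of unity on $\mathbb R^2\setminus\{0\}$ into non-negative smooth functions, homogeneous of degree $0$, with $\operatorname{supp}\eta_\kappa\subset\frac32\Gamma_\kappa$, and let $\tilde\eta_\kappa\ge0$ be smooth, homogeneous of degree $0$, with support equal to $2\Gamma_\kappa$ and $\tilde\eta_\kappa\eta_\kappa=\eta_\kappa$; both families satisfy $|\partial^\beta\eta(\xi)|\le C_\beta 2^{l|\beta|}|\xi|^{-|\beta|}$ and $|(\omega(\kappa)\cdot\nabla)^n\eta(\xi)|\le C_n|\xi|^{-n}$, with constants independent of $l$ and $\kappa$. Fix an integer $c>30$. Define $$A_{k,\kappa}=\operatorname{supp}(\eta_\kappa\chi_k),\quad \tilde A_{k,\kappa}=\operatorname{supp}(\tilde\eta_\kappa\tilde\chi_k),\quad B_{k,\kappa}=\operatorname{supp}\big[\chi_{\le k-2l-c}(\tau-\langle\xi\rangle)\,\eta_\kappa(\xi)\chi_k(\xi)\big]\subset\mathbb R_\tau\times\mathbb R^2_\xi .$$ For $\lambda\in\mathbb R$ and $\omega=(\omega_1,\omega_2)\in\mathbb S^1$ let $\Theta=(1+\lambda^2)^{-1/2}(\lambda,\omega)$,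 $\Theta^\perp=(1+\lambda^2)^{-1/2}(-1,\lambda\omega)$, $\omega^\perp=(-\omega_2,\omega_1)$, and let $(t_\Theta,x^1_\Theta,x^2_\Theta)$ be the coordinates of $(t,x)$ in the orthonormal frame $\Theta,\Theta^\perp,(0,\omega^\perp)$; $x_\Theta=(x^1_\Theta,x^2_\Theta)$. For $r\in\mathbb N$ let $\Lambda_{99,\omega}=\{i2^{-r}: i\in\mathbb Z,\ |i|\le 2^r(1+2^{-202})^{-1/2}\}\times\{\omega\}$ and, for $j\ge100$, $\Lambda_{j,\omega}=\{(1+\mu^{-2})^{-1/2}:\mu\in2^{2j-r-20}\mathbb Z\cap[2^{j-3},2^{j+3}]\}\times\{\omega\}$ if $j<r+20$, and $\Lambda_{j,\omega}=\{(1+2^{-2j})^{-1/2}\}\times\{\omega\}$ if $j\ge r+20$. **Theorem.** Let $j,k$ be integers, $m=\min(j,k)\ge99$, $0\le l\le m+10$, $\kappa\in\mathcal K_l$, $\omega\in\mathbb S^1$, $(\lambda,\omega)\in\Lambda_{j,\omega}$, $\alpha=\operatorname{dist}(\omega,\kappa)$ and $\tilde\alpha=\max(\alpha,2^{-m})$.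 Assume that either * $l\le m+9$, $j\ge100$, $2^{-3-l}\le\alpha\le2^{3-l}$, and $\big|\omega-\xi/|\xi|\big|\ge2^{-3-l}$ for all $\xi\in A_{k,\kappa}$; or * $l=m+10$ and $\alpha\le2^{3-l}$. Consider the two ranges * (R1) $l\le m-10$, or $l=m+10$ and $|j-k|\ge10$; * (R2) $l\le m+9$ and $\big|\omega+\xi/|\xi|\big|\ge2^{-3-l}$ for all $\xi\in A_{k,\kappa}$ (automatic for $l\ge3$). The implicit constants below depend only on $\rho$, on the caps and the functions $\eta_\kappa,\tilde\eta_\kappa$, and on $c$. (i) Let $f\in L^2(\mathbb R^2)$ with $\operatorname{supp}\hat f\subset A_{k,\kappa}$. Then $$\tilde\alpha\,\|e^{it\langle D\rangle}f\|_{L^\infty_{t_\Theta}L^2_{x_\Theta}}\lesssim\|f\|_{L^2}\ \text{ in (R1)},\qquad \alpha^{1/2}\|e^{it\langle D\rangle}f\|_{L^\infty_{x^2_\Theta}L^2_{(t,x^1)_\Theta}}\lesssim\|f\|_{L^2}\ \text{ in (R2)}.$$ (ii) Let $g$ be a function on space-time whose space-time Fourier transform is supported in $B_{k,\kappa}$,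 with $g\in L^1_{t_\Theta}L^2_{x_\Theta}$ in case (R1), respectively $g\in L^1_{x^2_\Theta}L^2_{(t,x^1)_\Theta}$ in case (R2). Then the equation $(i\partial_t+\langle D\rangle)u=g$, $u(0)=0$, has a (distributional) solution $u\in C(\mathbb R;L^2(\mathbb R^2))$, and every such solution satisfies $$\tilde\alpha\,\|u\|_{L^\infty_{t_\Theta}L^2_{x_\Theta}}\lesssim\tilde\alpha^{-1}\|g\|_{L^1_{t_\Theta}L^2_{x_\Theta}},\quad\text{respectively}\quad \alpha^{1/2}\|u\|_{L^\infty_{x^2_\Theta}L^2_{(t,x^1)_\Theta}}\lesssim\alpha^{-1/2}\|g\|_{L^1_{x^2_\Theta}L^2_{(t,x^1)_\Theta}} .$$ (iii) In the situation of (ii), in case (R1) there are $\tilde v_0\in L^2(\mathbb R^2)$ and an integrable family $(v_s)_{s\in\mathbb R}$ in $L^2(\mathbb R^2)$, all with Fourier transform supported in $\tilde A_{k,\kappa}$, such that for all $t$ $$u(t)=e^{it\langle D\rangle}\tilde v_0+\int_{-\infty}^\infty 1_{\{t_\Theta>s\}}\,e^{it\langle D\rangle}v_s\,ds,\qquad \|\tilde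 v_0\|_{L^2}+\int_{-\infty}^\infty\|v_s\|_{L^2}\,ds\lesssim\tilde\alpha^{-1}\|g\|_{L^1_{t_\Theta}L^2_{x_\Theta}} .$$ In case (R2) the same holds with $1_{\{x^2_\Theta>s\}}$ in place of $1_{\{t_\Theta>s\}}$ and with the bound $\alpha^{-1/2}\|g\|_{L^1_{x^2_\Theta}L^2_{(t,x^1)_\Theta}}$. -/

import Mathlib

open MeasureTheory Set Filter Topology
open scoped FourierTransform ENNReal

noncomputable section

namespace HalfKG

/-! ### Frequency localization -/

/-- The frequency plane and the physical plane. -/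
abbrev E2 : Type := EuclideanSpace ℝ (Fin 2)

/-- The Hilbert space `L²(ℝ²)`. -/
abbrev L2 : Type := Lp ℂ 2 (volume : Measure E2)

/-- Japanese bracket `⟨ξ⟩ = (1 + |ξ|^2)^(1/2)`. -/
def jb (ξ : E2) : ℝ := Real.sqrt (1 + ‖ξ‖ ^ 2)

/-- The radial cutoff profiles: smooth, even, compactly supported in `(-2,2)`, equal to one on
`[-1,1]`, with values in `[0,1]`, decreasing on the positive half-line. -/
structure IsCutoff (ρ : ℝ → ℝ) : Prop where
  smooth : ContDiff ℝ (⊤ : ℕ∞) ρ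
  even : ∀ s, ρ (-s) = ρ s
  supp : tsupport ρ ⊆ Ioo (-2) 2
  eq_one : ∀ s, |s| ≤ 1 → ρ s = 1
  nonneg : ∀ s, 0 ≤ ρ s
  le_one : ∀ s, ρ s ≤ 1
  anti : AntitoneOn ρ (Ici 0)

/-- The dyadic bump `χ_k`, as a function of a real number; on the plane it is evaluated at `‖ξ‖`. -/
def chi (ρ : ℝ → ℝ) (k : ℤ) (s : ℝ) : ℝ :=
  ρ ((2 : ℝ) ^ (-k) * |s|) - ρ ((2 : ℝ) ^ (-k + 1) * |s|)

/-- The fattened bump `χ_{k-1} + χ_k + χ_{k+1}`. -/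
def chiTilde (ρ : ℝ → ℝ) (k : ℤ) (s : ℝ) : ℝ :=
  chi ρ (k - 1) s + chi ρ k s + chi ρ (k + 1) s

/-- `χ_{≤ n}`, the sum of all `χ_i` with `i ≤ n`. -/
def chiLe (ρ : ℝ → ℝ) (n : ℤ) (s : ℝ) : ℝ := ∑' i : ℕ, chi ρ (n - (i : ℤ)) s

/-- Half of the opening angle of an arc of the unit circle whose Euclidean diameter is `2^(-l)`. -/
def capAngle (l : ℕ) : ℝ := Real.arcsin ((2 : ℝ) ^ (-(l : ℤ)) / 2)

/-- The closed cone with vertex `0`, axis the unit vector `κ` and half-opening angle `φ ∈ [0,π]`. -/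
def cone (κ : E2) (φ : ℝ) : Set E2 := {ξ | ‖ξ‖ * Real.cos φ ≤ inner ℝ ξ κ}

/-- The cap of diameter `2^(-l)` centered at `κ`. -/
def cap (l : ℕ) (κ : E2) : Set E2 := cone κ (capAngle l) ∩ Metric.sphere 0 1

/-- The symbol bounds required of the angular cutoffs: on the whole, each derivative costs
`2^l / |ξ|`; in the direction of the center of the cap, it costs only `1 / |ξ|`. -/
def HasAngularBounds (η : ℕ → E2 → E2 → ℝ) (K : ℕ → Finset E2) : Prop :=
  ∀ n : ℕ, ∃ C : ℝ, ∀ l : ℕ, ∀ κ ∈ K l, ∀ ξ : E2, ξ ≠ 0 →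
    ‖iteratedFDeriv ℝ n (η l κ) ξ‖ ≤ C * (2 : ℝ) ^ (l * n) * (‖ξ‖ ^ n)⁻¹ ∧
    |iteratedFDeriv ℝ n (η l κ) ξ (fun _ => κ)| ≤ C * (‖ξ‖ ^ n)⁻¹

/-- The angular localization. For every `l`, the finite set `K l` consists of the centers of the
caps of diameter `2^(-l)`; a cap is identified with its center `κ`. The cutoff `η l κ` belongs to
the partition of unity, `ηt l κ` is the fattened one. -/
structure AngularSystem where
  K : ℕ → Finset E2
  unit : ∀ l, ∀ κ ∈ K l, ‖κ‖ = 1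
  symm : ∀ l, ∀ κ ∈ K l, -κ ∈ K l
  cover : ∀ l, ∀ θ : E2, ‖θ‖ = 1 → ∃ κ ∈ K l, θ ∈ cap l κ
  overlap : ∃ N : ℕ, ∀ l, ∀ θ : E2, {κ | κ ∈ K l ∧ θ ∈ cap l κ}.ncard ≤ N
  η : ℕ → E2 → E2 → ℝ
  ηt : ℕ → E2 → E2 → ℝ
  smooth : ∀ l, ∀ κ ∈ K l, ContDiffOn ℝ (⊤ : ℕ∞) (η l κ) {0}ᶜ
  smooth_t : ∀ l, ∀ κ ∈ K l, ContDiffOn ℝ (⊤ : ℕ∞) (ηt l κ) {0}ᶜ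
  nonneg : ∀ l, ∀ κ ∈ K l, ∀ ξ, 0 ≤ η l κ ξ
  nonneg_t : ∀ l, ∀ κ ∈ K l, ∀ ξ, 0 ≤ ηt l κ ξ
  homog : ∀ l, ∀ κ ∈ K l, ∀ (a : ℝ) (ξ : E2), 0 < a → η l κ (a • ξ) = η l κ ξ
  homog_t : ∀ l, ∀ κ ∈ K l, ∀ (a : ℝ) (ξ : E2), 0 < a → ηt l κ (a • ξ) = ηt l κ ξ
  supp : ∀ l, ∀ κ ∈ K l, tsupport (η l κ) ⊆ cone κ (3 / 2 * capAngle l)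
  supp_t : ∀ l, ∀ κ ∈ K l, tsupport (ηt l κ) = cone κ (2 * capAngle l)
  partition : ∀ l, ∀ ξ : E2, ξ ≠ 0 → ∑ κ ∈ K l, η l κ ξ = 1
  reproducing : ∀ l, ∀ κ ∈ K l, ∀ ξ : E2, ξ ≠ 0 → ηt l κ ξ * η l κ ξ = η l κ ξ
  bounds : HasAngularBounds η K
  bounds_t : HasAngularBounds ηt K

/-- `A_{k,κ}`, the support of `η_κ χ_k`. -/
def setA (ρ : ℝ → ℝ) (S : AngularSystem) (k : ℤ) (l : ℕ) (κ : E2) : Set E2 :=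
  tsupport fun ξ : E2 => S.η l κ ξ * chi ρ k ‖ξ‖

/-- The fattened `A_{k,κ}`. -/
def setAt (ρ : ℝ → ℝ) (S : AngularSystem) (k : ℤ) (l : ℕ) (κ : E2) : Set E2 :=
  tsupport fun ξ : E2 => S.ηt l κ ξ * chiTilde ρ k ‖ξ‖

/-- `B_{k,κ}`, the support of the space-time symbol `χ_{≤ k-2l-c}(τ - ⟨ξ⟩) η_κ(ξ) χ_k(ξ)`. -/
def setB (ρ : ℝ → ℝ) (S : AngularSystem) (c : ℕ) (k : ℤ) (l : ℕ) (κ : E2) : Set (ℝ × E2) :=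
  tsupport fun q : ℝ × E2 =>
    chiLe ρ (k - 2 * (l : ℤ) - (c : ℤ)) (q.1 - jb q.2) * (S.η l κ q.2 * chi ρ k ‖q.2‖)

/-! ### Frames -/

/-- `ω^⊥ = (-ω₂, ω₁)`. -/
def perp (ω : E2) : E2 := !₂[-(ω 1), ω 0]

def Theta (lam : ℝ) (ω : E2) : ℝ × E2 := (Real.sqrt (1 + lam ^ 2))⁻¹ • (lam, ω)

def ThetaPerp (lam : ℝ) (ω : E2) : ℝ × E2 := (Real.sqrt (1 + lam ^ 2))⁻¹ • (-1, lam • ω)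

def ThetaZero (ω : E2) : ℝ × E2 := (0, perp ω)

/-- The coordinate `t_Θ` of `(t,x)`: its scalar product with `Θ`. -/
def tTheta (lam : ℝ) (ω : E2) (t : ℝ) (x : E2) : ℝ :=
  (Theta lam ω).1 * t + inner ℝ (Theta lam ω).2 x

/-- The coordinate `x²_Θ` of `(t,x)`: its scalar product with `(0, ω^⊥)`. -/
def x2Theta (ω : E2) (t : ℝ) (x : E2) : ℝ :=
  (ThetaZero ω).1 * t + inner ℝ (ThetaZero ω).2 x

/-- The space-time point whose coordinates in the orthonormal frame
`Θ, Θ^⊥, (0, ω^⊥)` are `(t_Θ, x¹_Θ, x²_Θ) = (a, b, d)`. -/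
def framePoint (lam : ℝ) (ω : E2) (a b d : ℝ) : ℝ × E2 :=
  a • Theta lam ω + b • ThetaPerp lam ω + d • ThetaZero ω

/-- `L²` norm over `x_Θ = (x¹_Θ, x²_Θ)` at `t_Θ = a`. -/
def sliceT (lam : ℝ) (ω : E2) (F : ℝ → E2 → ℂ) (a : ℝ) : ℝ≥0∞ :=
  eLpNorm (fun y : ℝ × ℝ =>
    F (framePoint lam ω a y.1 y.2).1 (framePoint lam ω a y.1 y.2).2) 2 volume

/-- `L²` norm over `(t_Θ, x¹_Θ)` at `x²_Θ = d`. -/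
def sliceX (lam : ℝ) (ω : E2) (F : ℝ → E2 → ℂ) (d : ℝ) : ℝ≥0∞ :=
  eLpNorm (fun y : ℝ × ℝ =>
    F (framePoint lam ω y.1 y.2 d).1 (framePoint lam ω y.1 y.2 d).2) 2 volume

/-- The norm of `L^∞_{t_Θ} L²_{x_Θ}`. -/
def normLinfT (lam : ℝ) (ω : E2) (F : ℝ → E2 → ℂ) : ℝ≥0∞ := essSup (sliceT lam ω F) volume

/-- The norm of `L^1_{t_Θ} L²_{x_Θ}`. -/
def normL1T (lam : ℝ) (ω : E2) (F : ℝ → E2 → ℂ) : ℝ≥0∞ := ∫⁻ a, sliceT lam ω F a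

/-- The norm of `L^∞_{x²_Θ} L²_{(t,x¹)_Θ}`. -/
def normLinfX (lam : ℝ) (ω : E2) (F : ℝ → E2 → ℂ) : ℝ≥0∞ := essSup (sliceX lam ω F) volume

/-- The norm of `L^1_{x²_Θ} L²_{(t,x¹)_Θ}`. -/
def normL1X (lam : ℝ) (ω : E2) (F : ℝ → E2 → ℂ) : ℝ≥0∞ := ∫⁻ d, sliceX lam ω F d

/-- The admissible parameters `λ` at frequency `2^k`, for the time scale `2^r`. -/
def lamSet (r : ℕ) (k : ℤ) : Set ℝ :=
  {lam | (k ≤ 99 ∧ ∃ i : ℤ, lam = (i : ℝ) * (2 : ℝ) ^ (-(r : ℤ)) ∧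
        |(i : ℝ)| ≤ (2 : ℝ) ^ r / Real.sqrt (1 + (2 : ℝ) ^ (-2 * k - 4))) ∨
    (100 ≤ k ∧ k < (r : ℤ) + 20 ∧ ∃ μ : ℝ, (∃ i : ℤ, μ = (2 : ℝ) ^ (2 * k - (r : ℤ) - 20) * (i : ℝ)) ∧
        (2 : ℝ) ^ (k - 3) ≤ μ ∧ μ ≤ (2 : ℝ) ^ (k + 3) ∧
        lam = 1 / Real.sqrt (1 + (μ ^ 2)⁻¹)) ∨
    (100 ≤ k ∧ (r : ℤ) + 20 ≤ k ∧ lam = 1 / Real.sqrt (1 + (2 : ℝ) ^ (-2 * k)))}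

/-- `Λ_{k,ω}`. -/
def LambdaSet (r : ℕ) (k : ℤ) (ω : E2) : Set (ℝ × E2) := lamSet r k ×ˢ {ω}

/-! ### Free waves and the inhomogeneous equation

Frequencies are normalized by plane waves `e^{i x·ξ}`, so that the frequency `ξ` corresponds to the
argument `ξ / (2π)` of Mathlib's Fourier transform. -/

/-- The Fourier transform of `f ∈ L²` is supported in the closed set `A`. -/
def HatSuppIn (f : L2) (A : Set E2) : Prop :=
  ∀ᵐ ζ : E2, (2 * Real.pi) • ζ ∉ A → (𝓕 f : L2) ζ = 0

/-- The free wave `(e^{it⟨D⟩} f)(x)`, for `f ∈ L²` with compactly supported Fourier transform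
(the integral then converges absolutely). -/
def freeWave (f : L2) (t : ℝ) (x : E2) : ℂ :=
  ∫ ζ : E2, Complex.exp (Complex.I * ((2 * Real.pi * inner ℝ x ζ : ℝ) : ℂ)) *
    Complex.exp (Complex.I * ((t * jb ((2 * Real.pi) • ζ) : ℝ) : ℂ)) *
    (𝓕 f : L2) ζ

/-- `⟨D⟩ φ` for a Schwartz function `φ`. -/
def japD (φ : SchwartzMap E2 ℂ) (x : E2) : ℂ :=
  𝓕⁻ (fun ζ : E2 => ((jb ((2 * Real.pi) • ζ) : ℝ) : ℂ) * 𝓕 (φ : E2 → ℂ) ζ) x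

/-- `u` is the solution, continuous in time with values in `L²`, of
`(i ∂_t + ⟨D⟩) u = g`, `u(0) = 0`; the equation is tested against Schwartz functions of `x` and
integrated in time. -/
structure IsSolution (g u : ℝ → E2 → ℂ) : Prop where
  meas : AEStronglyMeasurable (fun p : ℝ × E2 => u p.1 p.2) volume
  memLp : ∀ t, MemLp (u t) 2 volume
  cont : ∀ t₀, Tendsto (fun t => eLpNorm (u t - u t₀) 2 volume) (𝓝 t₀) (𝓝 0)
  init : u 0 =ᵐ[volume] 0
  eqn : ∀ (φ : SchwartzMap E2 ℂ) (t : ℝ),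
    Complex.I * (∫ x, u t x * φ x) + (∫ s in (0 : ℝ)..t, ∫ x, u s x * japD φ x) =
      ∫ s in (0 : ℝ)..t, ∫ x, g s x * φ x

/-- The Fourier integral on space-time `ℝ × ℝ²`. -/
def stFourier (φ : ℝ × E2 → ℂ) (p : ℝ × E2) : ℂ :=
  ∫ q : ℝ × E2, Complex.exp (-Complex.I * ((p.1 * q.1 + inner ℝ p.2 q.2 : ℝ) : ℂ)) * φ q

/-- The distributional space-time Fourier transform of `g` is supported in the closed set `B`. -/
def FourierSuppIn (g : ℝ → E2 → ℂ) (B : Set (ℝ × E2)) : Prop :=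
  ∀ φ : ℝ × E2 → ℂ, ContDiff ℝ (⊤ : ℕ∞) φ → HasCompactSupport φ → Disjoint (tsupport φ) B →
    ∫ p : ℝ × E2, g p.1 p.2 * stFourier φ p = 0

/-- `u(t) = e^{it⟨D⟩} v₀ + ∫ 1_{y > s} e^{it⟨D⟩} v_s ds` for the space-time function `y`, where
all the data have Fourier transforms supported in `A` and `∫ ‖v_s‖ ds < ∞`. -/
structure IsTruncatedSuperposition (y : ℝ → E2 → ℝ) (A : Set E2) (u : ℝ → E2 → ℂ)
    (v₀ : L2) (v : ℝ → L2) : Prop where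
  supp_zero : HatSuppIn v₀ A
  supp : ∀ s, HatSuppIn (v s) A
  integrable : Integrable v volume
  eq : ∀ t : ℝ, ∀ᵐ x : E2, u t x =
    freeWave v₀ t x + ∫ s : ℝ, Set.indicator {s | s < y t x} (fun s => freeWave (v s) t x) s

end HalfKG

end

/-!
A free wave `e^{it⟨D⟩}f` is a superposition of plane waves with frequencies on the hyperboloid
`τ = ⟨ξ⟩`. In an orthonormal frame of space-time whose evolution direction `e₀` is transversal to
the hyperboloid over the Fourier support of `f`, it is also an evolution with respect to the
coordinate `y = (t,x)·e₀`: on a level set of `y` the wave is the inverse Fourier transform of a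
density in the spatial frequencies of the frame, and passing from `ξ` to these costs the Jacobian,
which is the quotient of the component of the normal `(⟨ξ⟩, -ξ)` along `e₀` by `⟨ξ⟩`. If the
Jacobian is at least `δ`, then the `L²` norms on the level sets are at most `√(2/δ)‖f‖`
(`IsTransversal.slice_freeWave_le`); the `2` accounts for the two intersections of a line with the
two-sheeted hyperboloid. Throughout, `ζ = ξ/2π` is the frequency of Mathlib's Fourier transform.

For the inhomogeneous equation, a source `g` in `L¹_y L²` with bounded spectrum has a spectral
density, expressed by its partial Fourier transform `γ` in the spatial variables of the frame
(`exists_spectral`), and the Duhamel integral of that density is the only solution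
(`isSolution_duhamel`, `IsSolution.ae_eq`). The points near the hyperboloid are written as
`(⟨ζ⟩, ζ) + θ e₀` (`Frame.pt`). In the coordinates `(θ, ζ)` the factor `1/(τ - ⟨ξ⟩)` of the Duhamel
integral becomes a smooth function divided by `θ`. Therefore the Duhamel integral is the sum of an
integral from `0` to `y` of free waves with Fourier data `v̂(s, ζ)`, in which `s` is dual to `θ`, and
of a remainder (`SpectralData.duhamel_eq`, `SpectralData.firstPart_eq`). The remainder is a difference
quotient of waves on the hyperboloid, hence it is a free wave; at `t = 0` the Duhamel integral
vanishes, so that the data of the remainder are controlled by the first part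
(`SpectralData.remPart_freeWave`).
The data `v̂` arise from `γ`, restricted to the hyperboloid, by convolution in `s` with an
oscillatory integral whose amplitude is smooth on the scale `Δ` of the chart. Two integrations by
parts bound it by an integrable kernel of mass independent of `Δ`, so that
`∫ ‖v(s)‖ ds ≲ δ^{-1/2} ‖g‖` (`SpectralData.lintegral_eLpNorm_vHat_le`). Writing
`∫₀^y = ∫_{s<y} - ∫_{s<0}` gives the representation by truncated free waves
(`SpectralData.exists_superposition`). On a single level set of `y` a truncated superposition is one
free wave, so that the sup bound for the solution follows from the bound for free waves
(`slice_truncated_le`). The result is `transversal_estimates`, and, for compact sets of frequencies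
and sources of small modulation, `estimates_of_compact`.

It remains to verify transversality. For `e₀ = Θ` the normal component is, up to a bounded factor,
`λ⟨ξ⟩ - ω·ξ = (⟨ξ⟩ - ω·ξ) - (1 - λ)⟨ξ⟩`. Relative to `|ξ|` the first term has the size
`⟨ξ⟩^{-2} + ∠(ω,ξ)²`, while `1 - λ` is comparable with `2^{-2j}` if `j ≥ 100`, and at
least of that size if `j = 99`. The hypotheses ensure
that one of the angle, the mass and `1 - λ` dominates the other two, so that there is no cancellation
and `δ` is comparable with `α̃²` or larger (`exists_charNormal_lower`). For `e₀ = (0, ω^⊥)` the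
normal component is `|ξ|` times the sine of the angle between `ω` and `ξ`, and `δ` is comparable
with `α` (`frameX_conditions`).
-/


open MeasureTheory Set Filter Topology
open scoped FourierTransform ENNReal

noncomputable section

namespace HalfKG

/-! ### Plane waves and the Fourier transform on `L²` -/

/-- The character `s ↦ e^{2πis}`. -/
def ce (s : ℝ) : ℂ := Complex.exp (((2 * Real.pi * s : ℝ) : ℂ) * Complex.I)

@[simp] lemma norm_ce (s : ℝ) : ‖ce s‖ = 1 := Complex.norm_exp_ofReal_mul_I _

@[simp] lemma ce_zero : ce 0 = 1 := by simp [ce]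

lemma ce_add (s t : ℝ) : ce (s + t) = ce s * ce t := by
  rw [ce, ce, ce, ← Complex.exp_add]; push_cast; ring_nf

lemma continuous_ce : Continuous ce := by unfold ce; fun_prop

lemma hasDerivAt_ce (s : ℝ) : HasDerivAt ce (2 * Real.pi * Complex.I * ce s) s := by
  unfold ce
  have h1 : HasDerivAt (fun s : ℝ => ((2 * Real.pi * s : ℝ) : ℂ) * Complex.I)
      (((2 * Real.pi : ℝ) : ℂ) * Complex.I) s := by
    have := ((hasDerivAt_id s).const_mul (2 * Real.pi)).ofReal_comp.mul_const Complex.I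
    simpa using this
  convert h1.cexp using 1
  push_cast
  ring

lemma norm_ce_sub_le (s t : ℝ) : ‖ce s - ce t‖ ≤ 2 * Real.pi * |s - t| := by
  have := Convex.norm_image_sub_le_of_norm_hasDerivWithin_le (f := ce) (s := univ)
    (x := t) (y := s) (C := 2 * Real.pi)
    (fun x _ => (hasDerivAt_ce x).hasDerivWithinAt) (fun x _ => by
      simp [abs_of_pos Real.pi_pos]) convex_univ (mem_univ _) (mem_univ _)
  simpa using this

lemma measurable_ce : Measurable ce := continuous_ce.measurable

@[fun_prop] lemma Continuous.ce {X : Type*} [TopologicalSpace X] {f : X → ℝ} (hf : Continuous f) :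
    Continuous fun x => ce (f x) := continuous_ce.comp hf

lemma fourier_eq_ce {V : Type*} [NormedAddCommGroup V] [InnerProductSpace ℝ V]
    [FiniteDimensional ℝ V] [MeasurableSpace V] [BorelSpace V] (k : V → ℂ) (x : V) :
    𝓕 k x = ∫ y, ce (-inner ℝ y x) * k y := by
  rw [Real.fourier_eq']
  refine integral_congr_ae (ae_of_all _ fun y => ?_)
  simp only [ce, smul_eq_mul]
  congr 3
  push_cast; ring

lemma fourierInv_eq_ce {V : Type*} [NormedAddCommGroup V] [InnerProductSpace ℝ V]
    [FiniteDimensional ℝ V] [MeasurableSpace V] [BorelSpace V] (k : V → ℂ) (x : V) :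
    𝓕⁻ k x = ∫ y, ce (inner ℝ y x) * k y := by
  rw [Real.fourierInv_eq']
  rfl

/-- The multiplication formula for `f ∈ L²` and a Schwartz function. -/
lemma integral_L2_mul_fourier (f : L2) (ψ : SchwartzMap E2 ℂ) :
    ∫ x, f x * 𝓕 (ψ : E2 → ℂ) x = ∫ x, (𝓕 f : L2) x * ψ x := by
  have h := congrArg (fun T => T ψ) (Lp.fourier_toTemperedDistribution_eq f)
  simp only [TemperedDistribution.fourier_apply, Lp.toTemperedDistribution_apply] at h
  rw [← SchwartzMap.fourier_coe]
  calc _ = ∫ x, (𝓕 ψ) x • f x := by simp only [smul_eq_mul, mul_comm]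
    _ = _ := h
    _ = _ := by simp only [smul_eq_mul, mul_comm]

/-- On `L¹ ∩ L²`, the `L²` Fourier transform is given by the Fourier integral. -/
lemma fourier_toLp_ae_eq {k : E2 → ℂ} (hk : Integrable k) (hk2 : MemLp k 2) :
    ((𝓕 (hk2.toLp k) : L2) : E2 → ℂ) =ᵐ[volume] 𝓕 k := by
  have hcont : Continuous (𝓕 k) := VectorFourier.fourierIntegral_continuous
    Real.continuous_fourierChar (by exact continuous_inner) hk
  refine ae_eq_of_integral_contDiff_smul_eq
    ((Lp.memLp (𝓕 (hk2.toLp k) : L2)).locallyIntegrable (by norm_num))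
    hcont.locallyIntegrable fun g hg hgc => ?_
  have hg₁ : HasCompactSupport (Complex.ofRealCLM ∘ g) := hgc.comp_left rfl
  have hg₂ : ContDiff ℝ (⊤ : ℕ∞) (Complex.ofRealCLM ∘ g) := by fun_prop
  set ψ := hg₁.toSchwartzMap hg₂
  have hψ : ∀ x, ψ x = (g x : ℂ) := fun x => rfl
  have e1 := integral_L2_mul_fourier (hk2.toLp k) ψ
  have e2 : ∫ x, 𝓕 k x * ψ x = ∫ x, k x * 𝓕 (ψ : E2 → ℂ) x := by
    have := VectorFourier.integral_fourierIntegral_smul_eq_flip (L := innerₗ E2) (μ := volume)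
      (ν := volume) Real.continuous_fourierChar
      (by exact continuous_inner) hk ψ.integrable
    simpa [smul_eq_mul, flip_innerₗ] using! this
  have e3 : ∫ x, (hk2.toLp k) x * 𝓕 (ψ : E2 → ℂ) x = ∫ x, k x * 𝓕 (ψ : E2 → ℂ) x := by
    refine integral_congr_ae ?_
    filter_upwards [hk2.coeFn_toLp] with x hx
    rw [hx]
  calc ∫ x, g x • (𝓕 (hk2.toLp k) : L2) x = ∫ x, (𝓕 (hk2.toLp k) : L2) x * ψ x := by
        simp only [hψ, Complex.real_smul, mul_comm]
    _ = ∫ x, 𝓕 k x * ψ x := by rw [← e1, e3, e2]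
    _ = _ := by simp only [hψ, Complex.real_smul, mul_comm]

/-- On `L¹ ∩ L²`, the inverse `L²` Fourier transform is given by the Fourier integral. -/
lemma fourierInv_toLp_ae_eq {k : E2 → ℂ} (hk : Integrable k) (hk2 : MemLp k 2) :
    ((𝓕⁻ (hk2.toLp k) : L2) : E2 → ℂ) =ᵐ[volume] 𝓕⁻ k := by
  have hcont : Continuous (𝓕 k) := VectorFourier.fourierIntegral_continuous
    Real.continuous_fourierChar (by exact continuous_inner) hk
  have hcont' : Continuous (𝓕⁻ k) := by
    have : 𝓕⁻ k = fun x => 𝓕 k (-x) := by ext x; rw [Real.fourierInv_eq_fourier_neg]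
    rw [this]; exact hcont.comp continuous_neg
  refine ae_eq_of_integral_contDiff_smul_eq
    ((Lp.memLp (𝓕⁻ (hk2.toLp k) : L2)).locallyIntegrable (by norm_num))
    hcont'.locallyIntegrable fun g hg hgc => ?_
  have hg₁ : HasCompactSupport (Complex.ofRealCLM ∘ g) := hgc.comp_left rfl
  have hg₂ : ContDiff ℝ (⊤ : ℕ∞) (Complex.ofRealCLM ∘ g) := by fun_prop
  set ψ := hg₁.toSchwartzMap hg₂
  have hψ : ∀ x, ψ x = (g x : ℂ) := fun x => rfl
  -- apply the multiplication formula to `𝓕⁻ k` and `𝓕⁻ ψ`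
  have e1 := integral_L2_mul_fourier (𝓕⁻ (hk2.toLp k)) (𝓕⁻ ψ)
  rw [FourierTransform.fourier_fourierInv_eq, ← SchwartzMap.fourier_coe,
    FourierTransform.fourier_fourierInv_eq] at e1
  have e2 : ∫ x, 𝓕⁻ k x * ψ x = ∫ x, k x * (𝓕⁻ ψ) x := by
    have := VectorFourier.integral_fourierIntegral_smul_eq_flip (L := innerₗ E2) (μ := volume)
      (ν := volume) Real.continuous_fourierChar
      (by exact continuous_inner) hk (ψ.integrable.comp_neg (μ := volume))
    have h3 : ∫ x, 𝓕⁻ k x * ψ x = ∫ x, 𝓕 k x * ψ (-x) := by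
      rw [← integral_neg_eq_self]
      simp only [Real.fourierInv_eq_fourier_neg, neg_neg]
    have h4 : ∀ x, (𝓕⁻ ψ) x = 𝓕 (fun y => ψ (-y)) x := by
      intro x
      rw [SchwartzMap.fourierInv_coe, Real.fourierInv_eq_fourier_comp_neg]
    simp only [h4]
    rw [h3]
    simpa [smul_eq_mul, flip_innerₗ] using! this
  have e3 : ∫ x, (hk2.toLp k) x * (𝓕⁻ ψ) x = ∫ x, k x * (𝓕⁻ ψ) x := by
    refine integral_congr_ae ?_
    filter_upwards [hk2.coeFn_toLp] with x hx
    rw [hx]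
  calc ∫ x, g x • (𝓕⁻ (hk2.toLp k) : L2) x = ∫ x, (𝓕⁻ (hk2.toLp k) : L2) x * ψ x := by
        simp only [hψ, Complex.real_smul, mul_comm]
    _ = ∫ x, 𝓕⁻ k x * ψ x := by rw [e1, e3, e2]
    _ = _ := by simp only [hψ, Complex.real_smul, mul_comm]

lemma eLpNorm_coe_L2 (f : L2) : eLpNorm f 2 volume = ENNReal.ofReal ‖f‖ := by
  rw [Lp.norm_def, ENNReal.ofReal_toReal (Lp.eLpNorm_ne_top f)]

lemma norm_L2_inv (f : L2) : ‖(𝓕⁻ f : L2)‖ = ‖f‖ := by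
  rw [← Lp.norm_fourier_eq (𝓕⁻ f : L2), FourierTransform.fourier_fourierInv_eq]

/-- Plancherel's theorem on `L¹ ∩ L²`. -/
lemma eLpNorm_fourier {k : E2 → ℂ} (hk : Integrable k) (hk2 : MemLp k 2) :
    eLpNorm (𝓕 k) 2 volume = eLpNorm k 2 volume := by
  rw [← eLpNorm_congr_ae (fourier_toLp_ae_eq hk hk2), eLpNorm_coe_L2, Lp.norm_fourier_eq,
    ← eLpNorm_coe_L2, eLpNorm_congr_ae hk2.coeFn_toLp]

lemma eLpNorm_fourierInv {k : E2 → ℂ} (hk : Integrable k) (hk2 : MemLp k 2) :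
    eLpNorm (𝓕⁻ k) 2 volume = eLpNorm k 2 volume := by
  rw [← eLpNorm_congr_ae (fourierInv_toLp_ae_eq hk hk2), eLpNorm_coe_L2, norm_L2_inv,
    ← eLpNorm_coe_L2, eLpNorm_congr_ae hk2.coeFn_toLp]

lemma memLp_fourierInv {k : E2 → ℂ} (hk : Integrable k) (hk2 : MemLp k 2) :
    MemLp (𝓕⁻ k) 2 volume :=
  (memLp_congr_ae (fourierInv_toLp_ae_eq hk hk2)).1 (Lp.memLp _)

/-- The multiplication formula for two functions in `L²`. -/
lemma integral_L2_mul_fourier_L2 (f φ : L2) :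
    ∫ x, f x * (𝓕 φ : L2) x = ∫ x, (𝓕 f : L2) x * φ x := by
  let B : L2 →L[ℂ] L2 →L[ℂ] ℂ := (ContinuousLinearMap.mul ℂ ℂ).lpPairing volume 2 2
  have hB : ∀ a b : L2, B a b = ∫ x, a x * b x := fun a b => by
    simp [B, ContinuousLinearMap.lpPairing_eq_integral]
  rw [← hB, ← hB]
  refine DenseRange.induction_on (p := fun φ : L2 => B f (𝓕 φ) = B (𝓕 f) φ)
    (SchwartzMap.denseRange_toLpCLM (p := 2) (F := ℂ) (E := E2) (μ := volume)
      ENNReal.ofNat_ne_top) φ ?_ ?_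
  · exact isClosed_eq ((B f).continuous.comp
      (Lp.fourierTransformₗᵢ E2 ℂ).continuous) (B (𝓕 f)).continuous
  · intro ψ
    rw [hB, hB, SchwartzMap.toLpCLM_apply, SchwartzMap.toLp_fourier_eq]
    have e1 : ∫ x, f x * ((𝓕 ψ).toLp 2 : L2) x = ∫ x, f x * 𝓕 (ψ : E2 → ℂ) x := by
      refine integral_congr_ae ?_
      filter_upwards [(𝓕 ψ).coeFn_toLp 2 volume] with x hx
      rw [hx, SchwartzMap.fourier_coe]
    have e2 : ∫ x, (𝓕 f : L2) x * (ψ.toLp 2 : L2) x = ∫ x, (𝓕 f : L2) x * ψ x := by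
      refine integral_congr_ae ?_
      filter_upwards [ψ.coeFn_toLp 2 volume] with x hx
      rw [hx]
    rw [e1, e2, integral_L2_mul_fourier]

/-- The multiplication formula for `f ∈ L²` and `φ ∈ L¹ ∩ L²`. -/
lemma integral_L2_mul_fourier_integrable (f : L2) {φ : E2 → ℂ} (h1 : Integrable φ)
    (h2 : MemLp φ 2) : ∫ x, f x * 𝓕 φ x = ∫ x, (𝓕 f : L2) x * φ x := by
  have := integral_L2_mul_fourier_L2 f (h2.toLp φ)
  calc _ = ∫ x, f x * (𝓕 (h2.toLp φ) : L2) x := by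
        refine integral_congr_ae ?_
        filter_upwards [fourier_toLp_ae_eq h1 h2] with x hx
        rw [hx]
    _ = _ := this
    _ = _ := by
        refine integral_congr_ae ?_
        filter_upwards [h2.coeFn_toLp] with x hx
        rw [hx]

/-! ### Mixed norms and the partial Fourier transform -/

lemma eLpNorm_two_sq {X ε : Type*} [MeasurableSpace X] [TopologicalSpace ε] [ContinuousENorm ε]
    (f : X → ε) (μ : Measure X) : eLpNorm f 2 μ ^ 2 = ∫⁻ x, ‖f x‖ₑ ^ 2 ∂μ := by
  rw [eLpNorm_eq_lintegral_rpow_enorm_toReal (by norm_num) (by norm_num)]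
  rw [← ENNReal.rpow_natCast, ← ENNReal.rpow_mul]
  simp

lemma ennreal_add_sq_le (a b : ℝ≥0∞) : (a + b) ^ 2 ≤ 2 * (a ^ 2 + b ^ 2) := by
  have h := ENNReal.rpow_add_le_mul_rpow_add_rpow a b (p := 2) (by norm_num)
  have e : (2 : ℝ) - 1 = 1 := by norm_num
  rw [e] at h
  simpa using h

/-- The Cauchy–Schwarz inequality for extended non-negative functions. -/
lemma lintegral_mul_le_eLpNorm_two {X : Type*} [MeasurableSpace X] {μ : Measure X}
    {f g : X → ℝ≥0∞} (hf : AEMeasurable f μ) (hg : AEMeasurable g μ) :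
    ∫⁻ x, f x * g x ∂μ ≤ eLpNorm f 2 μ * eLpNorm g 2 μ := by
  have h := ENNReal.lintegral_mul_le_Lp_mul_Lq μ
    (Real.HolderConjugate.two_two) hf hg
  simpa [eLpNorm_eq_lintegral_rpow_enorm_toReal] using h

/-- Minkowski's integral inequality in `L²`. -/
lemma eLpNorm_lintegral_le {S X : Type*} [MeasurableSpace S] [MeasurableSpace X] {μ : Measure S}
    {ν : Measure X} [SFinite μ] [SFinite ν] {F : S → X → ℝ≥0∞}
    (hF : Measurable (Function.uncurry F)) :
    eLpNorm (fun x => ∫⁻ s, F s x ∂μ) 2 ν ≤ ∫⁻ s, eLpNorm (F s) 2 ν ∂μ := by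
  have hF1 : ∀ s, Measurable (F s) := fun s => hF.comp measurable_prodMk_left
  have hF2 : ∀ x, Measurable (fun s => F s x) := fun x => hF.comp measurable_prodMk_right
  have h : eLpNorm (fun x => ∫⁻ s, F s x ∂μ) 2 ν ^ 2 ≤ (∫⁻ s, eLpNorm (F s) 2 ν ∂μ) ^ 2 := by
    rw [eLpNorm_two_sq]
    simp only [enorm_eq_self]
    have hN : Measurable fun s => eLpNorm (F s) 2 ν := by
      have : (fun s => eLpNorm (F s) 2 ν) = fun s => (∫⁻ x, F s x ^ 2 ∂ν) ^ (1 / 2 : ℝ) := by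
        ext s
        rw [eLpNorm_eq_lintegral_rpow_enorm_toReal (by norm_num) (by norm_num)]
        simp
      rw [this]
      exact (Measurable.lintegral_prod_right' (f := fun p : S × X => F p.1 p.2 ^ 2)
        (hF.pow_const 2)).pow_const _
    calc ∫⁻ x, (∫⁻ s, F s x ∂μ) ^ 2 ∂ν
        = ∫⁻ x, ∫⁻ s, ∫⁻ s', F s x * F s' x ∂μ ∂μ ∂ν := by
          refine lintegral_congr fun x => ?_
          rw [sq, ← lintegral_mul_const _ (hF2 x)]
          refine lintegral_congr fun s => ?_
          rw [lintegral_const_mul _ (hF2 x)]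
      _ = ∫⁻ s, ∫⁻ x, ∫⁻ s', F s x * F s' x ∂μ ∂ν ∂μ := by
          refine lintegral_lintegral_swap ?_
          refine Measurable.aemeasurable ?_
          refine Measurable.lintegral_prod_right'
            (f := fun p : (X × S) × S => F p.1.2 p.1.1 * F p.2 p.1.1) ?_
          exact (hF.comp (measurable_fst.snd.prodMk measurable_fst.fst)).mul
            (hF.comp (measurable_snd.prodMk measurable_fst.fst))
      _ = ∫⁻ s, ∫⁻ s', ∫⁻ x, F s x * F s' x ∂ν ∂μ ∂μ := by
          refine lintegral_congr fun s => lintegral_lintegral_swap ?_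
          exact (((hF1 s).comp measurable_fst).mul
            (hF.comp (measurable_snd.prodMk measurable_fst))).aemeasurable
      _ ≤ ∫⁻ s, ∫⁻ s', eLpNorm (F s) 2 ν * eLpNorm (F s') 2 ν ∂μ ∂μ := by
          refine lintegral_mono fun s => lintegral_mono fun s' => ?_
          exact lintegral_mul_le_eLpNorm_two (hF1 s).aemeasurable (hF1 s').aemeasurable
      _ = (∫⁻ s, eLpNorm (F s) 2 ν ∂μ) ^ 2 := by
          rw [sq, ← lintegral_mul_const _ hN]
          refine lintegral_congr fun s => ?_
          rw [lintegral_const_mul _ hN]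
  exact (ENNReal.pow_le_pow_left_iff (two_ne_zero)).1 h

lemma measurable_eLpNorm_two_slice {S X : Type*} [MeasurableSpace S] [MeasurableSpace X]
    {ν : Measure X} [SFinite ν] {f : S × X → ℂ} (hf : StronglyMeasurable f) :
    Measurable fun s => eLpNorm (fun x => f (s, x)) 2 ν := by
  have : (fun s => eLpNorm (fun x => f (s, x)) 2 ν) =
      fun s => (∫⁻ x, ‖f (s, x)‖ₑ ^ 2 ∂ν) ^ (1 / 2 : ℝ) := by
    ext s
    rw [eLpNorm_eq_lintegral_rpow_enorm_toReal (by norm_num) (by norm_num)]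
    simp
  rw [this]
  exact (Measurable.lintegral_prod_right' (f := fun p : S × X => ‖f p‖ₑ ^ 2)
    (hf.measurable.enorm.pow_const 2)).pow_const _

lemma eLpNorm_two_prod_sq {S X : Type*} [MeasurableSpace S] [MeasurableSpace X]
    {μ : Measure S} {ν : Measure X} [SFinite ν] {f : S × X → ℂ}
    (hf : AEStronglyMeasurable f (μ.prod ν)) :
    eLpNorm f 2 (μ.prod ν) ^ 2 = ∫⁻ s, eLpNorm (fun x => f (s, x)) 2 ν ^ 2 ∂μ := by
  simp only [eLpNorm_two_sq]
  exact lintegral_prod _ (hf.enorm.pow_const 2)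

/-- Minkowski's integral inequality in `L²` for Bochner integrals. -/
lemma eLpNorm_integral_le {S X : Type*} [MeasurableSpace S] [MeasurableSpace X] {μ : Measure S}
    {ν : Measure X} [SFinite μ] [SFinite ν] {f : S × X → ℂ} (hf : StronglyMeasurable f) :
    eLpNorm (fun x => ∫ s, f (s, x) ∂μ) 2 ν ≤ ∫⁻ s, eLpNorm (fun x => f (s, x)) 2 ν ∂μ := by
  have h := eLpNorm_lintegral_le (μ := μ) (ν := ν) (F := fun s x => ‖f (s, x)‖ₑ)
    hf.measurable.enorm
  refine le_trans ?_ (h.trans_eq ?_)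
  · refine eLpNorm_mono_enorm fun x => ?_
    simpa using enorm_integral_le_lintegral_enorm _
  · refine lintegral_congr fun s => ?_
    exact eLpNorm_congr_enorm_ae (ae_of_all _ fun x => by simp)

lemma stronglyMeasurable_fourier_slice {g : ℝ × E2 → ℂ} (hg : StronglyMeasurable g) :
    StronglyMeasurable fun p : ℝ × E2 => 𝓕 (fun y => g (p.1, y)) p.2 := by
  simp only [fourier_eq_ce]
  refine StronglyMeasurable.integral_prod_right
    (f := fun (p : ℝ × E2) (y : E2) => ce (-inner ℝ y p.2) * g (p.1, y)) ?_
  refine StronglyMeasurable.mul ?_ (hg.comp_measurable (measurable_fst.fst.prodMk measurable_snd))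
  exact Continuous.stronglyMeasurable (by fun_prop)

/-- The partial Fourier transform, on `L²(ℝ × ℝ²)`: it has a jointly measurable representative. It
is obtained by truncation in the second variable. -/
lemma exists_partialFourier_L2 {g : ℝ × E2 → ℂ} (hg : StronglyMeasurable g) (hg2 : MemLp g 2) :
    ∃ γ : ℝ × E2 → ℂ, StronglyMeasurable γ ∧ ∀ᵐ s : ℝ, ∃ h : MemLp (fun y => g (s, y)) 2,
      (fun η => γ (s, η)) =ᵐ[volume] (𝓕 (h.toLp _) : L2) := by
  let gn : ℕ → ℝ × E2 → ℂ := fun n p => (Metric.ball (0 : E2) n).indicator (fun y => g (p.1, y)) p.2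
  have hgn_eq : ∀ n, gn n = (univ ×ˢ Metric.ball (0 : E2) n).indicator g := by
    intro n; ext p; simp [gn, indicator]
  have hgnm : ∀ n, StronglyMeasurable (gn n) := by
    intro n; rw [hgn_eq]
    exact hg.indicator (MeasurableSet.univ.prod measurableSet_ball)
  have hgn2 : ∀ n, MemLp (gn n) 2 := by
    intro n; rw [hgn_eq]
    exact hg2.indicator (MeasurableSet.univ.prod measurableSet_ball)
  have hslice : ∀ᵐ s : ℝ, MemLp (fun y => g (s, y)) 2 := by
    have h1 : ∫⁻ s, eLpNorm (fun x => g (s, x)) 2 volume ^ 2 < ⊤ := by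
      rw [← eLpNorm_two_prod_sq hg.aestronglyMeasurable]
      exact ENNReal.pow_lt_top hg2.2
    filter_upwards [ae_lt_top ((measurable_eLpNorm_two_slice hg).pow_const 2) h1.ne] with s hs
    refine ⟨(hg.comp_measurable measurable_prodMk_left).aestronglyMeasurable, ?_⟩
    by_contra hcon
    rw [not_lt, top_le_iff] at hcon
    rw [hcon] at hs
    simp at hs
  have hsl1 : ∀ s, MemLp (fun y => g (s, y)) 2 → ∀ n, MemLp (fun y => gn n (s, y)) 2 :=
    fun s hs n => hs.indicator measurableSet_ball
  have hsl2 : ∀ s, MemLp (fun y => g (s, y)) 2 → ∀ n, Integrable (fun y => gn n (s, y)) := by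
    intro s hs n
    have : IntegrableOn (fun y => g (s, y)) (Metric.ball (0 : E2) n) := by
      have : IsFiniteMeasure (volume.restrict (Metric.ball (0 : E2) n)) :=
        ⟨by rw [Measure.restrict_apply_univ]; exact measure_ball_lt_top⟩
      exact (hs.restrict _).integrable (by norm_num)
    exact this.integrable_indicator measurableSet_ball
  let γn : ℕ → ℝ × E2 → ℂ := fun n p => 𝓕 (fun y => gn n (p.1, y)) p.2
  have hγnm : ∀ n, StronglyMeasurable (γn n) := fun n => stronglyMeasurable_fourier_slice (hgnm n)
  have hdiff : ∀ n m, eLpNorm (γn n - γn m) 2 volume = eLpNorm (gn n - gn m) 2 volume := by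
    intro n m
    suffices h : eLpNorm (γn n - γn m) 2 volume ^ 2 = eLpNorm (gn n - gn m) 2 volume ^ 2 from
      le_antisymm ((ENNReal.pow_le_pow_left_iff two_ne_zero).1 h.le)
        ((ENNReal.pow_le_pow_left_iff two_ne_zero).1 h.ge)
    have e1 := eLpNorm_two_prod_sq (μ := (volume : Measure ℝ)) (ν := (volume : Measure E2))
      ((hγnm n).sub (hγnm m)).aestronglyMeasurable
    have e2 := eLpNorm_two_prod_sq (μ := (volume : Measure ℝ)) (ν := (volume : Measure E2))
      ((hgnm n).sub (hgnm m)).aestronglyMeasurable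
    rw [← Measure.volume_eq_prod] at e1 e2
    rw [e1, e2]
    refine lintegral_congr_ae ?_
    filter_upwards [hslice] with s hs
    congr 1
    have h3 : (fun x => (γn n - γn m) (s, x)) = 𝓕 (fun y => (gn n - gn m) (s, y)) := by
      ext η
      simp only [Pi.sub_apply, γn, fourier_eq_ce, mul_sub]
      have hi : ∀ k, Integrable fun y => ce (-inner ℝ y η) * gn k (s, y) := by
        intro k
        refine (hsl2 s hs k).bdd_mul (c := 1) ?_ (ae_of_all _ fun y => by simp)
        exact Continuous.aestronglyMeasurable (by fun_prop)
      rw [integral_sub (hi n) (hi m)]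
    rw [h3]
    exact eLpNorm_fourier ((hsl2 s hs n).sub (hsl2 s hs m)) ((hsl1 s hs n).sub (hsl1 s hs m))
  have hγn2 : ∀ n, MemLp (γn n) 2 := by
    intro n
    refine ⟨(hγnm n).aestronglyMeasurable, ?_⟩
    have h0 : gn 0 = 0 := by ext p; simp [gn]
    have h0' : γn 0 = 0 := by
      ext p; simp only [γn, h0, fourier_eq_ce]; simp
    have := hdiff n 0
    rw [h0, h0', sub_zero, sub_zero] at this
    rw [this]; exact (hgn2 n).2
  -- the truncations converge in `L²`, hence so do their partial Fourier transforms
  have hconv : Tendsto (fun n => eLpNorm (gn n - g) 2 volume ^ 2) atTop (𝓝 0) := by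
    simp only [eLpNorm_two_sq]
    have := tendsto_lintegral_of_dominated_convergence (μ := (volume : Measure (ℝ × E2)))
      (F := fun n p => ‖(gn n - g) p‖ₑ ^ 2) (f := fun _ => 0) (fun p => ‖g p‖ₑ ^ 2)
      (fun n => (((hgnm n).sub hg).measurable.enorm.pow_const 2)) (fun n => ?_) ?_ ?_
    · simpa using this
    · refine ae_of_all _ fun p => ?_
      simp only [Pi.sub_apply, gn, indicator]
      split_ifs <;> simp
    · rw [← eLpNorm_two_sq]; exact (ENNReal.pow_lt_top hg2.2).ne
    · refine ae_of_all _ fun p => ?_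
      refine tendsto_const_nhds.congr' ?_
      obtain ⟨N, hN⟩ := exists_nat_gt ‖p.2‖
      filter_upwards [eventually_ge_atTop N] with n hn
      have : p.2 ∈ Metric.ball (0 : E2) n := by
        simp only [Metric.mem_ball, dist_zero_right]
        exact hN.trans_le (by exact_mod_cast hn)
      simp [gn, indicator_of_mem this]
  have hconv' : Tendsto (fun n => eLpNorm (gn n - g) 2 volume) atTop (𝓝 0) := by
    have := (ENNReal.continuous_rpow_const (y := 1 / 2)).tendsto 0 |>.comp hconv
    simp only [Function.comp_def, ← ENNReal.rpow_natCast, ← ENNReal.rpow_mul] at this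
    simpa using this
  have hcau : CauchySeq fun n => (hγn2 n).toLp := by
    have h1 : Tendsto (fun n => (hgn2 n).toLp) atTop (𝓝 (hg2.toLp g)) := by
      rw [Lp.tendsto_Lp_iff_tendsto_eLpNorm'']
      exact hconv'
    have h2 := h1.cauchySeq
    rw [Metric.cauchySeq_iff] at h2 ⊢
    intro ε hε
    obtain ⟨N, hN⟩ := h2 ε hε
    refine ⟨N, fun m hm n hn => ?_⟩
    have := hN m hm n hn
    rw [Lp.dist_def] at this ⊢
    refine lt_of_le_of_lt (le_of_eq ?_) this
    congr 1
    rw [eLpNorm_congr_ae ((hγn2 m).coeFn_toLp.sub (hγn2 n).coeFn_toLp),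
      eLpNorm_congr_ae ((hgn2 m).coeFn_toLp.sub (hgn2 n).coeFn_toLp), hdiff]
  obtain ⟨a', ha⟩ := cauchySeq_tendsto_of_complete hcau
  let a : ℝ × E2 → ℂ := a'
  have ha' : Tendsto (fun n => eLpNorm (γn n - a) 2 volume) atTop (𝓝 0) := by
    rw [← Lp.toLp_coeFn a' (Lp.memLp a')] at ha
    exact (Lp.tendsto_Lp_iff_tendsto_eLpNorm'' _ _ _ _).1 ha
  have hasm : StronglyMeasurable a := Lp.stronglyMeasurable a'
  refine ⟨a, hasm, ?_⟩
  let R : ℕ → ℝ → ℝ≥0∞ := fun n s =>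
    2 * (eLpNorm (fun x => (γn n - a) (s, x)) 2 volume ^ 2 +
      eLpNorm (fun x => (gn n - g) (s, x)) 2 volume ^ 2)
  have hRm : ∀ n, Measurable (R n) := fun n => by
    refine Measurable.const_mul (Measurable.add ?_ ?_) 2
    · exact (measurable_eLpNorm_two_slice ((hγnm n).sub hasm)).pow_const 2
    · exact (measurable_eLpNorm_two_slice ((hgnm n).sub hg)).pow_const 2
  have hRi : Tendsto (fun n => ∫⁻ s, R n s) atTop (𝓝 0) := by
    have e : ∀ n, ∫⁻ s, R n s = 2 * (eLpNorm (γn n - a) 2 volume ^ 2 +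
        eLpNorm (gn n - g) 2 volume ^ 2) := by
      intro n
      have e1 := eLpNorm_two_prod_sq (μ := (volume : Measure ℝ)) (ν := (volume : Measure E2))
        ((hγnm n).sub hasm).aestronglyMeasurable
      have e2 := eLpNorm_two_prod_sq (μ := (volume : Measure ℝ)) (ν := (volume : Measure E2))
        ((hgnm n).sub hg).aestronglyMeasurable
      rw [← Measure.volume_eq_prod] at e1 e2
      rw [e1, e2, lintegral_const_mul, lintegral_add_left]
      · exact (measurable_eLpNorm_two_slice ((hγnm n).sub hasm)).pow_const 2
      · exact ((measurable_eLpNorm_two_slice ((hγnm n).sub hasm)).pow_const 2).add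
          ((measurable_eLpNorm_two_slice ((hgnm n).sub hg)).pow_const 2)
    simp only [e]
    have h3 : Tendsto (fun n => eLpNorm (γn n - a) 2 volume ^ 2) atTop (𝓝 0) := by
      have := (ENNReal.continuous_pow 2).tendsto 0 |>.comp ha'
      simpa [Function.comp_def] using this
    have := ENNReal.Tendsto.const_mul (a := 2) (h3.add hconv) (Or.inr (by norm_num))
    simpa using this
  have hlim : ∀ᵐ s, liminf (fun n => R n s) atTop = 0 := by
    have h1 : ∫⁻ s, liminf (fun n => R n s) atTop = 0 := by
      refine le_antisymm ((lintegral_liminf_le hRm).trans ?_) bot_le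
      rw [hRi.liminf_eq]
    exact (lintegral_eq_zero_iff (Measurable.liminf hRm)).1 h1
  filter_upwards [hslice, hlim] with s hs hls
  refine ⟨hs, ?_⟩
  have key : eLpNorm (fun η => a (s, η) - (𝓕 (hs.toLp _) : L2) η) 2 volume ^ 2 = 0 := by
    refine le_antisymm ?_ bot_le
    rw [← hls]
    refine le_liminf_of_le (by isBoundedDefault) (Eventually.of_forall fun n => ?_)
    have h4 : eLpNorm (fun η => γn n (s, η) - (𝓕 (hs.toLp _) : L2) η) 2 volume =
        eLpNorm (fun x => (gn n - g) (s, x)) 2 volume := by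
      have h5 : (fun η => γn n (s, η) - (𝓕 (hs.toLp _) : L2) η) =ᵐ[volume]
          (𝓕 ((hsl1 s hs n).toLp - hs.toLp _ : L2) : L2) := by
        have h6 : (𝓕 ((hsl1 s hs n).toLp - hs.toLp _ : L2) : L2) =
            𝓕 ((hsl1 s hs n).toLp : L2) - 𝓕 (hs.toLp _ : L2) :=
          map_sub (Lp.fourierTransformₗᵢ E2 ℂ) _ _
        rw [h6]
        filter_upwards [fourier_toLp_ae_eq (hsl2 s hs n) (hsl1 s hs n),
          Lp.coeFn_sub (𝓕 ((hsl1 s hs n).toLp : L2)) (𝓕 (hs.toLp _ : L2))] with η h7 h8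
        rw [h8, Pi.sub_apply, h7]
      rw [eLpNorm_congr_ae h5, eLpNorm_coe_L2, Lp.norm_fourier_eq, ← eLpNorm_coe_L2]
      refine eLpNorm_congr_ae ?_
      filter_upwards [Lp.coeFn_sub ((hsl1 s hs n).toLp : L2) (hs.toLp _), (hsl1 s hs n).coeFn_toLp,
        hs.coeFn_toLp] with y h9 h10 h11
      rw [h9, Pi.sub_apply, h10, h11]
      rfl
    have h12 : eLpNorm (fun η => a (s, η) - (𝓕 (hs.toLp _) : L2) η) 2 volume ≤
        eLpNorm (fun x => (γn n - a) (s, x)) 2 volume +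
        eLpNorm (fun x => (gn n - g) (s, x)) 2 volume := by
      rw [← h4]
      have h13 : (fun η => a (s, η) - (𝓕 (hs.toLp _) : L2) η) =
          (fun η => γn n (s, η) - (𝓕 (hs.toLp _) : L2) η) - (fun x => (γn n - a) (s, x)) := by
        ext η; simp
      rw [h13, add_comm]
      refine eLpNorm_sub_le ?_ ?_ (by norm_num)
      · exact ((hγnm n).comp_measurable measurable_prodMk_left).aestronglyMeasurable.sub
          (Lp.aestronglyMeasurable _)
      · exact (((hγnm n).sub hasm).comp_measurable measurable_prodMk_left).aestronglyMeasurable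
    refine (pow_le_pow_left' h12 2).trans ?_
    exact ennreal_add_sq_le _ _
  have key2 : eLpNorm (fun η => a (s, η) - (𝓕 (hs.toLp _) : L2) η) 2 volume = 0 := by
    simpa using key
  have hm : AEStronglyMeasurable (fun η => a (s, η) - (𝓕 (hs.toLp _) : L2) η) volume :=
    (hasm.comp_measurable measurable_prodMk_left).aestronglyMeasurable.sub
      (Lp.aestronglyMeasurable _)
  filter_upwards [(eLpNorm_eq_zero_iff hm (by norm_num)).1 key2] with η hη
  exact sub_eq_zero.1 hη

/-- The partial Fourier transform of a function in `L¹(ℝ; L²(ℝ²))`: it has a jointly measurable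
representative. Dividing by the square root of the norm of the slices reduces to `L²(ℝ × ℝ²)`. -/
lemma exists_partialFourier {g : ℝ × E2 → ℂ} (hg : AEStronglyMeasurable g volume)
    (hfin : ∫⁻ s, eLpNorm (fun y => g (s, y)) 2 volume < ⊤) :
    ∃ γ : ℝ × E2 → ℂ, StronglyMeasurable γ ∧ ∀ᵐ s : ℝ, ∃ h : MemLp (fun y => g (s, y)) 2,
      (fun η => γ (s, η)) =ᵐ[volume] (𝓕 (h.toLp _) : L2) := by
  wlog hsm : StronglyMeasurable g generalizing g
  · have hae : ∀ᵐ s : ℝ, ∀ᵐ y : E2, g (s, y) = hg.mk g (s, y) :=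
      Measure.ae_ae_of_ae_prod hg.ae_eq_mk
    have hfin' : ∫⁻ s, eLpNorm (fun y => hg.mk g (s, y)) 2 volume < ⊤ := by
      refine lt_of_le_of_lt (le_of_eq (lintegral_congr_ae ?_)) hfin
      filter_upwards [hae] with s hs
      exact (eLpNorm_congr_ae hs).symm
    obtain ⟨γ, hγ, h⟩ := this hg.stronglyMeasurable_mk.aestronglyMeasurable hfin'
      hg.stronglyMeasurable_mk
    refine ⟨γ, hγ, ?_⟩
    filter_upwards [hae, h] with s hs ⟨h1, h2⟩
    refine ⟨(memLp_congr_ae hs).2 h1, ?_⟩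
    have : ((memLp_congr_ae hs).2 h1).toLp (fun y => g (s, y)) = h1.toLp _ :=
      (MemLp.toLp_eq_toLp_iff _ _).2 hs
    rwa [this]
  have hwm := measurable_eLpNorm_two_slice (ν := (volume : Measure E2)) hsm
  set w : ℝ → ℝ≥0∞ := fun s => eLpNorm (fun y => g (s, y)) 2 volume with hw
  let r : ℝ → ℝ := fun s => Real.sqrt (w s).toReal
  have hrm : Measurable r := hwm.ennreal_toReal.sqrt
  have hwt : ∀ᵐ s, w s < ⊤ := ae_lt_top hwm hfin.ne
  let g' : ℝ × E2 → ℂ := fun p => (((r p.1)⁻¹ : ℝ) : ℂ) * g p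
  have hg'm : StronglyMeasurable g' :=
    ((Complex.measurable_ofReal.comp (hrm.inv.comp measurable_fst)).stronglyMeasurable).mul hsm
  have hg'2 : MemLp g' 2 := by
    refine ⟨hg'm.aestronglyMeasurable, ?_⟩
    have e := eLpNorm_two_prod_sq (μ := (volume : Measure ℝ)) (ν := (volume : Measure E2))
      hg'm.aestronglyMeasurable
    rw [← Measure.volume_eq_prod] at e
    have h1 : eLpNorm g' 2 volume ^ 2 < ⊤ := by
      rw [e]
      refine lt_of_le_of_lt (lintegral_mono_ae ?_) hfin
      filter_upwards [hwt] with s hs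
      have h2 : (fun x => g' (s, x)) = (((r s)⁻¹ : ℝ) : ℂ) • fun y => g (s, y) := rfl
      rw [h2, eLpNorm_const_smul, mul_pow]
      change _ * w s ^ 2 ≤ w s
      lift w s to NNReal using hs.ne with v hv
      have h3 : r s = Real.sqrt v := by simp [r, ← hv]
      rw [h3]
      by_cases hv0 : v = 0
      · simp [hv0]
      · have h4 : ‖(((Real.sqrt v)⁻¹ : ℝ) : ℂ)‖ₑ ^ 2 = ((v : ℝ≥0∞))⁻¹ := by
          rw [← ofReal_norm, ← ENNReal.ofReal_pow (norm_nonneg _)]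
          simp only [Complex.norm_real, norm_inv, inv_pow, Real.norm_eq_abs, sq_abs]
          rw [Real.sq_sqrt v.coe_nonneg, ENNReal.ofReal_inv_of_pos (by positivity),
            ENNReal.ofReal_coe_nnreal]
        rw [h4, sq, ← mul_assoc, ENNReal.inv_mul_cancel (by simpa using hv0) (by simp), one_mul]
    by_contra hcon
    rw [not_lt, top_le_iff] at hcon
    rw [hcon] at h1
    simp at h1
  obtain ⟨γ, hγ, h⟩ := exists_partialFourier_L2 hg'm hg'2
  refine ⟨fun p => ((r p.1 : ℝ) : ℂ) * γ p,
    ((Complex.measurable_ofReal.comp (hrm.comp measurable_fst)).stronglyMeasurable).mul hγ, ?_⟩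
  filter_upwards [h, hwt] with s ⟨h1, h2⟩ hs
  have hgs : MemLp (fun y => g (s, y)) 2 :=
    ⟨(hsm.comp_measurable measurable_prodMk_left).aestronglyMeasurable, hs⟩
  refine ⟨hgs, ?_⟩
  have h3 : hgs.toLp (fun y => g (s, y)) = ((r s : ℝ) : ℂ) • h1.toLp _ := by
    rw [← MemLp.toLp_const_smul, MemLp.toLp_eq_toLp_iff]
    by_cases h0 : w s = 0
    · have := (eLpNorm_eq_zero_iff hgs.1 (by norm_num)).1 h0
      filter_upwards [this] with y hy
      simp [g', hy]
    · refine ae_of_all _ fun y => ?_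
      have : r s ≠ 0 := (Real.sqrt_pos.2 (ENNReal.toReal_pos h0 hs.ne)).ne'
      have h' : ((r s : ℝ) : ℂ) ≠ 0 := by exact_mod_cast this
      simp only [g', Pi.smul_apply, smul_eq_mul]
      push_cast
      rw [← mul_assoc, mul_inv_cancel₀ h', one_mul]
  have h4 : (𝓕 (hgs.toLp (fun y => g (s, y))) : L2) = ((r s : ℝ) : ℂ) • (𝓕 (h1.toLp _) : L2) := by
    rw [h3]
    exact map_smul (Lp.fourierTransformₗᵢ E2 ℂ) _ _
  rw [h4]
  filter_upwards [h2, Lp.coeFn_smul ((r s : ℝ) : ℂ) (𝓕 (h1.toLp _) : L2)] with η h5 h6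
  rw [h6, Pi.smul_apply, ← h5, smul_eq_mul]

/-! ### Orthonormal frames of space-time -/

/-- The Euclidean scalar product on `ℝ × ℝ²`. -/
def pr (z w : ℝ × E2) : ℝ := z.1 * w.1 + inner ℝ z.2 w.2

lemma pr_comm (z w : ℝ × E2) : pr z w = pr w z := by
  simp only [pr, real_inner_comm]; ring

lemma pr_add_right (z w w' : ℝ × E2) : pr z (w + w') = pr z w + pr z w' := by
  simp only [pr, Prod.fst_add, Prod.snd_add, inner_add_right]; ring

lemma pr_smul_right (z w : ℝ × E2) (a : ℝ) : pr z (a • w) = a * pr z w := by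
  simp only [pr, Prod.smul_fst, Prod.smul_snd, inner_smul_right, smul_eq_mul]; ring

lemma pr_add_left (z w w' : ℝ × E2) : pr (w + w') z = pr w z + pr w' z := by
  simp only [pr_comm _ z, pr_add_right]

lemma pr_smul_left (z w : ℝ × E2) (a : ℝ) : pr (a • w) z = a * pr w z := by
  simp only [pr_comm _ z, pr_smul_right]

lemma pr_sub_right (z w w' : ℝ × E2) : pr z (w - w') = pr z w - pr z w' := by
  simp only [pr, Prod.fst_sub, Prod.snd_sub, inner_sub_right]; ring

@[fun_prop] lemma Continuous.pr {X : Type*} [TopologicalSpace X] {f g : X → ℝ × E2}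
    (hf : Continuous f) (hg : Continuous g) : Continuous fun x => HalfKG.pr (f x) (g x) := by
  unfold HalfKG.pr; fun_prop

/-- A linear change of coordinates of `ℝ × ℝ²` that preserves the Euclidean scalar product. The
first coordinate plays the role of the evolution variable. -/
structure Frame where
  toEquiv : (ℝ × E2) ≃L[ℝ] (ℝ × E2)
  pr_map : ∀ z w, pr (toEquiv z) (toEquiv w) = pr z w

namespace Frame

variable (Φ : Frame)

lemma pr_symm (z w : ℝ × E2) : pr (Φ.toEquiv.symm z) (Φ.toEquiv.symm w) = pr z w := by
  rw [← Φ.pr_map]; simp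

lemma pr_symm_left (z w : ℝ × E2) : pr (Φ.toEquiv.symm z) w = pr z (Φ.toEquiv w) := by
  rw [← Φ.pr_map]; simp

/-- The evolution direction of a frame. -/
def e0 : ℝ × E2 := Φ.toEquiv (1, 0)

lemma symm_fst (z : ℝ × E2) : (Φ.toEquiv.symm z).1 = pr z Φ.e0 := by
  rw [e0, ← pr_symm_left]; simp [pr]

lemma pr_e0 : pr Φ.e0 Φ.e0 = 1 := by rw [e0, Φ.pr_map]; simp [pr]

/-- The linear isometry of the Hilbert space `ℝ × ℝ²` that corresponds to a frame. -/
def isometry : WithLp 2 (ℝ × E2) ≃ₗᵢ[ℝ] WithLp 2 (ℝ × E2) where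
  toLinearEquiv := ((WithLp.linearEquiv 2 ℝ (ℝ × E2)).trans Φ.toEquiv.toLinearEquiv).trans
    (WithLp.linearEquiv 2 ℝ (ℝ × E2)).symm
  norm_map' x := by
    have h : ∀ y : WithLp 2 (ℝ × E2), ‖y‖ ^ 2 = pr y.ofLp y.ofLp := by
      intro y
      rw [WithLp.prod_norm_sq_eq_of_L2, pr, real_inner_self_eq_norm_sq, Real.norm_eq_abs, sq_abs,
        sq y.fst]
      rfl
    have h2 : ‖(((WithLp.linearEquiv 2 ℝ (ℝ × E2)).trans Φ.toEquiv.toLinearEquiv).trans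
        (WithLp.linearEquiv 2 ℝ (ℝ × E2)).symm) x‖ ^ 2 = ‖x‖ ^ 2 := by
      rw [h, h]
      exact Φ.pr_map _ _
    exact (sq_eq_sq₀ (norm_nonneg _) (norm_nonneg _)).1 h2

lemma measurePreserving : MeasurePreserving Φ.toEquiv volume volume := by
  have := (WithLp.volume_preserving_ofLp ℝ E2).comp
    ((Φ.isometry.measurePreserving).comp (WithLp.volume_preserving_toLp ℝ E2))
  exact this

lemma measurePreserving_symm : MeasurePreserving Φ.toEquiv.symm volume volume :=
  Φ.measurePreserving.symm (Φ.toEquiv.toHomeomorph.toMeasurableEquiv)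

lemma measurableEmbedding_symm : MeasurableEmbedding Φ.toEquiv.symm :=
  Φ.toEquiv.symm.toHomeomorph.measurableEmbedding

end Frame

/-! ### The space-time Fourier transform of a function in `L¹L²` -/

/-- The Fourier transform on `ℝ × ℝ²`. -/
def ft3 (φ : ℝ × E2 → ℂ) (w : ℝ × E2) : ℂ := ∫ z, ce (-pr w z) * φ z

/-- The Fourier transform in the first variable. -/
def ftFst (γ : ℝ × E2 → ℂ) (z : ℝ × E2) : ℂ := ∫ s, ce (-(s * z.1)) * γ (s, z.2)

/-- The integrable weight that dominates the admissible test functions. -/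
def decayWeight (z : ℝ × E2) : ℝ := (1 + z.1 ^ 2)⁻¹ * ((1 + ‖z.2‖ ^ 2) ^ 2)⁻¹

/-- Continuous functions with enough decay to serve as test functions. -/
structure IsTest (φ : ℝ × E2 → ℂ) : Prop where
  cont : Continuous φ
  decay : ∃ C, ∀ z, ‖φ z‖ ≤ C * decayWeight z

lemma integrable_weight_E2 : Integrable fun η : E2 => ((1 + ‖η‖ ^ 2) ^ 2)⁻¹ := by
  have h := integrable_rpow_neg_one_add_norm_sq (E := E2) (μ := volume) (r := 4)
    (by simp; norm_num)
  refine h.congr (ae_of_all _ fun η => ?_)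
  have : (-4 / 2 : ℝ) = -(2 : ℕ) := by norm_num
  simp only [this]
  rw [Real.rpow_neg (by positivity), Real.rpow_natCast]

lemma memLp_weight_E2 : MemLp (fun η : E2 => ((1 + ‖η‖ ^ 2) ^ 2)⁻¹) 2 := by
  have hc : Continuous fun η : E2 => ((1 + ‖η‖ ^ 2) ^ 2)⁻¹ :=
    Continuous.inv₀ (by fun_prop) (fun η => by positivity)
  rw [memLp_two_iff_integrable_sq hc.aestronglyMeasurable]
  refine integrable_weight_E2.mono (hc.pow 2).aestronglyMeasurable (ae_of_all _ fun η => ?_)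
  have h0 : 0 ≤ ((1 + ‖η‖ ^ 2) ^ 2)⁻¹ := by positivity
  have h1 : ((1 + ‖η‖ ^ 2) ^ 2)⁻¹ ≤ 1 := by
    apply inv_le_one_of_one_le₀
    nlinarith [sq_nonneg ‖η‖]
  rw [Real.norm_of_nonneg (by positivity), Real.norm_of_nonneg h0]
  nlinarith

lemma lintegral_enorm_mul_le {μ : Measure E2} {f h : E2 → ℂ} (hf : AEStronglyMeasurable f μ)
    (hh : AEStronglyMeasurable h μ) :
    ∫⁻ y, ‖f y * h y‖ₑ ∂μ ≤ eLpNorm f 2 μ * eLpNorm h 2 μ := by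
  have := lintegral_mul_le_eLpNorm_two hf.enorm hh.enorm
  simp only [enorm_mul]
  refine this.trans_eq ?_
  congr 1

/-- Local integrability in space-time from local integrability of the `L²` norms of the slices, by
the Cauchy–Schwarz inequality on the slices of a compact set. -/
lemma locallyIntegrable_of_slices {F : ℝ × E2 → ℂ} (hF : AEStronglyMeasurable F volume)
    (h : ∀ R : ℝ, ∫⁻ s in Icc (-R) R, eLpNorm (fun y => F (s, y)) 2 volume < ⊤) :
    LocallyIntegrable F volume := by
  rw [locallyIntegrable_iff]
  intro K hK
  obtain ⟨R, hR⟩ := hK.isBounded.subset_closedBall 0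
  have hsub : K ⊆ Icc (-R) R ×ˢ Metric.closedBall (0 : E2) R := by
    intro z hz
    have := hR hz
    rw [← Prod.mk_zero_zero, ← closedBall_prod_same] at this
    refine ⟨?_, this.2⟩
    have h1 := this.1
    rwa [Real.closedBall_eq_Icc, zero_sub, zero_add] at h1
  refine IntegrableOn.mono_set ?_ hsub
  have hFs : ∀ᵐ s : ℝ, AEStronglyMeasurable (fun y => F (s, y)) volume := by
    rw [Measure.volume_eq_prod] at hF
    exact hF.prodMk_left
  refine ⟨hF.restrict, ?_⟩
  rw [HasFiniteIntegral, Measure.volume_eq_prod, ← Measure.prod_restrict]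
  rw [lintegral_prod]
  · calc ∫⁻ s in Icc (-R) R, ∫⁻ y in Metric.closedBall (0 : E2) R, ‖F (s, y)‖ₑ
        ≤ ∫⁻ s in Icc (-R) R, eLpNorm (fun y => F (s, y)) 2 volume *
            (volume (Metric.closedBall (0 : E2) R)) ^ (1 / 2 : ℝ) := by
          refine lintegral_mono_ae (ae_restrict_of_ae ?_)
          filter_upwards [hFs] with s hs
          have := lintegral_enorm_mul_le (μ := volume.restrict (Metric.closedBall (0 : E2) R))
            hs.restrict (aestronglyMeasurable_const (b := (1 : ℂ)))
          simp only [mul_one] at this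
          refine this.trans ?_
          refine mul_le_mul' (eLpNorm_mono_measure _ Measure.restrict_le_self) ?_
          · rw [eLpNorm_const' _ (by norm_num) (by norm_num)]
            simp
      _ = (∫⁻ s in Icc (-R) R, eLpNorm (fun y => F (s, y)) 2 volume) *
            (volume (Metric.closedBall (0 : E2) R)) ^ (1 / 2 : ℝ) := by
          rw [lintegral_mul_const']
          exact (ENNReal.rpow_lt_top_of_nonneg (by norm_num) measure_closedBall_lt_top.ne).ne
      _ < ⊤ := ENNReal.mul_lt_top (h R)
          (ENNReal.rpow_lt_top_of_nonneg (by norm_num) measure_closedBall_lt_top.ne)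
  · rw [Measure.prod_restrict, ← Measure.volume_eq_prod]
    exact hF.enorm.restrict

lemma stronglyMeasurable_ftFst {γ : ℝ × E2 → ℂ} (hγ : StronglyMeasurable γ) :
    StronglyMeasurable (ftFst γ) := by
  refine StronglyMeasurable.integral_prod_right
    (f := fun (z : ℝ × E2) (s : ℝ) => ce (-(s * z.1)) * γ (s, z.2)) ?_
  refine StronglyMeasurable.mul ?_
    (hγ.comp_measurable (measurable_snd.prodMk measurable_fst.snd))
  exact Continuous.stronglyMeasurable (by fun_prop)

lemma eLpNorm_ftFst_le {γ : ℝ × E2 → ℂ} (hγ : StronglyMeasurable γ) (τ : ℝ) :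
    eLpNorm (fun η => ftFst γ (τ, η)) 2 volume ≤
      ∫⁻ s, eLpNorm (fun η => γ (s, η)) 2 volume := by
  have h := eLpNorm_integral_le (μ := (volume : Measure ℝ)) (ν := (volume : Measure E2))
    (f := fun p : ℝ × E2 => ce (-(p.1 * τ)) * γ p) (StronglyMeasurable.mul
      (Continuous.stronglyMeasurable (by fun_prop)) hγ)
  refine h.trans_eq (lintegral_congr fun s => ?_)
  exact eLpNorm_congr_norm_ae (ae_of_all _ fun x => by simp)

lemma locallyIntegrable_ftFst {γ : ℝ × E2 → ℂ} (hγ : StronglyMeasurable γ)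
    (hfin : ∫⁻ s, eLpNorm (fun η => γ (s, η)) 2 volume < ⊤) :
    LocallyIntegrable (ftFst γ) volume := by
  refine locallyIntegrable_of_slices (stronglyMeasurable_ftFst hγ).aestronglyMeasurable
    fun R => ?_
  refine lt_of_le_of_lt (lintegral_mono fun τ => eLpNorm_ftFst_le hγ τ) ?_
  rw [lintegral_const]
  refine ENNReal.mul_lt_top hfin ?_
  simp

lemma integrable_weight_Real : Integrable fun τ : ℝ => (1 + τ ^ 2)⁻¹ := integrable_inv_one_add_sq

lemma integrable_decayWeight : Integrable decayWeight :=
  Integrable.mul_prod integrable_weight_Real integrable_weight_E2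

lemma IsTest.integrable {φ : ℝ × E2 → ℂ} (hφ : IsTest φ) : Integrable φ := by
  obtain ⟨C, hC⟩ := hφ.decay
  exact (integrable_decayWeight.const_mul C).mono' hφ.cont.aestronglyMeasurable
    (ae_of_all _ hC)

lemma IsTest.integrable_slice {φ : ℝ × E2 → ℂ} (hφ : IsTest φ) (η : E2) :
    Integrable fun τ => φ (τ, η) := by
  obtain ⟨C, hC⟩ := hφ.decay
  refine (integrable_weight_Real.const_mul (C * ((1 + ‖η‖ ^ 2) ^ 2)⁻¹)).mono'
    (hφ.cont.comp (by fun_prop)).aestronglyMeasurable (ae_of_all _ fun τ => ?_)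
  refine (hC _).trans_eq ?_
  simp only [decayWeight]; ring

set_option maxHeartbeats 1000000 in
/-- The multiplication formula for a function in `L¹(ℝ; L²(ℝ²))` with partial Fourier
transform `γ`. -/
lemma integral_mul_ft3 {g γ : ℝ × E2 → ℂ} (hg : AEStronglyMeasurable g volume)
    (hγ : StronglyMeasurable γ)
    (hfin : ∫⁻ s, eLpNorm (fun y => g (s, y)) 2 volume < ⊤)
    (hfinγ : ∫⁻ s, eLpNorm (fun y => γ (s, y)) 2 volume < ⊤)
    (h : ∀ᵐ s : ℝ, ∃ h : MemLp (fun y => g (s, y)) 2,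
      (fun η => γ (s, η)) =ᵐ[volume] (𝓕 (h.toLp _) : L2))
    {φ : ℝ × E2 → ℂ} (hφ : IsTest φ) :
    ∫ w, g w * ft3 φ w = ∫ z, ftFst γ z * φ z := by
  obtain ⟨C, hC⟩ := hφ.decay
  have hC0 : 0 ≤ C := by
    have := (norm_nonneg _).trans (hC (0, 0))
    simpa [decayWeight] using this
  let φs : ℝ → E2 → ℂ := fun s η => ∫ τ, ce (-(s * τ)) * φ (τ, η)
  let A : ℝ := ∫ τ : ℝ, (1 + τ ^ 2)⁻¹
  have hA0 : 0 ≤ A := integral_nonneg fun τ => by positivity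
  have hφs_bd : ∀ s η, ‖φs s η‖ ≤ C * A * ((1 + ‖η‖ ^ 2) ^ 2)⁻¹ := by
    intro s η
    refine (norm_integral_le_of_norm_le (integrable_weight_Real.const_mul
      (C * ((1 + ‖η‖ ^ 2) ^ 2)⁻¹)) (ae_of_all _ fun τ => ?_)).trans_eq ?_
    · rw [norm_mul, norm_ce, one_mul]
      refine (hC _).trans_eq ?_
      simp only [decayWeight]; ring
    · rw [integral_const_mul]; ring
  have hφs_joint : StronglyMeasurable (fun p : ℝ × E2 => φs p.1 p.2) := by
    refine StronglyMeasurable.integral_prod_right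
      (f := fun (p : ℝ × E2) (τ : ℝ) => ce (-(p.1 * τ)) * φ (τ, p.2)) ?_
    have := hφ.cont
    exact Continuous.stronglyMeasurable (by fun_prop)
  have hφs_m : ∀ s, StronglyMeasurable (φs s) := fun s =>
    hφs_joint.comp_measurable measurable_prodMk_left
  have hφs1 : ∀ s, Integrable (φs s) := fun s =>
    (integrable_weight_E2.const_mul (C * A)).mono' (hφs_m s).aestronglyMeasurable
      (ae_of_all _ (hφs_bd s))
  have hφs2 : ∀ s, MemLp (φs s) 2 := fun s =>
    (memLp_weight_E2.const_mul (C * A)).mono (hφs_m s).aestronglyMeasurable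
      (ae_of_all _ fun η => (hφs_bd s η).trans (le_abs_self _))
  let W : ℝ≥0∞ := eLpNorm (fun η : E2 => C * A * ((1 + ‖η‖ ^ 2) ^ 2)⁻¹) 2 volume
  have hWt : W < ⊤ := (memLp_weight_E2.const_mul (C * A)).2
  have hφsW : ∀ s, eLpNorm (φs s) 2 volume ≤ W := fun s =>
    eLpNorm_mono fun η => (hφs_bd s η).trans (le_abs_self _)
  have hft : ∀ s y, ft3 φ (s, y) = 𝓕 (φs s) y := by
    intro s y
    rw [fourier_eq_ce, ft3, Measure.volume_eq_prod, integral_prod_symm]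
    · refine integral_congr_ae (ae_of_all _ fun η => ?_)
      simp only [φs, ← integral_const_mul]
      refine integral_congr_ae (ae_of_all _ fun τ => ?_)
      simp only [pr, ← mul_assoc, ← ce_add]
      congr 2
      rw [real_inner_comm]; ring
    · refine hφ.integrable.bdd_mul (c := 1) ?_ (ae_of_all _ fun y => by simp)
      exact Continuous.aestronglyMeasurable (by fun_prop)
  have hftm : StronglyMeasurable (ft3 φ) := by
    have : ft3 φ = fun p : ℝ × E2 => 𝓕 (fun y => (fun q : ℝ × E2 => φs q.1 q.2) (p.1, y)) p.2 := by
      ext p; rw [← hft]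
    rw [this]; exact stronglyMeasurable_fourier_slice hφs_joint
  have hgs : ∀ᵐ s : ℝ, AEStronglyMeasurable (fun y => g (s, y)) volume := by
    rw [Measure.volume_eq_prod] at hg
    exact hg.prodMk_left
  have hint : Integrable (fun w => g w * ft3 φ w) := by
    refine ⟨hg.mul hftm.aestronglyMeasurable, ?_⟩
    rw [HasFiniteIntegral, Measure.volume_eq_prod, lintegral_prod]
    · calc ∫⁻ s, ∫⁻ y, ‖g (s, y) * ft3 φ (s, y)‖ₑ
          ≤ ∫⁻ s, eLpNorm (fun y => g (s, y)) 2 volume * W := by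
            refine lintegral_mono_ae ?_
            filter_upwards [hgs] with s hs
            refine (lintegral_enorm_mul_le hs
              (hftm.comp_measurable measurable_prodMk_left).aestronglyMeasurable).trans ?_
            gcongr
            have : ft3 φ ∘ Prod.mk s = 𝓕 (φs s) := funext (hft s)
            rw [this, eLpNorm_fourier (hφs1 s) (hφs2 s)]
            exact hφsW s
        _ = (∫⁻ s, eLpNorm (fun y => g (s, y)) 2 volume) * W := lintegral_mul_const' _ _ hWt.ne
        _ < ⊤ := ENNReal.mul_lt_top hfin hWt
    · rw [← Measure.volume_eq_prod]
      exact (hg.mul hftm.aestronglyMeasurable).enorm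
  have hint2 : Integrable (fun p : ℝ × (ℝ × E2) => ce (-(p.1 * p.2.1)) * γ (p.1, p.2.2) * φ p.2)
      (volume.prod volume) := by
    have hm : StronglyMeasurable
        (fun p : ℝ × (ℝ × E2) => ce (-(p.1 * p.2.1)) * γ (p.1, p.2.2) * φ p.2) := by
      refine StronglyMeasurable.mul (StronglyMeasurable.mul
        (Continuous.stronglyMeasurable (by fun_prop)) ?_) ?_
      · exact hγ.comp_measurable (measurable_fst.prodMk measurable_snd.snd)
      · exact (hφ.cont.comp continuous_snd).stronglyMeasurable
    refine ⟨hm.aestronglyMeasurable, ?_⟩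
    rw [HasFiniteIntegral, lintegral_prod _ hm.aestronglyMeasurable.enorm]
    calc ∫⁻ s, ∫⁻ z : ℝ × E2, ‖ce (-(s * z.1)) * γ (s, z.2) * φ z‖ₑ
        ≤ ∫⁻ s, eLpNorm (fun y => γ (s, y)) 2 volume * W := by
          refine lintegral_mono fun s => ?_
          rw [Measure.volume_eq_prod, lintegral_prod_symm]
          · calc ∫⁻ η, ∫⁻ τ : ℝ, ‖ce (-(s * τ)) * γ (s, η) * φ (τ, η)‖ₑ
                = ∫⁻ η, ‖γ (s, η)‖ₑ * ∫⁻ τ : ℝ, ‖φ (τ, η)‖ₑ := by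
                  refine lintegral_congr fun η => ?_
                  rw [← lintegral_const_mul]
                  · refine lintegral_congr fun τ => ?_
                    simp [← ofReal_norm]
                  · exact (hφ.cont.comp (by fun_prop)).measurable.enorm
              _ ≤ ∫⁻ η, ‖γ (s, η)‖ₑ * ‖C * A * ((1 + ‖η‖ ^ 2) ^ 2)⁻¹‖ₑ := by
                  refine lintegral_mono fun η => ?_
                  gcongr
                  rw [← ofReal_integral_norm_eq_lintegral_enorm (hφ.integrable_slice η),
                    ← ofReal_norm]
                  refine ENNReal.ofReal_le_ofReal ?_
                  rw [Real.norm_of_nonneg (by positivity)]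
                  calc ∫ τ, ‖φ (τ, η)‖ ≤ ∫ τ, C * ((1 + ‖η‖ ^ 2) ^ 2)⁻¹ * (1 + τ ^ 2)⁻¹ := by
                        refine integral_mono (hφ.integrable_slice η).norm
                          (integrable_weight_Real.const_mul _) fun τ => ?_
                        refine (hC _).trans_eq ?_
                        simp only [decayWeight]; ring
                    _ = _ := by rw [integral_const_mul]; ring
              _ ≤ _ := by
                  have hcw : Continuous fun η : E2 => C * A * ((1 + ‖η‖ ^ 2) ^ 2)⁻¹ :=
                    continuous_const.mul (Continuous.inv₀ (by fun_prop) (fun η => by positivity))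
                  exact lintegral_mul_le_eLpNorm_two
                    (hγ.comp_measurable measurable_prodMk_left).measurable.enorm.aemeasurable
                    hcw.measurable.enorm.aemeasurable
          · exact (hm.comp_measurable measurable_prodMk_left).aestronglyMeasurable.enorm
      _ = (∫⁻ s, eLpNorm (fun y => γ (s, y)) 2 volume) * W := lintegral_mul_const' _ _ hWt.ne
      _ < ⊤ := ENNReal.mul_lt_top hfinγ hWt
  calc ∫ w, g w * ft3 φ w = ∫ s, ∫ y, g (s, y) * ft3 φ (s, y) := by
        rw [Measure.volume_eq_prod] at hint ⊢
        exact integral_prod _ hint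
    _ = ∫ s, ∫ z : ℝ × E2, ce (-(s * z.1)) * γ (s, z.2) * φ z := by
        have h3 := hint2.prod_right_ae
        refine integral_congr_ae ?_
        filter_upwards [h, h3] with s ⟨h1, h2⟩ h3
        simp only [hft]
        calc ∫ y, g (s, y) * 𝓕 (φs s) y = ∫ y, (h1.toLp _ : L2) y * 𝓕 (φs s) y := by
              refine integral_congr_ae ?_
              filter_upwards [h1.coeFn_toLp] with y hy
              rw [hy]
          _ = ∫ η, (𝓕 (h1.toLp _) : L2) η * φs s η :=
              integral_L2_mul_fourier_integrable _ (hφs1 s) (hφs2 s)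
          _ = ∫ η, γ (s, η) * φs s η := by
              refine integral_congr_ae ?_
              filter_upwards [h2] with y hy
              rw [hy]
          _ = _ := by
              rw [Measure.volume_eq_prod] at h3 ⊢
              rw [integral_prod_symm _ h3]
              refine integral_congr_ae (ae_of_all _ fun η => ?_)
              simp only [φs, ← integral_const_mul]
              refine integral_congr_ae (ae_of_all _ fun τ => ?_)
              simp only; ring
    _ = ∫ z : ℝ × E2, ∫ s, ce (-(s * z.1)) * γ (s, z.2) * φ z := integral_integral_swap hint2
    _ = _ := by
        refine integral_congr_ae (ae_of_all _ fun z => ?_)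
        simp only [ftFst, integral_mul_const]

instance isAddHaarMeasure_volume : (volume : Measure (ℝ × E2)).IsAddHaarMeasure :=
  inferInstanceAs ((volume : Measure ℝ).prod (volume : Measure E2)).IsAddHaarMeasure

lemma isTest_of_decay {φ : ℝ × E2 → ℂ} (hc : Continuous φ)
    (h : ∃ C, ∀ z, ‖φ z‖ * (1 + pr z z) ^ 3 ≤ C) : IsTest φ := by
  obtain ⟨C, hC⟩ := h
  refine ⟨hc, C, fun z => ?_⟩
  have h1 : 0 < (1 + z.1 ^ 2) * (1 + ‖z.2‖ ^ 2) ^ 2 := by positivity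
  have h2 : (1 + z.1 ^ 2) * (1 + ‖z.2‖ ^ 2) ^ 2 ≤ (1 + pr z z) ^ 3 := by
    have e : pr z z = z.1 ^ 2 + ‖z.2‖ ^ 2 := by rw [pr, real_inner_self_eq_norm_sq]; ring
    rw [e]
    have ha := sq_nonneg z.1
    have hb := sq_nonneg ‖z.2‖
    calc (1 + z.1 ^ 2) * (1 + ‖z.2‖ ^ 2) ^ 2
        ≤ (1 + (z.1 ^ 2 + ‖z.2‖ ^ 2)) * (1 + (z.1 ^ 2 + ‖z.2‖ ^ 2)) ^ 2 := by
          gcongr <;> linarith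
      _ = _ := by ring
  have h3 : decayWeight z = ((1 + z.1 ^ 2) * (1 + ‖z.2‖ ^ 2) ^ 2)⁻¹ := by
    rw [decayWeight, mul_inv]
  rw [h3, ← div_eq_mul_inv, le_div_iff₀ h1]
  exact (mul_le_mul_of_nonneg_left h2 (norm_nonneg _)).trans (hC z)

lemma isTest_of_compact {φ : ℝ × E2 → ℂ} (hc : Continuous φ) (h : HasCompactSupport φ) :
    IsTest φ := by
  refine isTest_of_decay hc ?_
  have hc2 : Continuous fun z => ‖φ z‖ * (1 + pr z z) ^ 3 := by fun_prop
  have hs : HasCompactSupport fun z => ‖φ z‖ * (1 + pr z z) ^ 3 := h.norm.mul_right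
  obtain ⟨C, hC⟩ := hs.exists_bound_of_continuous hc2
  exact ⟨C, fun z => (le_abs_self _).trans (hC z)⟩

lemma exists_bound_schwartz (f : SchwartzMap (WithLp 2 (ℝ × E2)) ℂ) :
    ∃ C, ∀ x, ‖f x‖ * (1 + ‖x‖ ^ 2) ^ 3 ≤ C := by
  obtain ⟨C0, -, h0⟩ := f.decay 0 0
  obtain ⟨C2, -, h2⟩ := f.decay 2 0
  obtain ⟨C4, -, h4⟩ := f.decay 4 0
  obtain ⟨C6, -, h6⟩ := f.decay 6 0
  refine ⟨C0 + 3 * C2 + 3 * C4 + C6, fun x => ?_⟩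
  have h0 := h0 x
  have h2 := h2 x
  have h4 := h4 x
  have h6 := h6 x
  simp only [norm_iteratedFDeriv_zero] at h0 h2 h4 h6
  nlinarith

/-- Every smooth compactly supported function is the Fourier transform of a test function. -/
lemma exists_ft3_eq {ψ : ℝ × E2 → ℂ} (h1 : ContDiff ℝ (⊤ : ℕ∞) ψ) (h2 : HasCompactSupport ψ) :
    IsTest (fun z => ∫ w, ce (pr z w) * ψ w) ∧ ft3 (fun z => ∫ w, ce (pr z w) * ψ w) = ψ := by
  have hcs : HasCompactSupport (fun x : WithLp 2 (ℝ × E2) => ψ x.ofLp) := by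
    exact h2.comp_homeomorph (WithLp.homeomorphProd 2 ℝ E2)
  have hsm : ContDiff ℝ (⊤ : ℕ∞) (fun x : WithLp 2 (ℝ × E2) => ψ x.ofLp) :=
    h1.comp (WithLp.prodContinuousLinearEquiv 2 ℝ ℝ E2).contDiff
  set ψ' := hcs.toSchwartzMap hsm
  have hψ' : ∀ x, ψ' x = ψ x.ofLp := fun x => rfl
  have hemb : MeasurableEmbedding (@WithLp.toLp 2 (ℝ × E2)) :=
    (MeasurableEquiv.toLp 2 (ℝ × E2)).measurableEmbedding
  have hin : ∀ z w : ℝ × E2, inner ℝ (WithLp.toLp 2 w) (WithLp.toLp 2 z) = pr z w := by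
    intro z w
    rw [WithLp.prod_inner_apply, pr_comm, pr]
    change inner ℝ w.1 z.1 + _ = _
    rw [real_inner_comm]
    rfl
  have hφ : (fun z => ∫ w, ce (pr z w) * ψ w) = fun z => (𝓕⁻ ψ') (WithLp.toLp 2 z) := by
    ext z
    rw [SchwartzMap.fourierInv_coe, fourierInv_eq_ce,
      ← (WithLp.volume_preserving_toLp ℝ E2).integral_comp hemb]
    simp only [hin, hψ']
  rw [hφ]
  constructor
  · refine isTest_of_decay ((𝓕⁻ ψ').continuous.comp
      (WithLp.prodContinuousLinearEquiv 2 ℝ ℝ E2).symm.continuous) ?_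
    obtain ⟨C, hC⟩ := exists_bound_schwartz (𝓕⁻ ψ')
    refine ⟨C, fun z => ?_⟩
    have := hC (WithLp.toLp 2 z)
    rwa [← real_inner_self_eq_norm_sq, hin] at this
  · ext w
    have h3 : (𝓕 (𝓕⁻ ψ')) (WithLp.toLp 2 w) = ψ w := by
      rw [FourierTransform.fourier_fourierInv_eq, hψ']
    rw [← h3, SchwartzMap.fourier_coe, fourier_eq_ce, ft3,
      ← (WithLp.volume_preserving_toLp ℝ E2).integral_comp hemb]
    simp only [hin]

lemma stFourier_eq (φ : ℝ × E2 → ℂ) (p : ℝ × E2) :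
    stFourier φ p = ∫ q, ce (-(2 * Real.pi)⁻¹ * pr p q) * φ q := by
  unfold stFourier
  refine integral_congr_ae (ae_of_all _ fun q => ?_)
  simp only [ce, pr]
  congr 2
  have : (Real.pi : ℂ) ≠ 0 := by exact_mod_cast Real.pi_ne_zero
  push_cast
  field_simp

/-- A function in `L¹L²` with bounded Fourier support, with respect to a frame: its partial Fourier
transform `γ` is jointly measurable, the Fourier transform of `γ` in the evolution variable
vanishes off the support, and the Fourier inversion formula holds. -/
theorem exists_spectral (Φ : Frame) {B : Set (ℝ × E2)} (hBc : IsClosed B)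
    (hBb : Bornology.IsBounded B) {g : ℝ → E2 → ℂ}
    (hg : AEStronglyMeasurable (fun p : ℝ × E2 => g p.1 p.2) volume)
    (hfin : ∫⁻ a, eLpNorm (fun y => g (Φ.toEquiv (a, y)).1 (Φ.toEquiv (a, y)).2) 2 volume < ⊤)
    (hsupp : FourierSuppIn g B) :
    ∃ γ : ℝ × E2 → ℂ, StronglyMeasurable γ ∧
      (∀ᵐ s : ℝ, eLpNorm (fun η => γ (s, η)) 2 volume =
        eLpNorm (fun y => g (Φ.toEquiv (s, y)).1 (Φ.toEquiv (s, y)).2) 2 volume) ∧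
      (∀ᵐ z : ℝ × E2, (2 * Real.pi) • z ∉ B → ftFst γ (Φ.toEquiv.symm z) = 0) ∧
      ∀ᵐ w : ℝ × E2, g w.1 w.2 =
        ∫ z in {z | (2 * Real.pi) • z ∈ B}, ce (pr w z) * ftFst γ (Φ.toEquiv.symm z) := by
  have hpi : (2 * Real.pi) ≠ 0 := by positivity
  set g' : ℝ × E2 → ℂ := fun z => g (Φ.toEquiv z).1 (Φ.toEquiv z).2 with hg'
  have hg'm : AEStronglyMeasurable g' volume :=
    hg.comp_measurePreserving Φ.measurePreserving
  obtain ⟨γ, hγ, hγg⟩ := exists_partialFourier hg'm hfin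
  have hnorm : ∀ᵐ s : ℝ, eLpNorm (fun η => γ (s, η)) 2 volume =
      eLpNorm (fun y => g' (s, y)) 2 volume := by
    filter_upwards [hγg] with s ⟨h1, h2⟩
    rw [eLpNorm_congr_ae h2, eLpNorm_coe_L2, Lp.norm_fourier_eq, ← eLpNorm_coe_L2,
      eLpNorm_congr_ae h1.coeFn_toLp]
  have hfinγ : ∫⁻ s, eLpNorm (fun y => γ (s, y)) 2 volume < ⊤ := by
    rw [lintegral_congr_ae hnorm]; exact hfin
  have hmul : ∀ {φ : ℝ × E2 → ℂ}, IsTest φ → ∫ w, g' w * ft3 φ w = ∫ z, ftFst γ z * φ z :=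
    fun hφ => integral_mul_ft3 hg'm hγ hfin hfinγ hγg hφ
  have hGloc := locallyIntegrable_ftFst hγ hfinγ
  let T : ℝ × E2 → ℝ × E2 := fun z => (2 * Real.pi) • Φ.toEquiv z
  have hTc : Continuous T := by fun_prop
  let S : Set (ℝ × E2) := T ⁻¹' B
  have hSc : IsClosed S := hBc.preimage hTc
  -- vanishing off the support
  have hvan : ∀ᵐ z : ℝ × E2, z ∈ Sᶜ → ftFst γ z = 0 := by
    refine hSc.isOpen_compl.ae_eq_zero_of_integral_contDiff_smul_eq_zero
      (hGloc.locallyIntegrableOn _) fun ψ h1 h2 h3 => ?_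
    let φ : ℝ × E2 → ℂ := fun q => (ψ (Φ.toEquiv.symm ((2 * Real.pi)⁻¹ • q)) : ℂ)
    let H : (ℝ × E2) ≃ₜ (ℝ × E2) :=
      (Homeomorph.smulOfNeZero ((2 * Real.pi)⁻¹) (inv_ne_zero hpi)).trans
        Φ.toEquiv.symm.toHomeomorph
    have hφH : φ = (fun z => (ψ z : ℂ)) ∘ H := rfl
    have hψC : tsupport (fun z => (ψ z : ℂ)) ⊆ tsupport ψ :=
      closure_mono fun x hx => by simpa using hx
    have hψcs : HasCompactSupport (fun z => (ψ z : ℂ)) := h2.comp_left (g := Complex.ofReal) rfl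
    have hψsm : ContDiff ℝ (⊤ : ℕ∞) (fun z => (ψ z : ℂ)) := Complex.ofRealCLM.contDiff.comp h1
    have hts : tsupport φ = H ⁻¹' tsupport (fun z => (ψ z : ℂ)) := by
      rw [hφH, tsupport_comp_eq_preimage]
    have key := hsupp φ ?_ ?_ ?_
    · have e1 : ∀ w, stFourier φ w =
          |((2 * Real.pi) ^ Module.finrank ℝ (ℝ × E2))| •
            ft3 (fun z => (ψ z : ℂ)) (Φ.toEquiv.symm w) := by
        intro w
        rw [stFourier_eq, ft3]
        have e2 := Measure.integral_comp_inv_smul (volume : Measure (ℝ × E2))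
          (fun q => ce (-pr w q) * (ψ (Φ.toEquiv.symm q) : ℂ)) (2 * Real.pi)
        rw [← Φ.measurePreserving_symm.integral_comp Φ.measurableEmbedding_symm
          (fun z => ce (-pr (Φ.toEquiv.symm w) z) * (ψ z : ℂ))]
        simp only [Φ.pr_symm]
        rw [← e2]
        refine integral_congr_ae (ae_of_all _ fun q => ?_)
        simp only [pr_smul_right, φ]
        congr 2
        ring
      have e3 : ∫ w, g' w * ft3 (fun z => (ψ z : ℂ)) w = 0 := by
        rw [← Φ.measurePreserving_symm.integral_comp Φ.measurableEmbedding_symm]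
        simp only [e1, hg', ContinuousLinearEquiv.apply_symm_apply, mul_smul_comm,
          integral_smul] at key ⊢
        rw [smul_eq_zero] at key
        rcases key with key | key
        · exact absurd key (by positivity)
        · exact key
      rw [hmul (isTest_of_compact hψsm.continuous hψcs)] at e3
      rw [← e3]
      refine integral_congr_ae (ae_of_all _ fun z => ?_)
      simp only [Complex.real_smul, mul_comm]
    · have : ContDiff ℝ (⊤ : ℕ∞) fun q : ℝ × E2 => Φ.toEquiv.symm ((2 * Real.pi)⁻¹ • q) :=
        Φ.toEquiv.symm.contDiff.comp (contDiff_const_smul _)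
      exact hψsm.comp this
    · exact hψcs.comp_homeomorph H
    · rw [hts, Set.disjoint_left]
      intro q hq hqB
      have h4 := h3 (hψC hq)
      refine h4 ?_
      change (2 * Real.pi) • Φ.toEquiv (Φ.toEquiv.symm ((2 * Real.pi)⁻¹ • q)) ∈ B
      rwa [ContinuousLinearEquiv.apply_symm_apply, smul_smul, mul_inv_cancel₀ hpi, one_smul]
  refine ⟨γ, hγ, hnorm, ?_, ?_⟩
  · filter_upwards [Φ.measurePreserving_symm.quasiMeasurePreserving.ae hvan] with z hz hzB
    refine hz ?_
    simpa [S, T] using hzB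
  -- the inversion formula
  have hSb : Bornology.IsBounded S := by
    obtain ⟨R, hR⟩ := hBb.subset_closedBall 0
    have h1 : S ⊆ Φ.toEquiv.symm '' Metric.closedBall 0 (R / (2 * Real.pi)) := by
      intro z hz
      refine ⟨Φ.toEquiv z, ?_, by simp⟩
      have := hR hz
      simp only [Metric.mem_closedBall, dist_zero_right, T, norm_smul, Real.norm_eq_abs] at this ⊢
      rw [abs_of_pos (by positivity)] at this
      rw [le_div_iff₀ (by positivity)]; linarith
    exact (((isCompact_closedBall _ _).image Φ.toEquiv.symm.continuous).isBounded).subset h1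
  have hGint : IntegrableOn (ftFst γ) S :=
    hGloc.integrableOn_isCompact (Metric.isCompact_of_isClosed_isBounded hSc hSb)
  let G1 : ℝ × E2 → ℂ := S.indicator (ftFst γ)
  have hG1i : Integrable G1 := (integrable_indicator_iff hSc.measurableSet).2 hGint
  have hG1 : ftFst γ =ᵐ[volume] G1 := by
    filter_upwards [hvan] with z hz
    by_cases h : z ∈ S
    · simp [G1, h]
    · simp [G1, h, hz h]
  let g0 : ℝ × E2 → ℂ := fun w => ∫ z, ce (pr w z) * G1 z
  have hg0c : Continuous g0 := by
    refine continuous_of_dominated (bound := fun z => ‖G1 z‖) (fun w => ?_) (fun w => ?_)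
      hG1i.norm (ae_of_all _ fun z => ?_)
    · exact (Continuous.aestronglyMeasurable (by fun_prop)).mul hG1i.1
    · exact ae_of_all _ fun z => by simp
    · fun_prop
  have hg'loc : LocallyIntegrable g' volume := by
    refine locallyIntegrable_of_slices hg'm fun R => lt_of_le_of_lt ?_ hfin
    exact setLIntegral_le_lintegral _ _
  have hmain : ∀ᵐ w, g' w = g0 w := by
    refine ae_eq_of_integral_contDiff_smul_eq hg'loc hg0c.locallyIntegrable fun ψ h1 h2 => ?_
    have hψcs : HasCompactSupport (fun z => (ψ z : ℂ)) := h2.comp_left (g := Complex.ofReal) rfl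
    have hψsm : ContDiff ℝ (⊤ : ℕ∞) (fun z => (ψ z : ℂ)) := Complex.ofRealCLM.contDiff.comp h1
    obtain ⟨ht, hft⟩ := exists_ft3_eq hψsm hψcs
    have hψi : Integrable (fun z => (ψ z : ℂ)) := hψsm.continuous.integrable_of_hasCompactSupport hψcs
    calc ∫ w, ψ w • g' w = ∫ w, g' w * ft3 (fun z => ∫ w, ce (pr z w) * ψ w) w := by
          rw [hft]; simp only [Complex.real_smul, mul_comm]
      _ = ∫ z, G1 z * ∫ w, ce (pr z w) * ψ w := by
          rw [hmul ht]
          refine integral_congr_ae ?_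
          filter_upwards [hG1] with z hz
          rw [hz]
      _ = ∫ z, ∫ w, G1 z * (ce (pr z w) * ψ w) := by simp only [integral_const_mul]
      _ = ∫ w, ∫ z, G1 z * (ce (pr z w) * ψ w) := by
          refine integral_integral_swap ?_
          have := (hG1i.mul_prod hψi).bdd_mul (c := 1)
            (f := fun p : (ℝ × E2) × (ℝ × E2) => ce (pr p.1 p.2))
            (Continuous.aestronglyMeasurable (by fun_prop)) (ae_of_all _ fun y => by simp)
          refine this.congr (ae_of_all _ fun p => ?_)
          simp only [Function.uncurry]; ring
      _ = _ := by
          refine integral_congr_ae (ae_of_all _ fun w => ?_)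
          simp only [g0, Complex.real_smul, ← integral_const_mul]
          refine integral_congr_ae (ae_of_all _ fun z => ?_)
          simp only [pr_comm z w]; ring
  filter_upwards [Φ.measurePreserving_symm.quasiMeasurePreserving.ae hmain] with w hw
  have e4 : g' (Φ.toEquiv.symm w) = g w.1 w.2 := by simp [hg']
  rw [← e4, hw]
  simp only [g0]
  have hms : MeasurableSet {z : ℝ × E2 | (2 * Real.pi) • z ∈ B} :=
    (hBc.preimage (continuous_const_smul (2 * Real.pi))).measurableSet
  rw [← integral_indicator hms,
    ← Φ.measurePreserving_symm.integral_comp Φ.measurableEmbedding_symm]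
  refine integral_congr_ae (ae_of_all _ fun z => ?_)
  have hmem : Φ.toEquiv.symm z ∈ S ↔ z ∈ {z : ℝ × E2 | (2 * Real.pi) • z ∈ B} := by
    simp [S, T]
  by_cases h : z ∈ {z : ℝ × E2 | (2 * Real.pi) • z ∈ B}
  · simp only [G1, indicator_of_mem h, indicator_of_mem (hmem.2 h), Φ.pr_symm]
  · simp only [G1, indicator_of_notMem h, indicator_of_notMem (fun h' => h (hmem.1 h')), mul_zero]

/-! ### The Duhamel solution for a source with bounded spectrum -/

/-- The Japanese bracket in the normalization of Mathlib's Fourier transform. -/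
def nb (ζ : E2) : ℝ := jb ((2 * Real.pi) • ζ) / (2 * Real.pi)

lemma jb_eq_nb (ζ : E2) : jb ((2 * Real.pi) • ζ) = 2 * Real.pi * nb ζ := by
  unfold nb; field_simp

lemma jb_pos (ξ : E2) : 0 < jb ξ := Real.sqrt_pos.2 (by positivity)

lemma jb_sq (ξ : E2) : jb ξ ^ 2 = 1 + ‖ξ‖ ^ 2 := Real.sq_sqrt (by positivity)

lemma nb_pos (ζ : E2) : 0 < nb ζ := div_pos (jb_pos _) (by positivity)

lemma nb_sq (ζ : E2) : nb ζ ^ 2 = ((2 * Real.pi) ^ 2)⁻¹ + ‖ζ‖ ^ 2 := by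
  rw [nb, div_pow, jb_sq, norm_smul, Real.norm_of_nonneg (by positivity)]
  field_simp

lemma jb_eq_rpow : jb = fun ξ => (1 + ‖ξ‖ ^ 2) ^ (1 / 2 : ℝ) := by
  ext ξ; rw [jb, Real.sqrt_eq_rpow]

lemma hasTemperateGrowth_jb : (fun ζ : E2 => ((jb ((2 * Real.pi) • ζ) : ℝ) : ℂ)).HasTemperateGrowth := by
  have h1 := Function.hasTemperateGrowth_one_add_norm_sq_rpow E2 (1 / 2)
  rw [← jb_eq_rpow] at h1
  have h2 : (fun ζ : E2 => (2 * Real.pi) • ζ).HasTemperateGrowth :=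
    ((2 * Real.pi) • ContinuousLinearMap.id ℝ E2).hasTemperateGrowth
  exact Function.HasTemperateGrowth.comp Function.Complex.hasTemperateGrowth_ofReal (h1.comp h2)

lemma continuous_jb : Continuous jb := by unfold jb; fun_prop

lemma continuous_nb : Continuous nb := by unfold nb jb; fun_prop

@[fun_prop] lemma Continuous.nb {X : Type*} [TopologicalSpace X] {f : X → E2} (hf : Continuous f) :
    Continuous fun x => HalfKG.nb (f x) := continuous_nb.comp hf

/-- `⟨D⟩` on Schwartz functions. -/
def japS (φ : SchwartzMap E2 ℂ) : SchwartzMap E2 ℂ :=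
  𝓕⁻ (SchwartzMap.smulLeftCLM ℂ (fun ζ : E2 => ((jb ((2 * Real.pi) • ζ) : ℝ) : ℂ)) (𝓕 φ))

lemma japS_coe (φ : SchwartzMap E2 ℂ) : (japS φ : E2 → ℂ) = japD φ := by
  rw [japS, SchwartzMap.fourierInv_coe, SchwartzMap.smulLeftCLM_apply hasTemperateGrowth_jb]
  rfl

lemma fourierInv_japS (φ : SchwartzMap E2 ℂ) (ζ : E2) :
    𝓕⁻ (japS φ : E2 → ℂ) ζ = ((2 * Real.pi * nb ζ : ℝ) : ℂ) * 𝓕⁻ (φ : E2 → ℂ) ζ := by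
  rw [Real.fourierInv_eq_fourier_neg, Real.fourierInv_eq_fourier_neg, ← SchwartzMap.fourier_coe,
    ← SchwartzMap.fourier_coe, japS, FourierTransform.fourier_fourierInv_eq,
    SchwartzMap.smulLeftCLM_apply_apply hasTemperateGrowth_jb, smul_eq_mul, ← jb_eq_nb]
  simp [jb]

/-- The primitive `∫₀ᵗ e^{2πisθ} ds`. -/
def ceInt (t θ : ℝ) : ℂ := ∫ s in (0 : ℝ)..t, ce (s * θ)

lemma norm_ceInt_sub_le (t t' θ : ℝ) : ‖ceInt t θ - ceInt t' θ‖ ≤ |t - t'| := by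
  unfold ceInt
  rw [intervalIntegral.integral_interval_sub_left
    (Continuous.intervalIntegrable (by fun_prop) _ _)
    (Continuous.intervalIntegrable (by fun_prop) _ _)]
  have := intervalIntegral.norm_integral_le_of_norm_le_const (a := t') (b := t) (C := 1)
    (f := fun s => ce (s * θ)) (fun s _ => by simp)
  simpa using this

@[simp] lemma ceInt_zero (θ : ℝ) : ceInt 0 θ = 0 := by simp [ceInt]

lemma norm_ceInt_le (t θ : ℝ) : ‖ceInt t θ‖ ≤ |t| := by
  simpa using norm_ceInt_sub_le t 0 θ

lemma hasDerivAt_ceInt (t θ : ℝ) : HasDerivAt (fun t => ceInt t θ) (ce (t * θ)) t :=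
  intervalIntegral.integral_hasDerivAt_right (Continuous.intervalIntegrable (by fun_prop) _ _)
    (Continuous.stronglyMeasurableAtFilter (by fun_prop) _ _)
    (Continuous.continuousAt (by fun_prop))

lemma hasDerivAt_ce_mul (t θ : ℝ) :
    HasDerivAt (fun t => ce (t * θ)) (2 * Real.pi * Complex.I * θ * ce (t * θ)) t := by
  have := (hasDerivAt_ce (t * θ)).scomp t ((hasDerivAt_id t).mul_const θ)
  refine this.congr_deriv ?_
  simp only [one_mul, Complex.real_smul]
  ring

lemma two_pi_I_mul_ceInt (t θ : ℝ) : 2 * Real.pi * Complex.I * θ * ceInt t θ = ce (t * θ) - 1 := by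
  have h := intervalIntegral.integral_eq_sub_of_hasDerivAt (a := 0) (b := t)
    (fun s _ => hasDerivAt_ce_mul s θ) (Continuous.intervalIntegrable (by fun_prop) _ _)
  rw [intervalIntegral.integral_const_mul] at h
  simpa [ceInt] using h

lemma continuous_ceInt : Continuous fun p : ℝ × ℝ => ceInt p.1 p.2 := by
  have h : ∀ p : ℝ × ℝ, ceInt p.1 p.2 = p.1 * ∫ u in (0 : ℝ)..1, ce (p.1 * u * p.2) := by
    intro p
    have := intervalIntegral.smul_integral_comp_mul_left (a := 0) (b := 1)
      (fun s => ce (s * p.2)) p.1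
    simp only [mul_zero, mul_one] at this
    rw [ceInt, ← this, Complex.real_smul]
  simp only [h]
  refine Continuous.mul (by fun_prop) ?_
  exact intervalIntegral.continuous_parametric_intervalIntegral_of_continuous'
    (f := fun (p : ℝ × ℝ) u => ce (p.1 * u * p.2)) (by fun_prop) 0 1

@[fun_prop] lemma Continuous.ceInt {X : Type*} [TopologicalSpace X] {f g : X → ℝ}
    (hf : Continuous f) (hg : Continuous g) : Continuous fun x => HalfKG.ceInt (f x) (g x) :=
  continuous_ceInt.comp (hf.prodMk hg)

/-- Duhamel's formula on the Fourier side. -/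
lemma duhamel_identity (t τ p : ℝ) :
    ce (t * p) * ceInt t (τ - p) -
      Complex.I * ∫ s in (0 : ℝ)..t, (2 * Real.pi * p : ℝ) * (ce (s * p) * ceInt s (τ - p)) =
      ceInt t τ := by
  have h : ∀ s, HasDerivAt (fun s => ce (s * p) * ceInt s (τ - p))
      (Complex.I * ((2 * Real.pi * p : ℝ) * (ce (s * p) * ceInt s (τ - p))) + ce (s * τ)) s := by
    intro s
    have := (hasDerivAt_ce_mul s p).mul (hasDerivAt_ceInt s (τ - p))
    refine this.congr_deriv ?_
    rw [← ce_add]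
    have : s * p + s * (τ - p) = s * τ := by ring
    rw [this]; push_cast; ring
  have h2 := intervalIntegral.integral_eq_sub_of_hasDerivAt (a := 0) (b := t) (fun s _ => h s)
    (Continuous.intervalIntegrable (by fun_prop) _ _)
  rw [intervalIntegral.integral_add (Continuous.intervalIntegrable (by fun_prop) _ _)
    (Continuous.intervalIntegrable (by fun_prop) _ _),
    intervalIntegral.integral_const_mul] at h2
  simp only [zero_mul, ce_zero, ceInt_zero, mul_zero, sub_zero] at h2
  rw [← h2]
  simp only [ceInt]
  ring

/-- Square integrable densities on frequency space with bounded support. -/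
structure IsDensity (R : ℝ) (G : ℝ × E2 → ℂ) : Prop where
  meas : StronglyMeasurable G
  memLp : MemLp G 2 volume
  fst : ∀ z, R < |z.1| → G z = 0
  snd : ∀ z, R < ‖z.2‖ → G z = 0

lemma IsDensity.integrable {R : ℝ} {G : ℝ × E2 → ℂ} (h : IsDensity R G) : Integrable G := by
  have h1 : IntegrableOn G (Metric.closedBall 0 R) := by
    have : IsFiniteMeasure (volume.restrict (Metric.closedBall (0 : ℝ × E2) R)) :=
      ⟨by rw [Measure.restrict_apply_univ]; exact measure_closedBall_lt_top⟩
    exact (h.memLp.restrict _).integrable (by norm_num)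
  refine (integrableOn_iff_integrable_of_support_subset fun z hz => ?_).1 h1
  by_contra hcon
  simp only [Metric.mem_closedBall, dist_zero_right, not_le, Prod.norm_def, lt_max_iff] at hcon
  rcases hcon with hc | hc
  · exact hz (h.fst z hc)
  · exact hz (h.snd z hc)

/-- The `L²` bound for integrals over the first frequency variable. -/
lemma eLpNorm_fibre_le {R C : ℝ} {G K : ℝ × E2 → ℂ} (hG : IsDensity R G)
    (hK : ∀ z, ‖K z‖ ≤ C) :
    eLpNorm (fun ζ => ∫ τ, K (τ, ζ) * G (τ, ζ)) 2 volume ≤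
      ENNReal.ofReal C * (ENNReal.ofReal (2 * R)) ^ (1 / 2 : ℝ) * eLpNorm G 2 volume := by
  have hGm := hG.meas.measurable
  have h1 : ∀ ζ, ‖∫ τ, K (τ, ζ) * G (τ, ζ)‖ₑ ≤ ENNReal.ofReal C *
      ((ENNReal.ofReal (2 * R)) ^ (1 / 2 : ℝ) * eLpNorm (fun τ => G (τ, ζ)) 2 volume) := by
    intro ζ
    refine (enorm_integral_le_lintegral_enorm _).trans ?_
    calc ∫⁻ τ, ‖K (τ, ζ) * G (τ, ζ)‖ₑ
        ≤ ∫⁻ τ, ENNReal.ofReal C * ((Icc (-R) R).indicator 1 τ * ‖G (τ, ζ)‖ₑ) := by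
          refine lintegral_mono fun τ => ?_
          rw [enorm_mul]
          by_cases hτ : τ ∈ Icc (-R) R
          · simp only [indicator_of_mem hτ, Pi.one_apply, one_mul]
            gcongr
            rw [← ofReal_norm]
            exact ENNReal.ofReal_le_ofReal (hK _)
          · have : R < |τ| := by
              by_contra hcon; exact hτ (abs_le.1 (not_lt.1 hcon))
            rw [hG.fst _ this]; simp
      _ = ENNReal.ofReal C * ∫⁻ τ, (Icc (-R) R).indicator 1 τ * ‖G (τ, ζ)‖ₑ := by
          rw [lintegral_const_mul']; exact ENNReal.ofReal_ne_top
      _ ≤ _ := by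
          gcongr
          refine (lintegral_mul_le_eLpNorm_two
            ((measurable_one.indicator measurableSet_Icc).aemeasurable)
            ((hGm.comp measurable_prodMk_right).enorm.aemeasurable)).trans ?_
          refine mul_le_mul' ?_ ?_
          · rw [eLpNorm_eq_lintegral_rpow_enorm_toReal (by norm_num) (by norm_num)]
            have : ∀ τ : ℝ, ‖(Icc (-R) R).indicator (1 : ℝ → ℝ≥0∞) τ‖ₑ ^ (ENNReal.toReal 2) =
                (Icc (-R) R).indicator 1 τ := by
              intro τ
              by_cases hτ : τ ∈ Icc (-R) R <;> simp [hτ]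
            simp only [this]
            rw [lintegral_indicator_one measurableSet_Icc, Real.volume_Icc]
            have e : R - -R = 2 * R := by ring
            rw [e]; norm_num
          · exact (eLpNorm_congr_enorm_ae (ae_of_all _ fun x => by simp)).le
  have h2 : eLpNorm (fun ζ => ∫ τ, K (τ, ζ) * G (τ, ζ)) 2 volume ^ 2 ≤
      (ENNReal.ofReal C * (ENNReal.ofReal (2 * R)) ^ (1 / 2 : ℝ) * eLpNorm G 2 volume) ^ 2 := by
    rw [eLpNorm_two_sq]
    calc ∫⁻ ζ, ‖∫ τ, K (τ, ζ) * G (τ, ζ)‖ₑ ^ 2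
        ≤ ∫⁻ ζ, (ENNReal.ofReal C * (ENNReal.ofReal (2 * R)) ^ (1 / 2 : ℝ)) ^ 2 *
            ∫⁻ τ, ‖G (τ, ζ)‖ₑ ^ 2 := by
          refine lintegral_mono fun ζ => ?_
          refine (pow_le_pow_left' (h1 ζ) 2).trans_eq ?_
          rw [← eLpNorm_two_sq (fun τ => G (τ, ζ))]; ring
      _ = (ENNReal.ofReal C * (ENNReal.ofReal (2 * R)) ^ (1 / 2 : ℝ)) ^ 2 *
            eLpNorm G 2 volume ^ 2 := by
          rw [lintegral_const_mul', eLpNorm_two_sq, Measure.volume_eq_prod,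
            lintegral_prod_symm _ (hGm.enorm.pow_const 2).aemeasurable]
          exact ENNReal.pow_ne_top (ENNReal.mul_ne_top ENNReal.ofReal_ne_top
            (ENNReal.rpow_ne_top_of_nonneg (by norm_num) ENNReal.ofReal_ne_top))
      _ = _ := by ring
  exact (ENNReal.pow_le_pow_left_iff two_ne_zero).1 h2

lemma stronglyMeasurable_fibre {G K : ℝ × E2 → ℂ} (hG : StronglyMeasurable G)
    (hK : StronglyMeasurable K) : StronglyMeasurable fun ζ => ∫ τ, K (τ, ζ) * G (τ, ζ) :=
  StronglyMeasurable.integral_prod_right (f := fun (ζ : E2) (τ : ℝ) => K (τ, ζ) * G (τ, ζ))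
    ((hK.mul hG).comp_measurable measurable_swap)

lemma memLp_fibre {R C : ℝ} {G K : ℝ × E2 → ℂ} (hG : IsDensity R G)
    (hKm : StronglyMeasurable K) (hK : ∀ z, ‖K z‖ ≤ C) :
    MemLp (fun ζ => ∫ τ, K (τ, ζ) * G (τ, ζ)) 2 volume := by
  refine ⟨(stronglyMeasurable_fibre hG.meas hKm).aestronglyMeasurable, ?_⟩
  refine (eLpNorm_fibre_le hG hK).trans_lt ?_
  exact ENNReal.mul_lt_top (ENNReal.mul_lt_top ENNReal.ofReal_lt_top
    (ENNReal.rpow_lt_top_of_nonneg (by norm_num) ENNReal.ofReal_ne_top)) hG.memLp.2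

lemma IsDensity.integrable_mul {R C : ℝ} {G K : ℝ × E2 → ℂ} (hG : IsDensity R G)
    (hKm : StronglyMeasurable K) (hK : ∀ z, ‖K z‖ ≤ C) : Integrable fun z => K z * G z :=
  hG.integrable.bdd_mul (c := C) hKm.aestronglyMeasurable (ae_of_all _ hK)

lemma integrable_fibre {R C : ℝ} {G K : ℝ × E2 → ℂ} (hG : IsDensity R G)
    (hKm : StronglyMeasurable K) (hK : ∀ z, ‖K z‖ ≤ C) :
    Integrable (fun ζ => ∫ τ, K (τ, ζ) * G (τ, ζ)) volume := by
  have := hG.integrable_mul hKm hK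
  rw [Measure.volume_eq_prod] at this
  exact this.integral_prod_right

/-- A plane wave superposition over space-time frequencies is an inverse Fourier transform of the
integral over the fibres. -/
lemma integral_ce_inner_fibre {R C : ℝ} {G K : ℝ × E2 → ℂ} (hG : IsDensity R G)
    (hKm : StronglyMeasurable K) (hK : ∀ z, ‖K z‖ ≤ C) (x : E2) :
    ∫ z : ℝ × E2, ce (inner ℝ x z.2) * (K z * G z) =
      𝓕⁻ (fun ζ => ∫ τ, K (τ, ζ) * G (τ, ζ)) x := by
  have h : Integrable fun z : ℝ × E2 => ce (inner ℝ x z.2) * (K z * G z) :=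
    (hG.integrable_mul hKm hK).bdd_mul (c := 1)
      (Continuous.aestronglyMeasurable (by fun_prop)) (ae_of_all _ fun z => by simp)
  rw [fourierInv_eq_ce]
  rw [Measure.volume_eq_prod] at h ⊢
  rw [integral_prod_symm _ h]
  refine integral_congr_ae (ae_of_all _ fun ζ => ?_)
  simp only [integral_const_mul, real_inner_comm]

/-- The Duhamel solution with source `∫ e^{2πi(tτ + x·ζ)} G(τ,ζ)`. -/
def duhamel (G : ℝ × E2 → ℂ) (t : ℝ) (x : E2) : ℂ :=
  ∫ z : ℝ × E2, ce (inner ℝ x z.2) * (-Complex.I * (ce (t * nb z.2) * ceInt t (z.1 - nb z.2)) * G z)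

lemma duhamel_eq_fourierInv {R : ℝ} {G : ℝ × E2 → ℂ} (hG : IsDensity R G) (t : ℝ) :
    duhamel G t = 𝓕⁻ (fun ζ => ∫ τ, -Complex.I * (ce (t * nb ζ) * ceInt t (τ - nb ζ)) * G (τ, ζ)) := by
  ext x
  exact integral_ce_inner_fibre (C := |t|) hG
    (K := fun z => -Complex.I * (ce (t * nb z.2) * ceInt t (z.1 - nb z.2)))
    (Continuous.stronglyMeasurable (by fun_prop)) (fun z => by simpa using norm_ceInt_le _ _) x

/-- Pairing of a superposition of plane waves in space with a Schwartz function. -/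
lemma integral_superposition_mul {Z : Type*} [MeasurableSpace Z] {μ : Measure Z} [SFinite μ]
    {H : Z → ℂ} (hH : Integrable H μ) {ζ : Z → E2} (hζ : Measurable ζ)
    (φ : SchwartzMap E2 ℂ) :
    ∫ x : E2, (∫ z, ce (inner ℝ x (ζ z)) * H z ∂μ) * φ x = ∫ z, H z * 𝓕⁻ (φ : E2 → ℂ) (ζ z) ∂μ := by
  have h : Integrable (fun p : E2 × Z => ce (inner ℝ p.1 (ζ p.2)) * (φ p.1 * H p.2))
      (volume.prod μ) := by
    refine (φ.integrable.mul_prod hH).bdd_mul (c := 1) ?_ (ae_of_all _ fun p => by simp)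
    refine Measurable.aestronglyMeasurable ?_
    exact measurable_ce.comp (measurable_fst.inner (hζ.comp measurable_snd))
  calc _ = ∫ x : E2, ∫ z, ce (inner ℝ x (ζ z)) * (φ x * H z) ∂μ := by
        refine integral_congr_ae (ae_of_all _ fun x => ?_)
        simp only [← integral_mul_const]
        refine integral_congr_ae (ae_of_all _ fun z => ?_)
        simp only; ring
    _ = ∫ z, (∫ x : E2, ce (inner ℝ x (ζ z)) * (φ x * H z)) ∂μ := integral_integral_swap h
    _ = _ := by
        refine integral_congr_ae (ae_of_all _ fun z => ?_)
        simp only [fourierInv_eq_ce, ← integral_const_mul]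
        refine integral_congr_ae (ae_of_all _ fun x => ?_)
        simp only; ring

lemma norm_fourierInv_schwartz_le (φ : SchwartzMap E2 ℂ) :
    ∃ C, ∀ ζ, ‖𝓕⁻ (φ : E2 → ℂ) ζ‖ ≤ C := by
  refine ⟨∫ x, ‖φ x‖, fun ζ => ?_⟩
  rw [fourierInv_eq_ce]
  refine (norm_integral_le_integral_norm _).trans_eq ?_
  simp

/-- The Duhamel formula solves the inhomogeneous equation. -/
lemma isSolution_duhamel {R : ℝ} {G : ℝ × E2 → ℂ} (hG : IsDensity R G) {g : ℝ → E2 → ℂ}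
    (hgG : ∀ᵐ w : ℝ × E2, g w.1 w.2 = ∫ z, ce (pr w z) * G z) :
    IsSolution g (duhamel G) := by
  have hnbR : ∃ M, 0 ≤ M ∧ ∀ ζ : E2, ‖ζ‖ ≤ R → nb ζ ≤ M := by
    refine ⟨Real.sqrt (((2 * Real.pi) ^ 2)⁻¹ + R ^ 2), Real.sqrt_nonneg _, fun ζ hζ => ?_⟩
    refine Real.le_sqrt_of_sq_le ?_
    rw [nb_sq]
    have := norm_nonneg ζ
    gcongr
  obtain ⟨M, hM0, hM⟩ := hnbR
  have hkm : ∀ t, StronglyMeasurable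
      fun z : ℝ × E2 => -Complex.I * (ce (t * nb z.2) * ceInt t (z.1 - nb z.2)) := fun t =>
    Continuous.stronglyMeasurable (by fun_prop)
  have hkb : ∀ t (z : ℝ × E2), ‖-Complex.I * (ce (t * nb z.2) * ceInt t (z.1 - nb z.2))‖ ≤ |t| :=
    fun t z => by simpa using norm_ceInt_le _ _
  have hmem : ∀ t, MemLp (duhamel G t) 2 volume := fun t => by
    rw [duhamel_eq_fourierInv hG]
    exact memLp_fourierInv (integrable_fibre hG (hkm t) (hkb t)) (memLp_fibre hG (hkm t) (hkb t))
  refine ⟨?_, hmem, ?_, ?_, ?_⟩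
  · refine StronglyMeasurable.aestronglyMeasurable ?_
    refine StronglyMeasurable.integral_prod_right (f := fun (p : ℝ × E2) (z : ℝ × E2) =>
      ce (inner ℝ p.2 z.2) * (-Complex.I * (ce (p.1 * nb z.2) * ceInt p.1 (z.1 - nb z.2)) * G z)) ?_
    have h1 : StronglyMeasurable fun q : (ℝ × E2) × (ℝ × E2) => G q.2 :=
      hG.meas.comp_measurable measurable_snd
    refine StronglyMeasurable.mul (Continuous.stronglyMeasurable (by fun_prop)) ?_
    exact StronglyMeasurable.mul (Continuous.stronglyMeasurable (by fun_prop)) h1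
  · intro t₀
    -- the kernels are Lipschitz in time, uniformly on the bounded support of `G`
    let A : ℝ := 2 * Real.pi * M
    have hb : ∀ t, eLpNorm (duhamel G t - duhamel G t₀) 2 volume ≤
        ENNReal.ofReal (|t - t₀| + A * |t - t₀| * |t₀|) *
          (ENNReal.ofReal (2 * R)) ^ (1 / 2 : ℝ) * eLpNorm G 2 volume := by
      intro t
      let K : ℝ × E2 → ℂ := fun z => if ‖z.2‖ ≤ R then
        -Complex.I * (ce (t * nb z.2) * ceInt t (z.1 - nb z.2)) -
        -Complex.I * (ce (t₀ * nb z.2) * ceInt t₀ (z.1 - nb z.2)) else 0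
      have hKm : StronglyMeasurable K := by
        refine StronglyMeasurable.ite ?_ ((hkm t).sub (hkm t₀)) stronglyMeasurable_const
        exact measurableSet_le (by fun_prop) measurable_const
      have hKb : ∀ z, ‖K z‖ ≤ |t - t₀| + A * |t - t₀| * |t₀| := by
        intro z
        simp only [K]
        have hA : 0 ≤ A := by positivity
        split_ifs with hz
        · rw [← mul_sub, norm_mul, norm_neg, Complex.norm_I, one_mul]
          have e : ce (t * nb z.2) * ceInt t (z.1 - nb z.2) -
              ce (t₀ * nb z.2) * ceInt t₀ (z.1 - nb z.2) =
              ce (t * nb z.2) * (ceInt t (z.1 - nb z.2) - ceInt t₀ (z.1 - nb z.2)) +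
              (ce (t * nb z.2) - ce (t₀ * nb z.2)) * ceInt t₀ (z.1 - nb z.2) := by ring
          rw [e]
          refine (norm_add_le _ _).trans ?_
          rw [norm_mul, norm_mul, norm_ce, one_mul]
          refine add_le_add (norm_ceInt_sub_le _ _ _) ?_
          refine mul_le_mul ?_ (norm_ceInt_le _ _) (norm_nonneg _) (by positivity)
          refine (norm_ce_sub_le _ _).trans ?_
          rw [← sub_mul, abs_mul, abs_of_pos (nb_pos _)]
          have := hM _ hz
          calc 2 * Real.pi * (|t - t₀| * nb z.2) ≤ 2 * Real.pi * (|t - t₀| * M) := by gcongr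
            _ = _ := by simp only [A]; ring
        · simp only [norm_zero]; positivity
      have hdiff : duhamel G t - duhamel G t₀ = 𝓕⁻ (fun ζ => ∫ τ, K (τ, ζ) * G (τ, ζ)) := by
        ext x
        rw [← integral_ce_inner_fibre hG hKm hKb x]
        simp only [Pi.sub_apply, duhamel]
        rw [← integral_sub]
        · refine integral_congr_ae (ae_of_all _ fun z => ?_)
          simp only [K]
          split_ifs with hz
          · ring
          · rw [hG.snd _ (not_le.1 hz)]; ring
        · exact (hG.integrable_mul (hkm t) (hkb t)).bdd_mul (c := 1)
            (Continuous.aestronglyMeasurable (by fun_prop)) (ae_of_all _ fun z => by simp)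
        · exact (hG.integrable_mul (hkm t₀) (hkb t₀)).bdd_mul (c := 1)
            (Continuous.aestronglyMeasurable (by fun_prop)) (ae_of_all _ fun z => by simp)
      rw [hdiff, eLpNorm_fourierInv (integrable_fibre hG hKm hKb) (memLp_fibre hG hKm hKb)]
      exact eLpNorm_fibre_le hG hKb
    refine tendsto_of_tendsto_of_tendsto_of_le_of_le tendsto_const_nhds ?_ (fun _ => bot_le) hb
    have hc : Tendsto (fun t => ENNReal.ofReal (|t - t₀| + A * |t - t₀| * |t₀|)) (𝓝 t₀) (𝓝 0) := by
      have : Continuous fun t => ENNReal.ofReal (|t - t₀| + A * |t - t₀| * |t₀|) :=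
        ENNReal.continuous_ofReal.comp (by fun_prop)
      simpa using this.tendsto t₀
    have hfin : (ENNReal.ofReal (2 * R)) ^ (1 / 2 : ℝ) * eLpNorm G 2 volume ≠ ⊤ :=
      ENNReal.mul_ne_top (ENNReal.rpow_ne_top_of_nonneg (by norm_num) ENNReal.ofReal_ne_top)
        hG.memLp.2.ne
    have := ENNReal.Tendsto.mul_const hc (Or.inr hfin)
    simpa only [zero_mul, mul_assoc] using this
  · refine ae_of_all _ fun x => ?_
    simp [duhamel]
  · intro φ t
    obtain ⟨Cφ, hCφ⟩ := norm_fourierInv_schwartz_le φ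
    have hφm : Continuous (𝓕⁻ (φ : E2 → ℂ)) := by
      rw [← SchwartzMap.fourierInv_coe]; exact (𝓕⁻ φ).continuous
    let F : E2 → ℂ := 𝓕⁻ (φ : E2 → ℂ)
    have hFm : Continuous F := hφm
    have hu : ∀ (ψ : SchwartzMap E2 ℂ) s, ∫ x, duhamel G s x * ψ x =
        ∫ z : ℝ × E2, -Complex.I * (ce (s * nb z.2) * ceInt s (z.1 - nb z.2)) * G z *
          𝓕⁻ (ψ : E2 → ℂ) z.2 := fun ψ s =>
      integral_superposition_mul (hG.integrable_mul (hkm s) (hkb s)) measurable_snd ψ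
    -- all the space-time integrals below converge absolutely
    have hGF : Integrable fun z : ℝ × E2 => F z.2 * G z :=
      hG.integrable_mul (K := fun z => F z.2) (hFm.comp continuous_snd).stronglyMeasurable
        (fun z => hCφ z.2)
    have hGFp : Integrable fun z : ℝ × E2 => ((2 * Real.pi * nb z.2 : ℝ) : ℂ) * (F z.2 * G z) := by
      let K : ℝ × E2 → ℂ := fun z => if ‖z.2‖ ≤ R then ((2 * Real.pi * nb z.2 : ℝ) : ℂ) else 0
      have hKm : StronglyMeasurable K := by
        refine StronglyMeasurable.ite ?_ (Continuous.stronglyMeasurable (by fun_prop))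
          stronglyMeasurable_const
        exact measurableSet_le (by fun_prop) measurable_const
      refine (hGF.bdd_mul (c := 2 * Real.pi * M) hKm.aestronglyMeasurable
        (ae_of_all _ fun z => ?_)).congr (ae_of_all _ fun z => ?_)
      · simp only [K]
        split_ifs with hz
        · rw [Complex.norm_real, Real.norm_of_nonneg (by have := nb_pos z.2; positivity)]
          have := hM _ hz
          gcongr
        · simp only [norm_zero]; positivity
      · simp only [K]
        split_ifs with hz
        · rfl
        · rw [hG.snd _ (not_le.1 hz)]; ring
    have h1 : ∫ s in (0 : ℝ)..t, ∫ x, duhamel G s x * japD φ x =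
        ∫ z : ℝ × E2, -Complex.I * (∫ s in (0 : ℝ)..t, (2 * Real.pi * nb z.2 : ℝ) *
          (ce (s * nb z.2) * ceInt s (z.1 - nb z.2))) * (F z.2 * G z) := by
      rw [← japS_coe]
      simp only [hu, fourierInv_japS]
      rw [intervalIntegral_integral_swap]
      · refine integral_congr_ae (ae_of_all _ fun z => ?_)
        simp only
        rw [← intervalIntegral.integral_const_mul, ← intervalIntegral.integral_mul_const]
        refine intervalIntegral.integral_congr fun s _ => ?_
        simp only [F]; ring
      · have hi : Integrable (fun q : ℝ × (ℝ × E2) => (1 : ℝ) •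
            (((2 * Real.pi * nb q.2.2 : ℝ) : ℂ) * (F q.2.2 * G q.2)))
            ((volume.restrict (uIoc 0 t)).prod volume) := by
          have : IntegrableOn (fun _ : ℝ => (1 : ℝ)) (uIoc 0 t) :=
            integrableOn_const (by simp [uIoc])
          exact this.smul_prod hGFp
        refine (hi.bdd_mul (c := |t|) (f := fun q : ℝ × (ℝ × E2) =>
            -Complex.I * (ce (q.1 * nb q.2.2) * ceInt q.1 (q.2.1 - nb q.2.2)))
            (Continuous.aestronglyMeasurable (by fun_prop)) ?_).congr (ae_of_all _ fun q => ?_)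
        · have : ∀ᵐ q : ℝ × (ℝ × E2) ∂((volume.restrict (uIoc 0 t)).prod volume),
              q.1 ∈ uIoc 0 t :=
            Measure.quasiMeasurePreserving_fst.ae (ae_restrict_mem measurableSet_uIoc)
          filter_upwards [this] with q hq
          refine (hkb q.1 q.2).trans ?_
          rcases le_total 0 t with h0 | h0
          · rw [uIoc_of_le h0] at hq
            rw [abs_of_pos hq.1, abs_of_nonneg h0]; exact hq.2
          · rw [uIoc_of_ge h0] at hq
            rw [abs_of_nonpos hq.2, abs_of_nonpos h0]; linarith [hq.1]
        · simp only [Function.uncurry, one_smul]; simp only [F]; ring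
    have h2 : ∫ s in (0 : ℝ)..t, ∫ x, g s x * φ x =
        ∫ z : ℝ × E2, ceInt t z.1 * (F z.2 * G z) := by
      have e1 : ∀ s, ∫ x, (∫ z, ce (pr (s, x) z) * G z) * φ x =
          ∫ z : ℝ × E2, ce (s * z.1) * (F z.2 * G z) := by
        intro s
        have hi : Integrable fun z : ℝ × E2 => ce (s * z.1) * G z :=
          hG.integrable_mul (C := 1) (Continuous.stronglyMeasurable (by fun_prop)) (by simp)
        have := integral_superposition_mul hi measurable_snd φ
        calc _ = ∫ x, (∫ z : ℝ × E2, ce (inner ℝ x z.2) * (ce (s * z.1) * G z)) * φ x := by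
              refine integral_congr_ae (ae_of_all _ fun x => ?_)
              simp only
              congr 1
              refine integral_congr_ae (ae_of_all _ fun z => ?_)
              simp only [pr, ce_add]; ring
          _ = _ := this
          _ = _ := by
              refine integral_congr_ae (ae_of_all _ fun z => ?_)
              simp only [F]; ring
      have e2 : ∫ s in (0 : ℝ)..t, ∫ x, g s x * φ x =
          ∫ s in (0 : ℝ)..t, ∫ z : ℝ × E2, ce (s * z.1) * (F z.2 * G z) := by
        refine intervalIntegral.integral_congr_ae ?_
        have : ∀ᵐ s : ℝ, ∀ᵐ x : E2, g s x = ∫ z, ce (pr (s, x) z) * G z :=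
          Measure.ae_ae_of_ae_prod hgG
        filter_upwards [this] with s hs _
        rw [← e1]
        refine integral_congr_ae ?_
        filter_upwards [hs] with x hx
        rw [hx]
      rw [e2, intervalIntegral_integral_swap]
      · refine integral_congr_ae (ae_of_all _ fun z => ?_)
        simp only [ceInt, intervalIntegral.integral_mul_const]
      · have hi : Integrable (fun q : ℝ × (ℝ × E2) => (1 : ℝ) • (F q.2.2 * G q.2))
            ((volume.restrict (uIoc 0 t)).prod volume) := by
          have : IntegrableOn (fun _ : ℝ => (1 : ℝ)) (uIoc 0 t) :=
            integrableOn_const (by simp [uIoc])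
          exact this.smul_prod hGF
        refine (hi.bdd_mul (c := 1) (f := fun q : ℝ × (ℝ × E2) => ce (q.1 * q.2.1))
            (Continuous.aestronglyMeasurable (by fun_prop)) (ae_of_all _ fun q => by simp)).congr
            (ae_of_all _ fun q => ?_)
        simp only [Function.uncurry, one_smul]
    have h3 : Integrable fun z : ℝ × E2 =>
        -Complex.I * (∫ s in (0 : ℝ)..t, (2 * Real.pi * nb z.2 : ℝ) *
          (ce (s * nb z.2) * ceInt s (z.1 - nb z.2))) * (F z.2 * G z) := by
      have e : ∀ z : ℝ × E2, -Complex.I * (∫ s in (0 : ℝ)..t, (2 * Real.pi * nb z.2 : ℝ) *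
          (ce (s * nb z.2) * ceInt s (z.1 - nb z.2))) * (F z.2 * G z) =
          (ceInt t z.1 - ce (t * nb z.2) * ceInt t (z.1 - nb z.2)) * (F z.2 * G z) := by
        intro z
        rw [← duhamel_identity t z.1 (nb z.2)]; ring
      simp only [e]
      refine hGF.bdd_mul (c := |t| + |t|) (Continuous.aestronglyMeasurable (by fun_prop))
        (ae_of_all _ fun z => ?_)
      refine (norm_sub_le _ _).trans (add_le_add (norm_ceInt_le _ _) ?_)
      rw [norm_mul, norm_ce, one_mul]
      exact norm_ceInt_le _ _
    rw [h1, h2, hu φ t, ← integral_const_mul, ← integral_add ?_ h3]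
    · refine integral_congr_ae (ae_of_all _ fun z => ?_)
      simp only
      rw [← duhamel_identity t z.1 (nb z.2)]
      have hI : Complex.I * Complex.I = -1 := Complex.I_mul_I
      simp only [F]
      linear_combination (-(ce (t * nb z.2) * ceInt t (z.1 - nb z.2) * G z *
        𝓕⁻ (φ : E2 → ℂ) z.2)) * hI
    · refine (hGF.bdd_mul (c := |t|) (f := fun z : ℝ × E2 =>
        Complex.I * (-Complex.I * (ce (t * nb z.2) * ceInt t (z.1 - nb z.2))))
        (Continuous.aestronglyMeasurable (by fun_prop)) (ae_of_all _ fun z => ?_)).congr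
        (ae_of_all _ fun z => ?_)
      · rw [norm_mul, Complex.norm_I, one_mul]; exact hkb t z
      · simp only [F]; ring

/-! ### Uniqueness of solutions -/

/-- The bilinear pairing on `L²`. -/
def pairL2 : L2 →L[ℂ] L2 →L[ℂ] ℂ := (ContinuousLinearMap.mul ℂ ℂ).lpPairing volume 2 2

lemma pairL2_apply (a b : L2) : pairL2 a b = ∫ x, a x * b x := by
  simp [pairL2, ContinuousLinearMap.lpPairing_eq_integral]

lemma norm_integral_mul_le {μ : Measure E2} {f h : E2 → ℂ} (hf : MemLp f 2 μ) (hh : MemLp h 2 μ) :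
    ‖∫ y, f y * h y ∂μ‖ ≤ (eLpNorm f 2 μ).toReal * (eLpNorm h 2 μ).toReal := by
  rw [← ENNReal.toReal_mul]
  refine norm_integral_le_lintegral_norm _ |>.trans ?_
  refine ENNReal.toReal_mono (ENNReal.mul_ne_top hf.2.ne hh.2.ne) ?_
  simpa only [ofReal_norm] using lintegral_enorm_mul_le hf.1 hh.1

lemma norm_pairL2_le (a b : L2) : ‖pairL2 a b‖ ≤ ‖a‖ * ‖b‖ := by
  rw [pairL2_apply]
  simpa [Lp.norm_def] using norm_integral_mul_le (Lp.memLp a) (Lp.memLp b)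

lemma continuous_pairL2_left (b : L2) : Continuous fun a => pairL2 a b := by
  have : Continuous fun a => pairL2 a := pairL2.continuous
  exact this.clm_apply continuous_const

/-- A solution as a curve in `L²`. -/
def IsSolution.curve {g u : ℝ → E2 → ℂ} (h : IsSolution g u) (t : ℝ) : L2 := (h.memLp t).toLp (u t)

lemma IsSolution.continuous_curve {g u : ℝ → E2 → ℂ} (h : IsSolution g u) :
    Continuous h.curve := by
  rw [continuous_iff_continuousAt]
  intro t₀
  rw [ContinuousAt, tendsto_iff_norm_sub_tendsto_zero]
  have e : ∀ t, ‖h.curve t - h.curve t₀‖ = (eLpNorm (u t - u t₀) 2 volume).toReal := by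
    intro t
    rw [IsSolution.curve, IsSolution.curve, ← MemLp.toLp_sub, Lp.norm_toLp]
  simp only [e]
  simpa [Function.comp_def] using (ENNReal.tendsto_toReal ENNReal.zero_ne_top).comp (h.cont t₀)

lemma IsSolution.pair_curve {g u : ℝ → E2 → ℂ} (h : IsSolution g u) (t : ℝ)
    (φ : SchwartzMap E2 ℂ) : pairL2 (h.curve t) (φ.toLp 2) = ∫ x, u t x * φ x := by
  rw [pairL2_apply]
  refine integral_congr_ae ?_
  filter_upwards [(h.memLp t).coeFn_toLp, φ.coeFn_toLp 2 volume] with x h1 h2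
  rw [h2, IsSolution.curve, h1]

/-- On functions of bounded frequency, `⟨D⟩` is bounded in `L²`. -/
lemma norm_japS_le {R M : ℝ} (hM0 : 0 ≤ M) (hM : ∀ ζ : E2, ‖ζ‖ ≤ R → 2 * Real.pi * nb ζ ≤ M)
    (φ : SchwartzMap E2 ℂ) (hφ : ∀ ζ, R < ‖ζ‖ → 𝓕⁻ (φ : E2 → ℂ) ζ = 0) :
    ‖(japS φ).toLp 2 (volume : Measure E2)‖ ≤ M * ‖φ.toLp 2 (volume : Measure E2)‖ := by
  have key : ∀ ψ : SchwartzMap E2 ℂ, ENNReal.ofReal ‖ψ.toLp 2 (volume : Measure E2)‖ =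
      eLpNorm (𝓕⁻ (ψ : E2 → ℂ)) 2 volume := by
    intro ψ
    rw [eLpNorm_fourierInv ψ.integrable (ψ.memLp 2 volume), ← eLpNorm_coe_L2]
    exact eLpNorm_congr_ae (ψ.coeFn_toLp 2 volume)
  rw [← ENNReal.ofReal_le_ofReal_iff (by positivity), ENNReal.ofReal_mul hM0, key, key]
  refine eLpNorm_le_mul_eLpNorm_of_ae_le_mul (ae_of_all _ fun ζ => ?_) 2
  rw [fourierInv_japS, norm_mul, Complex.norm_real,
    Real.norm_of_nonneg (by have := nb_pos ζ; positivity)]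
  rcases lt_or_ge R ‖ζ‖ with h | h
  · simp [hφ ζ h]
  · have := hM ζ h
    gcongr

/-- Iteration of `i a(t,φ) + ∫₀ᵗ a(s,Lφ) ds = 0` for an operator `L` bounded by `M`. -/
lemma norm_le_pow_div_factorial {V : Type*} {L : V → V} {N : V → ℝ} {Q : V → Prop} {M : ℝ}
    (hM0 : 0 ≤ M) (hQ : ∀ φ, Q φ → Q (L φ)) (hM : ∀ φ, Q φ → N (L φ) ≤ M * N φ)
    {a : ℝ → V → ℂ} {T U : ℝ} (hU : ∀ t φ, |t| ≤ T → ‖a t φ‖ ≤ U * N φ) (hU0 : 0 ≤ U)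
    (heq : ∀ φ t, Complex.I * a t φ + (∫ s in (0 : ℝ)..t, a s (L φ)) = 0) (n : ℕ) :
    ∀ φ, Q φ → ∀ t, |t| ≤ T → ‖a t φ‖ ≤ U * N φ * (M ^ n * |t| ^ n / n.factorial) := by
  induction n with
  | zero =>
    intro φ _ t ht
    simp only [pow_zero, Nat.factorial_zero, Nat.cast_one, div_one, mul_one]
    exact hU t φ ht
  | succ n ih =>
    intro φ hφ t ht
    have h1 : ‖a t φ‖ = ‖∫ s in (0 : ℝ)..t, a s (L φ)‖ := by
      have h := eq_neg_of_add_eq_zero_right (heq φ t)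
      rw [h]; simp
    rw [h1]
    refine intervalIntegral.norm_integral_le_integral_norm_uIoc.trans ?_
    have h2 : ∀ s ∈ uIoc 0 t, |s| ≤ |t| := by
      intro s hs
      rcases le_total 0 t with h0 | h0
      · rw [uIoc_of_le h0] at hs
        rw [abs_of_pos hs.1, abs_of_nonneg h0]; exact hs.2
      · rw [uIoc_of_ge h0] at hs
        rw [abs_of_nonpos hs.2, abs_of_nonpos h0]; linarith [hs.1]
    have hint : IntegrableOn (fun s : ℝ => U * N (L φ) * (M ^ n / n.factorial) * |s - 0| ^ n)
        (uIoc 0 t) :=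
      (Continuous.integrableOn_uIcc (by fun_prop)).mono_set uIoc_subset_uIcc
    calc ∫ s in uIoc 0 t, ‖a s (L φ)‖
        ≤ ∫ s in uIoc 0 t, U * N (L φ) * (M ^ n / n.factorial) * |s - 0| ^ n := by
          refine integral_mono_of_nonneg (ae_of_all _ fun s => norm_nonneg _) hint ?_
          filter_upwards [ae_restrict_mem measurableSet_uIoc] with s hs
          refine (ih (L φ) (hQ φ hφ) s ((h2 s hs).trans ht)).trans_eq ?_
          rw [sub_zero]; ring
      _ = U * N (L φ) * (M ^ n / n.factorial) * (|t| ^ (n + 1) / (n + 1)) := by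
          rw [integral_const_mul, integral_pow_abs_sub_uIoc, sub_zero]
      _ ≤ U * (M * N φ) * (M ^ n / n.factorial) * (|t| ^ (n + 1) / (n + 1)) := by
          have := hM φ hφ
          gcongr
      _ = _ := by
          rw [Nat.factorial_succ]; push_cast; field_simp; ring

/-- Against test functions of bounded frequency a solution of the homogeneous equation vanishes:
there `⟨D⟩` is bounded, and the iterated equation gives the bounds `Mⁿ|t|ⁿ/n!`. -/
lemma pairL2_eq_zero_of_homogeneous {v : ℝ → L2} (hv : Continuous v)
    (heq : ∀ (φ : SchwartzMap E2 ℂ) (t : ℝ), Complex.I * pairL2 (v t) (φ.toLp 2) +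
      (∫ s in (0 : ℝ)..t, pairL2 (v s) ((japS φ).toLp 2)) = 0) (t : ℝ)
    (φ : SchwartzMap E2 ℂ) (R : ℝ) (hφ : ∀ ζ, R < ‖ζ‖ → 𝓕⁻ (φ : E2 → ℂ) ζ = 0) :
    pairL2 (v t) (φ.toLp 2) = 0 := by
  obtain ⟨M, hM⟩ := (isCompact_closedBall (0 : E2) R).exists_bound_of_continuousOn
    (f := fun ζ => 2 * Real.pi * nb ζ) (by fun_prop)
  obtain ⟨U, hU⟩ := (isCompact_closedBall (0 : ℝ) |t|).exists_bound_of_continuousOn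
    (f := v) hv.continuousOn
  have hM' : ∀ ζ : E2, ‖ζ‖ ≤ R → 2 * Real.pi * nb ζ ≤ |M| := fun ζ hζ =>
    ((le_abs_self _).trans (hM ζ (by simpa using hζ))).trans (le_abs_self _)
  obtain ⟨N, hN⟩ : ∃ N : SchwartzMap E2 ℂ → ℝ, ∀ φ, N φ = ‖φ.toLp 2 (volume : Measure E2)‖ :=
    ⟨_, fun _ => rfl⟩
  obtain ⟨a, ha⟩ : ∃ a : ℝ → SchwartzMap E2 ℂ → ℂ, ∀ s φ, a s φ = pairL2 (v s) (φ.toLp 2) :=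
    ⟨_, fun _ _ => rfl⟩
  have haU : ∀ s φ, |s| ≤ |t| → ‖a s φ‖ ≤ |U| * N φ := by
    intro s φ hs
    rw [ha, hN]
    exact (norm_pairL2_le _ _).trans (mul_le_mul_of_nonneg_right
      ((hU s (by simpa using hs)).trans (le_abs_self _)) (norm_nonneg _))
  have haeq : ∀ φ t, Complex.I * a t φ + (∫ s in (0 : ℝ)..t, a s (japS φ)) = 0 := by
    intro φ t
    simp only [ha]
    exact heq φ t
  have hNj : ∀ φ : SchwartzMap E2 ℂ, (∀ ζ, R < ‖ζ‖ → 𝓕⁻ (φ : E2 → ℂ) ζ = 0) →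
      N (japS φ) ≤ |M| * N φ := by
    intro φ hφ
    rw [hN, hN]
    exact norm_japS_le (abs_nonneg _) hM' φ hφ
  have hb := norm_le_pow_div_factorial (abs_nonneg M)
    (Q := fun φ : SchwartzMap E2 ℂ => ∀ ζ, R < ‖ζ‖ → 𝓕⁻ (φ : E2 → ℂ) ζ = 0)
    (fun φ hφ ζ hζ => by rw [fourierInv_japS, hφ ζ hζ, mul_zero]) hNj haU (abs_nonneg U) haeq
  have hlim : Tendsto (fun n : ℕ => |U| * N φ * (|M| ^ n * |t| ^ n / n.factorial)) atTop
      (𝓝 0) := by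
    have := (FloorSemiring.tendsto_pow_div_factorial_atTop (|M| * |t|)).const_mul (|U| * N φ)
    simpa [mul_pow] using this
  have := ge_of_tendsto hlim (Eventually.of_forall fun n => hb n φ hφ t le_rfl)
  rw [← ha]
  simpa using this

/-- The homogeneous equation with zero initial value has no solution but zero: the test functions of
bounded frequency determine the Fourier transform. -/
lemma eq_zero_of_homogeneous {v : ℝ → L2} (hv : Continuous v)
    (heq : ∀ (φ : SchwartzMap E2 ℂ) (t : ℝ), Complex.I * pairL2 (v t) (φ.toLp 2) +
      (∫ s in (0 : ℝ)..t, pairL2 (v s) ((japS φ).toLp 2)) = 0) (t : ℝ) : v t = 0 := by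
  have h0 : ((𝓕 (v t) : L2) : E2 → ℂ) =ᵐ[volume] 0 := by
    refine ae_eq_zero_of_integral_contDiff_smul_eq_zero
      ((Lp.memLp (𝓕 (v t) : L2)).locallyIntegrable (by norm_num)) fun g hg hgc => ?_
    have hg₁ : HasCompactSupport (Complex.ofRealCLM ∘ g) := hgc.comp_left rfl
    have hg₂ : ContDiff ℝ (⊤ : ℕ∞) (Complex.ofRealCLM ∘ g) := by fun_prop
    set ψ := hg₁.toSchwartzMap hg₂
    have hψ : ∀ x, ψ x = (g x : ℂ) := fun x => rfl
    obtain ⟨R, hR⟩ := hgc.isCompact.isBounded.subset_closedBall 0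
    have h1 := pairL2_eq_zero_of_homogeneous hv heq t (𝓕 ψ) R (fun ζ hζ => by
      rw [← SchwartzMap.fourierInv_coe, FourierTransform.fourierInv_fourier_eq, hψ]
      have : ζ ∉ tsupport g := fun hcon => by
        have := hR hcon
        rw [mem_closedBall_zero_iff] at this; linarith
      simp [image_eq_zero_of_notMem_tsupport this])
    rw [pairL2_apply] at h1
    calc ∫ x, g x • (𝓕 (v t) : L2) x = ∫ x, (𝓕 (v t) : L2) x * ψ x := by
          simp only [hψ, Complex.real_smul, mul_comm]
      _ = ∫ x, v t x * 𝓕 (ψ : E2 → ℂ) x := (integral_L2_mul_fourier _ _).symm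
      _ = ∫ x, v t x * ((𝓕 ψ).toLp 2 (volume : Measure E2)) x := by
          refine integral_congr_ae ?_
          filter_upwards [(𝓕 ψ).coeFn_toLp 2 volume] with x hx
          rw [hx, SchwartzMap.fourier_coe]
      _ = 0 := h1
  have h1 : (𝓕 (v t) : L2) = 0 := (Lp.eq_zero_iff_ae_eq_zero).2 h0
  have : ‖v t‖ = 0 := by rw [← Lp.norm_fourier_eq, h1, norm_zero]
  exact norm_eq_zero.1 this

/-- Uniqueness for the inhomogeneous equation. -/
lemma IsSolution.ae_eq {g u₁ u₂ : ℝ → E2 → ℂ} (h₁ : IsSolution g u₁) (h₂ : IsSolution g u₂)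
    (t : ℝ) : u₁ t =ᵐ[volume] u₂ t := by
  have h := eq_zero_of_homogeneous (h₁.continuous_curve.sub h₂.continuous_curve) (fun φ t => by
    have e : ∀ (ψ : SchwartzMap E2 ℂ) s, pairL2 ((h₁.curve - h₂.curve) s) (ψ.toLp 2) =
        pairL2 (h₁.curve s) (ψ.toLp 2) - pairL2 (h₂.curve s) (ψ.toLp 2) := fun ψ s => by simp
    have hi : ∀ {u : ℝ → E2 → ℂ} (h : IsSolution g u) (ψ : SchwartzMap E2 ℂ),
        IntervalIntegrable (fun s => pairL2 (h.curve s) (ψ.toLp 2)) volume 0 t := fun h ψ =>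
      ((continuous_pairL2_left _).comp h.continuous_curve).intervalIntegrable _ _
    simp only [e]
    rw [intervalIntegral.integral_sub (hi h₁ _) (hi h₂ _)]
    simp only [IsSolution.pair_curve, japS_coe]
    linear_combination h₁.eqn φ t - h₂.eqn φ t) t
  have h3 : h₁.curve t = h₂.curve t := sub_eq_zero.1 h
  exact (MemLp.toLp_eq_toLp_iff _ _).1 h3

/-! ### The hyperboloid in the coordinates of a frame -/

/-- The point of the hyperboloid `τ = ⟨ξ⟩` over a frequency. -/
def hyp (ζ : E2) : ℝ × E2 := (nb ζ, ζ)

@[fun_prop] lemma continuous_hyp : Continuous hyp := by unfold hyp; fun_prop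

@[fun_prop] lemma Continuous.hyp {X : Type*} [TopologicalSpace X] {f : X → E2}
    (hf : Continuous f) : Continuous fun x => HalfKG.hyp (f x) := continuous_hyp.comp hf

lemma hasFDerivAt_nb (ζ : E2) : HasFDerivAt nb ((nb ζ)⁻¹ • innerSL ℝ ζ) ζ := by
  have h : nb = fun ζ : E2 => Real.sqrt (((2 * Real.pi) ^ 2)⁻¹ + ‖ζ‖ ^ 2) := by
    ext ζ; rw [← nb_sq, Real.sqrt_sq (nb_pos ζ).le]
  have h1 : HasFDerivAt (fun ζ : E2 => ((2 * Real.pi) ^ 2)⁻¹ + ‖ζ‖ ^ 2) (2 • innerSL ℝ ζ) ζ :=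
    ((hasStrictFDerivAt_norm_sq ζ).hasFDerivAt).const_add _
  have h2 := h1.sqrt (by positivity)
  rw [← h] at h2
  refine h2.congr_fderiv ?_
  have e : Real.sqrt (((2 * Real.pi) ^ 2)⁻¹ + ‖ζ‖ ^ 2) = nb ζ := (congrFun h ζ).symm
  rw [e]
  ext v
  have := (nb_pos ζ).ne'
  simp
  field_simp

namespace Frame

variable (Φ : Frame)

/-- The Minkowski square of the evolution direction. -/
def mink : ℝ := Φ.e0.1 ^ 2 - ‖Φ.e0.2‖ ^ 2

/-- The component along the evolution direction of the normal `(⟨ξ⟩, -ξ)` to the hyperboloid. -/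
def nor (ζ : E2) : ℝ := Φ.e0.1 * nb ζ - inner ℝ Φ.e0.2 ζ

/-- The point at signed distance `q.1` from the hyperboloid, along the evolution direction, over
the base frequency `q.2`. -/
def pt (q : ℝ × E2) : ℝ × E2 := hyp q.2 + q.1 • Φ.e0

/-- The Jacobian of `Frame.pt`. -/
def jac (ζ : E2) : ℝ := Φ.nor ζ / nb ζ

@[fun_prop] lemma continuous_pt : Continuous Φ.pt := by unfold pt; fun_prop

@[fun_prop] lemma continuous_nor : Continuous Φ.nor := by unfold nor; fun_prop

@[fun_prop] lemma continuous_jac : Continuous Φ.jac := by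
  unfold jac; exact Continuous.div (by fun_prop) (by fun_prop) fun ζ => (nb_pos ζ).ne'

lemma norm_e0_sq : Φ.e0.1 ^ 2 + ‖Φ.e0.2‖ ^ 2 = 1 := by
  have := Φ.pr_e0
  rw [pr, real_inner_self_eq_norm_sq] at this
  rw [← this]; ring

lemma abs_e0_fst_le : |Φ.e0.1| ≤ 1 := by
  have := Φ.norm_e0_sq
  rw [← sq_le_one_iff_abs_le_one]; nlinarith [sq_nonneg ‖Φ.e0.2‖]

lemma norm_e0_snd_le : ‖Φ.e0.2‖ ≤ 1 := by
  have := Φ.norm_e0_sq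
  rw [← abs_of_nonneg (norm_nonneg Φ.e0.2), ← sq_le_one_iff_abs_le_one]
  nlinarith [sq_nonneg Φ.e0.1]

/-- The defining function of the hyperboloid along a line in the evolution direction. -/
lemma pt_sq_sub (θ : ℝ) (ζ : E2) : (Φ.pt (θ, ζ)).1 ^ 2 - nb (Φ.pt (θ, ζ)).2 ^ 2 =
    θ * (2 * Φ.nor ζ + Φ.mink * θ) := by
  simp only [pt, hyp, Prod.fst_add, Prod.snd_add, Prod.smul_fst, Prod.smul_snd, smul_eq_mul]
  have h1 := nb_sq ζ
  rw [nb_sq, norm_add_sq_real, norm_smul, inner_smul_right, Real.norm_eq_abs, nor,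
    mink, real_inner_comm, mul_pow |θ|, sq_abs]
  linear_combination h1

/-- Along a line in the evolution direction the hyperboloid is met at most twice. -/
lemma eq_of_pt_eq {θ θ' : ℝ} {ζ ζ' : E2} (h : Φ.pt (θ, ζ) = Φ.pt (θ', ζ')) :
    (θ - θ') * (2 * Φ.nor ζ + Φ.mink * (θ - θ')) = 0 := by
  have h1 : Φ.pt (θ - θ', ζ) = hyp ζ' := by
    simp only [pt] at h ⊢
    rw [sub_smul, add_sub, h, add_sub_cancel_right]
  rw [← pt_sq_sub, h1]; simp [hyp]

lemma hasFDerivAt_pt (q : ℝ × E2) : HasFDerivAt Φ.pt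
    (((((nb q.2)⁻¹ • innerSL ℝ q.2).comp (ContinuousLinearMap.snd ℝ ℝ E2)).prod
      (ContinuousLinearMap.snd ℝ ℝ E2)) + (ContinuousLinearMap.fst ℝ ℝ E2).smulRight Φ.e0) q := by
  have h1 : HasFDerivAt (fun q : ℝ × E2 => nb q.2)
      (((nb q.2)⁻¹ • innerSL ℝ q.2).comp (ContinuousLinearMap.snd ℝ ℝ E2)) q :=
    (hasFDerivAt_nb q.2).comp q hasFDerivAt_snd
  exact (h1.prodMk hasFDerivAt_snd).add (hasFDerivAt_fst.smul_const Φ.e0)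

lemma det_fderiv_pt (q : ℝ × E2) :
    (((((nb q.2)⁻¹ • innerSL ℝ q.2).comp (ContinuousLinearMap.snd ℝ ℝ E2)).prod
      (ContinuousLinearMap.snd ℝ ℝ E2)) +
      (ContinuousLinearMap.fst ℝ ℝ E2).smulRight Φ.e0).det = Φ.jac q.2 := by
  let b := (Module.Basis.singleton Unit ℝ).prod (EuclideanSpace.basisFun (Fin 2) ℝ).toBasis
  rw [ContinuousLinearMap.det, ← LinearMap.det_toMatrix b]
  have : LinearMap.toMatrix b b
      (((((nb q.2)⁻¹ • innerSL ℝ q.2).comp (ContinuousLinearMap.snd ℝ ℝ E2)).prod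
      (ContinuousLinearMap.snd ℝ ℝ E2)) +
      (ContinuousLinearMap.fst ℝ ℝ E2).smulRight Φ.e0 : ℝ × E2 →L[ℝ] ℝ × E2) =
      Matrix.fromBlocks (Matrix.of fun _ _ => Φ.e0.1) (Matrix.of fun _ i => (nb q.2)⁻¹ * q.2 i)
        (Matrix.of fun i _ => Φ.e0.2 i) 1 := by
    ext i j
    rw [LinearMap.toMatrix_apply]
    rcases i with i | i <;> rcases j with j | j
    · simp [b]
    · simp [b, real_inner_comm, EuclideanSpace.inner_single_right]
    · simp [b]
    · simp [b, Matrix.one_apply]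
  rw [this, Matrix.det_fromBlocks_one₂₂, Matrix.det_unique]
  have := (nb_pos q.2).ne'
  simp [Matrix.mul_apply, jac, nor, PiLp.inner_apply, Fin.sum_univ_two]
  field_simp

/-- Change of variables to the coordinates of `Frame.pt`. -/
lemma lintegral_image_pt {s : Set (ℝ × E2)} (hs : MeasurableSet s) (hi : InjOn Φ.pt s)
    (F : ℝ × E2 → ℝ≥0∞) :
    ∫⁻ z in Φ.pt '' s, F z = ∫⁻ q in s, ENNReal.ofReal |Φ.jac q.2| * F (Φ.pt q) := by
  rw [lintegral_image_eq_lintegral_abs_det_fderiv_mul volume hs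
    (fun q _ => (Φ.hasFDerivAt_pt q).hasFDerivWithinAt) hi]
  simp only [det_fderiv_pt]

lemma integral_image_pt {s : Set (ℝ × E2)} (hs : MeasurableSet s) (hi : InjOn Φ.pt s)
    (F : ℝ × E2 → ℂ) :
    ∫ z in Φ.pt '' s, F z = ∫ q in s, ((|Φ.jac q.2| : ℝ) : ℂ) * F (Φ.pt q) := by
  rw [integral_image_eq_integral_abs_det_fderiv_smul volume hs
    (fun q _ => (Φ.hasFDerivAt_pt q).hasFDerivWithinAt) hi]
  simp only [det_fderiv_pt, Complex.real_smul]

end Frame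

/-- A bounded set of base frequencies near which the hyperboloid is transversal to the evolution
direction of the frame: its normal component is bounded below by `δ⟨ξ⟩`, and lines of length `Δ`
are short compared with the frequency and with the distance to the second intersection. -/
structure IsTransversal (Φ : Frame) (D : Set E2) (Δ δ : ℝ) : Prop where
  meas : MeasurableSet D
  bdd : Bornology.IsBounded D
  pos : 0 < Δ
  pos' : 0 < δ
  le_nb : ∀ ζ ∈ D, 4 * Δ ≤ nb ζ
  mink_le : ∀ ζ ∈ D, 2 * Δ * |Φ.mink| ≤ |Φ.nor ζ|
  le_nor : ∀ ζ ∈ D, δ * nb ζ ≤ |Φ.nor ζ|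

namespace IsTransversal

variable {Φ : Frame} {D : Set E2} {Δ δ : ℝ} (h : IsTransversal Φ D Δ δ)

include h

lemma nor_ne_zero {ζ : E2} (hζ : ζ ∈ D) : Φ.nor ζ ≠ 0 := by
  have h1 := h.le_nor ζ hζ
  have h2 := mul_pos h.pos' (nb_pos ζ)
  exact abs_pos.1 (h2.trans_le h1)

lemma le_jac {ζ : E2} (hζ : ζ ∈ D) : δ ≤ |Φ.jac ζ| := by
  rw [Frame.jac, abs_div, abs_of_pos (nb_pos ζ), le_div_iff₀ (nb_pos ζ)]
  exact h.le_nor ζ hζ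

lemma eq_of_pt_eq {θ θ' : ℝ} {ζ ζ' : E2} (hζ : ζ ∈ D) (he : Φ.pt (θ, ζ) = Φ.pt (θ', ζ'))
    (hθ : |θ| ≤ 2 * Δ) (hθ' : |θ'| ≤ Δ) : θ = θ' ∧ ζ = ζ' := by
  have h1 : θ = θ' := by
    by_contra hne
    have h2 := (mul_eq_zero.1 (Φ.eq_of_pt_eq he)).resolve_left (sub_ne_zero.2 hne)
    have h3 : 2 * |Φ.nor ζ| = |Φ.mink| * |θ - θ'| := by
      have : 2 * Φ.nor ζ = -(Φ.mink * (θ - θ')) := by linarith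
      have h4 := congrArg abs this
      rwa [abs_mul, abs_neg, abs_mul, abs_two] at h4
    have h4 : |θ - θ'| ≤ 3 * Δ := (abs_sub _ _).trans (by linarith)
    have h5 := h.mink_le ζ hζ
    have h6 : 0 < |Φ.nor ζ| := abs_pos.2 (h.nor_ne_zero hζ)
    have h7 := mul_le_mul_of_nonneg_left h4 (abs_nonneg Φ.mink)
    nlinarith
  refine ⟨h1, ?_⟩
  subst h1
  have h2 : hyp ζ = hyp ζ' := add_right_cancel he
  exact congrArg Prod.snd h2

lemma injOn_Icc : InjOn Φ.pt (Icc (-Δ) Δ ×ˢ D) := by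
  rintro ⟨θ, ζ⟩ ⟨hθ, hζ⟩ ⟨θ', ζ'⟩ ⟨hθ', _⟩ he
  have := h.eq_of_pt_eq hζ he ((abs_le.2 hθ).trans (by linarith [h.pos])) (abs_le.2 hθ')
  exact Prod.ext this.1 this.2

omit h in
lemma injOn_of_mul_pos {s : Set E2} (hs : ∀ ζ ∈ s, ∀ ζ' ∈ s, 0 < Φ.nor ζ * Φ.nor ζ') :
    InjOn Φ.pt (univ ×ˢ s) := by
  rintro ⟨θ, ζ⟩ ⟨_, hζ⟩ ⟨θ', ζ'⟩ ⟨_, hζ'⟩ he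
  have h1 : θ = θ' := by
    by_contra hne
    have h2 := (mul_eq_zero.1 (Φ.eq_of_pt_eq he)).resolve_left (sub_ne_zero.2 hne)
    have h3 := (mul_eq_zero.1 (Φ.eq_of_pt_eq he.symm)).resolve_left (sub_ne_zero.2 (Ne.symm hne))
    have h4 : Φ.nor ζ = - Φ.nor ζ' := by linarith
    have := hs ζ hζ ζ' hζ'
    rw [h4] at this
    nlinarith [sq_nonneg (Φ.nor ζ')]
  subst h1
  have h2 : hyp ζ = hyp ζ' := add_right_cancel he
  have h3 : ζ = ζ' := congrArg (fun z : ℝ × E2 => z.2) h2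
  rw [h3]

lemma lintegral_pt_le (F : ℝ × E2 → ℝ≥0∞) :
    ∫⁻ q in univ ×ˢ D, ENNReal.ofReal |Φ.jac q.2| * F (Φ.pt q) ≤ 2 * ∫⁻ z, F z := by
  have key : ∀ s : Set E2, MeasurableSet s → (∀ ζ ∈ s, ∀ ζ' ∈ s, 0 < Φ.nor ζ * Φ.nor ζ') →
      ∫⁻ q in univ ×ˢ s, ENNReal.ofReal |Φ.jac q.2| * F (Φ.pt q) ≤ ∫⁻ z, F z := by
    intro s hs hpos
    rw [← Φ.lintegral_image_pt (MeasurableSet.univ.prod hs) (injOn_of_mul_pos hpos)]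
    exact setLIntegral_le_lintegral _ _
  have hP : MeasurableSet {ζ | 0 < Φ.nor ζ} := measurableSet_lt measurable_const (by fun_prop)
  have h1 := key (D ∩ {ζ | 0 < Φ.nor ζ}) (h.meas.inter hP)
    (fun ζ hζ ζ' hζ' => mul_pos hζ.2 hζ'.2)
  have h2 := key (D \ {ζ | 0 < Φ.nor ζ}) (h.meas.diff hP) (fun ζ hζ ζ' hζ' =>
    mul_pos_of_neg_of_neg (lt_of_le_of_ne (not_lt.1 hζ.2) (h.nor_ne_zero hζ.1))
      (lt_of_le_of_ne (not_lt.1 hζ'.2) (h.nor_ne_zero hζ'.1)))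
  have h3 : (univ : Set ℝ) ×ˢ D = univ ×ˢ (D ∩ {ζ | 0 < Φ.nor ζ}) ∪
      univ ×ˢ (D \ {ζ | 0 < Φ.nor ζ}) := by
    rw [← prod_union, inter_union_sdiff]
  rw [h3, two_mul]
  exact (lintegral_union_le _ _ _).trans (add_le_add h1 h2)

/-- Null sets pull back to null sets. -/
lemma ae_pt {P : ℝ × E2 → Prop} (hP : ∀ᵐ z, P z) : ∀ᵐ q : ℝ × E2, q.2 ∈ D → P (Φ.pt q) := by
  obtain ⟨N, hN, hNm, hN0⟩ := exists_measurable_superset_of_null hP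
  have h1 := h.lintegral_pt_le (N.indicator 1)
  rw [lintegral_indicator_one hNm, hN0, mul_zero, nonpos_iff_eq_zero, lintegral_eq_zero_iff] at h1
  · rw [Filter.EventuallyEq, ae_restrict_iff' (MeasurableSet.univ.prod h.meas)] at h1
    filter_upwards [h1] with q hq hqD
    have h2 := hq ⟨mem_univ _, hqD⟩
    by_contra hcon
    have h3 : Φ.pt q ∈ N := hN hcon
    rw [indicator_of_mem h3] at h2
    have h4 := h.le_jac hqD
    have h5 := h.pos'
    simp only [Pi.one_apply, mul_one, Pi.zero_apply, ENNReal.ofReal_eq_zero] at h2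
    linarith
  · refine Measurable.mul (by fun_prop) ?_
    exact (measurable_one.indicator hNm).comp (by fun_prop)

/-- The `L²` comparison of a function of the spatial frame coordinates with its restriction to
the hyperboloid. -/
lemma lintegral_hyp_le {f : E2 → ℝ≥0∞} (hf : Measurable f) :
    ∫⁻ ζ in D, ENNReal.ofReal |Φ.jac ζ| * f (Φ.toEquiv.symm (hyp ζ)).2 ≤ 2 * ∫⁻ y, f y := by
  let F : ℝ × E2 → ℝ≥0∞ := fun z => (Icc (0 : ℝ) 1).indicator 1 z.1 * f z.2
  have hFm : Measurable F := by
    refine Measurable.mul ?_ (hf.comp measurable_snd)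
    exact (measurable_one.indicator measurableSet_Icc).comp measurable_fst
  have h1 := h.lintegral_pt_le (fun z => F (Φ.toEquiv.symm z))
  have h2 : ∫⁻ z, F (Φ.toEquiv.symm z) = ∫⁻ y, f y := by
    rw [Φ.measurePreserving_symm.lintegral_comp hFm, Measure.volume_eq_prod,
      lintegral_prod _ hFm.aemeasurable]
    simp only [F]
    have : ∀ x : ℝ, ∫⁻ y, (Icc (0 : ℝ) 1).indicator 1 x * f y =
        (Icc (0 : ℝ) 1).indicator (fun _ => ∫⁻ y, f y) x := by
      intro x
      by_cases hx : x ∈ Icc (0 : ℝ) 1 <;> simp [hx]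
    simp only [this]
    rw [lintegral_indicator_const measurableSet_Icc]
    simp
  rw [h2, Measure.volume_eq_prod, ← Measure.prod_restrict, Measure.restrict_univ] at h1
  have hFm' : Measurable fun q : ℝ × E2 => F (Φ.toEquiv.symm (Φ.pt q)) :=
    hFm.comp (Continuous.measurable (by fun_prop))
  have hm : Measurable fun q : ℝ × E2 =>
      ENNReal.ofReal |Φ.jac q.2| * F (Φ.toEquiv.symm (Φ.pt q)) :=
    Measurable.mul (by fun_prop) hFm'
  rw [lintegral_prod_symm _ hm.aemeasurable] at h1
  refine le_trans (le_of_eq ?_) h1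
  refine lintegral_congr fun ζ => ?_
  dsimp only
  rw [lintegral_const_mul' _ _ ENNReal.ofReal_ne_top]
  congr 1
  have e : ∀ θ, Φ.toEquiv.symm (Φ.pt (θ, ζ)) = Φ.toEquiv.symm (hyp ζ) + (θ, 0) := by
    intro θ
    rw [Frame.pt, map_add, Frame.e0]
    simp
  simp only [e, F, Prod.fst_add, Prod.snd_add, add_zero]
  rw [lintegral_mul_const _ (by
    exact (measurable_one.indicator measurableSet_Icc).comp (by fun_prop)),
    lintegral_add_left_eq_self (fun θ : ℝ => (Icc (0 : ℝ) 1).indicator (1 : ℝ → ℝ≥0∞) θ),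
    lintegral_indicator_one measurableSet_Icc]
  simp

/-- Null sets of spatial frame coordinates pull back to null sets of base frequencies. -/
lemma ae_hyp {P : E2 → Prop} (hP : ∀ᵐ y, P y) :
    ∀ᵐ ζ : E2, ζ ∈ D → P (Φ.toEquiv.symm (hyp ζ)).2 := by
  obtain ⟨N, hN, hNm, hN0⟩ := exists_measurable_superset_of_null hP
  have h1 := h.lintegral_hyp_le (measurable_one.indicator hNm)
  rw [lintegral_indicator_one hNm, hN0, mul_zero, nonpos_iff_eq_zero, lintegral_eq_zero_iff] at h1
  · rw [Filter.EventuallyEq, ae_restrict_iff' h.meas] at h1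
    filter_upwards [h1] with q hq hqD
    have h2 := hq hqD
    by_contra hcon
    have h3 : (Φ.toEquiv.symm (hyp q)).2 ∈ N := hN hcon
    rw [indicator_of_mem h3] at h2
    have h4 := h.le_jac hqD
    have h5 := h.pos'
    simp only [Pi.one_apply, mul_one, Pi.zero_apply, ENNReal.ofReal_eq_zero] at h2
    linarith
  · refine Measurable.mul (by fun_prop) ?_
    exact (measurable_one.indicator hNm).comp (Continuous.measurable (by fun_prop))

/-- The restriction to the hyperboloid is bounded in `L²`. -/
lemma eLpNorm_hyp_le {f : E2 → ℂ} (hf : StronglyMeasurable f) :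
    eLpNorm (fun ζ => f (Φ.toEquiv.symm (hyp ζ)).2) 2 (volume.restrict D) ≤
      ENNReal.ofReal (Real.sqrt (2 / δ)) * eLpNorm f 2 volume := by
  have hδ := h.pos'
  refine (ENNReal.pow_le_pow_left_iff two_ne_zero).1 ?_
  rw [mul_pow, eLpNorm_two_sq, eLpNorm_two_sq, ← ENNReal.ofReal_pow (Real.sqrt_nonneg _),
    Real.sq_sqrt (by positivity)]
  have h1 := h.lintegral_hyp_le (hf.measurable.enorm.pow_const 2)
  have h2 : ENNReal.ofReal δ * ∫⁻ ζ in D, ‖f (Φ.toEquiv.symm (hyp ζ)).2‖ₑ ^ 2 ≤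
      2 * ∫⁻ y, ‖f y‖ₑ ^ 2 := by
    refine le_trans ?_ h1
    rw [← lintegral_const_mul' _ _ ENNReal.ofReal_ne_top]
    refine setLIntegral_mono' h.meas fun ζ hζ => ?_
    gcongr
    exact h.le_jac hζ
  have h3 : ENNReal.ofReal (2 / δ) = (ENNReal.ofReal δ)⁻¹ * 2 := by
    rw [div_eq_mul_inv, mul_comm, ENNReal.ofReal_mul (by positivity), ENNReal.ofReal_inv_of_pos hδ]
    simp
  rw [h3, mul_assoc]
  exact (ENNReal.mul_le_iff_le_inv (by simpa using hδ) ENNReal.ofReal_ne_top).1 h2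

end IsTransversal

/-! ### Free waves on the level sets of a frame coordinate -/

/-- The `L²` norm of a space-time function on a level set of the evolution coordinate. -/
def Frame.slice (Φ : Frame) (F : ℝ → E2 → ℂ) (a : ℝ) : ℝ≥0∞ :=
  eLpNorm (fun y : E2 => F (Φ.toEquiv (a, y)).1 (Φ.toEquiv (a, y)).2) 2 volume

lemma freeWave_eq (f : L2) (t : ℝ) (x : E2) :
    freeWave f t x = ∫ ζ, ce (pr (t, x) (hyp ζ)) * (𝓕 f : L2) ζ := by
  rw [freeWave]
  refine integral_congr_ae (ae_of_all _ fun ζ => ?_)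
  simp only
  rw [← Complex.exp_add, ce, jb_eq_nb]
  congr 2
  simp only [pr, hyp]
  push_cast; ring

/-- An `L²` bound follows from bounds for the pairings with bounded functions of bounded
support. -/
lemma eLpNorm_two_le_of_pairing {F : E2 → ℂ} (hF : Continuous F) {C : ℝ≥0∞}
    (h : ∀ φ : E2 → ℂ, Integrable φ → MemLp φ 2 → StronglyMeasurable φ →
      ‖∫ y, F y * φ y‖ₑ ≤ C * eLpNorm φ 2 volume) : eLpNorm F 2 volume ≤ C := by
  have hn : ∀ n : ℕ, ∫⁻ y in Metric.closedBall (0 : E2) n, ‖F y‖ₑ ^ 2 ≤ C ^ 2 := by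
    intro n
    let B := Metric.closedBall (0 : E2) n
    have hB : MeasurableSet B := measurableSet_closedBall
    let φ : E2 → ℂ := B.indicator fun y => (starRingEnd ℂ) (F y)
    have hc : Continuous fun y => (starRingEnd ℂ) (F y) := Complex.continuous_conj.comp hF
    have hφm : StronglyMeasurable φ := hc.stronglyMeasurable.indicator hB
    obtain ⟨M, hM⟩ := (isCompact_closedBall (0 : E2) n).exists_bound_of_continuousOn
      (f := fun y => (starRingEnd ℂ) (F y)) hc.continuousOn
    have hfin : IsFiniteMeasure (volume.restrict B) :=
      ⟨by rw [Measure.restrict_apply_univ]; exact measure_closedBall_lt_top⟩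
    have hmem : ∀ p : ℝ≥0∞, MemLp φ p volume := by
      intro p
      rw [memLp_indicator_iff_restrict hB]
      exact MemLp.of_bound hc.aestronglyMeasurable M
        ((ae_restrict_iff' hB).2 (ae_of_all _ hM))
    have h1 := h φ (memLp_one_iff_integrable.1 (hmem 1)) (hmem 2) hφm
    have h2 : ‖∫ y, F y * φ y‖ₑ = eLpNorm φ 2 volume ^ 2 := by
      have e : ∀ y, F y * φ y = ((‖φ y‖ ^ 2 : ℝ) : ℂ) := by
        intro y
        by_cases hy : y ∈ B
        · simp only [φ, indicator_of_mem hy, RCLike.norm_conj, Complex.mul_conj,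
            Complex.normSq_eq_norm_sq]
        · simp [φ, indicator_of_notMem hy]
      simp only [e]
      rw [integral_complex_ofReal, ← ofReal_norm, Complex.norm_real, Real.norm_of_nonneg
        (integral_nonneg fun y => by positivity), ofReal_integral_eq_lintegral_ofReal
        ((memLp_two_iff_integrable_sq_norm hφm.aestronglyMeasurable).1 (hmem 2))
        (ae_of_all _ fun y => by positivity), eLpNorm_two_sq]
      refine lintegral_congr fun y => ?_
      rw [ENNReal.ofReal_pow (norm_nonneg _), ofReal_norm]
    have h3 : eLpNorm φ 2 volume ≤ C := by
      rw [h2, sq] at h1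
      by_cases h0 : eLpNorm φ 2 volume = 0
      · rw [h0]; exact bot_le
      · exact (ENNReal.mul_le_mul_iff_left h0 (hmem 2).2.ne).1 h1
    calc ∫⁻ y in B, ‖F y‖ₑ ^ 2 = eLpNorm φ 2 volume ^ 2 := by
          rw [eLpNorm_two_sq, ← lintegral_indicator hB]
          refine lintegral_congr fun y => ?_
          by_cases hy : y ∈ B
          · simp only [φ, indicator_of_mem hy]
            congr 1
            rw [← ofReal_norm, ← ofReal_norm, RCLike.norm_conj]
          · simp [φ, indicator_of_notMem hy]
      _ ≤ C ^ 2 := by gcongr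
  refine (ENNReal.pow_le_pow_left_iff two_ne_zero).1 ?_
  rw [eLpNorm_two_sq, ← setLIntegral_univ, ← Metric.iUnion_closedBall_nat (0 : E2),
    setLIntegral_iUnion_of_directed]
  · exact iSup_le hn
  · exact Monotone.directed_le fun m n hmn =>
      Metric.closedBall_subset_closedBall (by exact_mod_cast hmn)

namespace IsTransversal

variable {Φ : Frame} {D : Set E2} {Δ δ : ℝ} (h : IsTransversal Φ D Δ δ)

include h

lemma integrableOn {b : E2 → ℂ} (hb : MemLp b 2 (volume.restrict D)) : IntegrableOn b D := by
  have : IsFiniteMeasure (volume.restrict D) :=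
    ⟨by rw [Measure.restrict_apply_univ]; exact h.bdd.measure_lt_top⟩
  exact hb.integrable (by norm_num)

/-- Superpositions of plane waves with frequencies on the hyperboloid, in the spatial variables of
the frame. -/
lemma eLpNorm_superposition_le {b : E2 → ℂ} (hb : MemLp b 2 (volume.restrict D)) :
    eLpNorm (fun y : E2 => ∫ ζ in D, ce (inner ℝ y (Φ.toEquiv.symm (hyp ζ)).2) * b ζ) 2 volume ≤
      ENNReal.ofReal (Real.sqrt (2 / δ)) * eLpNorm b 2 (volume.restrict D) := by
  have hbi : Integrable b (volume.restrict D) := h.integrableOn hb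
  refine eLpNorm_two_le_of_pairing ?_ fun φ hφ hφ2 hφm => ?_
  · refine continuous_of_dominated (bound := fun ζ => ‖b ζ‖)
      (fun y => (Continuous.aestronglyMeasurable (by fun_prop)).mul hbi.1)
      (fun y => ae_of_all _ fun ζ => by simp) hbi.norm (ae_of_all _ fun ζ => by fun_prop)
  · have hi : Integrable (fun p : E2 × E2 =>
        ce (inner ℝ p.1 (Φ.toEquiv.symm (hyp p.2)).2) * (φ p.1 * b p.2))
        (volume.prod (volume.restrict D)) := by
      refine (hφ.mul_prod hbi).bdd_mul (c := 1) ?_ (ae_of_all _ fun p => by simp)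
      exact Continuous.aestronglyMeasurable (by fun_prop)
    have e : ∫ y, (∫ ζ in D, ce (inner ℝ y (Φ.toEquiv.symm (hyp ζ)).2) * b ζ) * φ y =
        ∫ ζ in D, b ζ * 𝓕⁻ φ (Φ.toEquiv.symm (hyp ζ)).2 := by
      calc _ = ∫ y, ∫ ζ in D, ce (inner ℝ y (Φ.toEquiv.symm (hyp ζ)).2) * (φ y * b ζ) := by
            refine integral_congr_ae (ae_of_all _ fun y => ?_)
            simp only [← integral_mul_const]
            refine integral_congr_ae (ae_of_all _ fun z => ?_)
            simp only; ring
        _ = ∫ ζ in D, (∫ y, ce (inner ℝ y (Φ.toEquiv.symm (hyp ζ)).2) * (φ y * b ζ)) :=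
            integral_integral_swap hi
        _ = _ := by
            refine integral_congr_ae (ae_of_all _ fun z => ?_)
            simp only [fourierInv_eq_ce, ← integral_const_mul]
            refine integral_congr_ae (ae_of_all _ fun x => ?_)
            simp only; ring
    have hcont : StronglyMeasurable (𝓕⁻ φ) := by
      have : Continuous (𝓕 φ) := VectorFourier.fourierIntegral_continuous
        Real.continuous_fourierChar (by exact continuous_inner) hφ
      have h2 : 𝓕⁻ φ = fun x => 𝓕 φ (-x) := by ext x; rw [Real.fourierInv_eq_fourier_neg]
      rw [h2]; exact (this.comp continuous_neg).stronglyMeasurable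
    rw [e]
    refine (enorm_integral_le_lintegral_enorm _).trans ?_
    refine (lintegral_enorm_mul_le hb.1 ?_).trans ?_
    · exact (hcont.comp_measurable (Continuous.measurable (by fun_prop))).aestronglyMeasurable
    · rw [mul_comm, mul_assoc, mul_comm (eLpNorm b 2 _), ← mul_assoc]
      gcongr
      rw [← eLpNorm_fourierInv hφ hφ2]
      exact h.eLpNorm_hyp_le hcont

lemma freeWave_frame {f : L2} (hf : ∀ᵐ ζ, ζ ∉ D → (𝓕 f : L2) ζ = 0) (a : ℝ) (y : E2) :
    freeWave f (Φ.toEquiv (a, y)).1 (Φ.toEquiv (a, y)).2 =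
      ∫ ζ in D, ce (inner ℝ y (Φ.toEquiv.symm (hyp ζ)).2) *
        (ce (a * pr (hyp ζ) Φ.e0) * (𝓕 f : L2) ζ) := by
  rw [freeWave_eq, ← integral_indicator h.meas]
  refine integral_congr_ae ?_
  filter_upwards [hf] with ζ hζ
  by_cases hD : ζ ∈ D
  · rw [indicator_of_mem hD]
    have : pr ((Φ.toEquiv (a, y)).1, (Φ.toEquiv (a, y)).2) (hyp ζ) =
        inner ℝ y (Φ.toEquiv.symm (hyp ζ)).2 + a * pr (hyp ζ) Φ.e0 := by
      rw [Prod.mk.eta, pr_comm, ← Φ.pr_symm_left, pr, Φ.symm_fst, real_inner_comm]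
      ring
    rw [this, ce_add, mul_assoc]
  · rw [indicator_of_notMem hD, hζ hD, mul_zero]

/-- The estimate for free waves on the level sets of the evolution coordinate. -/
lemma slice_freeWave_le {f : L2} (hf : ∀ᵐ ζ, ζ ∉ D → (𝓕 f : L2) ζ = 0) (a : ℝ) :
    Φ.slice (freeWave f) a ≤ ENNReal.ofReal (Real.sqrt (2 / δ)) * ENNReal.ofReal ‖f‖ := by
  simp only [Frame.slice, h.freeWave_frame hf]
  have hm : MemLp (fun ζ => ce (a * pr (hyp ζ) Φ.e0) * (𝓕 f : L2) ζ) 2 (volume.restrict D) := by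
    refine ((Lp.memLp (𝓕 f : L2)).restrict D).of_le ?_ (ae_of_all _ fun ζ => by simp)
    exact (Continuous.aestronglyMeasurable (by fun_prop)).mul
      (Lp.aestronglyMeasurable (𝓕 f : L2)).restrict
  refine (h.eLpNorm_superposition_le hm).trans ?_
  gcongr
  rw [← Lp.norm_fourier_eq f, ← eLpNorm_coe_L2]
  refine le_trans (eLpNorm_congr_norm_ae (ae_of_all _ fun ζ => by simp)).le
    (eLpNorm_mono_measure _ Measure.restrict_le_self)

end IsTransversal

/-! ### Oscillatory integrals with twice differentiable amplitudes -/

/-- On `[-2,2]`, the functions `f₁` and `f₂` are the first two derivatives of `f`, and all three are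
bounded by `K`. -/
structure C2Bound (f f₁ f₂ : ℝ → ℝ) (K : ℝ) : Prop where
  deriv₁ : ∀ σ ∈ Icc (-2 : ℝ) 2, HasDerivAt f (f₁ σ) σ
  deriv₂ : ∀ σ ∈ Icc (-2 : ℝ) 2, HasDerivAt f₁ (f₂ σ) σ
  cont : ContinuousOn f₂ (Icc (-2 : ℝ) 2)
  bound₀ : ∀ σ ∈ Icc (-2 : ℝ) 2, |f σ| ≤ K
  bound₁ : ∀ σ ∈ Icc (-2 : ℝ) 2, |f₁ σ| ≤ K
  bound₂ : ∀ σ ∈ Icc (-2 : ℝ) 2, |f₂ σ| ≤ K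

namespace C2Bound

variable {f f₁ f₂ g g₁ g₂ : ℝ → ℝ} {K L : ℝ}

lemma continuousOn (hf : C2Bound f f₁ f₂ K) : ContinuousOn f (Icc (-2 : ℝ) 2) :=
  fun σ hσ => (hf.deriv₁ σ hσ).continuousAt.continuousWithinAt

lemma continuousOn₁ (hf : C2Bound f f₁ f₂ K) : ContinuousOn f₁ (Icc (-2 : ℝ) 2) :=
  fun σ hσ => (hf.deriv₂ σ hσ).continuousAt.continuousWithinAt

lemma nonneg (hf : C2Bound f f₁ f₂ K) : 0 ≤ K :=
  (abs_nonneg _).trans (hf.bound₀ 0 (by norm_num))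

lemma mul (hf : C2Bound f f₁ f₂ K) (hg : C2Bound g g₁ g₂ L) :
    C2Bound (fun σ => f σ * g σ) (fun σ => f₁ σ * g σ + f σ * g₁ σ)
      (fun σ => (f₂ σ * g σ + f₁ σ * g₁ σ) + (f₁ σ * g₁ σ + f σ * g₂ σ)) (4 * (K * L)) := by
  have hK := hf.nonneg
  have hL := hg.nonneg
  have key : ∀ {a b : ℝ}, |a| ≤ K → |b| ≤ L → |a * b| ≤ K * L := fun ha hb => by
    rw [abs_mul]; exact mul_le_mul ha hb (abs_nonneg _) hK
  have hKL : 0 ≤ K * L := by positivity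
  refine ⟨fun σ hσ => (hf.deriv₁ σ hσ).mul (hg.deriv₁ σ hσ), fun σ hσ =>
    ((hf.deriv₂ σ hσ).mul (hg.deriv₁ σ hσ)).add ((hf.deriv₁ σ hσ).mul (hg.deriv₂ σ hσ)), ?_,
    fun σ hσ => ?_, fun σ hσ => ?_, fun σ hσ => ?_⟩
  · have := hf.cont; have := hg.cont; have := hf.continuousOn; have := hg.continuousOn
    have := hf.continuousOn₁; have := hg.continuousOn₁
    fun_prop
  · have := key (hf.bound₀ σ hσ) (hg.bound₀ σ hσ)
    linarith
  · have h1 := key (hf.bound₁ σ hσ) (hg.bound₀ σ hσ)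
    have h2 := key (hf.bound₀ σ hσ) (hg.bound₁ σ hσ)
    refine (abs_add_le _ _).trans ?_
    linarith
  · have h1 := key (hf.bound₂ σ hσ) (hg.bound₀ σ hσ)
    have h2 := key (hf.bound₁ σ hσ) (hg.bound₁ σ hσ)
    have h3 := key (hf.bound₀ σ hσ) (hg.bound₂ σ hσ)
    refine (abs_add_le _ _).trans ?_
    refine (add_le_add (abs_add_le _ _) (abs_add_le _ _)).trans ?_
    linarith

/-- Two integrations by parts. -/
lemma oscillatory (hf : C2Bound f f₁ f₂ K) (h2 : f 2 = 0) (h2' : f (-2) = 0) (h3 : f₁ 2 = 0)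
    (h3' : f₁ (-2) = 0) (t : ℝ) :
    ‖∫ σ in (-2 : ℝ)..2, ce (σ * t) * f σ‖ ≤ 8 * K / (1 + t ^ 2) := by
  have hK := hf.nonneg
  have bd : ∀ {g : ℝ → ℝ}, (∀ σ ∈ Icc (-2 : ℝ) 2, |g σ| ≤ K) →
      ‖∫ σ in (-2 : ℝ)..2, ce (σ * t) * g σ‖ ≤ 4 * K := by
    intro g hg
    have := intervalIntegral.norm_integral_le_of_norm_le_const (a := -2) (b := 2) (C := K)
      (f := fun σ => ce (σ * t) * g σ) (fun σ hσ => by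
        rw [norm_mul, norm_ce, one_mul, Complex.norm_real]
        rw [uIoc_of_le (by norm_num)] at hσ
        exact hg σ ⟨hσ.1.le, hσ.2⟩)
    refine this.trans_eq ?_
    norm_num; ring
  have ibp : ∀ {g g₁ : ℝ → ℝ}, (∀ σ ∈ Icc (-2 : ℝ) 2, HasDerivAt g (g₁ σ) σ) →
      ContinuousOn g₁ (Icc (-2 : ℝ) 2) → g 2 = 0 → g (-2) = 0 →
      (2 * Real.pi * Complex.I * t) * ∫ σ in (-2 : ℝ)..2, ce (σ * t) * g σ =
        -∫ σ in (-2 : ℝ)..2, ce (σ * t) * g₁ σ := by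
    intro g g₁ hd hc hg hg'
    have hu : uIcc (-2 : ℝ) 2 = Icc (-2) 2 := uIcc_of_le (by norm_num)
    have hgc : ContinuousOn g (Icc (-2 : ℝ) 2) :=
      fun σ hσ => (hd σ hσ).continuousAt.continuousWithinAt
    have hgC : ContinuousOn (fun σ => (g σ : ℂ)) (Icc (-2 : ℝ) 2) :=
      Complex.continuous_ofReal.comp_continuousOn hgc
    have hg1C : ContinuousOn (fun σ => (g₁ σ : ℂ)) (Icc (-2 : ℝ) 2) :=
      Complex.continuous_ofReal.comp_continuousOn hc
    have hE : Continuous fun σ : ℝ => ce (σ * t) := by fun_prop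
    have i1 : IntervalIntegrable (fun σ => ce (σ * t) * g₁ σ) volume (-2) 2 :=
      ContinuousOn.intervalIntegrable (by rw [hu]; exact hE.continuousOn.mul hg1C)
    have i2 : IntervalIntegrable (fun σ => 2 * Real.pi * Complex.I * t * ce (σ * t) * g σ)
        volume (-2) 2 :=
      ContinuousOn.intervalIntegrable (by
        rw [hu]; exact (continuousOn_const.mul hE.continuousOn).mul hgC)
    have h := intervalIntegral.integral_eq_sub_of_hasDerivAt (a := -2) (b := 2)
      (f := fun σ => ce (σ * t) * g σ)
      (f' := fun σ => 2 * Real.pi * Complex.I * t * ce (σ * t) * g σ + ce (σ * t) * g₁ σ)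
      (fun σ hσ => (hasDerivAt_ce_mul σ t).mul ((hd σ (hu ▸ hσ)).ofReal_comp)) (i2.add i1)
    rw [intervalIntegral.integral_add i2 i1] at h
    simp only [hg, hg', Complex.ofReal_zero, mul_zero, sub_zero, mul_assoc] at h
    simp only [intervalIntegral.integral_const_mul] at h
    rw [eq_neg_iff_add_eq_zero, ← h]
    ring
  have e1 := ibp hf.deriv₁ hf.continuousOn₁ h2 h2'
  have e2 := ibp hf.deriv₂ hf.cont h3 h3'
  have b0 := bd hf.bound₀
  have b2 := bd hf.bound₂
  have e3 : (2 * Real.pi * |t|) ^ 2 * ‖∫ σ in (-2 : ℝ)..2, ce (σ * t) * f σ‖ ≤ 4 * K := by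
    have : (2 * Real.pi * Complex.I * t) * ((2 * Real.pi * Complex.I * t) *
        ∫ σ in (-2 : ℝ)..2, ce (σ * t) * f σ) = ∫ σ in (-2 : ℝ)..2, ce (σ * t) * f₂ σ := by
      rw [e1, mul_neg, e2, neg_neg]
    rw [← this] at b2
    refine le_trans (le_of_eq ?_) b2
    simp only [norm_mul, Complex.norm_real, Complex.norm_I, Real.norm_eq_abs, Complex.norm_ofNat,
      abs_of_pos Real.pi_pos]
    ring
  have h6 : 1 ≤ (2 * Real.pi) ^ 2 := by nlinarith [Real.pi_gt_three]
  rw [mul_pow, sq_abs] at e3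
  have hI := norm_nonneg (∫ σ in (-2 : ℝ)..2, ce (σ * t) * f σ)
  have e4 : t ^ 2 * ‖∫ σ in (-2 : ℝ)..2, ce (σ * t) * f σ‖ ≤ 4 * K := by
    refine le_trans ?_ e3
    nlinarith [mul_nonneg (sq_nonneg t) hI]
  rw [le_div_iff₀ (by positivity)]
  linarith

end C2Bound

lemma IsCutoff.exists_c2Bound {ρ : ℝ → ℝ} (hρ : IsCutoff ρ) :
    ∃ K, 1 ≤ K ∧ C2Bound ρ (deriv ρ) (deriv (deriv ρ)) K := by
  have h1 : ContDiff ℝ 2 ρ := contDiff_infty.1 hρ.smooth 2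
  have h2 : ContDiff ℝ 1 (deriv ρ) := by
    have : ContDiff ℝ (1 + 1) ρ := h1
    exact (contDiff_succ_iff_deriv.1 this).2.2
  have h3 : Continuous (deriv (deriv ρ)) := h2.continuous_deriv le_rfl
  obtain ⟨A, hA⟩ := (isCompact_Icc (a := (-2 : ℝ)) (b := 2)).exists_bound_of_continuousOn
    h1.continuous.continuousOn
  obtain ⟨B, hB⟩ := (isCompact_Icc (a := (-2 : ℝ)) (b := 2)).exists_bound_of_continuousOn
    h2.continuous.continuousOn
  obtain ⟨C, hC⟩ := (isCompact_Icc (a := (-2 : ℝ)) (b := 2)).exists_bound_of_continuousOn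
    h3.continuousOn
  refine ⟨max 1 (max A (max B C)), le_max_left _ _,
    fun σ _ => (h1.differentiable (by norm_num) σ).hasDerivAt,
    fun σ _ => (h2.differentiable (by norm_num) σ).hasDerivAt, h3.continuousOn,
    fun σ hσ => (hA σ hσ).trans ?_, fun σ hσ => (hB σ hσ).trans ?_,
    fun σ hσ => (hC σ hσ).trans ?_⟩ <;> simp

lemma IsCutoff.eventuallyEq_zero {ρ : ℝ → ℝ} (hρ : IsCutoff ρ) {s : ℝ} (hs : 2 ≤ |s|) :
    ρ =ᶠ[𝓝 s] 0 := by
  rw [← notMem_tsupport_iff_eventuallyEq]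
  intro hcon
  have := hρ.supp hcon
  exact absurd (abs_lt.2 this) (not_lt.2 hs)

lemma IsCutoff.eq_zero {ρ : ℝ → ℝ} (hρ : IsCutoff ρ) {s : ℝ} (hs : 2 ≤ |s|) : ρ s = 0 :=
  (hρ.eventuallyEq_zero hs).eq_of_nhds

lemma IsCutoff.deriv_eq_zero {ρ : ℝ → ℝ} (hρ : IsCutoff ρ) {s : ℝ} (hs : 2 ≤ |s|) :
    deriv ρ s = 0 := by
  rw [(hρ.eventuallyEq_zero hs).deriv_eq]; simp

/-! ### The inverse of the symbol near the hyperboloid -/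

lemma norm_le_nb (ζ : E2) : ‖ζ‖ ≤ nb ζ := by
  have h := nb_sq ζ
  have h0 : 0 < ((2 * Real.pi) ^ 2)⁻¹ := by positivity
  exact abs_le_of_sq_le_sq' (by linarith) (nb_pos ζ).le |>.2

lemma nb_add_le (ζ v : E2) : nb (ζ + v) ≤ nb ζ + ‖v‖ := by
  refine abs_le_of_sq_le_sq' ?_ (by have := nb_pos ζ; positivity) |>.2
  have h1 := norm_le_nb ζ
  have h2 := norm_add_le ζ v
  rw [nb_sq, add_sq, nb_sq]
  nlinarith [norm_nonneg ζ, norm_nonneg v, norm_nonneg (ζ + v)]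

lemma le_nb_add (ζ v : E2) : nb ζ - ‖v‖ ≤ nb (ζ + v) := by
  have := nb_add_le (ζ + v) (-v)
  rw [norm_neg, add_neg_cancel_right] at this
  linarith

namespace Frame

variable (Φ : Frame)

/-- The quotient `θ / (τ - ⟨ξ⟩)` at the point of signed distance `θ` over a base frequency, in a
form that is regular at `θ = 0`. -/
def ratio (q : ℝ × E2) : ℝ :=
  (nb q.2 + q.1 * Φ.e0.1 + nb (q.2 + q.1 • Φ.e0.2)) / (2 * Φ.nor q.2 + Φ.mink * q.1)

lemma measurable_ratio : Measurable Φ.ratio := by unfold ratio; fun_prop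

lemma ratio_mul {q : ℝ × E2} (hq : 2 * Φ.nor q.2 + Φ.mink * q.1 ≠ 0) :
    Φ.ratio q * ((Φ.pt q).1 - nb (Φ.pt q).2) = q.1 := by
  have h := Φ.pt_sq_sub q.1 q.2
  have e1 : (Φ.pt (q.1, q.2)).1 = nb q.2 + q.1 * Φ.e0.1 := by simp [pt, hyp]
  have e2 : (Φ.pt (q.1, q.2)).2 = q.2 + q.1 • Φ.e0.2 := by simp [pt, hyp]
  rw [Prod.mk.eta] at h e1 e2
  rw [e1, e2] at h ⊢
  rw [ratio, div_mul_eq_mul_div, div_eq_iff hq]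
  linear_combination h

end Frame

namespace IsTransversal

variable {Φ : Frame} {D : Set E2} {Δ δ : ℝ} (h : IsTransversal Φ D Δ δ)

include h

lemma le_abs_denom {ζ : E2} (hζ : ζ ∈ D) {θ : ℝ} (hθ : |θ| ≤ 2 * Δ) :
    |Φ.nor ζ| ≤ |2 * Φ.nor ζ + Φ.mink * θ| := by
  have h1 := h.mink_le ζ hζ
  have h2 : |Φ.mink * θ| ≤ |Φ.nor ζ| := by
    rw [abs_mul]
    have := mul_le_mul_of_nonneg_left hθ (abs_nonneg Φ.mink)
    linarith
  have h3 := abs_sub_abs_le_abs_sub (2 * Φ.nor ζ) (-(Φ.mink * θ))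
  rw [abs_neg, sub_neg_eq_add, abs_mul, abs_two] at h3
  linarith

lemma denom_ne_zero {ζ : E2} (hζ : ζ ∈ D) {θ : ℝ} (hθ : |θ| ≤ 2 * Δ) :
    2 * Φ.nor ζ + Φ.mink * θ ≠ 0 :=
  abs_pos.1 ((abs_pos.2 (h.nor_ne_zero hζ)).trans_le (h.le_abs_denom hζ hθ))

/-- The inverse of the denominator of `Frame.ratio`, rescaled to the unit length: as `2Δ|mink|` is at
most `|nor|`, the denominator stays away from zero. -/
lemma c2Bound_inv {ζ : E2} (hζ : ζ ∈ D) :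
    ∃ f₁ f₂, C2Bound (fun σ => (2 * Φ.nor ζ + Φ.mink * (Δ * σ))⁻¹) f₁ f₂ |Φ.nor ζ|⁻¹ := by
  have hΔ := h.pos
  have hj : 0 < |Φ.nor ζ| := abs_pos.2 (h.nor_ne_zero hζ)
  have hβ : |Φ.mink * Δ| ≤ |Φ.nor ζ| / 2 := by
    rw [abs_mul, abs_of_pos hΔ]; linarith [h.mink_le ζ hζ]
  have hσ2 : ∀ σ ∈ Icc (-2 : ℝ) 2, |Δ * σ| ≤ 2 * Δ := fun σ hσ => by
    rw [abs_mul, abs_of_pos hΔ]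
    nlinarith [abs_le.2 hσ]
  have hne : ∀ σ ∈ Icc (-2 : ℝ) 2, 2 * Φ.nor ζ + Φ.mink * (Δ * σ) ≠ 0 := fun σ hσ =>
    h.denom_ne_zero hζ (hσ2 σ hσ)
  have hle : ∀ σ ∈ Icc (-2 : ℝ) 2, |(2 * Φ.nor ζ + Φ.mink * (Δ * σ))⁻¹| ≤ |Φ.nor ζ|⁻¹ :=
    fun σ hσ => by
      rw [abs_inv]
      exact inv_anti₀ hj (h.le_abs_denom hζ (hσ2 σ hσ))
  have hd : ∀ σ, HasDerivAt (fun σ => 2 * Φ.nor ζ + Φ.mink * (Δ * σ)) (Φ.mink * Δ) σ := by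
    intro σ
    have := (((hasDerivAt_id σ).const_mul Δ).const_mul Φ.mink).const_add (2 * Φ.nor ζ)
    simpa using this
  refine ⟨fun σ => -(Φ.mink * Δ) * (2 * Φ.nor ζ + Φ.mink * (Δ * σ))⁻¹ ^ 2,
    fun σ => 2 * (Φ.mink * Δ) ^ 2 * (2 * Φ.nor ζ + Φ.mink * (Δ * σ))⁻¹ ^ 3,
    fun σ hσ => ?_, fun σ hσ => ?_, ?_, hle, fun σ hσ => ?_, fun σ hσ => ?_⟩
  · refine ((hd σ).inv (hne σ hσ)).congr_deriv ?_
    have := hne σ hσ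
    field_simp
  · refine ((((hd σ).inv (hne σ hσ)).pow 2).const_mul (-(Φ.mink * Δ))).congr_deriv ?_
    have := hne σ hσ
    simp only [Nat.cast_ofNat, Pi.inv_apply]
    generalize 2 * Φ.nor ζ + Φ.mink * (Δ * σ) = X at this
    field_simp
    ring_nf
    rw [mul_assoc, mul_inv_cancel₀ this, mul_one]
  · refine ContinuousOn.mul continuousOn_const (ContinuousOn.pow ?_ _)
    exact ContinuousOn.inv₀ (by fun_prop) hne
  · rw [abs_mul, abs_neg, abs_pow]
    calc _ ≤ |Φ.nor ζ| / 2 * |Φ.nor ζ|⁻¹ ^ 2 := by gcongr; exact hle σ hσ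
      _ ≤ |Φ.nor ζ|⁻¹ := by
        have : |Φ.nor ζ| / 2 * |Φ.nor ζ|⁻¹ ^ 2 = |Φ.nor ζ|⁻¹ / 2 := by field_simp
        rw [this]
        have := inv_pos.2 hj
        linarith
  · rw [abs_mul, abs_pow, abs_mul, abs_two, abs_pow]
    calc _ ≤ 2 * (|Φ.nor ζ| / 2) ^ 2 * |Φ.nor ζ|⁻¹ ^ 3 := by gcongr; exact hle σ hσ
      _ ≤ |Φ.nor ζ|⁻¹ := by
        have : 2 * (|Φ.nor ζ| / 2) ^ 2 * |Φ.nor ζ|⁻¹ ^ 3 = |Φ.nor ζ|⁻¹ / 2 := by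
          field_simp
        rw [this]
        have := inv_pos.2 hj
        linarith

/-- The numerator of `Frame.ratio`, rescaled to the unit length, is of the size of the
frequency, together with its derivatives. -/
lemma c2Bound_num {ζ : E2} (hζ : ζ ∈ D) :
    ∃ f₁ f₂, C2Bound (fun σ => nb ζ + Δ * σ * Φ.e0.1 + nb (ζ + (Δ * σ) • Φ.e0.2)) f₁ f₂
      (3 * nb ζ) := by
  have hΔ := h.pos
  have hP := nb_pos ζ
  have hΔP := h.le_nb ζ hζ
  obtain ⟨a, v, ha, hv⟩ : ∃ a v, Φ.e0.1 = a ∧ Φ.e0.2 = v := ⟨_, _, rfl, rfl⟩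
  have ha1 := Φ.abs_e0_fst_le
  have hv1 := Φ.norm_e0_snd_le
  rw [ha] at ha1 ⊢
  rw [hv] at hv1 ⊢
  let z : ℝ → E2 := fun σ => ζ + (Δ * σ) • v
  have hzn : ∀ σ ∈ Icc (-2 : ℝ) 2, ‖(Δ * σ) • v‖ ≤ 2 * Δ := fun σ hσ => by
    rw [norm_smul, Real.norm_eq_abs, abs_mul, abs_of_pos hΔ]
    have h1 := abs_le.2 hσ
    have : |σ| * ‖v‖ ≤ 2 * 1 := mul_le_mul h1 hv1 (norm_nonneg _) (by norm_num)
    nlinarith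
  have hup : ∀ σ ∈ Icc (-2 : ℝ) 2, nb (z σ) ≤ nb ζ + 2 * Δ := fun σ hσ =>
    (nb_add_le _ _).trans (by linarith [hzn σ hσ])
  have hlo : ∀ σ ∈ Icc (-2 : ℝ) 2, nb ζ / 2 ≤ nb (z σ) := fun σ hσ =>
    le_trans (by linarith [hzn σ hσ]) (le_nb_add _ _)
  have hz : ∀ σ, HasDerivAt z (Δ • v) σ := by
    intro σ
    refine ((((hasDerivAt_id σ).const_mul Δ).smul_const v).const_add ζ).congr_deriv ?_
    simp
  have hnb : ∀ σ, HasDerivAt (fun σ => nb (z σ)) ((nb (z σ))⁻¹ * (Δ * inner ℝ (z σ) v)) σ := by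
    intro σ
    refine ((hasFDerivAt_nb (z σ)).comp_hasDerivAt σ (hz σ)).congr_deriv ?_
    simp
    ring
  have hin : ∀ σ, HasDerivAt (fun σ => inner ℝ (z σ) v) (Δ * ‖v‖ ^ 2) σ := by
    intro σ
    have := (hz σ).inner ℝ (hasDerivAt_const σ v)
    refine this.congr_deriv ?_
    simp [inner_smul_left]
  have hq : ∀ σ, |inner ℝ (z σ) v| ≤ nb (z σ) := fun σ => by
    refine (abs_real_inner_le_norm _ _).trans ?_
    have := norm_le_nb (z σ)
    nlinarith [norm_nonneg (z σ), norm_nonneg v]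
  refine ⟨fun σ => Δ * a + (nb (z σ))⁻¹ * (Δ * inner ℝ (z σ) v),
    fun σ => -((nb (z σ))⁻¹ * (Δ * inner ℝ (z σ) v)) * (nb (z σ))⁻¹ ^ 2 * (Δ * inner ℝ (z σ) v) +
      (nb (z σ))⁻¹ * (Δ * (Δ * ‖v‖ ^ 2)),
    fun σ hσ => ?_, fun σ hσ => ?_, ?_, fun σ hσ => ?_, fun σ hσ => ?_, fun σ hσ => ?_⟩
  · have h1 := (((hasDerivAt_id σ).const_mul Δ).mul_const a).const_add (nb ζ)
    refine (h1.add (hnb σ)).congr_deriv ?_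
    simp
  · have hne : nb (z σ) ≠ 0 := (nb_pos _).ne'
    refine ((((hnb σ).inv hne).mul ((hin σ).const_mul Δ)).const_add (Δ * a)).congr_deriv ?_
    simp only [Pi.inv_apply]
    field_simp
  · have hzc : Continuous z := by fun_prop
    have hinv : Continuous fun σ => (nb (z σ))⁻¹ :=
      Continuous.inv₀ (by fun_prop) fun σ => (nb_pos _).ne'
    exact Continuous.continuousOn (by fun_prop)
  · have h1 : |Δ * σ * a| ≤ 2 * Δ := by
      rw [abs_mul, abs_mul, abs_of_pos hΔ]
      have h1 := abs_le.2 hσ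
      have : |σ| * |a| ≤ 2 * 1 := mul_le_mul h1 ha1 (abs_nonneg _) (by norm_num)
      nlinarith
    have h2 := hup σ hσ
    have h3 := nb_pos (z σ)
    rw [abs_le] at h1 ⊢
    constructor <;> simp only [z] at * <;> linarith
  · have h1 : |(nb (z σ))⁻¹ * (Δ * inner ℝ (z σ) v)| ≤ Δ := by
      rw [abs_mul, abs_mul, abs_of_pos hΔ, abs_of_pos (inv_pos.2 (nb_pos _)),
        inv_mul_le_iff₀ (nb_pos _)]
      have := hq σ
      nlinarith
    have h2 : |Δ * a| ≤ Δ := by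
      rw [abs_mul, abs_of_pos hΔ]; nlinarith
    refine (abs_add_le _ _).trans ?_
    linarith
  · have h1 : |(nb (z σ))⁻¹ * (Δ * inner ℝ (z σ) v)| ≤ Δ := by
      rw [abs_mul, abs_mul, abs_of_pos hΔ, abs_of_pos (inv_pos.2 (nb_pos _)),
        inv_mul_le_iff₀ (nb_pos _)]
      have := hq σ
      nlinarith
    have h0 := inv_pos.2 (nb_pos (z σ))
    have h5 : (nb (z σ))⁻¹ * Δ ≤ 1 / 2 := by
      rw [inv_mul_le_iff₀ (nb_pos _)]
      linarith [hlo σ hσ]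
    have h6 : (nb (z σ))⁻¹ * Δ * Δ ≤ Δ / 2 := by nlinarith
    have e : -((nb (z σ))⁻¹ * (Δ * inner ℝ (z σ) v)) * (nb (z σ))⁻¹ ^ 2 *
        (Δ * inner ℝ (z σ) v) = -((nb (z σ))⁻¹ * ((nb (z σ))⁻¹ * (Δ * inner ℝ (z σ) v)) ^ 2) := by
      ring
    rw [e]
    have h7 : ((nb (z σ))⁻¹ * (Δ * inner ℝ (z σ) v)) ^ 2 ≤ Δ ^ 2 := by
      rw [← sq_abs]; exact pow_le_pow_left₀ (abs_nonneg _) h1 2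
    have h8 : (nb (z σ))⁻¹ * ((nb (z σ))⁻¹ * (Δ * inner ℝ (z σ) v)) ^ 2 ≤ Δ / 2 := by
      refine le_trans ?_ h6
      rw [mul_assoc, ← sq]; gcongr
    have h9 : (nb (z σ))⁻¹ * (Δ * (Δ * ‖v‖ ^ 2)) ≤ Δ / 2 := by
      refine le_trans ?_ h6
      have : ‖v‖ ^ 2 ≤ 1 := pow_le_one₀ (norm_nonneg _) hv1
      calc _ = (nb (z σ))⁻¹ * Δ * Δ * ‖v‖ ^ 2 := by ring
        _ ≤ (nb (z σ))⁻¹ * Δ * Δ * 1 := by gcongr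
        _ = _ := by ring
    have h10 : 0 ≤ (nb (z σ))⁻¹ * ((nb (z σ))⁻¹ * (Δ * inner ℝ (z σ) v)) ^ 2 := by positivity
    have h11 : 0 ≤ (nb (z σ))⁻¹ * (Δ * (Δ * ‖v‖ ^ 2)) := by positivity
    rw [abs_le]
    constructor <;> linarith

/-- The kernel that results from the truncation of the inverse symbol decays on the scale `Δ⁻¹`. -/
lemma norm_kernel_le {ρ : ℝ → ℝ} (hρ : IsCutoff ρ) {K : ℝ}
    (hK : C2Bound ρ (deriv ρ) (deriv (deriv ρ)) K) {ζ : E2} (hζ : ζ ∈ D) (t : ℝ) :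
    |Φ.jac ζ| * ‖∫ θ in (-(2 * Δ))..(2 * Δ), ce (t * θ) * (ρ (θ / Δ) * Φ.ratio (θ, ζ) : ℝ)‖ ≤
      400 * K * (Δ / (1 + (Δ * t) ^ 2)) := by
  have hΔ := h.pos
  obtain ⟨f₁, f₂, hf⟩ := h.c2Bound_num hζ
  obtain ⟨g₁, g₂, hg⟩ := h.c2Bound_inv hζ
  have hfg := hK.mul (hf.mul hg)
  have hz : ∀ s : ℝ, 2 ≤ |s| → ρ s = 0 ∧ deriv ρ s = 0 := fun s hs =>
    ⟨hρ.eq_zero hs, hρ.deriv_eq_zero hs⟩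
  have h1 := hfg.oscillatory (by simp [hz 2 (by norm_num)]) (by simp [hz (-2) (by norm_num)])
    (by simp [hz 2 (by norm_num)]) (by simp [hz (-2) (by norm_num)]) (Δ * t)
  have h2 : ∫ θ in (-(2 * Δ))..(2 * Δ), ce (t * θ) * (ρ (θ / Δ) * Φ.ratio (θ, ζ) : ℝ) =
      Δ * ∫ σ in (-2 : ℝ)..2, ce (σ * (Δ * t)) * ((ρ σ * ((nb ζ + Δ * σ * Φ.e0.1 +
        nb (ζ + (Δ * σ) • Φ.e0.2)) * (2 * Φ.nor ζ + Φ.mink * (Δ * σ))⁻¹) : ℝ) : ℂ) := by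
    have := intervalIntegral.smul_integral_comp_mul_left (a := -2) (b := 2)
      (fun θ => ce (t * θ) * (ρ (θ / Δ) * Φ.ratio (θ, ζ) : ℝ)) Δ
    have e1 : Δ * -2 = -(2 * Δ) := by ring
    have e2 : Δ * 2 = 2 * Δ := by ring
    rw [e1, e2, Complex.real_smul] at this
    rw [← this]
    congr 1
    refine intervalIntegral.integral_congr fun σ _ => ?_
    simp only [Frame.ratio]
    rw [mul_div_cancel_left₀ _ hΔ.ne', div_eq_mul_inv]
    congr 2
    ring
  rw [h2, norm_mul, Complex.norm_real, Real.norm_of_nonneg hΔ.le]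
  have hP := nb_pos ζ
  have hj : 0 < |Φ.nor ζ| := abs_pos.2 (h.nor_ne_zero hζ)
  have hK0 := hK.nonneg
  have hJ : |Φ.jac ζ| = |Φ.nor ζ| / nb ζ := by rw [Frame.jac, abs_div, abs_of_pos hP]
  calc _ ≤ |Φ.jac ζ| * (Δ * (8 * (4 * (K * (4 * (3 * nb ζ * |Φ.nor ζ|⁻¹)))) /
        (1 + (Δ * t) ^ 2))) := by gcongr
    _ = 384 * K * (Δ / (1 + (Δ * t) ^ 2)) := by
        rw [hJ]; field_simp; ring
    _ ≤ _ := by gcongr; norm_num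

end IsTransversal

/-! ### The Duhamel integral in the coordinates of a frame -/

/-- The spectral density of a source: the Fourier transform, computed in the frame, cut off to the
spectral set `S`. -/
def dens (Φ : Frame) (S : Set (ℝ × E2)) (γ : ℝ × E2 → ℂ) : ℝ × E2 → ℂ :=
  S.indicator fun z => ftFst γ (Φ.toEquiv.symm z)

/-- The spectral density divided by the symbol `τ - ⟨ξ⟩`, up to the factor `θ`, as a density in
the coordinates `(θ, ζ)` of `Frame.pt`. -/
def chartDens (Φ : Frame) (D : Set E2) (Δ : ℝ) (S : Set (ℝ × E2)) (γ : ℝ × E2 → ℂ) : ℝ × E2 → ℂ :=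
  (Icc (-Δ) Δ ×ˢ D).indicator fun q =>
    ((|Φ.jac q.2| * Φ.ratio q : ℝ) : ℂ) * dens Φ S γ (Φ.pt q)

/-- A source with bounded spectrum `S`, all of which is reached from the hyperboloid, over the
transversal set `D`, by moving at most `Δ` in the evolution direction; `γ` is its partial Fourier
transform in the spatial variables of the frame. -/
structure SpectralData (Φ : Frame) (D : Set E2) (Δ δ : ℝ) (S : Set (ℝ × E2)) (γ : ℝ × E2 → ℂ) :
    Prop extends IsTransversal Φ D Δ δ where
  closed : IsClosed D
  closed_spec : IsClosed S
  bdd_spec : Bornology.IsBounded S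
  snd_mem : ∀ z ∈ S, z.2 ∈ D
  exists_pt : ∀ z ∈ S, ∃ θ ζ, |θ| ≤ Δ ∧ ζ ∈ D ∧ Φ.pt (θ, ζ) = z
  meas_partial : StronglyMeasurable γ
  fin : ∫⁻ s, eLpNorm (fun η => γ (s, η)) 2 volume < ⊤
  null : ∀ᵐ z : ℝ × E2, z ∉ S → ftFst γ (Φ.toEquiv.symm z) = 0

namespace IsTransversal

variable {Φ : Frame} {D : Set E2} {Δ δ : ℝ} (h : IsTransversal Φ D Δ δ)

include h

lemma abs_jac_mul_ratio_le {θ : ℝ} {ζ : E2} (hζ : ζ ∈ D) (hθ : |θ| ≤ Δ) :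
    |Φ.jac ζ| * |Φ.ratio (θ, ζ)| ≤ 3 := by
  have hP := nb_pos ζ
  have hj : 0 < |Φ.nor ζ| := abs_pos.2 (h.nor_ne_zero hζ)
  have h1 := h.le_abs_denom hζ (hθ.trans (by linarith [h.pos]))
  have h2 : |nb ζ + θ * Φ.e0.1 + nb (ζ + θ • Φ.e0.2)| ≤ 3 * nb ζ := by
    have h3 : |θ * Φ.e0.1| ≤ Δ := by
      rw [abs_mul]; nlinarith [Φ.abs_e0_fst_le, abs_nonneg θ, abs_nonneg Φ.e0.1]
    have h4 : ‖θ • Φ.e0.2‖ ≤ Δ := by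
      rw [norm_smul, Real.norm_eq_abs]
      nlinarith [Φ.norm_e0_snd_le, abs_nonneg θ, norm_nonneg Φ.e0.2]
    have h5 := nb_add_le ζ (θ • Φ.e0.2)
    have h6 := nb_pos (ζ + θ • Φ.e0.2)
    have h7 := h.le_nb ζ hζ
    rw [abs_le] at h3 ⊢
    constructor <;> linarith
  simp only [Frame.jac, Frame.ratio, abs_div, abs_of_pos hP]
  rw [div_mul_div_comm, div_le_iff₀ (mul_pos hP (hj.trans_le h1))]
  have h8 := mul_le_mul h1 h2 (abs_nonneg _) (abs_nonneg _)
  linarith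

end IsTransversal

namespace SpectralData

variable {Φ : Frame} {D : Set E2} {Δ δ : ℝ} {S : Set (ℝ × E2)} {γ : ℝ × E2 → ℂ}
  (h : SpectralData Φ D Δ δ S γ)

include h

lemma measurableSet_chart : MeasurableSet (Icc (-Δ) Δ ×ˢ D : Set (ℝ × E2)) :=
  measurableSet_Icc.prod h.meas

lemma stronglyMeasurable_dens : StronglyMeasurable (dens Φ S γ) :=
  ((stronglyMeasurable_ftFst h.meas_partial).comp_measurable
    Φ.toEquiv.symm.continuous.measurable).indicator h.closed_spec.measurableSet

lemma ae_dens_eq : ∀ᵐ z, dens Φ S γ z = ftFst γ (Φ.toEquiv.symm z) := by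
  filter_upwards [h.null] with z hz
  by_cases hzS : z ∈ S
  · rw [dens, indicator_of_mem hzS]
  · rw [dens, indicator_of_notMem hzS, hz hzS]

lemma memLp_dens : MemLp (dens Φ S γ) 2 volume := by
  refine ⟨h.stronglyMeasurable_dens.aestronglyMeasurable, ?_⟩
  obtain ⟨R, hR⟩ := h.bdd_spec.subset_closedBall 0
  -- the spectral set is contained in a slab of the frame
  obtain ⟨R', hR'⟩ : ∃ R', ∀ z ∈ S, |(Φ.toEquiv.symm z).1| ≤ R' := by
    obtain ⟨M, hM⟩ := (isCompact_closedBall (0 : ℝ × E2) R).exists_bound_of_continuousOn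
      (f := fun z => (Φ.toEquiv.symm z).1) (by fun_prop)
    exact ⟨M, fun z hz => hM z (hR hz)⟩
  have hlt : eLpNorm (dens Φ S γ) 2 volume ^ 2 < ⊤ := by
    rw [eLpNorm_two_sq]
    let F : ℝ × E2 → ℝ≥0∞ := fun q => (Icc (-R') R').indicator 1 q.1 * ‖ftFst γ q‖ₑ ^ 2
    have hF1 : Measurable fun q : ℝ × E2 => (Icc (-R') R').indicator (1 : ℝ → ℝ≥0∞) q.1 :=
      (measurable_one.indicator measurableSet_Icc).comp measurable_fst
    have hFm : Measurable F :=
      hF1.mul ((stronglyMeasurable_ftFst h.meas_partial).measurable.enorm.pow_const 2)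
    calc ∫⁻ z, ‖dens Φ S γ z‖ₑ ^ 2 ≤ ∫⁻ z, F (Φ.toEquiv.symm z) := by
          refine lintegral_mono fun z => ?_
          by_cases hz : z ∈ S
          · simp only [F, dens, indicator_of_mem hz]
            have hmem : (Φ.toEquiv.symm z).1 ∈ Icc (-R') R' := abs_le.1 (hR' z hz)
            rw [indicator_of_mem hmem]
            simp
          · simp [dens, indicator_of_notMem hz]
      _ = ∫⁻ q, F q := Φ.measurePreserving_symm.lintegral_comp hFm
      _ = ∫⁻ τ, (Icc (-R') R').indicator 1 τ * eLpNorm (fun η => ftFst γ (τ, η)) 2 volume ^ 2 := by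
          rw [Measure.volume_eq_prod, lintegral_prod _ hFm.aemeasurable]
          refine lintegral_congr fun τ => ?_
          rw [eLpNorm_two_sq]
          simp only [F]
          exact lintegral_const_mul' _ _ (by
            by_cases hτ : τ ∈ Icc (-R') R' <;> simp [hτ])
      _ ≤ ∫⁻ τ, (Icc (-R') R').indicator 1 τ * (∫⁻ s, eLpNorm (fun η => γ (s, η)) 2 volume) ^ 2 := by
          refine lintegral_mono fun τ => ?_
          gcongr
          exact eLpNorm_ftFst_le h.meas_partial τ
      _ = volume (Icc (-R') R') * (∫⁻ s, eLpNorm (fun η => γ (s, η)) 2 volume) ^ 2 := by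
          rw [lintegral_mul_const' _ _ (ENNReal.pow_ne_top h.fin.ne),
            lintegral_indicator_one measurableSet_Icc]
      _ < ⊤ := ENNReal.mul_lt_top (by simp) (ENNReal.pow_lt_top h.fin)
  by_contra hcon
  rw [not_lt, top_le_iff] at hcon
  rw [hcon] at hlt
  simp at hlt

lemma dens_eq_zero {z : ℝ × E2} (hz : z ∉ Φ.pt '' (Icc (-Δ) Δ ×ˢ D)) : dens Φ S γ z = 0 := by
  refine indicator_of_notMem (fun hzS => hz ?_) _
  obtain ⟨θ, ζ, hθ, hζ, e⟩ := h.exists_pt z hzS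
  exact ⟨(θ, ζ), ⟨abs_le.1 hθ, hζ⟩, e⟩

lemma stronglyMeasurable_chartDens : StronglyMeasurable (chartDens Φ D Δ S γ) := by
  refine StronglyMeasurable.indicator ?_ h.measurableSet_chart
  refine StronglyMeasurable.mul ?_
    (h.stronglyMeasurable_dens.comp_measurable Φ.continuous_pt.measurable)
  have := Φ.measurable_ratio
  exact Measurable.stronglyMeasurable (by fun_prop)

lemma norm_chartDens_sq_le (q : ℝ × E2) : ‖chartDens Φ D Δ S γ q‖ₑ ^ 2 ≤
    ENNReal.ofReal (9 / δ) * (Icc (-Δ) Δ ×ˢ D).indicator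
      (fun q => ENNReal.ofReal |Φ.jac q.2| * ‖dens Φ S γ (Φ.pt q)‖ₑ ^ 2) q := by
  have hδ := h.pos'
  by_cases hq : q ∈ (Icc (-Δ) Δ ×ˢ D : Set (ℝ × E2))
  · rw [chartDens, indicator_of_mem hq, indicator_of_mem hq, enorm_mul, mul_pow, ← mul_assoc,
      ← ENNReal.ofReal_mul (by positivity)]
    gcongr
    rw [← ofReal_norm, ← ENNReal.ofReal_pow (norm_nonneg _)]
    refine ENNReal.ofReal_le_ofReal ?_
    rw [Complex.norm_real, Real.norm_eq_abs, abs_mul, abs_abs]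
    have h1 := h.abs_jac_mul_ratio_le hq.2 (abs_le.2 hq.1)
    have h2 := h.le_jac hq.2
    have h3 : (|Φ.jac q.2| * |Φ.ratio q|) ^ 2 ≤ 3 ^ 2 := by gcongr
    have h4 : 1 ≤ |Φ.jac q.2| / δ := by rwa [one_le_div hδ]
    calc _ ≤ (9 : ℝ) * 1 := by linarith
      _ ≤ 9 * (|Φ.jac q.2| / δ) := by gcongr
      _ = _ := by ring
  · rw [chartDens, indicator_of_notMem hq]; simp

lemma memLp_chartDens : MemLp (chartDens Φ D Δ S γ) 2 volume := by
  refine ⟨h.stronglyMeasurable_chartDens.aestronglyMeasurable, ?_⟩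
  have hlt : eLpNorm (chartDens Φ D Δ S γ) 2 volume ^ 2 < ⊤ := by
    rw [eLpNorm_two_sq]
    refine (lintegral_mono h.norm_chartDens_sq_le).trans_lt ?_
    rw [lintegral_const_mul' _ _ ENNReal.ofReal_ne_top, lintegral_indicator h.measurableSet_chart,
      ← Φ.lintegral_image_pt h.measurableSet_chart h.injOn_Icc (fun z => ‖dens Φ S γ z‖ₑ ^ 2)]
    refine ENNReal.mul_lt_top ENNReal.ofReal_lt_top ?_
    refine (setLIntegral_le_lintegral _ _).trans_lt ?_
    rw [← eLpNorm_two_sq]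
    exact ENNReal.pow_lt_top h.memLp_dens.2
  by_contra hcon
  rw [not_lt, top_le_iff] at hcon
  rw [hcon] at hlt
  simp at hlt

lemma exists_isDensity : ∃ R, IsDensity R (dens Φ S γ) ∧ IsDensity R (chartDens Φ D Δ S γ) := by
  obtain ⟨R₁, hR₁⟩ := h.bdd_spec.subset_closedBall 0
  obtain ⟨R₂, hR₂⟩ := h.bdd.subset_closedBall 0
  refine ⟨max R₁ (max R₂ Δ), ⟨h.stronglyMeasurable_dens, h.memLp_dens, fun z hz => ?_,
    fun z hz => ?_⟩, ⟨h.stronglyMeasurable_chartDens, h.memLp_chartDens, fun z hz => ?_,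
    fun z hz => ?_⟩⟩
  · refine indicator_of_notMem (fun hzS => ?_) _
    have h1 := hR₁ hzS
    rw [mem_closedBall_zero_iff] at h1
    have h2 := (norm_fst_le z).trans h1
    exact absurd hz (not_lt.2 (h2.trans (le_max_left _ _)))
  · refine indicator_of_notMem (fun hzS => ?_) _
    have h1 := hR₁ hzS
    rw [mem_closedBall_zero_iff] at h1
    have h2 := (norm_snd_le z).trans h1
    exact absurd hz (not_lt.2 (h2.trans (le_max_left _ _)))
  · refine indicator_of_notMem (fun hq => ?_) _
    exact absurd hz (not_lt.2 ((abs_le.2 hq.1).trans ((le_max_right _ _).trans (le_max_right _ _))))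
  · refine indicator_of_notMem (fun hq => ?_) _
    have h1 := hR₂ hq.2
    rw [mem_closedBall_zero_iff] at h1
    exact absurd hz (not_lt.2 (h1.trans ((le_max_left _ _).trans (le_max_right _ _))))

/-- Integrals against the spectral density in the coordinates of the frame. -/
lemma integral_dens (K : ℝ × E2 → ℂ) : ∫ z, K z * dens Φ S γ z =
    ∫ q in Icc (-Δ) Δ ×ˢ D, ((|Φ.jac q.2| : ℝ) : ℂ) * (K (Φ.pt q) * dens Φ S γ (Φ.pt q)) := by
  rw [← Φ.integral_image_pt h.measurableSet_chart h.injOn_Icc (fun z => K z * dens Φ S γ z)]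
  rw [setIntegral_eq_integral_of_forall_compl_eq_zero fun z hz => by rw [h.dens_eq_zero hz, mul_zero]]

end SpectralData

/-- The difference quotient of the plane waves at a base frequency and at the frequency
at distance `q.1` in the evolution direction, both on the hyperboloid. -/
def remKernel (Φ : Frame) (w q : ℝ × E2) : ℂ :=
  (2 * Real.pi * Complex.I * q.1)⁻¹ * (ce (pr w (hyp q.2)) - ce (pr w (hyp (Φ.pt q).2)))

lemma abs_nb_sub_le (ζ ζ' : E2) : |nb ζ - nb ζ'| ≤ ‖ζ - ζ'‖ := by
  have h1 := nb_add_le ζ' (ζ - ζ')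
  have h2 := nb_add_le ζ (ζ' - ζ)
  rw [add_sub_cancel] at h1 h2
  rw [norm_sub_rev] at h2
  rw [abs_le]; constructor <;> linarith

lemma norm_inv_two_pi_mul (θ : ℝ) : ‖(2 * Real.pi * Complex.I * θ)⁻¹‖ = (2 * Real.pi * |θ|)⁻¹ := by
  simp [abs_of_pos Real.pi_pos]

lemma norm_remKernel_le (Φ : Frame) (w q : ℝ × E2) : ‖remKernel Φ w q‖ ≤ |w.1| + ‖w.2‖ := by
  by_cases h0 : q.1 = 0
  · rw [remKernel, h0]
    simp only [Complex.ofReal_zero, mul_zero, inv_zero, zero_mul, norm_zero]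
    positivity
  · have hq : 0 < |q.1| := abs_pos.2 h0
    have hpt : (Φ.pt q).2 = q.2 + q.1 • Φ.e0.2 := by simp [Frame.pt, hyp]
    have hn : ‖q.2 - (Φ.pt q).2‖ ≤ |q.1| := by
      rw [hpt, sub_add_cancel_left, norm_neg, norm_smul, Real.norm_eq_abs]
      nlinarith [Φ.norm_e0_snd_le]
    rw [remKernel, norm_mul, norm_inv_two_pi_mul, inv_mul_le_iff₀ (by positivity)]
    refine (norm_ce_sub_le _ _).trans ?_
    rw [← pr_sub_right, mul_assoc (2 * Real.pi)]
    refine mul_le_mul_of_nonneg_left ?_ (by positivity)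
    simp only [pr, hyp, Prod.fst_sub, Prod.snd_sub]
    refine (abs_add_le _ _).trans ?_
    rw [abs_mul]
    have h1 := (abs_nb_sub_le q.2 (Φ.pt q).2).trans hn
    have h2 := (abs_real_inner_le_norm w.2 (q.2 - (Φ.pt q).2)).trans
      (mul_le_mul_of_nonneg_left hn (norm_nonneg _))
    have h3 := mul_le_mul_of_nonneg_left h1 (abs_nonneg w.1)
    linarith

lemma measurable_remKernel (Φ : Frame) : Measurable fun p : (ℝ × E2) × (ℝ × E2) =>
    remKernel Φ p.1 p.2 := by
  unfold remKernel
  refine Measurable.mul (by fun_prop) (Measurable.sub ?_ ?_) <;>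
  exact Continuous.measurable (by fun_prop)

/-- The part of the Duhamel integral that depends on the evolution coordinate. -/
def firstPart (Φ : Frame) (W : ℝ × E2 → ℂ) (w : ℝ × E2) : ℂ :=
  ∫ q, ce (pr w (hyp q.2)) * ceInt (pr w Φ.e0) q.1 * W q

/-- The part of the Duhamel integral that is a free wave. -/
def remPart (Φ : Frame) (W : ℝ × E2 → ℂ) (w : ℝ × E2) : ℂ := ∫ q, remKernel Φ w q * W q

namespace SpectralData

variable {Φ : Frame} {D : Set E2} {Δ δ : ℝ} {S : Set (ℝ × E2)} {γ : ℝ × E2 → ℂ}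
  (h : SpectralData Φ D Δ δ S γ)

include h

/-- The splitting of the Duhamel integral. With `z = pt (θ, ζ)`, its primitive
`(e^{2πi w·z} - e^{2πi w·hyp z₂}) / (τ - ⟨ξ⟩)` has the factor `ratio / θ`, and the numerator is the
sum of the differences `e^{2πi w·z} - e^{2πi w·hyp ζ}`, which gives the primitive in the evolution
coordinate, and `e^{2πi w·hyp ζ} - e^{2πi w·hyp z₂}`, which involves only the hyperboloid. -/
lemma duhamel_eq (t : ℝ) (x : E2) : duhamel (dens Φ S γ) t x =
    -Complex.I * (firstPart Φ (chartDens Φ D Δ S γ) (t, x) +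
      remPart Φ (chartDens Φ D Δ S γ) (t, x)) := by
  obtain ⟨R, -, hW⟩ := h.exists_isDensity
  have hWi := hW.integrable
  have i1 : Integrable fun q : ℝ × E2 =>
      ce (pr (t, x) (hyp q.2)) * ceInt (pr (t, x) Φ.e0) q.1 * chartDens Φ D Δ S γ q :=
    hW.integrable_mul (C := |pr (t, x) Φ.e0|) (Continuous.stronglyMeasurable (by fun_prop))
      (fun z => by simpa using norm_ceInt_le _ _)
  have i2 : Integrable fun q : ℝ × E2 => remKernel Φ (t, x) q * chartDens Φ D Δ S γ q :=
    hW.integrable_mul ((measurable_remKernel Φ).comp measurable_prodMk_left).stronglyMeasurable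
      (norm_remKernel_le Φ (t, x))
  rw [firstPart, remPart, ← integral_add i1 i2, ← integral_const_mul]
  have e1 : duhamel (dens Φ S γ) t x = ∫ z : ℝ × E2, (ce (inner ℝ x z.2) * (-Complex.I *
      (ce (t * nb z.2) * ceInt t (z.1 - nb z.2)))) * dens Φ S γ z := by
    rw [duhamel]; simp only [mul_assoc]
  rw [e1, h.integral_dens, ← integral_indicator h.measurableSet_chart]
  have hne : ∀ᵐ q : ℝ × E2, q.1 ≠ 0 := by
    have : ∀ᵐ θ : ℝ, θ ≠ 0 := by simp [ae_iff]
    exact Measure.quasiMeasurePreserving_fst.ae this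
  refine integral_congr_ae ?_
  filter_upwards [hne] with q hq0
  by_cases hq : q ∈ (Icc (-Δ) Δ ×ˢ D : Set (ℝ × E2))
  · simp only [chartDens, indicator_of_mem hq]
    have hr := Φ.ratio_mul (q := q) (h.denom_ne_zero hq.2
      ((abs_le.2 hq.1).trans (by linarith [h.pos])))
    have hθ : (2 * Real.pi * Complex.I * q.1 : ℂ) ≠ 0 := by
      simp [hq0, Real.pi_ne_zero]
    -- both primitives are divided by `2πiθ`
    have c1 : (2 * Real.pi * Complex.I * q.1) * ceInt t ((Φ.pt q).1 - nb (Φ.pt q).2) =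
        Φ.ratio q * (ce (t * ((Φ.pt q).1 - nb (Φ.pt q).2)) - 1) := by
      rw [← two_pi_I_mul_ceInt]
      nth_rewrite 1 [← hr]
      push_cast; ring
    have c2 := two_pi_I_mul_ceInt (pr (t, x) Φ.e0) q.1
    have p1 : ce (inner ℝ x (Φ.pt q).2) * ce (t * nb (Φ.pt q).2) = ce (pr (t, x) (hyp (Φ.pt q).2)) := by
      rw [← ce_add]; congr 1; simp only [pr, hyp]; ring
    have p2 : ce (pr (t, x) (hyp (Φ.pt q).2)) * ce (t * ((Φ.pt q).1 - nb (Φ.pt q).2)) =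
        ce (pr (t, x) (hyp q.2)) * ce (pr (t, x) Φ.e0 * q.1) := by
      rw [← ce_add, ← ce_add]; congr 1
      have : pr (t, x) (Φ.pt q) = pr (t, x) (hyp q.2) + q.1 * pr (t, x) Φ.e0 := by
        rw [Frame.pt, pr_add_right, pr_smul_right]
      have e : pr (t, x) (hyp (Φ.pt q).2) + t * ((Φ.pt q).1 - nb (Φ.pt q).2) =
          pr (t, x) (Φ.pt q) := by simp only [pr, hyp]; ring
      rw [e, this]; ring
    have key : ce (inner ℝ x (Φ.pt q).2) * (ce (t * nb (Φ.pt q).2) *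
        ceInt t ((Φ.pt q).1 - nb (Φ.pt q).2)) =
        Φ.ratio q * (ce (pr (t, x) (hyp q.2)) * ceInt (pr (t, x) Φ.e0) q.1 +
          remKernel Φ (t, x) q) := by
      apply mul_left_cancel₀ hθ
      have c3 : (2 * Real.pi * Complex.I * q.1) * remKernel Φ (t, x) q =
          ce (pr (t, x) (hyp q.2)) - ce (pr (t, x) (hyp (Φ.pt q).2)) := by
        rw [remKernel, mul_inv_cancel_left₀ hθ]
      linear_combination (ce (inner ℝ x (Φ.pt q).2) * ce (t * nb (Φ.pt q).2)) * c1 +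
        (Φ.ratio q * (ce (t * ((Φ.pt q).1 - nb (Φ.pt q).2)) - 1)) * p1 + Φ.ratio q * p2 -
        Φ.ratio q * ce (pr (t, x) (hyp q.2)) * c2 - Φ.ratio q * c3
    push_cast
    linear_combination (-Complex.I * ((|Φ.jac q.2| : ℝ) : ℂ) * dens Φ S γ (Φ.pt q)) * key
  · simp [chartDens, indicator_of_notMem hq]

end SpectralData

/-! ### The family of free waves -/

/-- The Fourier transforms of the family of initial data, indexed by the values of the evolution
coordinate. -/
def vHat (W : ℝ × E2 → ℂ) (p : ℝ × E2) : ℂ := ∫ θ, ce (p.1 * θ) * W (θ, p.2)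

/-- The mass of the kernel from `IsTransversal.norm_kernel_le` does not depend on `Δ`. -/
lemma lintegral_scaled_poisson {Δ : ℝ} (hΔ : 0 < Δ) (c : ℝ) :
    ∫⁻ s, ENNReal.ofReal (Δ / (1 + (Δ * (s - c)) ^ 2)) = ENNReal.ofReal Real.pi := by
  have h0 : Integrable fun s : ℝ => (1 + (Δ * (s - c)) ^ 2)⁻¹ :=
    ((integrable_inv_one_add_sq.comp_mul_left' hΔ.ne').comp_sub_right c)
  have h1 : Integrable fun s : ℝ => Δ / (1 + (Δ * (s - c)) ^ 2) := by
    simpa only [div_eq_mul_inv] using h0.const_mul Δ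
  rw [← ofReal_integral_eq_lintegral_ofReal h1 (ae_of_all _ fun s => by positivity)]
  congr 1
  simp only [div_eq_mul_inv, integral_const_mul]
  rw [integral_sub_right_eq_self (fun s : ℝ => (1 + (Δ * s) ^ 2)⁻¹) c,
    Measure.integral_comp_mul_left (fun s : ℝ => (1 + s ^ 2)⁻¹) Δ, integral_univ_inv_one_add_sq,
    abs_of_pos (inv_pos.2 hΔ), smul_eq_mul, mul_inv_cancel_left₀ hΔ.ne']

lemma eLpNorm_two_eq_restrict {D : Set E2} (hD : MeasurableSet D) {v : E2 → ℂ}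
    (hz : ∀ ζ, ζ ∉ D → v ζ = 0) : eLpNorm v 2 volume = eLpNorm v 2 (volume.restrict D) := by
  rw [← eLpNorm_indicator_eq_eLpNorm_restrict hD]
  congr 1
  ext ζ
  by_cases hζ : ζ ∈ D
  · rw [indicator_of_mem hζ]
  · rw [indicator_of_notMem hζ, hz ζ hζ]

/-- Minkowski's inequality for a function that is dominated by a weighted superposition. -/
lemma eLpNorm_two_le_of_kernel {μ : Measure E2} [SFinite μ] {v : E2 → ℂ} {k : ℝ → ℝ≥0∞}
    (hk : Measurable k) {f : ℝ × E2 → ℂ} (hf : StronglyMeasurable f) {N : ℝ → ℝ≥0∞}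
    (hN : ∀ s, eLpNorm (fun ζ => f (s, ζ)) 2 μ ≤ N s)
    (hv : ∀ᵐ ζ ∂μ, ‖v ζ‖ₑ ≤ ∫⁻ s, k s * ‖f (s, ζ)‖ₑ) :
    eLpNorm v 2 μ ≤ ∫⁻ s, k s * N s := by
  have hF : Measurable (Function.uncurry fun (s : ℝ) (ζ : E2) => k s * ‖f (s, ζ)‖ₑ) :=
    (hk.comp measurable_fst).mul hf.measurable.enorm
  calc eLpNorm v 2 μ ≤ eLpNorm (fun ζ => ∫⁻ s, k s * ‖f (s, ζ)‖ₑ) 2 μ := by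
        refine eLpNorm_mono_enorm_ae ?_
        filter_upwards [hv] with ζ hζ
        simpa using hζ
    _ ≤ ∫⁻ s, eLpNorm (fun ζ => k s * ‖f (s, ζ)‖ₑ) 2 μ := eLpNorm_lintegral_le hF
    _ ≤ _ := by
        refine lintegral_mono fun s => ?_
        have e2 : eLpNorm (fun ζ => k s * ‖f (s, ζ)‖ₑ) 2 μ ≤
            k s * eLpNorm (fun ζ => f (s, ζ)) 2 μ := by
          refine eLpNorm_le_mul_eLpNorm_of_ae_le_mul'' 2 ?_ (ae_of_all _ fun ζ => by simp)
          exact (hf.comp_measurable measurable_prodMk_left).aestronglyMeasurable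
        exact e2.trans (by gcongr; exact hN s)

namespace SpectralData

variable {Φ : Frame} {D : Set E2} {Δ δ : ℝ} {S : Set (ℝ × E2)} {γ : ℝ × E2 → ℂ}
  (h : SpectralData Φ D Δ δ S γ)

include h

lemma stronglyMeasurable_vHat : StronglyMeasurable (vHat (chartDens Φ D Δ S γ)) :=
  StronglyMeasurable.integral_prod_right
    (f := fun (p : ℝ × E2) (θ : ℝ) => ce (p.1 * θ) * chartDens Φ D Δ S γ (θ, p.2))
    (StronglyMeasurable.mul (Continuous.stronglyMeasurable (by fun_prop))
      (h.stronglyMeasurable_chartDens.comp_measurable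
        (measurable_snd.prodMk measurable_fst.snd)))

omit h in
lemma vHat_eq_zero {s : ℝ} {ζ : E2} (hζ : ζ ∉ D) : vHat (chartDens Φ D Δ S γ) (s, ζ) = 0 := by
  have : ∀ θ, chartDens Φ D Δ S γ (θ, ζ) = 0 := fun θ => indicator_of_notMem (fun hq => hζ hq.2) _
  simp [vHat, this]

lemma memLp_vHat (s : ℝ) : MemLp (fun ζ => vHat (chartDens Φ D Δ S γ) (s, ζ)) 2 volume := by
  obtain ⟨R, -, hW⟩ := h.exists_isDensity
  exact memLp_fibre (C := 1) hW (K := fun z => ce (s * z.1))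
    (Continuous.stronglyMeasurable (by fun_prop)) (by simp)

lemma integrable_vHat (s : ℝ) : Integrable fun ζ => vHat (chartDens Φ D Δ S γ) (s, ζ) := by
  obtain ⟨R, -, hW⟩ := h.exists_isDensity
  exact integrable_fibre (C := 1) hW (K := fun z => ce (s * z.1))
    (Continuous.stronglyMeasurable (by fun_prop)) (by simp)

lemma continuous_vHat_toLp : Continuous fun s => (h.memLp_vHat s).toLp _ := by
  obtain ⟨R, -, hW⟩ := h.exists_isDensity
  have hR : 0 ≤ 2 * Real.pi * |R| := by positivity
  let c : ℝ≥0∞ := (ENNReal.ofReal (2 * R)) ^ (1 / 2 : ℝ) * eLpNorm (chartDens Φ D Δ S γ) 2 volume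
  have hc : c ≠ ⊤ := ENNReal.mul_ne_top
    (ENNReal.rpow_ne_top_of_nonneg (by norm_num) ENNReal.ofReal_ne_top) h.memLp_chartDens.2.ne
  have hb : ∀ s s', eLpNorm ((fun ζ => vHat (chartDens Φ D Δ S γ) (s, ζ)) -
      fun ζ => vHat (chartDens Φ D Δ S γ) (s', ζ)) 2 volume ≤
      ENNReal.ofReal (2 * Real.pi * |R| * |s - s'|) * c := by
    intro s s'
    let K : ℝ × E2 → ℂ := fun z => if |z.1| ≤ R then ce (s * z.1) - ce (s' * z.1) else 0
    have hKb : ∀ z, ‖K z‖ ≤ 2 * Real.pi * |R| * |s - s'| := by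
      intro z
      simp only [K]
      split_ifs with hz
      · refine (norm_ce_sub_le _ _).trans ?_
        rw [← sub_mul, abs_mul]
        calc 2 * Real.pi * (|s - s'| * |z.1|) ≤ 2 * Real.pi * (|s - s'| * |R|) := by
              refine mul_le_mul_of_nonneg_left (mul_le_mul_of_nonneg_left ?_ (abs_nonneg _))
                (by positivity)
              exact hz.trans (le_abs_self R)
          _ = _ := by ring
      · simp only [norm_zero]; positivity
    have e : ((fun ζ => vHat (chartDens Φ D Δ S γ) (s, ζ)) -
        fun ζ => vHat (chartDens Φ D Δ S γ) (s', ζ)) =ᵐ[volume]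
        fun ζ => ∫ θ, K (θ, ζ) * chartDens Φ D Δ S γ (θ, ζ) := by
      have hi : ∀ᵐ ζ : E2, Integrable fun θ => chartDens Φ D Δ S γ (θ, ζ) := by
        have := hW.integrable
        rw [Measure.volume_eq_prod] at this
        exact this.prod_left_ae
      filter_upwards [hi] with ζ hζ
      simp only [Pi.sub_apply, vHat]
      rw [← integral_sub]
      · refine integral_congr_ae (ae_of_all _ fun θ => ?_)
        simp only [K]
        split_ifs with hz
        · ring
        · rw [hW.fst (θ, ζ) (not_le.1 hz)]; ring
      · exact hζ.bdd_mul (c := 1) (Continuous.aestronglyMeasurable (by fun_prop))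
          (ae_of_all _ fun θ => by simp)
      · exact hζ.bdd_mul (c := 1) (Continuous.aestronglyMeasurable (by fun_prop))
          (ae_of_all _ fun θ => by simp)
    rw [eLpNorm_congr_ae e]
    refine (eLpNorm_fibre_le hW hKb).trans_eq ?_
    rw [mul_assoc]
  have hlip : LipschitzWith (2 * Real.pi * |R| * c.toReal).toNNReal
      fun s => (h.memLp_vHat s).toLp _ := by
    refine LipschitzWith.of_dist_le_mul fun s s' => ?_
    rw [dist_eq_norm, ← MemLp.toLp_sub, Lp.norm_toLp, Real.coe_toNNReal _ (by positivity),
      Real.dist_eq]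
    refine (ENNReal.toReal_mono (ENNReal.mul_ne_top ENNReal.ofReal_ne_top hc) (hb s s')).trans_eq ?_
    rw [ENNReal.toReal_mul, ENNReal.toReal_ofReal (by positivity)]
    ring
  exact hlip.continuous

/-- The first part is an integral of free waves over the values of the evolution coordinate between
`0` and its value at `w`. -/
lemma firstPart_eq (w : ℝ × E2) : firstPart Φ (chartDens Φ D Δ S γ) w =
    ∫ s in (0 : ℝ)..pr w Φ.e0, ∫ ζ, ce (pr w (hyp ζ)) * vHat (chartDens Φ D Δ S γ) (s, ζ) := by
  obtain ⟨R, -, hW⟩ := h.exists_isDensity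
  have e1 : ∀ s : ℝ, ∫ ζ, ce (pr w (hyp ζ)) * vHat (chartDens Φ D Δ S γ) (s, ζ) =
      ∫ q : ℝ × E2, ce (pr w (hyp q.2)) * (ce (s * q.1) * chartDens Φ D Δ S γ q) := by
    intro s
    have hi : Integrable fun q : ℝ × E2 =>
        ce (pr w (hyp q.2)) * (ce (s * q.1) * chartDens Φ D Δ S γ q) :=
      (hW.integrable.bdd_mul (c := 1) (Continuous.aestronglyMeasurable (by fun_prop))
        (ae_of_all _ fun θ => by simp)).bdd_mul (c := 1)
        (Continuous.aestronglyMeasurable (by fun_prop)) (ae_of_all _ fun θ => by simp)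
    rw [Measure.volume_eq_prod] at hi ⊢
    rw [integral_prod_symm _ hi]
    simp only [vHat, integral_const_mul]
  simp only [e1]
  rw [intervalIntegral_integral_swap]
  · refine integral_congr_ae (ae_of_all _ fun q => ?_)
    simp only [ceInt]
    rw [← intervalIntegral.integral_const_mul, ← intervalIntegral.integral_mul_const]
    refine intervalIntegral.integral_congr fun s _ => ?_
    ring
  · have hi : Integrable (fun p : ℝ × (ℝ × E2) => (1 : ℝ) • chartDens Φ D Δ S γ p.2)
        ((volume.restrict (uIoc 0 (pr w Φ.e0))).prod volume) := by
      have : IntegrableOn (fun _ : ℝ => (1 : ℝ)) (uIoc 0 (pr w Φ.e0)) :=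
        integrableOn_const (by simp [uIoc])
      exact this.smul_prod hW.integrable
    refine (hi.bdd_mul (c := 1) (f := fun p : ℝ × (ℝ × E2) =>
        ce (pr w (hyp p.2.2)) * ce (p.1 * p.2.1))
        (Continuous.aestronglyMeasurable (by fun_prop)) (ae_of_all _ fun q => by simp)).congr
        (ae_of_all _ fun q => ?_)
    simp only [Function.uncurry, one_smul]; ring

/-- Outside of the chart but within the range of the cutoff, the density vanishes. -/
lemma dens_pt_eq_zero {θ : ℝ} {ζ : E2} (hζ : ζ ∈ D) (h1 : Δ < |θ|) (h2 : |θ| ≤ 2 * Δ) :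
    dens Φ S γ (Φ.pt (θ, ζ)) = 0 := by
  refine h.dens_eq_zero ?_
  rintro ⟨⟨θ', ζ'⟩, ⟨hθ', _⟩, e⟩
  have := (h.eq_of_pt_eq hζ e.symm h2 (abs_le.2 hθ')).1
  rw [this] at h1
  exact absurd (abs_le.2 hθ') (not_le.2 h1)

lemma ae_integrable_partial : ∀ᵐ η : E2, Integrable fun s => γ (s, η) := by
  have h1 := eLpNorm_lintegral_le (μ := (volume : Measure ℝ)) (ν := (volume : Measure E2))
    (F := fun s η => ‖γ (s, η)‖ₑ) h.meas_partial.measurable.enorm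
  have h2 : ∀ s, eLpNorm (fun η => ‖γ (s, η)‖ₑ) 2 (volume : Measure E2) =
      eLpNorm (fun η => γ (s, η)) 2 volume :=
    fun s => eLpNorm_congr_enorm_ae (ae_of_all _ fun x => by simp)
  simp only [h2] at h1
  have hm : Measurable fun η : E2 => ∫⁻ s, ‖γ (s, η)‖ₑ :=
    Measurable.lintegral_prod_left' (f := fun p : ℝ × E2 => ‖γ p‖ₑ) h.meas_partial.measurable.enorm
  have h3 : ∫⁻ η : E2, (∫⁻ s, ‖γ (s, η)‖ₑ) ^ 2 < ⊤ := by
    have h4 := eLpNorm_two_sq (fun η : E2 => ∫⁻ s, ‖γ (s, η)‖ₑ) volume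
    simp only [enorm_eq_self] at h4
    rw [← h4]
    exact ENNReal.pow_lt_top (h1.trans_lt h.fin)
  filter_upwards [ae_lt_top (hm.pow_const 2) h3.ne] with η hη
  refine ⟨(h.meas_partial.comp_measurable measurable_prodMk_right).aestronglyMeasurable, ?_⟩
  rw [hasFiniteIntegral_iff_enorm]
  by_contra hcon
  rw [not_lt, top_le_iff] at hcon
  rw [hcon] at hη
  simp at hη

/-- The pointwise bound for the Fourier transforms of the data, by a convolution of the partial
Fourier transform `γ` over the point of the hyperboloid. The cutoff `ρ(θ/Δ)` can be inserted because
the density vanishes for `Δ < |θ| ≤ 2Δ`; it makes the amplitude of the kernel smooth. -/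
lemma enorm_vHat_le {ρ : ℝ → ℝ} (hρ : IsCutoff ρ) {K : ℝ}
    (hK : C2Bound ρ (deriv ρ) (deriv (deriv ρ)) K) : ∀ᵐ ζ : E2, ζ ∈ D → ∀ s,
    ‖vHat (chartDens Φ D Δ S γ) (s, ζ)‖ₑ ≤ ∫⁻ s', ENNReal.ofReal (400 * K) *
      ENNReal.ofReal (Δ / (1 + (Δ * (s - s')) ^ 2)) * ‖γ (s', (Φ.toEquiv.symm (hyp ζ)).2)‖ₑ := by
  have hΔ := h.pos
  have hK0 := hK.nonneg
  have a1 := h.ae_hyp h.ae_integrable_partial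
  have a2 : ∀ᵐ ζ : E2, ∀ᵐ θ : ℝ, ζ ∈ D →
      dens Φ S γ (Φ.pt (θ, ζ)) = ftFst γ (Φ.toEquiv.symm (Φ.pt (θ, ζ))) := by
    have := h.ae_pt h.ae_dens_eq
    rw [Measure.volume_eq_prod] at this
    have hsw : ∀ᵐ p : E2 × ℝ, p.1 ∈ D →
        dens Φ S γ (Φ.pt (p.2, p.1)) = ftFst γ (Φ.toEquiv.symm (Φ.pt (p.2, p.1))) :=
      (Measure.measurePreserving_swap (μ := (volume : Measure E2))
        (ν := (volume : Measure ℝ))).quasiMeasurePreserving.ae this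
    exact Measure.ae_ae_of_ae_prod hsw
  filter_upwards [a1, a2] with ζ hζ1 hζ2 hζ s
  have hint := hζ1 hζ
  let η := (Φ.toEquiv.symm (hyp ζ)).2
  let c := (Φ.toEquiv.symm (hyp ζ)).1
  have hpt : ∀ θ, Φ.toEquiv.symm (Φ.pt (θ, ζ)) = (c + θ, η) := by
    intro θ
    rw [Frame.pt, map_add, Frame.e0]
    simp only [map_smul, ContinuousLinearEquiv.symm_apply_apply]
    ext <;> simp [c, η]
  have hm2 : MeasurableSet (Ioc (-(2 * Δ)) (2 * Δ)) := measurableSet_Ioc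
  -- the smooth cutoff equals `1` on the support of `chartDens`; elsewhere the density vanishes
  have e1 : vHat (chartDens Φ D Δ S γ) (s, ζ) = ∫ θ in (-(2 * Δ))..(2 * Δ),
      ∫ s', (ce (s * θ) * ((|Φ.jac ζ| * (ρ (θ / Δ) * Φ.ratio (θ, ζ)) : ℝ) : ℂ)) *
        (ce (-(s' * (c + θ))) * γ (s', η)) := by
    rw [intervalIntegral.integral_of_le (by linarith), vHat, ← integral_indicator hm2]
    refine integral_congr_ae ?_
    -- the endpoint of the interval is negligible
    have hne : ∀ᵐ θ : ℝ, θ ≠ -(2 * Δ) := by simp [ae_iff]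
    filter_upwards [hζ2] with θ hθ
    have e2 : ∫ s', (ce (s * θ) * ((|Φ.jac ζ| * (ρ (θ / Δ) * Φ.ratio (θ, ζ)) : ℝ) : ℂ)) *
        (ce (-(s' * (c + θ))) * γ (s', η)) =
        (ce (s * θ) * ((|Φ.jac ζ| * (ρ (θ / Δ) * Φ.ratio (θ, ζ)) : ℝ) : ℂ)) *
          dens Φ S γ (Φ.pt (θ, ζ)) := by
      rw [integral_const_mul, hθ hζ, hpt, ftFst]
    by_cases hc : |θ| ≤ Δ
    · have hq : ((θ, ζ) : ℝ × E2) ∈ (Icc (-Δ) Δ ×ˢ D : Set (ℝ × E2)) := ⟨abs_le.1 hc, hζ⟩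
      have hI : θ ∈ Ioc (-(2 * Δ)) (2 * Δ) := by
        have := abs_le.1 hc
        constructor <;> linarith
      have hρ1 : ρ (θ / Δ) = 1 := hρ.eq_one _ (by
        rw [abs_div, abs_of_pos hΔ, div_le_one hΔ]; exact hc)
      rw [indicator_of_mem hI, e2, chartDens, indicator_of_mem hq, hρ1, one_mul, mul_assoc]
    · have hq : ((θ, ζ) : ℝ × E2) ∉ (Icc (-Δ) Δ ×ˢ D : Set (ℝ × E2)) := fun hq => hc (abs_le.2 hq.1)
      simp only [chartDens, indicator_of_notMem hq, mul_zero]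
      by_cases hI : θ ∈ Ioc (-(2 * Δ)) (2 * Δ)
      · rw [indicator_of_mem hI, e2, h.dens_pt_eq_zero hζ (not_le.1 hc) (abs_le.2 ⟨hI.1.le, hI.2⟩),
          mul_zero]
      · rw [indicator_of_notMem hI]
  -- the amplitude is continuous on the interval
  obtain ⟨f₁, f₂, hf⟩ := h.c2Bound_num hζ
  obtain ⟨g₁, g₂, hg⟩ := h.c2Bound_inv hζ
  have hbd : ∀ θ, |θ| ≤ 2 * Δ → |ρ (θ / Δ) * Φ.ratio (θ, ζ)| ≤ K * (3 * nb ζ * |Φ.nor ζ|⁻¹) := by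
    intro θ hθ
    have hσ : θ / Δ ∈ Icc (-2 : ℝ) 2 := by
      rw [mem_Icc, ← abs_le, abs_div, abs_of_pos hΔ, div_le_iff₀ hΔ]; exact hθ
    have e : Δ * (θ / Δ) = θ := mul_div_cancel₀ _ hΔ.ne'
    have b1 := hf.bound₀ _ hσ
    have b2 := hg.bound₀ _ hσ
    rw [e] at b1 b2
    have er : Φ.ratio (θ, ζ) = (nb ζ + θ * Φ.e0.1 + nb (ζ + θ • Φ.e0.2)) *
        (2 * Φ.nor ζ + Φ.mink * θ)⁻¹ := by rw [Frame.ratio, div_eq_mul_inv]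
    rw [er, abs_mul, abs_mul]
    have hP := nb_pos ζ
    gcongr
    exact hK.bound₀ _ hσ
  have hswap : ∫ θ in (-(2 * Δ))..(2 * Δ),
      ∫ s', (ce (s * θ) * ((|Φ.jac ζ| * (ρ (θ / Δ) * Φ.ratio (θ, ζ)) : ℝ) : ℂ)) *
        (ce (-(s' * (c + θ))) * γ (s', η)) = ∫ s', ∫ θ in (-(2 * Δ))..(2 * Δ),
        (ce (s * θ) * ((|Φ.jac ζ| * (ρ (θ / Δ) * Φ.ratio (θ, ζ)) : ℝ) : ℂ)) *
        (ce (-(s' * (c + θ))) * γ (s', η)) := by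
    rw [intervalIntegral_integral_swap]
    have hi : Integrable (fun p : ℝ × ℝ => (1 : ℝ) • γ (p.2, η))
        ((volume.restrict (uIoc (-(2 * Δ)) (2 * Δ))).prod volume) := by
      have : IntegrableOn (fun _ : ℝ => (1 : ℝ)) (uIoc (-(2 * Δ)) (2 * Δ)) :=
        integrableOn_const (by simp [uIoc])
      exact this.smul_prod hint
    refine (hi.bdd_mul (c := |Φ.jac ζ| * (K * (3 * nb ζ * |Φ.nor ζ|⁻¹))) (f := fun p : ℝ × ℝ =>
      (ce (s * p.1) * ((|Φ.jac ζ| * (ρ (p.1 / Δ) * Φ.ratio (p.1, ζ)) : ℝ) : ℂ)) *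
        ce (-(p.2 * (c + p.1)))) ?_ ?_).congr (ae_of_all _ fun p => ?_)
    · have := Φ.measurable_ratio
      have := hρ.smooth.continuous.measurable
      refine Measurable.aestronglyMeasurable ?_
      refine Measurable.mul (Measurable.mul (Continuous.measurable (by fun_prop)) ?_)
        (Continuous.measurable (by fun_prop))
      fun_prop
    · have : ∀ᵐ p : ℝ × ℝ ∂((volume.restrict (uIoc (-(2 * Δ)) (2 * Δ))).prod volume),
          p.1 ∈ uIoc (-(2 * Δ)) (2 * Δ) :=
        Measure.quasiMeasurePreserving_fst.ae (ae_restrict_mem measurableSet_uIoc)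
      filter_upwards [this] with p hp
      rw [uIoc_of_le (by linarith)] at hp
      rw [norm_mul, norm_mul, norm_ce, norm_ce, one_mul, mul_one, Complex.norm_real,
        Real.norm_eq_abs, abs_mul, abs_abs]
      gcongr
      exact hbd _ (abs_le.2 ⟨hp.1.le, hp.2⟩)
    · simp only [Function.uncurry, one_smul]; ring
  rw [e1, hswap]
  refine (enorm_integral_le_lintegral_enorm _).trans (lintegral_mono fun s' => ?_)
  have e3 : ∫ θ in (-(2 * Δ))..(2 * Δ),
        (ce (s * θ) * ((|Φ.jac ζ| * (ρ (θ / Δ) * Φ.ratio (θ, ζ)) : ℝ) : ℂ)) *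
        (ce (-(s' * (c + θ))) * γ (s', η)) =
      ((|Φ.jac ζ| : ℝ) : ℂ) * (∫ θ in (-(2 * Δ))..(2 * Δ),
        ce ((s - s') * θ) * (ρ (θ / Δ) * Φ.ratio (θ, ζ) : ℝ)) * (ce (-(s' * c)) * γ (s', η)) := by
    rw [← intervalIntegral.integral_const_mul, ← intervalIntegral.integral_mul_const]
    refine intervalIntegral.integral_congr fun θ _ => ?_
    have a : ce (s * θ) * ce (-(s' * (c + θ))) = ce ((s - s') * θ) * ce (-(s' * c)) := by
      rw [← ce_add, ← ce_add]; congr 1; ring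
    simp only [Complex.ofReal_mul]
    linear_combination (((|Φ.jac ζ| : ℝ) : ℂ) * (ρ (θ / Δ) * Φ.ratio (θ, ζ)) * γ (s', η)) * a
  dsimp only
  rw [e3, enorm_mul, enorm_mul _ (γ _), ← ofReal_norm (ce _), norm_ce, ENNReal.ofReal_one, one_mul]
  gcongr
  rw [← ofReal_norm, ← ENNReal.ofReal_mul (by positivity)]
  refine ENNReal.ofReal_le_ofReal ?_
  rw [norm_mul, Complex.norm_real, Real.norm_eq_abs, abs_abs]
  exact h.norm_kernel_le hρ hK hζ (s - s')

lemma eLpNorm_vHat_le {ρ : ℝ → ℝ} (hρ : IsCutoff ρ) {K : ℝ}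
    (hK : C2Bound ρ (deriv ρ) (deriv (deriv ρ)) K) (s : ℝ) :
    eLpNorm (fun ζ => vHat (chartDens Φ D Δ S γ) (s, ζ)) 2 volume ≤
      ∫⁻ s', (ENNReal.ofReal (400 * K) * ENNReal.ofReal (Δ / (1 + (Δ * (s - s')) ^ 2))) *
        (ENNReal.ofReal (Real.sqrt (2 / δ)) * eLpNorm (fun η => γ (s', η)) 2 volume) := by
  have hΨ : Measurable fun ζ : E2 => (Φ.toEquiv.symm (hyp ζ)).2 :=
    Continuous.measurable (by fun_prop)
  have hgm : StronglyMeasurable fun p : ℝ × E2 => γ (p.1, (Φ.toEquiv.symm (hyp p.2)).2) :=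
    h.meas_partial.comp_measurable (measurable_fst.prodMk (hΨ.comp measurable_snd))
  have hkm : Measurable fun s' => ENNReal.ofReal (400 * K) *
      ENNReal.ofReal (Δ / (1 + (Δ * (s - s')) ^ 2)) := by fun_prop
  have e1 := eLpNorm_two_eq_restrict h.meas
    (v := fun ζ => vHat (chartDens Φ D Δ S γ) (s, ζ)) fun ζ hζ => vHat_eq_zero hζ
  rw [e1]
  have hN : ∀ s', eLpNorm (fun ζ => γ (s', (Φ.toEquiv.symm (hyp ζ)).2)) 2 (volume.restrict D) ≤
      ENNReal.ofReal (Real.sqrt (2 / δ)) * eLpNorm (fun η => γ (s', η)) 2 volume := fun s' =>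
    h.eLpNorm_hyp_le (f := fun η => γ (s', η))
      (h.meas_partial.comp_measurable measurable_prodMk_left)
  refine eLpNorm_two_le_of_kernel hkm hgm hN ?_
  rw [ae_restrict_iff' h.meas]
  filter_upwards [h.enorm_vHat_le hρ hK] with ζ hζ hD
  exact hζ hD s

/-- The data of the family are integrable in `L²`; the constant does not depend on the length `Δ`. -/
lemma lintegral_eLpNorm_vHat_le {ρ : ℝ → ℝ} (hρ : IsCutoff ρ) {K : ℝ}
    (hK : C2Bound ρ (deriv ρ) (deriv (deriv ρ)) K) :
    ∫⁻ s, eLpNorm (fun ζ => vHat (chartDens Φ D Δ S γ) (s, ζ)) 2 volume ≤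
      ENNReal.ofReal (400 * K * Real.pi * Real.sqrt (2 / δ)) *
        ∫⁻ s, eLpNorm (fun η => γ (s, η)) 2 volume := by
  have hK0 := hK.nonneg
  have hN : Measurable fun s' => eLpNorm (fun η => γ (s', η)) 2 (volume : Measure E2) :=
    measurable_eLpNorm_two_slice h.meas_partial
  refine (lintegral_mono (h.eLpNorm_vHat_le hρ hK)).trans ?_
  obtain ⟨N, hN'⟩ : ∃ N : ℝ → ℝ≥0∞, ∀ s', eLpNorm (fun η => γ (s', η)) 2 (volume : Measure E2) =
    N s' := ⟨_, fun _ => rfl⟩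
  simp only [hN'] at hN ⊢
  rw [lintegral_lintegral_swap]
  · have e3 : ∀ s', ∫⁻ s, (ENNReal.ofReal (400 * K) *
        ENNReal.ofReal (Δ / (1 + (Δ * (s - s')) ^ 2))) * (ENNReal.ofReal (Real.sqrt (2 / δ)) *
        N s') = ENNReal.ofReal (400 * K * Real.pi * Real.sqrt (2 / δ)) * N s' := by
      intro s'
      rw [lintegral_mul_const _ (by fun_prop), lintegral_const_mul _ (by fun_prop),
        lintegral_scaled_poisson h.pos, ← mul_assoc, ← ENNReal.ofReal_mul (by positivity),
        ← ENNReal.ofReal_mul (by positivity)]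
    simp only [e3]
    rw [lintegral_const_mul _ hN]
  · refine Measurable.aemeasurable ?_
    have : Measurable fun p : ℝ × ℝ => N p.2 := hN.comp measurable_snd
    simp only [Function.uncurry_def]
    fun_prop

end SpectralData

/-! ### The remainder is a free wave -/

/-- The free wave with Fourier data `vHat W (s, ·)`. -/
def vWave (W : ℝ × E2 → ℂ) (s : ℝ) (w : ℝ × E2) : ℂ :=
  ∫ ζ, ce (pr w (hyp ζ)) * vHat W (s, ζ)

lemma vWave_eq_fourierInv (W : ℝ × E2 → ℂ) (s t : ℝ) (x : E2) :
    vWave W s (t, x) = 𝓕⁻ (fun ζ => ce (t * nb ζ) * vHat W (s, ζ)) x := by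
  rw [fourierInv_eq_ce, vWave]
  refine integral_congr_ae (ae_of_all _ fun ζ => ?_)
  have : pr (t, x) (hyp ζ) = inner ℝ ζ x + t * nb ζ := by
    simp only [pr, hyp, real_inner_comm]; ring
  simp only [this, ce_add, mul_assoc]

lemma contDiff_nb : ContDiff ℝ (⊤ : ℕ∞) nb := by
  have h : nb = fun ζ : E2 => Real.sqrt (((2 * Real.pi) ^ 2)⁻¹ + ‖ζ‖ ^ 2) := by
    ext ζ; rw [← nb_sq, Real.sqrt_sq (nb_pos ζ).le]
  rw [h]
  exact ContDiff.sqrt (contDiff_const.add (contDiff_norm_sq ℝ)) fun ζ => by positivity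

lemma contDiff_ce : ContDiff ℝ (⊤ : ℕ∞) ce := by
  unfold ce
  refine ContDiff.cexp (ContDiff.mul ?_ contDiff_const)
  exact Complex.ofRealCLM.contDiff.comp (contDiff_const.mul contDiff_id)

lemma integrable_norm_mul_schwartz (ψ : SchwartzMap E2 ℂ) (t : ℝ) :
    Integrable fun x : E2 => (|t| + ‖x‖) * ‖ψ x‖ := by
  have h1 : Integrable fun x : E2 => ‖x‖ ^ 1 * ‖ψ x‖ := ψ.integrable_pow_mul volume 1
  have := (ψ.integrable (μ := volume)).norm.const_mul |t| |>.add h1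
  refine this.congr (ae_of_all _ fun x => ?_)
  simp only [Pi.add_apply, pow_one]; ring

lemma measurable_remKernel_space (Φ : Frame) (t : ℝ) :
    Measurable fun p : E2 × (ℝ × E2) => remKernel Φ (t, p.1) p.2 := by
  have hp : Measurable fun p : E2 × (ℝ × E2) => ((t, p.1), p.2) :=
    (measurable_const.prodMk measurable_fst).prodMk measurable_snd
  have := (measurable_remKernel Φ).comp hp
  simpa only [Function.comp_def] using this

/-- The pairing of the remainder with a test function of compact Fourier support. -/
lemma integral_remPart_mul (Φ : Frame) {W : ℝ × E2 → ℂ} (hWm : StronglyMeasurable W)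
    (hWi : Integrable W) (t : ℝ) (ψ : SchwartzMap E2 ℂ) :
    ∫ x, remPart Φ W (t, x) * 𝓕 (ψ : E2 → ℂ) x =
      ∫ q : ℝ × E2, (2 * Real.pi * Complex.I * q.1)⁻¹ * (ce (t * nb q.2) * ψ q.2 -
        ce (t * nb (Φ.pt q).2) * ψ (Φ.pt q).2) * W q := by
  have hFm : Continuous (𝓕 (ψ : E2 → ℂ)) := by
    rw [← SchwartzMap.fourier_coe]; exact (𝓕 ψ).continuous
  have hkm := measurable_remKernel_space Φ t
  have hi : Integrable (fun p : E2 × (ℝ × E2) =>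
      remKernel Φ (t, p.1) p.2 * (𝓕 (ψ : E2 → ℂ) p.1 * W p.2)) (volume.prod volume) := by
    have h1 : Integrable fun x : E2 => (|t| + ‖x‖) * ‖𝓕 (ψ : E2 → ℂ) x‖ := by
      rw [← SchwartzMap.fourier_coe]; exact integrable_norm_mul_schwartz (𝓕 ψ) t
    have hm : Measurable fun p : E2 × (ℝ × E2) =>
        remKernel Φ (t, p.1) p.2 * (𝓕 (ψ : E2 → ℂ) p.1 * W p.2) :=
      hkm.mul ((hFm.measurable.comp measurable_fst).mul (hWm.measurable.comp measurable_snd))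
    refine (h1.mul_prod hWi.norm).mono hm.aestronglyMeasurable (ae_of_all _ fun p => ?_)
    rw [norm_mul, norm_mul, Real.norm_of_nonneg (by positivity), ← mul_assoc]
    gcongr
    exact norm_remKernel_le Φ (t, p.1) p.2
  have hinv : ∀ ζ : E2, ∫ x, ce (inner ℝ x ζ) * 𝓕 (ψ : E2 → ℂ) x = ψ ζ := by
    intro ζ
    have h2 : 𝓕⁻ (𝓕 ψ) ζ = ψ ζ := by rw [FourierTransform.fourierInv_fourier_eq]
    rw [SchwartzMap.fourierInv_coe, SchwartzMap.fourier_coe, fourierInv_eq_ce] at h2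
    exact h2
  have hci : ∀ ζ : E2, Integrable fun x => ce (inner ℝ x ζ) * 𝓕 (ψ : E2 → ℂ) x := by
    intro ζ
    have : Integrable (𝓕 (ψ : E2 → ℂ)) := by
      rw [← SchwartzMap.fourier_coe]; exact (𝓕 ψ).integrable
    exact this.bdd_mul (c := 1) (Continuous.aestronglyMeasurable (by fun_prop))
      (ae_of_all _ fun x => by simp)
  calc _ = ∫ x, ∫ q, remKernel Φ (t, x) q * (𝓕 (ψ : E2 → ℂ) x * W q) := by
        refine integral_congr_ae (ae_of_all _ fun x => ?_)
        simp only [remPart]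
        rw [← integral_mul_const]
        refine integral_congr_ae (ae_of_all _ fun z => ?_)
        simp only; ring
    _ = ∫ q, ∫ x, remKernel Φ (t, x) q * (𝓕 (ψ : E2 → ℂ) x * W q) := integral_integral_swap hi
    _ = _ := by
        refine integral_congr_ae (ae_of_all _ fun q => ?_)
        have e : ∀ x, remKernel Φ (t, x) q * (𝓕 (ψ : E2 → ℂ) x * W q) =
            (2 * Real.pi * Complex.I * q.1)⁻¹ * W q * (ce (t * nb q.2) *
              (ce (inner ℝ x q.2) * 𝓕 (ψ : E2 → ℂ) x)) -
            (2 * Real.pi * Complex.I * q.1)⁻¹ * W q * (ce (t * nb (Φ.pt q).2) *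
              (ce (inner ℝ x (Φ.pt q).2) * 𝓕 (ψ : E2 → ℂ) x)) := by
          intro x
          simp only [remKernel, pr, hyp, ce_add]; ring
        simp only [e]
        rw [integral_sub (((hci _).const_mul _).const_mul _) (((hci _).const_mul _).const_mul _)]
        simp only [integral_const_mul, hinv]
        ring

namespace SpectralData

variable {Φ : Frame} {D : Set E2} {Δ δ : ℝ} {S : Set (ℝ × E2)} {γ : ℝ × E2 → ℂ}
  (h : SpectralData Φ D Δ δ S γ)

include h

lemma stronglyMeasurable_vWave : StronglyMeasurable fun p : ℝ × (ℝ × E2) =>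
    vWave (chartDens Φ D Δ S γ) p.1 p.2 := by
  refine StronglyMeasurable.integral_prod_right (f := fun (p : ℝ × (ℝ × E2)) (ζ : E2) =>
    ce (pr p.2 (hyp ζ)) * vHat (chartDens Φ D Δ S γ) (p.1, ζ)) ?_
  refine StronglyMeasurable.mul (Continuous.stronglyMeasurable (by fun_prop)) ?_
  exact h.stronglyMeasurable_vHat.comp_measurable (measurable_fst.fst.prodMk measurable_snd)

lemma eLpNorm_vWave (s t : ℝ) : eLpNorm (fun x => vWave (chartDens Φ D Δ S γ) s (t, x)) 2 volume =
    eLpNorm (fun ζ => vHat (chartDens Φ D Δ S γ) (s, ζ)) 2 volume := by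
  have hm : AEStronglyMeasurable (fun ζ => ce (t * nb ζ) * vHat (chartDens Φ D Δ S γ) (s, ζ))
      volume := (Continuous.aestronglyMeasurable (by fun_prop)).mul (h.memLp_vHat s).1
  have h1 : Integrable fun ζ => ce (t * nb ζ) * vHat (chartDens Φ D Δ S γ) (s, ζ) :=
    (h.integrable_vHat s).mono hm (ae_of_all _ fun ζ => by simp)
  have h2 : MemLp (fun ζ => ce (t * nb ζ) * vHat (chartDens Φ D Δ S γ) (s, ζ)) 2 volume :=
    (h.memLp_vHat s).of_le hm (ae_of_all _ fun ζ => by simp)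
  have e : (fun x => vWave (chartDens Φ D Δ S γ) s (t, x)) =
      𝓕⁻ (fun ζ => ce (t * nb ζ) * vHat (chartDens Φ D Δ S γ) (s, ζ)) := by
    ext x; exact vWave_eq_fourierInv _ _ _ _
  rw [e, eLpNorm_fourierInv h1 h2]
  exact eLpNorm_congr_norm_ae (ae_of_all _ fun ζ => by simp)

lemma eLpNorm_firstPart_le (t : ℝ) :
    eLpNorm (fun x => firstPart Φ (chartDens Φ D Δ S γ) (t, x)) 2 volume ≤
      ∫⁻ s, eLpNorm (fun ζ => vHat (chartDens Φ D Δ S γ) (s, ζ)) 2 volume := by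
  have hm : Measurable (Function.uncurry fun (s : ℝ) (x : E2) =>
      ‖vWave (chartDens Φ D Δ S γ) s (t, x)‖ₑ) :=
    (h.stronglyMeasurable_vWave.measurable.comp
      (measurable_fst.prodMk (measurable_const.prodMk measurable_snd))).enorm
  calc _ ≤ eLpNorm (fun x => ∫⁻ s, ‖vWave (chartDens Φ D Δ S γ) s (t, x)‖ₑ) 2 volume := by
        refine eLpNorm_mono_enorm fun x => ?_
        rw [h.firstPart_eq, enorm_eq_self, intervalIntegral.intervalIntegral_eq_integral_uIoc]
        rw [← ofReal_norm, norm_smul]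
        have h1 : ‖(if (0 : ℝ) ≤ pr (t, x) Φ.e0 then (1 : ℝ) else -1)‖ = 1 := by
          split_ifs <;> simp
        rw [h1, one_mul, ofReal_norm]
        exact (enorm_integral_le_lintegral_enorm _).trans (setLIntegral_le_lintegral _ _)
    _ ≤ ∫⁻ s, eLpNorm (fun x => ‖vWave (chartDens Φ D Δ S γ) s (t, x)‖ₑ) 2 volume :=
        eLpNorm_lintegral_le hm
    _ = _ := by
        refine lintegral_congr fun s => ?_
        rw [← h.eLpNorm_vWave s t]
        exact eLpNorm_congr_enorm_ae (ae_of_all _ fun x => by simp)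

lemma stronglyMeasurable_firstPart (t : ℝ) :
    StronglyMeasurable fun x => firstPart Φ (chartDens Φ D Δ S γ) (t, x) :=
  StronglyMeasurable.integral_prod_right (f := fun (x : E2) (q : ℝ × E2) =>
    ce (pr (t, x) (hyp q.2)) * ceInt (pr (t, x) Φ.e0) q.1 * chartDens Φ D Δ S γ q)
    (StronglyMeasurable.mul (Continuous.stronglyMeasurable (by fun_prop))
      (h.stronglyMeasurable_chartDens.comp_measurable measurable_snd))

lemma memLp_firstPart (hfin : ∫⁻ s, eLpNorm (fun ζ => vHat (chartDens Φ D Δ S γ) (s, ζ)) 2 volume < ⊤)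
    (t : ℝ) : MemLp (fun x => firstPart Φ (chartDens Φ D Δ S γ) (t, x)) 2 volume :=
  ⟨(h.stronglyMeasurable_firstPart t).aestronglyMeasurable,
    (h.eLpNorm_firstPart_le t).trans_lt hfin⟩

lemma remPart_eq (t : ℝ) (x : E2) : remPart Φ (chartDens Φ D Δ S γ) (t, x) =
    Complex.I * duhamel (dens Φ S γ) t x - firstPart Φ (chartDens Φ D Δ S γ) (t, x) := by
  rw [h.duhamel_eq]
  linear_combination ((firstPart Φ (chartDens Φ D Δ S γ) (t, x) +
    remPart Φ (chartDens Φ D Δ S γ) (t, x))) * Complex.I_mul_I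

lemma memLp_duhamel (t : ℝ) : MemLp (duhamel (dens Φ S γ) t) 2 volume := by
  obtain ⟨R, hG, -⟩ := h.exists_isDensity
  have hkm : StronglyMeasurable
      fun z : ℝ × E2 => -Complex.I * (ce (t * nb z.2) * ceInt t (z.1 - nb z.2)) :=
    Continuous.stronglyMeasurable (by fun_prop)
  have hkb : ∀ z : ℝ × E2, ‖-Complex.I * (ce (t * nb z.2) * ceInt t (z.1 - nb z.2))‖ ≤ |t| :=
    fun z => by simpa using norm_ceInt_le _ _
  rw [duhamel_eq_fourierInv hG]
  exact memLp_fourierInv (integrable_fibre hG hkm hkb) (memLp_fibre hG hkm hkb)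

lemma memLp_remPart (hfin : ∫⁻ s, eLpNorm (fun ζ => vHat (chartDens Φ D Δ S γ) (s, ζ)) 2 volume < ⊤)
    (t : ℝ) : MemLp (fun x => remPart Φ (chartDens Φ D Δ S γ) (t, x)) 2 volume := by
  have := ((h.memLp_duhamel t).const_mul Complex.I).sub (h.memLp_firstPart hfin t)
  exact (memLp_congr_ae (ae_of_all _ fun x => h.remPart_eq t x)).2 this

/-- The remainder at time `t` is the free evolution of the remainder at time `0`, whose Fourier
transform is supported in `D`. -/
lemma remPart_freeWave (hfin : ∫⁻ s, eLpNorm (fun ζ => vHat (chartDens Φ D Δ S γ) (s, ζ)) 2 volume < ⊤) :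
    ∃ f : L2, (∀ᵐ ζ, ζ ∉ D → (𝓕 f : L2) ζ = 0) ∧
      ENNReal.ofReal ‖f‖ ≤ ∫⁻ s, eLpNorm (fun ζ => vHat (chartDens Φ D Δ S γ) (s, ζ)) 2 volume ∧
      ∀ t, (fun x => remPart Φ (chartDens Φ D Δ S γ) (t, x)) =ᵐ[volume] freeWave f t := by
  let r : ℝ → L2 := fun t => (h.memLp_remPart hfin t).toLp _
  have hr : ∀ t (ψ : SchwartzMap E2 ℂ), ∫ ζ, (𝓕 (r t) : L2) ζ * ψ ζ =
      ∫ q : ℝ × E2, (2 * Real.pi * Complex.I * q.1)⁻¹ * (ce (t * nb q.2) * ψ q.2 -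
        ce (t * nb (Φ.pt q).2) * ψ (Φ.pt q).2) * chartDens Φ D Δ S γ q := by
    intro t ψ
    obtain ⟨R, -, hW⟩ := h.exists_isDensity
    rw [← integral_L2_mul_fourier,
      ← integral_remPart_mul Φ h.stronglyMeasurable_chartDens hW.integrable t ψ]
    refine integral_congr_ae ?_
    filter_upwards [(h.memLp_remPart hfin t).coeFn_toLp] with x hx
    rw [hx]
  have hsupp : ∀ᵐ ζ, ζ ∉ D → (𝓕 (r 0) : L2) ζ = 0 := by
    have := (h.closed.isOpen_compl).ae_eq_zero_of_integral_contDiff_smul_eq_zero (μ := volume)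
      (f := ((𝓕 (r 0) : L2) : E2 → ℂ))
      (((Lp.memLp (𝓕 (r 0) : L2)).locallyIntegrable (by norm_num)).locallyIntegrableOn _)
      fun g hg hgc hgs => by
        have hg₁ : HasCompactSupport (Complex.ofRealCLM ∘ g) := hgc.comp_left rfl
        have hg₂ : ContDiff ℝ (⊤ : ℕ∞) (Complex.ofRealCLM ∘ g) := by fun_prop
        have e := hr 0 (hg₁.toSchwartzMap hg₂)
        have hz : ∀ ζ ∈ D, g ζ = 0 := fun ζ hζ =>
          image_eq_zero_of_notMem_tsupport fun hcon => hgs hcon hζ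
        calc ∫ x, g x • (𝓕 (r 0) : L2) x = ∫ x, (𝓕 (r 0) : L2) x * (hg₁.toSchwartzMap hg₂) x := by
              refine integral_congr_ae (ae_of_all _ fun x => ?_)
              simp only [Complex.real_smul]
              rw [mul_comm]; rfl
          _ = 0 := by
              rw [e]
              refine integral_eq_zero_of_ae (ae_of_all _ fun q => ?_)
              by_cases hq : q ∈ (Icc (-Δ) Δ ×ˢ D : Set (ℝ × E2))
              · by_cases hS : Φ.pt q ∈ S
                · have e1 : (hg₁.toSchwartzMap hg₂) q.2 = 0 := by
                    change ((g q.2 : ℝ) : ℂ) = 0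
                    rw [hz _ hq.2]; rfl
                  have e2 : (hg₁.toSchwartzMap hg₂) (Φ.pt q).2 = 0 := by
                    change ((g (Φ.pt q).2 : ℝ) : ℂ) = 0
                    rw [hz _ (h.snd_mem _ hS)]; rfl
                  simp only [e1, e2]; simp
                · simp only [chartDens, dens, indicator_of_mem hq, indicator_of_notMem hS]; simp
              · simp only [chartDens, indicator_of_notMem hq]; simp
    exact this
  have hevol : ∀ t, ((𝓕 (r t) : L2) : E2 → ℂ) =ᵐ[volume] fun ζ => ce (t * nb ζ) * (𝓕 (r 0) : L2) ζ := by
    intro t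
    have hl : MemLp (fun ζ => ce (t * nb ζ) * (𝓕 (r 0) : L2) ζ) 2 volume :=
      (Lp.memLp (𝓕 (r 0) : L2)).of_le ((Continuous.aestronglyMeasurable (by fun_prop)).mul
        (Lp.aestronglyMeasurable _)) (ae_of_all _ fun ζ => by simp)
    refine ae_eq_of_integral_contDiff_smul_eq
      ((Lp.memLp (𝓕 (r t) : L2)).locallyIntegrable (by norm_num))
      (hl.locallyIntegrable (by norm_num)) fun g hg hgc => ?_
    have hg₁ : HasCompactSupport (Complex.ofRealCLM ∘ g) := hgc.comp_left rfl
    have hg₂ : ContDiff ℝ (⊤ : ℕ∞) (Complex.ofRealCLM ∘ g) := by fun_prop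
    have hg₃ : HasCompactSupport fun ζ => ce (t * nb ζ) * (Complex.ofRealCLM ∘ g) ζ :=
      hg₁.mul_left
    have hg₄ : ContDiff ℝ (⊤ : ℕ∞) fun ζ => ce (t * nb ζ) * (Complex.ofRealCLM ∘ g) ζ :=
      (contDiff_ce.comp (contDiff_const.mul contDiff_nb)).mul hg₂
    have e1 := hr t (hg₁.toSchwartzMap hg₂)
    have e2 := hr 0 (hg₃.toSchwartzMap hg₄)
    have v1 : ∀ ζ, (hg₁.toSchwartzMap hg₂) ζ = ((g ζ : ℝ) : ℂ) := fun ζ => rfl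
    have v2 : ∀ ζ, (hg₃.toSchwartzMap hg₄) ζ = ce (t * nb ζ) * ((g ζ : ℝ) : ℂ) := fun ζ => rfl
    simp only [v1, v2, zero_mul, ce_zero, one_mul] at e1 e2
    rw [← e2] at e1
    calc ∫ x, g x • (𝓕 (r t) : L2) x = ∫ x, (𝓕 (r t) : L2) x * ((g x : ℝ) : ℂ) := by
          simp only [Complex.real_smul, mul_comm]
      _ = ∫ x, (𝓕 (r 0) : L2) x * (ce (t * nb x) * ((g x : ℝ) : ℂ)) := e1
      _ = _ := by
          refine integral_congr_ae (ae_of_all _ fun x => ?_)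
          simp only [Complex.real_smul]; ring
  refine ⟨r 0, hsupp, ?_, fun t => ?_⟩
  · have e : ENNReal.ofReal ‖r 0‖ = eLpNorm (fun x => firstPart Φ (chartDens Φ D Δ S γ) (0, x)) 2 volume := by
      rw [← eLpNorm_coe_L2, eLpNorm_congr_ae (h.memLp_remPart hfin 0).coeFn_toLp]
      refine eLpNorm_congr_norm_ae (ae_of_all _ fun x => ?_)
      simp only [h.remPart_eq]
      simp [duhamel]
    rw [e]
    exact h.eLpNorm_firstPart_le 0
  · have hD : Integrable ((𝓕 (r t) : L2) : E2 → ℂ) := by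
      have h1 : IntegrableOn ((𝓕 (r t) : L2) : E2 → ℂ) D :=
        h.integrableOn ((Lp.memLp (𝓕 (r t) : L2)).restrict D)
      have h2 : D.indicator ((𝓕 (r t) : L2) : E2 → ℂ) =ᵐ[volume] ((𝓕 (r t) : L2) : E2 → ℂ) := by
        filter_upwards [hsupp, hevol t] with ζ hζ1 hζ2
        by_cases hζ : ζ ∈ D
        · rw [indicator_of_mem hζ]
        · rw [indicator_of_notMem hζ, hζ2, hζ1 hζ, mul_zero]
      exact ((integrable_indicator_iff h.meas).2 h1).congr h2
    have e1 := fourierInv_toLp_ae_eq hD (Lp.memLp (𝓕 (r t) : L2))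
    rw [Lp.toLp_coeFn, FourierTransform.fourierInv_fourier_eq] at e1
    have e2 : ∀ x, 𝓕⁻ ((𝓕 (r t) : L2) : E2 → ℂ) x = freeWave (r 0) t x := by
      intro x
      rw [freeWave_eq, fourierInv_eq_ce]
      refine integral_congr_ae ?_
      filter_upwards [hevol t] with ζ hζ
      rw [hζ]
      have : pr (t, x) (hyp ζ) = inner ℝ ζ x + t * nb ζ := by
        simp only [pr, hyp, real_inner_comm]; ring
      simp only [this, ce_add, mul_assoc]
    have e3 := (h.memLp_remPart hfin t).coeFn_toLp
    filter_upwards [e1, e3] with x hx1 hx3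
    rw [← e2, ← hx1, ← hx3]

end SpectralData

/-! ### Superpositions of free waves -/

/-- The Fourier transform of `f` vanishes outside of the set `D`; the frequencies are those of
Mathlib's Fourier transform. -/
def FourierSupported (D : Set E2) (f : L2) : Prop := ∀ᵐ ζ, ζ ∉ D → (𝓕 f : L2) ζ = 0

/-- The Fourier transform of `L²` as a continuous linear map. -/
def fourierL2 : L2 →L[ℂ] L2 := (Lp.fourierTransformₗᵢ E2 ℂ).toContinuousLinearEquiv

lemma fourierL2_apply (f : L2) : fourierL2 f = 𝓕 f := rfl

namespace FourierSupported

variable {D : Set E2}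

lemma add {f g : L2} (hf : FourierSupported D f) (hg : FourierSupported D g) :
    FourierSupported D (f + g) := by
  have e : (𝓕 (f + g) : L2) = 𝓕 f + 𝓕 g := map_add fourierL2 f g
  rw [FourierSupported, e]
  filter_upwards [hf, hg, Lp.coeFn_add (𝓕 f : L2) (𝓕 g)] with ζ h1 h2 h3 hζ
  rw [h3, Pi.add_apply, h1 hζ, h2 hζ, add_zero]

lemma smul {f : L2} (hf : FourierSupported D f) (c : ℂ) : FourierSupported D (c • f) := by
  have e : (𝓕 (c • f) : L2) = c • 𝓕 f := map_smul fourierL2 c f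
  rw [FourierSupported, e]
  filter_upwards [hf, Lp.coeFn_smul c (𝓕 f : L2)] with ζ h1 h3 hζ
  rw [h3, Pi.smul_apply, h1 hζ, smul_zero]

/-- The functions supported off `D` pair to zero with all Fourier transforms in the family, hence also
with that of the integral; the test function is the conjugate of the latter off `D`. -/
lemma integral (hD : MeasurableSet D) {μ : Measure ℝ} {V : ℝ → L2} (hV : Integrable V μ)
    (hs : ∀ s, FourierSupported D (V s)) : FourierSupported D (∫ s, V s ∂μ) := by
  let F : L2 := 𝓕 (∫ s, V s ∂μ)
  have hconj : MemLp (Dᶜ.indicator fun ζ => (starRingEnd ℂ) (F ζ)) 2 volume := by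
    refine (MemLp.indicator hD.compl ?_)
    exact (Lp.memLp F).of_le (Complex.continuous_conj.comp_aestronglyMeasurable
      (Lp.aestronglyMeasurable F)) (ae_of_all _ fun ζ => by simp)
  let b : L2 := hconj.toLp _
  have h1 : pairL2 F b = ∫ s, pairL2 (fourierL2 (V s)) b ∂μ := by
    have := ((pairL2.flip b).comp fourierL2).integral_comp_comm hV
    simpa [fourierL2_apply, F] using this.symm
  have h2 : ∀ s, pairL2 (fourierL2 (V s)) b = 0 := by
    intro s
    rw [pairL2_apply]
    refine integral_eq_zero_of_ae ?_
    filter_upwards [hs s, hconj.coeFn_toLp] with ζ hζ hb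
    rw [hb, fourierL2_apply]
    by_cases hm : ζ ∈ D
    · simp [indicator_of_notMem (notMem_compl_iff.2 hm)]
    · simp [hζ hm]
  have h3 : pairL2 F b = ((∫ ζ, Dᶜ.indicator (fun ζ => ‖F ζ‖ ^ 2) ζ : ℝ) : ℂ) := by
    rw [pairL2_apply, ← integral_complex_ofReal]
    refine integral_congr_ae ?_
    filter_upwards [hconj.coeFn_toLp] with ζ hb
    rw [hb]
    by_cases hm : ζ ∈ D
    · simp [indicator_of_notMem (notMem_compl_iff.2 hm)]
    · have : ζ ∈ Dᶜ := hm
      simp only [indicator_of_mem this, Complex.mul_conj, Complex.normSq_eq_norm_sq]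
  have h4 : ∫ ζ, Dᶜ.indicator (fun ζ => ‖F ζ‖ ^ 2) ζ = 0 := by
    have : ((∫ ζ, Dᶜ.indicator (fun ζ => ‖F ζ‖ ^ 2) ζ : ℝ) : ℂ) = 0 := by
      rw [← h3, h1]; simp [h2]
    exact_mod_cast this
  rw [integral_eq_zero_iff_of_nonneg (fun ζ => indicator_nonneg (fun _ _ => by positivity) _)
    (((memLp_two_iff_integrable_sq_norm (Lp.aestronglyMeasurable F)).1
      (Lp.memLp F)).indicator hD.compl)] at h4
  filter_upwards [h4] with ζ hζ hm
  have : ζ ∈ Dᶜ := hm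
  rw [indicator_of_mem this] at hζ
  simpa using hζ

end FourierSupported

lemma memLp_planeWave {D : Set E2} (hD : MeasurableSet D) (hb : Bornology.IsBounded D)
    (w : ℝ × E2) : MemLp (D.indicator fun ζ => ce (pr w (hyp ζ))) 2 volume := by
  rw [memLp_indicator_iff_restrict hD]
  have : IsFiniteMeasure (volume.restrict D) :=
    ⟨by rw [Measure.restrict_apply_univ]; exact hb.measure_lt_top⟩
  exact MemLp.of_bound (Continuous.aestronglyMeasurable (by fun_prop)) 1
    (ae_of_all _ fun ζ => by simp)

/-- The value at the point `w` of the free wave with data `f`, for `f` with Fourier support in the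
bounded set `D`: a continuous functional of `f`. -/
def evalWave {D : Set E2} (hD : MeasurableSet D) (hb : Bornology.IsBounded D) (w : ℝ × E2) :
    L2 →L[ℂ] ℂ := (pairL2.flip ((memLp_planeWave hD hb w).toLp _)).comp fourierL2

section

variable {D : Set E2} (hD : MeasurableSet D) (hb : Bornology.IsBounded D)

lemma evalWave_apply {f : L2} (hf : FourierSupported D f) (t : ℝ) (x : E2) :
    evalWave hD hb (t, x) f = freeWave f t x := by
  rw [freeWave_eq]
  simp only [evalWave, ContinuousLinearMap.comp_apply, ContinuousLinearMap.flip_apply,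
    fourierL2_apply, pairL2_apply]
  refine integral_congr_ae ?_
  filter_upwards [hf, (memLp_planeWave hD hb (t, x)).coeFn_toLp] with ζ h1 h2
  rw [h2]
  by_cases hm : ζ ∈ D
  · rw [indicator_of_mem hm, mul_comm]
  · rw [h1 hm]; simp

include hD hb

lemma freeWave_add {f g : L2} (hf : FourierSupported D f) (hg : FourierSupported D g) (t : ℝ)
    (x : E2) : freeWave (f + g) t x = freeWave f t x + freeWave g t x := by
  rw [← evalWave_apply hD hb hf, ← evalWave_apply hD hb hg, ← evalWave_apply hD hb (hf.add hg),
    map_add]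

lemma freeWave_smul {f : L2} (hf : FourierSupported D f) (c : ℂ) (t : ℝ)
    (x : E2) : freeWave (c • f) t x = c * freeWave f t x := by
  rw [← evalWave_apply hD hb hf, ← evalWave_apply hD hb (hf.smul c), map_smul, smul_eq_mul]

lemma freeWave_integral {μ : Measure ℝ} {V : ℝ → L2} (hV : Integrable V μ)
    (hs : ∀ s, FourierSupported D (V s)) (t : ℝ) (x : E2) :
    freeWave (∫ s, V s ∂μ) t x = ∫ s, freeWave (V s) t x ∂μ := by
  rw [← evalWave_apply hD hb (FourierSupported.integral hD hV hs),
    ← ContinuousLinearMap.integral_comp_comm _ hV]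
  simp only [evalWave_apply hD hb (hs _)]

lemma integrable_freeWave {μ : Measure ℝ} {V : ℝ → L2} (hV : Integrable V μ)
    (hs : ∀ s, FourierSupported D (V s)) (t : ℝ) (x : E2) :
    Integrable (fun s => freeWave (V s) t x) μ := by
  have := (evalWave hD hb (t, x)).integrable_comp hV
  simpa only [evalWave_apply hD hb (hs _)] using this

end

lemma stronglyMeasurable_freeWave (f : L2) :
    StronglyMeasurable fun w : ℝ × E2 => freeWave f w.1 w.2 := by
  simp only [freeWave_eq]
  refine StronglyMeasurable.integral_prod_right (f := fun (w : ℝ × E2) (ζ : E2) =>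
    ce (pr (w.1, w.2) (hyp ζ)) * (𝓕 f : L2) ζ) ?_
  exact StronglyMeasurable.mul (Continuous.stronglyMeasurable (by fun_prop))
    ((Lp.stronglyMeasurable (𝓕 f : L2)).comp_measurable measurable_snd)

/-- An identity between measurable functions that holds at every time for almost every position
holds almost everywhere in space-time. -/
lemma ae_eq_spacetime {F G : ℝ × E2 → ℂ} (hF : AEStronglyMeasurable F volume)
    (hG : AEStronglyMeasurable G volume) (h : ∀ t, ∀ᵐ x : E2, F (t, x) = G (t, x)) :
    F =ᵐ[volume] G := by
  have h1 : ∀ᵐ t : ℝ, ∀ᵐ x : E2, F (t, x) = hF.mk F (t, x) :=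
    Measure.ae_ae_of_ae_prod hF.ae_eq_mk
  have h2 : ∀ᵐ t : ℝ, ∀ᵐ x : E2, G (t, x) = hG.mk G (t, x) :=
    Measure.ae_ae_of_ae_prod hG.ae_eq_mk
  have h3 : ∀ᵐ t : ℝ, ∀ᵐ x : E2, hF.mk F (t, x) = hG.mk G (t, x) := by
    filter_upwards [h1, h2] with t a b
    filter_upwards [a, b, h t] with x a b c
    rw [← a, ← b, c]
  have h4 : ∀ᵐ w : ℝ × E2, hF.mk F w = hG.mk G w :=
    (Measure.ae_prod_iff_ae_ae
      (measurableSet_eq_fun hF.measurable_mk hG.measurable_mk)).2 h3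
  filter_upwards [hF.ae_eq_mk, hG.ae_eq_mk, h4] with w a b c
  rw [a, b, c]

/-- The superposition of the free wave with data `v₀` and of the free waves with data `v s`, each
cut off to the half-space `y > s`. -/
def truncated (v₀ : L2) (v : ℝ → L2) (y : ℝ → E2 → ℝ) (t : ℝ) (x : E2) : ℂ :=
  freeWave v₀ t x + ∫ s : ℝ, indicator {s | s < y t x} (fun s => freeWave (v s) t x) s

/-- On a level set of the evolution coordinate, a truncated superposition is a free wave. -/
lemma slice_truncated_le {Φ : Frame} {D : Set E2} {Δ δ : ℝ} (h : IsTransversal Φ D Δ δ)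
    {v₀ : L2} {v : ℝ → L2} (h₀ : FourierSupported D v₀) (hv : ∀ s, FourierSupported D (v s))
    (hi : Integrable v) (a : ℝ) : Φ.slice (truncated v₀ v fun t x => pr (t, x) Φ.e0) a ≤
      ENNReal.ofReal (Real.sqrt (2 / δ)) * ENNReal.ofReal (‖v₀‖ + ∫ s, ‖v s‖) := by
  have hI := FourierSupported.integral h.meas (hi.integrableOn (s := Iio a)) hv
  have e : ∀ y : E2, truncated v₀ v (fun t x => pr (t, x) Φ.e0) (Φ.toEquiv (a, y)).1
      (Φ.toEquiv (a, y)).2 = freeWave (v₀ + ∫ s in Iio a, v s) (Φ.toEquiv (a, y)).1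
        (Φ.toEquiv (a, y)).2 := by
    intro y
    rw [freeWave_add h.meas h.bdd h₀ hI, freeWave_integral h.meas h.bdd hi.integrableOn hv,
      truncated, Prod.mk.eta]
    have : pr (Φ.toEquiv (a, y)) Φ.e0 = a := by
      rw [← Φ.symm_fst, ContinuousLinearEquiv.symm_apply_apply]
    rw [this]
    congr 1
    exact integral_indicator measurableSet_Iio
  simp only [Frame.slice, e]
  refine (h.slice_freeWave_le (h₀.add hI) a).trans ?_
  gcongr
  refine (norm_add_le _ _).trans ?_
  gcongr
  refine (norm_integral_le_integral_norm _).trans ?_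
  exact setIntegral_le_integral hi.norm (ae_of_all _ fun s => norm_nonneg _)

/-- The slices of functions that agree almost everywhere agree almost everywhere. -/
lemma Frame.slice_congr (Φ : Frame) {F G : ℝ → E2 → ℂ}
    (h : ∀ᵐ w : ℝ × E2, F w.1 w.2 = G w.1 w.2) : ∀ᵐ a, Φ.slice F a = Φ.slice G a := by
  have h1 : ∀ᵐ z : ℝ × E2, F (Φ.toEquiv z).1 (Φ.toEquiv z).2 =
      G (Φ.toEquiv z).1 (Φ.toEquiv z).2 := Φ.measurePreserving.quasiMeasurePreserving.ae h
  have h2 := Measure.ae_ae_of_ae_prod h1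
  filter_upwards [h2] with a ha
  exact eLpNorm_congr_ae ha

namespace SpectralData

variable {Φ : Frame} {D : Set E2} {Δ δ : ℝ} {S : Set (ℝ × E2)} {γ : ℝ × E2 → ℂ}
  (h : SpectralData Φ D Δ δ S γ)

/-- The function with Fourier transform `vHat (chartDens Φ D Δ S γ) (s, ·)`. -/
def vL2 (s : ℝ) : L2 := 𝓕⁻ ((h.memLp_vHat s).toLp _)

include h

lemma fourier_vL2 (s : ℝ) : ((𝓕 (h.vL2 s) : L2) : E2 → ℂ) =ᵐ[volume]
    fun ζ => vHat (chartDens Φ D Δ S γ) (s, ζ) := by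
  rw [vL2, FourierTransform.fourier_fourierInv_eq]
  exact (h.memLp_vHat s).coeFn_toLp

lemma fourierSupported_vL2 (s : ℝ) : FourierSupported D (h.vL2 s) := by
  filter_upwards [h.fourier_vL2 s] with ζ h1 hζ
  rw [h1, SpectralData.vHat_eq_zero hζ]

lemma norm_vL2 (s : ℝ) : ENNReal.ofReal ‖h.vL2 s‖ =
    eLpNorm (fun ζ => vHat (chartDens Φ D Δ S γ) (s, ζ)) 2 volume := by
  rw [← Lp.norm_fourier_eq, ← eLpNorm_coe_L2, eLpNorm_congr_ae (h.fourier_vL2 s)]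

lemma freeWave_vL2 (s t : ℝ) (x : E2) :
    freeWave (h.vL2 s) t x = vWave (chartDens Φ D Δ S γ) s (t, x) := by
  rw [freeWave_eq, vWave]
  refine integral_congr_ae ?_
  filter_upwards [h.fourier_vL2 s] with ζ h1
  rw [h1]

lemma continuous_vL2 : Continuous h.vL2 :=
  (Lp.fourierTransformₗᵢ E2 ℂ).symm.continuous.comp h.continuous_vHat_toLp

lemma integrable_vL2
    (hfin : ∫⁻ s, eLpNorm (fun ζ => vHat (chartDens Φ D Δ S γ) (s, ζ)) 2 volume < ⊤) :
    Integrable h.vL2 := by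
  refine ⟨h.continuous_vL2.aestronglyMeasurable, ?_⟩
  rw [hasFiniteIntegral_iff_norm]
  simpa only [h.norm_vL2] using hfin

lemma ofReal_integral_norm_vL2
    (hfin : ∫⁻ s, eLpNorm (fun ζ => vHat (chartDens Φ D Δ S γ) (s, ζ)) 2 volume < ⊤) :
    ENNReal.ofReal (∫ s, ‖h.vL2 s‖) =
      ∫⁻ s, eLpNorm (fun ζ => vHat (chartDens Φ D Δ S γ) (s, ζ)) 2 volume := by
  rw [ofReal_integral_norm_eq_lintegral_enorm (h.integrable_vL2 hfin)]
  refine lintegral_congr fun s => ?_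
  rw [← ofReal_norm, h.norm_vL2]

lemma stronglyMeasurable_remPart : StronglyMeasurable (remPart Φ (chartDens Φ D Δ S γ)) := by
  refine StronglyMeasurable.integral_prod_right (f := fun (w q : ℝ × E2) =>
    remKernel Φ w q * chartDens Φ D Δ S γ q) ?_
  exact (measurable_remKernel Φ).stronglyMeasurable.mul
    (h.stronglyMeasurable_chartDens.comp_measurable measurable_snd)

lemma stronglyMeasurable_duhamel :
    StronglyMeasurable fun w : ℝ × E2 => duhamel (dens Φ S γ) w.1 w.2 := by
  refine StronglyMeasurable.integral_prod_right (f := fun (w z : ℝ × E2) =>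
    ce (inner ℝ w.2 z.2) * (-Complex.I * (ce (w.1 * nb z.2) * ceInt w.1 (z.1 - nb z.2)) *
      dens Φ S γ z)) ?_
  refine StronglyMeasurable.mul (Continuous.stronglyMeasurable (by fun_prop)) ?_
  exact StronglyMeasurable.mul (Continuous.stronglyMeasurable (by fun_prop))
    (h.stronglyMeasurable_dens.comp_measurable measurable_snd)

/-- The Duhamel integral is a superposition of free waves truncated to half-spaces. -/
lemma exists_superposition
    (hfin : ∫⁻ s, eLpNorm (fun ζ => vHat (chartDens Φ D Δ S γ) (s, ζ)) 2 volume < ⊤) :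
    ∃ (v₀ : L2) (v : ℝ → L2), FourierSupported D v₀ ∧ (∀ s, FourierSupported D (v s)) ∧
      Integrable v ∧
      (∀ t, ∀ᵐ x : E2, duhamel (dens Φ S γ) t x = truncated v₀ v (fun t x => pr (t, x) Φ.e0) t x) ∧
      (∀ᵐ w : ℝ × E2, duhamel (dens Φ S γ) w.1 w.2 =
        truncated v₀ v (fun t x => pr (t, x) Φ.e0) w.1 w.2) ∧
      ENNReal.ofReal (‖v₀‖ + ∫ s, ‖v s‖) ≤
        3 * ∫⁻ s, eLpNorm (fun ζ => vHat (chartDens Φ D Δ S γ) (s, ζ)) 2 volume := by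
  obtain ⟨f, hf, hfn, hfw⟩ := h.remPart_freeWave hfin
  have hfs : FourierSupported D f := hf
  have hV := h.integrable_vL2 hfin
  let v : ℝ → L2 := fun s => (-Complex.I) • h.vL2 s
  have hvi : Integrable v := hV.smul (-Complex.I)
  have hvs : ∀ s, FourierSupported D (v s) := fun s => (h.fourierSupported_vL2 s).smul _
  have hneg : FourierSupported D (∫ s in Iio (0 : ℝ), v s) :=
    FourierSupported.integral h.meas hvi.integrableOn hvs
  have hvn : ∀ s, ‖v s‖ = ‖h.vL2 s‖ := fun s => by simp [v, norm_smul]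
  have key : ∀ t x, remPart Φ (chartDens Φ D Δ S γ) (t, x) = freeWave f t x →
      duhamel (dens Φ S γ) t x = truncated ((-Complex.I) • f + (-1 : ℂ) • ∫ s in Iio (0 : ℝ), v s)
        v (fun t x => pr (t, x) Φ.e0) t x := by
    intro t x hx
    rw [h.duhamel_eq, hx, truncated, freeWave_add h.meas h.bdd (hfs.smul _) (hneg.smul _),
      freeWave_smul h.meas h.bdd hfs, freeWave_smul h.meas h.bdd hneg,
      freeWave_integral h.meas h.bdd hvi.integrableOn hvs]
    set y := pr (t, x) Φ.e0
    have hi : Integrable fun s => freeWave (v s) t x :=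
      integrable_freeWave h.meas h.bdd hvi hvs t x
    -- the integral over `(0, y)`, of either orientation, is a difference of integrals over half-lines
    have e1 : ∫ s : ℝ, indicator {s | s < y} (fun s => freeWave (v s) t x) s =
        ∫ s in Iio y, freeWave (v s) t x := integral_indicator measurableSet_Iio
    have e2 : firstPart Φ (chartDens Φ D Δ S γ) (t, x) =
        ∫ s in (0 : ℝ)..y, freeWave (h.vL2 s) t x := by
      rw [h.firstPart_eq]
      refine intervalIntegral.integral_congr fun s _ => ?_
      rw [h.freeWave_vL2, vWave]
    have e3 : ∫ s in (0 : ℝ)..y, freeWave (v s) t x =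
        (-Complex.I) * ∫ s in (0 : ℝ)..y, freeWave (h.vL2 s) t x := by
      rw [← intervalIntegral.integral_const_mul]
      refine intervalIntegral.integral_congr fun s _ => ?_
      exact freeWave_smul h.meas h.bdd (h.fourierSupported_vL2 s) _ t x
    have e4 : (∫ s in Iio y, freeWave (v s) t x) - ∫ s in Iio 0, freeWave (v s) t x =
        ∫ s in (0 : ℝ)..y, freeWave (v s) t x := by
      rw [← setIntegral_congr_set Iio_ae_eq_Iic.symm, ← setIntegral_congr_set Iio_ae_eq_Iic.symm]
      exact intervalIntegral.integral_Iic_sub_Iic hi.integrableOn hi.integrableOn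
    rw [e1, e2]
    linear_combination -e3 - e4
  refine ⟨(-Complex.I) • f + (-1 : ℂ) • ∫ s in Iio (0 : ℝ), v s, v, (hfs.smul _).add (hneg.smul _), hvs, hvi,
    fun t => ?_, ?_, ?_⟩
  · filter_upwards [hfw t] with x hx
    exact key t x hx
  · filter_upwards [ae_eq_spacetime h.stronglyMeasurable_remPart.aestronglyMeasurable
      (stronglyMeasurable_freeWave f).aestronglyMeasurable hfw] with w hw
    exact key w.1 w.2 hw
  · have hnn : 0 ≤ ∫ s, ‖h.vL2 s‖ := integral_nonneg fun s => norm_nonneg _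
    have h1 : ‖∫ s in Iio (0 : ℝ), v s‖ ≤ ∫ s, ‖h.vL2 s‖ := by
      refine (norm_integral_le_integral_norm _).trans ?_
      simp only [hvn]
      exact setIntegral_le_integral hV.norm (ae_of_all _ fun s => norm_nonneg _)
    have h2 : ‖(-Complex.I) • f + (-1 : ℂ) • ∫ s in Iio (0 : ℝ), v s‖ ≤ ‖f‖ + ∫ s, ‖h.vL2 s‖ := by
      refine (norm_add_le _ _).trans ?_
      rw [norm_smul, norm_smul]
      simpa using h1
    simp only [hvn]
    calc _ ≤ ENNReal.ofReal (‖f‖ + ((∫ s, ‖h.vL2 s‖) + ∫ s, ‖h.vL2 s‖)) :=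
          ENNReal.ofReal_le_ofReal (by linarith)
      _ = ENNReal.ofReal ‖f‖ + (ENNReal.ofReal (∫ s, ‖h.vL2 s‖) +
            ENNReal.ofReal (∫ s, ‖h.vL2 s‖)) := by
          rw [ENNReal.ofReal_add (norm_nonneg _) (by positivity), ENNReal.ofReal_add hnn hnn]
      _ ≤ _ := by
          rw [h.ofReal_integral_norm_vL2 hfin]
          refine (add_le_add_left hfn _).trans_eq ?_
          ring

end SpectralData

/-! ### Estimates in a transversal frame -/

/-- The free wave estimate, the solvability and estimate of the inhomogeneous equation, and the
representation by truncated free waves, with respect to the evolution coordinate of a frame, for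
sources with spectrum in `B` that is close to the hyperboloid over the transversal set `D`. The
weight `β` is the square root of the transversality up to the constant `C₁`. -/
theorem transversal_estimates {ρ : ℝ → ℝ} (hρ : IsCutoff ρ) {C₁ : ℝ} (hC₁ : 0 < C₁) :
    ∃ C : ℝ, 0 < C ∧ ∀ (Φ : Frame) (D : Set E2) (Δ β : ℝ) (B : Set (ℝ × E2)), 0 < β →
      IsTransversal Φ D Δ ((β / C₁) ^ 2) → IsClosed D → IsClosed B → Bornology.IsBounded B →
      (∀ z : ℝ × E2, (2 * Real.pi) • z ∈ B → z.2 ∈ D ∧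
        ∃ θ ζ, |θ| ≤ Δ ∧ ζ ∈ D ∧ Φ.pt (θ, ζ) = z) →
      (∀ f : L2, FourierSupported D f →
        ENNReal.ofReal β * essSup (Φ.slice (freeWave f)) volume ≤ ENNReal.ofReal (C * ‖f‖)) ∧
      ∀ g : ℝ → E2 → ℂ, AEStronglyMeasurable (fun p : ℝ × E2 => g p.1 p.2) volume →
        ∫⁻ a, Φ.slice g a < ⊤ → FourierSuppIn g B →
        (∃ u, IsSolution g u) ∧ ∀ u, IsSolution g u →
          ENNReal.ofReal β * essSup (Φ.slice u) volume ≤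
            ENNReal.ofReal (C * β⁻¹) * ∫⁻ a, Φ.slice g a ∧
          ∃ (v₀ : L2) (v : ℝ → L2), FourierSupported D v₀ ∧ (∀ s, FourierSupported D (v s)) ∧
            Integrable v ∧
            (∀ t, ∀ᵐ x : E2, u t x = truncated v₀ v (fun t x => pr (t, x) Φ.e0) t x) ∧
            ENNReal.ofReal (‖v₀‖ + ∫ s, ‖v s‖) ≤
              ENNReal.ofReal (C * β⁻¹) * ∫⁻ a, Φ.slice g a := by
  obtain ⟨K, hK1, hK⟩ := hρ.exists_c2Bound
  have hK0 : 0 < K := by linarith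
  have hpi := Real.pi_pos
  set A := Real.sqrt 2 * C₁ with hA
  have hA0 : 0 < A := by positivity
  set M := 1200 * K * Real.pi * A with hM
  have hM0 : 0 < M := by positivity
  refine ⟨A + M + A * M, by positivity, fun Φ D Δ β B hβ hT hDc hBc hBb hB => ?_⟩
  have hsq : Real.sqrt (2 / (β / C₁) ^ 2) = A * β⁻¹ := by
    rw [Real.sqrt_div (by norm_num), Real.sqrt_sq (by positivity), hA]
    field_simp
  have hcancel : ∀ c : ℝ, 0 ≤ c → ENNReal.ofReal β * ENNReal.ofReal (c * β⁻¹) = ENNReal.ofReal c := by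
    intro c hc
    rw [← ENNReal.ofReal_mul hβ.le]
    congr 1; field_simp
  refine ⟨fun f hf => ?_, fun g hg hfin hsupp => ?_⟩
  · calc _ ≤ ENNReal.ofReal β * (ENNReal.ofReal (A * β⁻¹) * ENNReal.ofReal ‖f‖) := by
          gcongr
          rw [← hsq]
          exact essSup_le_of_ae_le _ (ae_of_all _ fun a => hT.slice_freeWave_le hf a)
      _ = ENNReal.ofReal (A * ‖f‖) := by
          rw [← mul_assoc, hcancel A hA0.le, ENNReal.ofReal_mul hA0.le]
      _ ≤ _ := by
          refine ENNReal.ofReal_le_ofReal (mul_le_mul_of_nonneg_right ?_ (norm_nonneg _))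
          nlinarith [mul_pos hA0 hM0]
  · obtain ⟨γ, hγm, hγ, hnull, hrep⟩ := exists_spectral Φ hBc hBb hg hfin hsupp
    have hγN : ∫⁻ s, eLpNorm (fun η => γ (s, η)) 2 volume = ∫⁻ a, Φ.slice g a :=
      lintegral_congr_ae hγ
    set S : Set (ℝ × E2) := {z | (2 * Real.pi) • z ∈ B} with hS
    have hSb : Bornology.IsBounded S := by
      have h1 : S ⊆ (fun z : ℝ × E2 => (2 * Real.pi)⁻¹ • z) '' B := fun z hz =>
        ⟨_, hz, by simp only; rw [smul_smul, inv_mul_cancel₀ (by positivity), one_smul]⟩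
      exact (hBb.smul₀ (2 * Real.pi)⁻¹).subset h1
    have h : SpectralData Φ D Δ ((β / C₁) ^ 2) S γ :=
      { toIsTransversal := hT
        closed := hDc
        closed_spec := hBc.preimage (continuous_const_smul _)
        bdd_spec := hSb
        snd_mem := fun z hz => (hB z hz).1
        exists_pt := fun z hz => (hB z hz).2
        meas_partial := hγm
        fin := by rw [hγN]; exact hfin
        null := hnull }
    have hV := h.lintegral_eLpNorm_vHat_le hρ hK
    rw [hγN, hsq] at hV
    have hVfin : ∫⁻ s, eLpNorm (fun ζ => vHat (chartDens Φ D Δ S γ) (s, ζ)) 2 volume < ⊤ :=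
      hV.trans_lt (ENNReal.mul_lt_top ENNReal.ofReal_lt_top hfin)
    obtain ⟨R, hG, -⟩ := h.exists_isDensity
    have hsol : IsSolution g (duhamel (dens Φ S γ)) := by
      refine isSolution_duhamel hG ?_
      filter_upwards [hrep] with w hw
      rw [hw, ← integral_indicator h.closed_spec.measurableSet]
      refine integral_congr_ae (ae_of_all _ fun z => ?_)
      simp only [dens]
      by_cases hz : z ∈ S
      · rw [indicator_of_mem hz, indicator_of_mem hz]
      · rw [indicator_of_notMem hz, indicator_of_notMem hz, mul_zero]
    obtain ⟨v₀, v, hv₀, hvs, hvi, hform, hform', hbound⟩ := h.exists_superposition hVfin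
    have hbd : ENNReal.ofReal (‖v₀‖ + ∫ s, ‖v s‖) ≤
        ENNReal.ofReal (M * β⁻¹) * ∫⁻ a, Φ.slice g a := by
      refine hbound.trans ((mul_le_mul_right hV 3).trans_eq ?_)
      have h3 : (3 : ℝ≥0∞) = ENNReal.ofReal 3 := by simp
      rw [h3, ← mul_assoc, ← ENNReal.ofReal_mul (by norm_num), hM]
      congr 2; ring
    refine ⟨⟨_, hsol⟩, fun u hu => ⟨?_, v₀, v, hv₀, hvs, hvi, fun t => ?_, ?_⟩⟩
    · have hae : ∀ᵐ w : ℝ × E2, u w.1 w.2 =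
          truncated v₀ v (fun t x => pr (t, x) Φ.e0) w.1 w.2 := by
        have h1 : ∀ᵐ w : ℝ × E2, u w.1 w.2 = duhamel (dens Φ S γ) w.1 w.2 :=
          ae_eq_spacetime hu.meas h.stronglyMeasurable_duhamel.aestronglyMeasurable
            fun t => hu.ae_eq hsol t
        filter_upwards [h1, hform'] with w a b
        rw [a, b]
      calc _ ≤ ENNReal.ofReal β * (ENNReal.ofReal (A * β⁻¹) *
              (ENNReal.ofReal (M * β⁻¹) * ∫⁻ a, Φ.slice g a)) := by
            gcongr
            refine essSup_le_of_ae_le _ ?_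
            filter_upwards [Φ.slice_congr hae] with a ha
            rw [ha]
            refine (slice_truncated_le hT hv₀ hvs hvi a).trans ?_
            rw [hsq]
            gcongr
        _ = ENNReal.ofReal (A * M * β⁻¹) * ∫⁻ a, Φ.slice g a := by
            rw [← mul_assoc, ← mul_assoc, hcancel A hA0.le, ← ENNReal.ofReal_mul hA0.le, ← mul_assoc A M]
        _ ≤ _ := by
            gcongr
            nlinarith
    · filter_upwards [hu.ae_eq hsol t, hform t] with x a b
      rw [a, b]
    · refine hbd.trans ?_
      gcongr
      nlinarith [mul_pos hA0 hM0]

/-! ### The frames of the characteristic and of the lateral coordinate -/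

/-- The frame given by a linear endomorphism that preserves the scalar product. -/
def Frame.ofLinearMap (L : (ℝ × E2) →ₗ[ℝ] (ℝ × E2)) (hL : ∀ z w, pr (L z) (L w) = pr z w) :
    Frame where
  toEquiv := (LinearEquiv.ofInjectiveEndo L (by
    rw [injective_iff_map_eq_zero]
    intro z hz
    have h1 : pr z z = 0 := by rw [← hL, hz]; simp [pr]
    rw [pr, real_inner_self_eq_norm_sq] at h1
    have h2 : z.1 = 0 := by nlinarith [sq_nonneg ‖z.2‖, mul_self_nonneg z.1]
    have h3 : ‖z.2‖ = 0 := by nlinarith [sq_nonneg ‖z.2‖, mul_self_nonneg z.1]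
    exact Prod.ext h2 (norm_eq_zero.1 h3))).toContinuousLinearEquiv
  pr_map := hL

lemma inner_E2 (x y : E2) : inner ℝ x y = x 0 * y 0 + x 1 * y 1 := by
  simp [PiLp.inner_apply, Fin.sum_univ_two, mul_comm]

lemma inner_perp (ω : E2) : inner ℝ ω (perp ω) = 0 := by
  rw [inner_E2]; simp [perp]; ring

lemma norm_perp (ω : E2) : ‖perp ω‖ = ‖ω‖ := by
  have : ‖perp ω‖ ^ 2 = ‖ω‖ ^ 2 := by
    rw [← real_inner_self_eq_norm_sq, ← real_inner_self_eq_norm_sq, inner_E2, inner_E2]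
    simp [perp]; ring
  exact (sq_eq_sq₀ (norm_nonneg _) (norm_nonneg _)).1 this

section

variable {ω : E2} (lam : ℝ) (hω : ‖ω‖ = 1)

include hω

lemma pr_framePoint (a b d a' b' d' : ℝ) :
    pr (framePoint lam ω a b d) (framePoint lam ω a' b' d') = a * a' + b * b' + d * d' := by
  have h1 : inner ℝ ω ω = (1 : ℝ) := by rw [real_inner_self_eq_norm_sq, hω]; norm_num
  have h2 : inner ℝ (perp ω) (perp ω) = (1 : ℝ) := by
    rw [real_inner_self_eq_norm_sq, norm_perp, hω]; norm_num
  have h3 := inner_perp ω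
  have h4 : inner ℝ (perp ω) ω = (0 : ℝ) := by rw [real_inner_comm]; exact h3
  have hs : (Real.sqrt (1 + lam ^ 2))⁻¹ ^ 2 * (1 + lam ^ 2) = 1 := by
    rw [inv_pow, Real.sq_sqrt (by positivity), inv_mul_cancel₀ (by positivity)]
  simp only [framePoint, Theta, ThetaPerp, ThetaZero, pr_add_left, pr_add_right, pr_smul_left,
    pr_smul_right]
  simp only [pr, inner_smul_left, inner_smul_right, h1, h2, h3, h4]
  simp only [conj_trivial]
  linear_combination (a * a' + b * b') * hs

/-- The frame whose evolution coordinate is `t_Θ`. -/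
def frameT : Frame := Frame.ofLinearMap
  { toFun := fun z => framePoint lam ω z.1 (z.2 0) (z.2 1)
    map_add' := fun z w => by
      simp only [framePoint, Prod.fst_add, Prod.snd_add, PiLp.add_apply]; module
    map_smul' := fun c z => by
      simp only [framePoint, Prod.smul_fst, Prod.smul_snd, PiLp.smul_apply, smul_eq_mul,
        RingHom.id_apply]; module }
  fun z w => (pr_framePoint lam hω _ _ _ _ _ _).trans (by rw [pr, inner_E2]; ring)

/-- The frame whose evolution coordinate is `x²_Θ`. -/
def frameX : Frame := Frame.ofLinearMap
  { toFun := fun z => framePoint lam ω (z.2 0) (z.2 1) z.1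
    map_add' := fun z w => by
      simp only [framePoint, Prod.fst_add, Prod.snd_add, PiLp.add_apply]; module
    map_smul' := fun c z => by
      simp only [framePoint, Prod.smul_fst, Prod.smul_snd, PiLp.smul_apply, smul_eq_mul,
        RingHom.id_apply]; module }
  fun z w => (pr_framePoint lam hω _ _ _ _ _ _).trans (by rw [pr, inner_E2]; ring)

lemma frameT_e0 : (frameT lam hω).e0 = Theta lam ω := by
  change framePoint lam ω 1 ((0 : E2) 0) ((0 : E2) 1) = _
  simp [framePoint]

lemma frameX_e0 : (frameX lam hω).e0 = ThetaZero ω := by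
  change framePoint lam ω ((0 : E2) 0) ((0 : E2) 1) 1 = _
  simp [framePoint]

lemma pr_frameT_e0 (t : ℝ) (x : E2) : pr (t, x) (frameT lam hω).e0 = tTheta lam ω t x := by
  rw [frameT_e0, pr_comm]; rfl

lemma pr_frameX_e0 (t : ℝ) (x : E2) : pr (t, x) (frameX lam hω).e0 = x2Theta ω t x := by
  rw [frameX_e0, pr_comm]; rfl

omit hω in
lemma eLpNorm_E2_eq (G : ℝ × ℝ → ℂ) :
    eLpNorm (fun y : E2 => G (y 0, y 1)) 2 volume = eLpNorm G 2 volume := by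
  have h := (volume_preserving_finTwoArrow ℝ).comp (PiLp.volume_preserving_ofLp (Fin 2))
  have he : MeasurableEmbedding (⇑(MeasurableEquiv.finTwoArrow (α := ℝ)) ∘
      (@WithLp.ofLp 2 (Fin 2 → ℝ))) :=
    (MeasurableEquiv.finTwoArrow (α := ℝ)).measurableEmbedding.comp
      (MeasurableEquiv.toLp 2 (Fin 2 → ℝ)).symm.measurableEmbedding
  have h2 := he.eLpNorm_map_measure (g := G) (p := 2) (μ := (volume : Measure E2))
  rw [h.map_eq] at h2
  rw [h2]
  rfl

lemma slice_frameT (F : ℝ → E2 → ℂ) : (frameT lam hω).slice F = sliceT lam ω F := by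
  ext a
  exact eLpNorm_E2_eq fun y : ℝ × ℝ =>
    F (framePoint lam ω a y.1 y.2).1 (framePoint lam ω a y.1 y.2).2

lemma slice_frameX (F : ℝ → E2 → ℂ) : (frameX lam hω).slice F = sliceX lam ω F := by
  ext a
  exact eLpNorm_E2_eq fun y : ℝ × ℝ =>
    F (framePoint lam ω y.1 y.2 a).1 (framePoint lam ω y.1 y.2 a).2

end

/-! ### Spectral sets near the hyperboloid -/

namespace Frame

variable (Φ : Frame)

/-- The normal component `Frame.nor` in the frequency variable `ξ = 2πζ`. -/
def nu (ξ : E2) : ℝ := Φ.e0.1 * jb ξ - inner ℝ Φ.e0.2 ξ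

lemma nu_two_pi_smul (ζ : E2) : Φ.nu ((2 * Real.pi) • ζ) = 2 * Real.pi * Φ.nor ζ := by
  rw [nu, nor, jb_eq_nb, inner_smul_right]; ring

end Frame

lemma norm_le_jb (ξ : E2) : ‖ξ‖ ≤ jb ξ :=
  Real.le_sqrt_of_sq_le (by linarith)

lemma Frame.abs_nu_le (Φ : Frame) (ξ : E2) : |Φ.nu ξ| ≤ 2 * jb ξ := by
  have h1 := Φ.abs_e0_fst_le
  have h2 := Φ.norm_e0_snd_le
  have h3 := abs_real_inner_le_norm Φ.e0.2 ξ
  have h4 := norm_le_jb ξ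
  have h5 := jb_pos ξ
  have h6 : |Φ.e0.1 * jb ξ| ≤ jb ξ := by
    rw [abs_mul, abs_of_pos h5]; nlinarith
  have h7 : ‖Φ.e0.2‖ * ‖ξ‖ ≤ jb ξ := by nlinarith [norm_nonneg ξ, norm_nonneg Φ.e0.2]
  rw [Frame.nu]
  refine (abs_sub _ _).trans ?_
  linarith

/-- A point near the hyperboloid is reached from it along the evolution direction: the square of
the defining function is quadratic along a line, and it changes sign on the segment. -/
lemma Frame.exists_jb_eq (Φ : Frame) {ξ : E2} {τ Δ ε : ℝ} (hΔ : 0 < Δ) (h1 : 4 * Δ ≤ jb ξ)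
    (h2 : 2 * Δ * |Φ.mink| ≤ |Φ.nu ξ|) (h3 : 2 * ε * jb ξ ≤ Δ * |Φ.nu ξ|)
    (h4 : |τ - jb ξ| ≤ ε) :
    ∃ θ, |θ| ≤ Δ ∧ τ - θ * Φ.e0.1 = jb (ξ - θ • Φ.e0.2) := by
  have hp := jb_pos ξ
  have hνle := Φ.abs_nu_le ξ
  have he := Φ.abs_e0_fst_le
  set ν := Φ.nu ξ with hν
  set P := jb ξ with hP
  have hε0 : 0 ≤ ε := (abs_nonneg _).trans h4
  have hε1 : 8 * ε ≤ |ν| := by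
    have : 2 * ε * P ≤ P / 4 * |ν| := h3.trans (by nlinarith [abs_nonneg ν])
    nlinarith
  let f : ℝ → ℝ := fun θ => (τ ^ 2 - P ^ 2) - 2 * θ * (ν + Φ.e0.1 * (τ - P)) + Φ.mink * θ ^ 2
  have hf : ∀ θ, f θ = (τ - θ * Φ.e0.1) ^ 2 - jb (ξ - θ • Φ.e0.2) ^ 2 := by
    intro θ
    have e := jb_sq ξ
    rw [jb_sq, norm_sub_sq_real, norm_smul, inner_smul_right, mul_pow, Real.norm_eq_abs, sq_abs,
      real_inner_comm]
    simp only [f, Frame.mink]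
    rw [hν, Frame.nu]
    linear_combination -e
  have hc : Continuous f := by fun_prop
  have ha1 : |τ ^ 2 - P ^ 2| ≤ ε * (2 * P + ε) := by
    rw [sq_sub_sq, abs_mul, mul_comm]
    refine mul_le_mul h4 ?_ (abs_nonneg _) hε0
    have := abs_le.1 h4
    rw [abs_le]; constructor <;> linarith
  have ha2 : |Φ.e0.1 * (τ - P)| ≤ ε := by
    rw [abs_mul]
    exact (mul_le_of_le_one_left (abs_nonneg _) he).trans h4
  have ha3 : |Φ.mink * Δ ^ 2| ≤ Δ * |ν| / 2 := by
    rw [abs_mul, abs_of_nonneg (sq_nonneg Δ)]; nlinarith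
  -- the linear term dominates at both ends of the segment
  have hkey : ε * (2 * P + ε) + 2 * Δ * ε + Δ * |ν| / 2 ≤ 2 * Δ * |ν| := by
    have : 8 * ε ≤ 2 * P := hε1.trans hνle
    nlinarith
  obtain ⟨b1, b2⟩ := abs_le.1 ha1
  obtain ⟨b3, b4⟩ := abs_le.1 ha2
  obtain ⟨b5, b6⟩ := abs_le.1 ha3
  have hroot : ∃ θ ∈ Icc (-Δ) Δ, f θ = 0 := by
    rcases le_total 0 ν with h0 | h0
    · rw [abs_of_nonneg h0] at hkey b5 b6
      have c1 : f Δ ≤ 0 := by simp only [f]; nlinarith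
      have c2 : 0 ≤ f (-Δ) := by simp only [f]; nlinarith
      exact intermediate_value_Icc' (by linarith) hc.continuousOn ⟨c1, c2⟩
    · rw [abs_of_nonpos h0] at hkey b5 b6
      have c1 : 0 ≤ f Δ := by simp only [f]; nlinarith
      have c2 : f (-Δ) ≤ 0 := by simp only [f]; nlinarith
      exact intermediate_value_Icc (by linarith) hc.continuousOn ⟨c2, c1⟩
  obtain ⟨θ, hθ, hθ0⟩ := hroot
  have hθ' : |θ| ≤ Δ := abs_le.2 hθ
  refine ⟨θ, hθ', ?_⟩
  rw [hf, sub_eq_zero] at hθ0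
  have h5 : |θ * Φ.e0.1| ≤ Δ := by
    rw [abs_mul]
    exact (mul_le_of_le_one_right (abs_nonneg _) he).trans hθ'
  refine (sq_eq_sq₀ ?_ (jb_pos _).le).1 hθ0
  have := (abs_le.1 h4).1
  have := (abs_le.1 h5).2
  linarith

/-- The estimates for a compact set `A` of frequencies such that, at all points reached from `A`
by moves of length at most `Δ` in the evolution direction, the hyperboloid is transversal to that
direction, and for sources whose modulation is at most `ε`. -/
theorem estimates_of_compact {ρ : ℝ → ℝ} (hρ : IsCutoff ρ) :
    ∃ C : ℝ, 0 < C ∧ ∀ (Φ : Frame) (A A' : Set E2) (B : Set (ℝ × E2)) (Δ ε β : ℝ), 0 < β → 0 < Δ →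
      IsCompact A → IsClosed B → (∀ z ∈ B, z.2 ∈ A ∧ |z.1 - jb z.2| ≤ ε) →
      (∀ ξ ∈ A, ∀ s, |s| ≤ Δ → ξ + s • Φ.e0.2 ∈ A' ∧ 4 * Δ ≤ jb (ξ + s • Φ.e0.2) ∧
        2 * Δ * |Φ.mink| ≤ |Φ.nu (ξ + s • Φ.e0.2)| ∧
        β ^ 2 * jb (ξ + s • Φ.e0.2) ≤ 2 ^ 16 * |Φ.nu (ξ + s • Φ.e0.2)|) →
      (∀ ξ ∈ A, 2 * ε * jb ξ ≤ Δ * |Φ.nu ξ|) →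
      (∀ f : L2, HatSuppIn f A →
        ENNReal.ofReal β * essSup (Φ.slice (freeWave f)) volume ≤ ENNReal.ofReal (C * ‖f‖)) ∧
      ∀ g : ℝ → E2 → ℂ, AEStronglyMeasurable (fun p : ℝ × E2 => g p.1 p.2) volume →
        ∫⁻ a, Φ.slice g a < ⊤ → FourierSuppIn g B →
        (∃ u, IsSolution g u) ∧ ∀ u, IsSolution g u →
          ENNReal.ofReal β * essSup (Φ.slice u) volume ≤
            ENNReal.ofReal (C * β⁻¹) * ∫⁻ a, Φ.slice g a ∧
          ∃ (v₀ : L2) (v : ℝ → L2),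
            IsTruncatedSuperposition (fun t x => pr (t, x) Φ.e0) A' u v₀ v ∧
            ENNReal.ofReal (‖v₀‖ + ∫ s, ‖v s‖) ≤
              ENNReal.ofReal (C * β⁻¹) * ∫⁻ a, Φ.slice g a := by
  obtain ⟨C, hC, hmain⟩ := transversal_estimates hρ (C₁ := 2 ^ 8) (by norm_num)
  refine ⟨C, hC, fun Φ A A' B Δ ε β hβ hΔ hA hBc hB hT hε => ?_⟩
  have hpi := Real.pi_pos
  have h2pi : (0 : ℝ) < 2 * Real.pi := by positivity
  let D : Set E2 := (fun p : E2 × ℝ => (2 * Real.pi)⁻¹ • (p.1 + p.2 • Φ.e0.2)) '' (A ×ˢ Icc (-Δ) Δ)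
  have hDc : IsCompact D := (hA.prod isCompact_Icc).image (by fun_prop)
  have hD : ∀ ζ ∈ D, ∃ ξ ∈ A, ∃ s, |s| ≤ Δ ∧ (2 * Real.pi) • ζ = ξ + s • Φ.e0.2 := by
    rintro ζ ⟨⟨ξ, s⟩, ⟨hξ, hs⟩, rfl⟩
    exact ⟨ξ, hξ, s, abs_le.2 hs, by simp only; rw [smul_inv_smul₀ h2pi.ne']⟩
  have hD' : ∀ ξ ∈ A, ∀ s, |s| ≤ Δ → (2 * Real.pi)⁻¹ • (ξ + s • Φ.e0.2) ∈ D := fun ξ hξ s hs =>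
    ⟨(ξ, s), ⟨hξ, abs_le.1 hs⟩, rfl⟩
  have hAD : ∀ ζ : E2, (2 * Real.pi) • ζ ∈ A → ζ ∈ D := by
    intro ζ hζ
    have := hD' _ hζ 0 (by simpa using hΔ.le)
    rwa [zero_smul, add_zero, inv_smul_smul₀ h2pi.ne'] at this
  have hDA' : ∀ ζ ∈ D, (2 * Real.pi) • ζ ∈ A' := by
    intro ζ hζ
    obtain ⟨ξ, hξ, s, hs, e⟩ := hD ζ hζ
    rw [e]; exact (hT ξ hξ s hs).1
  have htr : IsTransversal Φ D (Δ / (2 * Real.pi)) ((β / 2 ^ 8) ^ 2) := by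
    refine ⟨hDc.measurableSet, hDc.isBounded, by positivity, by positivity, ?_, ?_, ?_⟩ <;>
    · intro ζ hζ
      obtain ⟨ξ, hξ, s, hs, e⟩ := hD ζ hζ
      obtain ⟨-, t1, t2, t3⟩ := hT ξ hξ s hs
      rw [← e] at t1 t2 t3
      rw [Φ.nu_two_pi_smul, abs_mul, abs_of_pos h2pi] at t2 t3
      rw [jb_eq_nb] at t1 t3
      first
        | rw [← mul_div_assoc, div_le_iff₀ h2pi]; linarith
        | (have : 2 * (Δ / (2 * Real.pi)) * |Φ.mink| = 2 * Δ * |Φ.mink| / (2 * Real.pi) := by ring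
           rw [this, div_le_iff₀ h2pi]; linarith)
        | (have : 2 * Real.pi * (β ^ 2 * nb ζ) ≤ 2 * Real.pi * (2 ^ 16 * |Φ.nor ζ|) := by linarith
           have := le_of_mul_le_mul_left this h2pi
           rw [div_pow]
           norm_num at this ⊢
           linarith)
  have hBb : Bornology.IsBounded B := by
    obtain ⟨M, hM⟩ := hA.exists_bound_of_continuousOn (f := jb) continuous_jb.continuousOn
    refine (((Metric.isBounded_Icc (-(M + ε)) (M + ε))).prod hA.isBounded).subset fun z hz => ?_
    obtain ⟨b1, b2⟩ := hB z hz
    have b3 := hM _ b1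
    rw [Real.norm_of_nonneg (jb_pos _).le] at b3
    have := abs_le.1 b2
    have := jb_pos z.2
    exact ⟨⟨by linarith, by linarith⟩, b1⟩
  have hBD : ∀ z : ℝ × E2, (2 * Real.pi) • z ∈ B → z.2 ∈ D ∧
      ∃ θ ζ, |θ| ≤ Δ / (2 * Real.pi) ∧ ζ ∈ D ∧ Φ.pt (θ, ζ) = z := by
    intro z hz
    obtain ⟨b1, b2⟩ := hB _ hz
    refine ⟨hAD _ b1, ?_⟩
    have hT0 := hT _ b1 0 (by simpa using hΔ.le)
    rw [zero_smul, add_zero] at hT0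
    obtain ⟨θ, hθ, e⟩ := Φ.exists_jb_eq hΔ hT0.2.1 hT0.2.2.1 (hε _ b1) b2
    refine ⟨θ / (2 * Real.pi), (2 * Real.pi)⁻¹ • (((2 * Real.pi) • z).2 - θ • Φ.e0.2), ?_, ?_, ?_⟩
    · rw [abs_div, abs_of_pos h2pi]; gcongr
    · have := hD' _ b1 (-θ) (by rwa [abs_neg])
      rwa [neg_smul, ← sub_eq_add_neg] at this
    · have hnb : nb ((2 * Real.pi)⁻¹ • (((2 * Real.pi) • z).2 - θ • Φ.e0.2)) =
          (2 * Real.pi)⁻¹ * (((2 * Real.pi) • z).1 - θ * Φ.e0.1) := by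
        rw [e]
        have := jb_eq_nb ((2 * Real.pi)⁻¹ • (((2 * Real.pi) • z).2 - θ • Φ.e0.2))
        rw [smul_inv_smul₀ h2pi.ne'] at this
        rw [this, inv_mul_cancel_left₀ h2pi.ne']
      refine Prod.ext ?_ ?_
      · simp only [Frame.pt, hyp, Prod.fst_add, Prod.smul_fst, smul_eq_mul] at hnb ⊢
        rw [hnb]; field_simp; ring
      · simp only [Frame.pt, hyp, Prod.snd_add, Prod.smul_snd] at hnb ⊢
        rw [smul_sub, inv_smul_smul₀ h2pi.ne', smul_smul, div_eq_inv_mul, sub_add_cancel]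
  obtain ⟨m1, m2⟩ := hmain Φ D _ β B hβ htr hDc.isClosed hBc hBb hBD
  refine ⟨fun f hf => m1 f ?_, fun g hg hfin hsupp => ?_⟩
  · filter_upwards [hf] with ζ hζ hn
    exact hζ fun hA => hn (hAD _ hA)
  · obtain ⟨m3, m4⟩ := m2 g hg hfin hsupp
    refine ⟨m3, fun u hu => ?_⟩
    obtain ⟨m5, v₀, v, s0, sv, vi, form, bd⟩ := m4 u hu
    have hs : ∀ f : L2, FourierSupported D f → HatSuppIn f A' := by
      intro f hf
      filter_upwards [hf] with ζ hζ hn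
      exact hζ fun hd => hn (hDA' _ hd)
    exact ⟨m5, v₀, v, ⟨hs _ s0, fun s => hs _ (sv s), vi, form⟩, bd⟩

/-! ### The frequency localizations -/

section

variable {ρ : ℝ → ℝ} (hρ : IsCutoff ρ)

include hρ

lemma chi_eq_zero_of_le {k : ℤ} {s : ℝ} (h : |s| ≤ (2 : ℝ) ^ (k - 1)) : chi ρ k s = 0 := by
  have h2 : (2 : ℝ) ^ (-k + 1) * |s| ≤ 1 := by
    calc (2 : ℝ) ^ (-k + 1) * |s| ≤ (2 : ℝ) ^ (-k + 1) * (2 : ℝ) ^ (k - 1) := by gcongr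
      _ = 1 := by rw [← zpow_add₀ two_ne_zero]; simp
  have h1 : (2 : ℝ) ^ (-k) * |s| ≤ 1 := by
    refine le_trans ?_ h2
    gcongr
    · norm_num
    · linarith
  have h3 : (0 : ℝ) ≤ (2 : ℝ) ^ (-k) * |s| := by positivity
  have h4 : (0 : ℝ) ≤ (2 : ℝ) ^ (-k + 1) * |s| := by positivity
  rw [chi, hρ.eq_one _ (by rwa [abs_of_nonneg h3]), hρ.eq_one _ (by rwa [abs_of_nonneg h4]), sub_self]

lemma chi_eq_zero_of_ge {k : ℤ} {s : ℝ} (h : (2 : ℝ) ^ (k + 1) ≤ |s|) : chi ρ k s = 0 := by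
  have h1 : 2 ≤ (2 : ℝ) ^ (-k) * |s| := by
    calc (2 : ℝ) = (2 : ℝ) ^ (-k) * (2 : ℝ) ^ (k + 1) := by rw [← zpow_add₀ two_ne_zero]; simp
      _ ≤ _ := by gcongr
  have h2 : 2 ≤ (2 : ℝ) ^ (-k + 1) * |s| := by
    refine h1.trans ?_
    gcongr
    · norm_num
    · linarith
  rw [chi, hρ.eq_zero (h1.trans (le_abs_self _)), hρ.eq_zero (h2.trans (le_abs_self _)), sub_self]

lemma abs_lt_of_chi_ne_zero {k : ℤ} {s : ℝ} (h : chi ρ k s ≠ 0) :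
    (2 : ℝ) ^ (k - 1) < |s| ∧ |s| < (2 : ℝ) ^ (k + 1) := by
  constructor
  · by_contra hcon
    exact h (chi_eq_zero_of_le hρ (not_lt.1 hcon))
  · by_contra hcon
    exact h (chi_eq_zero_of_ge hρ (not_lt.1 hcon))

lemma abs_lt_of_chiLe_ne_zero {n : ℤ} {s : ℝ} (h : chiLe ρ n s ≠ 0) :
    |s| < (2 : ℝ) ^ (n + 1) := by
  by_contra hcon
  rw [not_lt] at hcon
  refine h ?_
  rw [chiLe]
  have : ∀ i : ℕ, chi ρ (n - (i : ℤ)) s = 0 := fun i => by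
    refine chi_eq_zero_of_ge hρ (le_trans ?_ hcon)
    exact zpow_le_zpow_right₀ (by norm_num) (by omega)
  simp [this]

omit hρ in
lemma chiTilde_eq (ρ : ℝ → ℝ) (k : ℤ) (s : ℝ) : chiTilde ρ k s =
    ρ ((2 : ℝ) ^ (-k - 1) * |s|) - ρ ((2 : ℝ) ^ (-k + 2) * |s|) := by
  rw [chiTilde, chi, chi, chi]
  have e1 : -(k - 1) + 1 = -k + 2 := by ring
  have e2 : -(k - 1) = -k + 1 := by ring
  have e3 : -(k + 1) + 1 = -k := by ring
  have e4 : -(k + 1) = -k - 1 := by ring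
  rw [e1, e2, e3, e4]; ring

/-- The fattened bump is positive within a factor two of the points where the bump is. -/
lemma chiTilde_pos {k : ℤ} {r s : ℝ} (h : chi ρ k r ≠ 0) (hr : 0 ≤ r) (h1 : r / 2 ≤ s)
    (h2 : s ≤ 2 * r) : 0 < chiTilde ρ k s := by
  have hs : 0 ≤ s := by linarith
  rw [chiTilde_eq, abs_of_nonneg hs, sub_pos]
  rw [chi, abs_of_nonneg hr, sub_ne_zero] at h
  have p : (0 : ℝ) < (2 : ℝ) ^ (-k) := by positivity
  have e1 : (2 : ℝ) ^ (-k + 1) = 2 ^ (-k) * 2 := by rw [zpow_add₀ two_ne_zero]; simp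
  have e2 : (2 : ℝ) ^ (-k + 2) = 2 ^ (-k) * 4 := by rw [zpow_add₀ two_ne_zero]; norm_num
  have e3 : (2 : ℝ) ^ (-k - 1) = 2 ^ (-k) / 2 := by rw [zpow_sub₀ two_ne_zero]; simp
  rw [e1] at h
  rw [e2, e3]
  have a1 : ρ (2 ^ (-k) * 2 * r) ≤ ρ (2 ^ (-k) * r) :=
    hρ.anti (mem_Ici.2 (by positivity)) (mem_Ici.2 (by positivity)) (by nlinarith)
  have a2 : ρ (2 ^ (-k) * 4 * s) ≤ ρ (2 ^ (-k) * 2 * r) :=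
    hρ.anti (mem_Ici.2 (by positivity)) (mem_Ici.2 (by positivity)) (by nlinarith)
  have a3 : ρ (2 ^ (-k) * r) ≤ ρ (2 ^ (-k) / 2 * s) :=
    hρ.anti (mem_Ici.2 (by positivity)) (mem_Ici.2 (by positivity)) (by nlinarith)
  exact a2.trans_lt ((lt_of_le_of_ne a1 h.symm).trans_le a3)

variable {S : AngularSystem} {k : ℤ} {l : ℕ} {κ : E2}

lemma norm_of_mem_setA {ξ : E2} (hξ : ξ ∈ setA ρ S k l κ) :
    (2 : ℝ) ^ (k - 1) ≤ ‖ξ‖ ∧ ‖ξ‖ ≤ (2 : ℝ) ^ (k + 1) := by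
  have hc : IsClosed {ξ : E2 | (2 : ℝ) ^ (k - 1) ≤ ‖ξ‖ ∧ ‖ξ‖ ≤ (2 : ℝ) ^ (k + 1)} :=
    (isClosed_le continuous_const continuous_norm).inter
      (isClosed_le continuous_norm continuous_const)
  refine closure_minimal (fun η hη => ?_) hc hξ
  have := abs_lt_of_chi_ne_zero hρ (right_ne_zero_of_mul hη)
  rw [abs_norm] at this
  exact ⟨this.1.le, this.2.le⟩

omit hρ in
lemma mem_cone_of_mem_setA (hκ : κ ∈ S.K l) {ξ : E2} (hξ : ξ ∈ setA ρ S k l κ) :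
    ξ ∈ cone κ (3 / 2 * capAngle l) :=
  S.supp l κ hκ (tsupport_mul_subset_left hξ)

lemma isCompact_setA : IsCompact (setA ρ S k l κ) := by
  refine Metric.isCompact_of_isClosed_isBounded (isClosed_tsupport _) ?_
  refine Metric.isBounded_closedBall (x := (0 : E2)) (r := (2 : ℝ) ^ (k + 1)) |>.subset fun ξ hξ => ?_
  rw [mem_closedBall_zero_iff]
  exact (norm_of_mem_setA hρ hξ).2

/-- Frequencies in the spectral set `B` lie in `A`, and their modulation is bounded. -/
lemma of_mem_setB {c : ℕ} {z : ℝ × E2} (hz : z ∈ setB ρ S c k l κ) :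
    z.2 ∈ setA ρ S k l κ ∧ |z.1 - jb z.2| ≤ (2 : ℝ) ^ (k - 2 * (l : ℤ) - (c : ℤ) + 1) := by
  have hc : IsClosed {z : ℝ × E2 | z.2 ∈ setA ρ S k l κ ∧
      |z.1 - jb z.2| ≤ (2 : ℝ) ^ (k - 2 * (l : ℤ) - (c : ℤ) + 1)} := by
    have c1 : IsClosed {z : ℝ × E2 | z.2 ∈ setA ρ S k l κ} :=
      (isClosed_tsupport _).preimage continuous_snd
    have c2 : IsClosed {z : ℝ × E2 | |z.1 - jb z.2| ≤ (2 : ℝ) ^ (k - 2 * (l : ℤ) - (c : ℤ) + 1)} :=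
      isClosed_le (continuous_fst.sub (continuous_jb.comp continuous_snd)).abs continuous_const
    exact c1.inter c2
  refine closure_minimal (fun q hq => ?_) hc hz
  have h1 := subset_tsupport (fun ξ : E2 => S.η l κ ξ * chi ρ k ‖ξ‖) (right_ne_zero_of_mul hq)
  exact ⟨h1, (abs_lt_of_chiLe_ne_zero hρ (left_ne_zero_of_mul hq)).le⟩

/-- A point of the fattened cone whose size is within a factor two of a point of `A` lies in the
fattened set. Both sets are closures; the points of non-vanishing nearby are used. -/
lemma mem_setAt (hκ : κ ∈ S.K l) {ξ ξ' : E2} (hξ : ξ ∈ setA ρ S k l κ)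
    (hξ' : ξ' ∈ cone κ (2 * capAngle l)) (h1 : ‖ξ‖ / 2 < ‖ξ'‖) (h2 : ‖ξ'‖ < 2 * ‖ξ‖) :
    ξ' ∈ setAt ρ S k l κ := by
  obtain ⟨ξ₀, ⟨a1, a2⟩, a3⟩ : ∃ ξ₀ : E2, (‖ξ₀‖ / 2 < ‖ξ'‖ ∧ ‖ξ'‖ < 2 * ‖ξ₀‖) ∧
      S.η l κ ξ₀ * chi ρ k ‖ξ₀‖ ≠ 0 := by
    have o1 : IsOpen {ξ : E2 | ‖ξ‖ / 2 < ‖ξ'‖} := isOpen_lt (by fun_prop) (by fun_prop)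
    have o2 : IsOpen {ξ : E2 | ‖ξ'‖ < 2 * ‖ξ‖} := isOpen_lt (by fun_prop) (by fun_prop)
    have ho : IsOpen {ξ : E2 | ‖ξ‖ / 2 < ‖ξ'‖ ∧ ‖ξ'‖ < 2 * ‖ξ‖} := o1.inter o2
    obtain ⟨x, hx1, hx2⟩ := mem_closure_iff.1 hξ _ ho ⟨h1, h2⟩
    exact ⟨x, hx1, hx2⟩
  rw [← S.supp_t l κ hκ] at hξ'
  rw [setAt, tsupport, mem_closure_iff]
  intro o ho hmem
  have o1 : IsOpen {ξ : E2 | ‖ξ₀‖ / 2 < ‖ξ‖} := isOpen_lt (by fun_prop) (by fun_prop)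
  have o2 : IsOpen {ξ : E2 | ‖ξ‖ < 2 * ‖ξ₀‖} := isOpen_lt (by fun_prop) (by fun_prop)
  have ho' : IsOpen {ξ : E2 | ‖ξ₀‖ / 2 < ‖ξ‖ ∧ ‖ξ‖ < 2 * ‖ξ₀‖} := o1.inter o2
  obtain ⟨y, ⟨y1, y2, y3⟩, y4⟩ := mem_closure_iff.1 hξ' _ (ho.inter ho') ⟨hmem, a1, a2⟩
  exact ⟨y, y1, mul_ne_zero y4
    (chiTilde_pos hρ (right_ne_zero_of_mul a3) (norm_nonneg _) y2.le y3.le).ne'⟩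

end

/-! ### Angles -/

open InnerProductGeometry

lemma capAngle_bounds (l : ℕ) : (2 : ℝ) ^ (-(l : ℤ)) / 2 ≤ capAngle l ∧
    capAngle l ≤ 4 / 5 * (2 : ℝ) ^ (-(l : ℤ)) ∧ 0 < capAngle l ∧ 2 * capAngle l ≤ Real.pi := by
  set u := (2 : ℝ) ^ (-(l : ℤ)) with hu
  have hu0 : 0 < u := by positivity
  have hu1 : u ≤ 1 := zpow_le_one_of_nonpos₀ (by norm_num) (by omega)
  have hpi := Real.pi_pos
  have hpos : 0 < capAngle l := Real.arcsin_pos.2 (by positivity)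
  have hle : capAngle l ≤ Real.pi / 2 := Real.arcsin_le_pi_div_two _
  have hsin : Real.sin (capAngle l) = u / 2 := Real.sin_arcsin (by linarith) (by linarith)
  refine ⟨?_, ?_, hpos, by linarith⟩
  · rw [← hsin]; exact Real.sin_le hpos.le
  · have := Real.mul_le_sin hpos.le hle
    rw [hsin, div_mul_eq_mul_div, div_le_iff₀ hpi] at this
    have := Real.pi_lt_d2
    nlinarith

lemma mem_cone_iff {κ ξ : E2} (hκ : ‖κ‖ = 1) (hξ : ξ ≠ 0) {φ : ℝ} (h0 : 0 ≤ φ) (h1 : φ ≤ Real.pi) :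
    ξ ∈ cone κ φ ↔ angle ξ κ ≤ φ := by
  have hp : 0 < ‖ξ‖ := norm_pos_iff.2 hξ
  have e : inner ℝ ξ κ = ‖ξ‖ * Real.cos (angle ξ κ) := by
    rw [← cos_angle_mul_norm_mul_norm, hκ]; ring
  rw [cone, mem_ofPred_eq, e, mul_le_mul_iff_right₀ hp,
    Real.strictAntiOn_cos.le_iff_ge ⟨h0, h1⟩ ⟨angle_nonneg _ _, angle_le_pi _ _⟩]

/-- A relative perturbation by `ε` changes the direction by an angle of at most `4ε`. -/
lemma angle_le_of_norm_sub_le {a b : E2} {ε : ℝ} (hε : ε ≤ 1 / 2) (h : ‖a - b‖ ≤ ε * ‖b‖)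
    (hb : b ≠ 0) : angle a b ≤ 4 * ε := by
  have hbp : 0 < ‖b‖ := norm_pos_iff.2 hb
  have hε0 : 0 ≤ ε := by
    by_contra hcon
    have := norm_nonneg (a - b)
    nlinarith
  have ha : ‖b‖ / 2 ≤ ‖a‖ := by
    have := norm_sub_norm_le b a
    rw [norm_sub_rev] at this
    nlinarith
  have hap : 0 < ‖a‖ := by linarith
  have hsplit : inner ℝ a b = ‖b‖ ^ 2 + inner ℝ (a - b) b := by
    rw [inner_sub_left, real_inner_self_eq_norm_sq]; ring
  have hd := abs_real_inner_le_norm (a - b) b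
  have hin : 0 ≤ inner ℝ a b := by
    have := (abs_le.1 hd).1
    rw [hsplit]; nlinarith
  have hang : angle a b ≤ Real.pi / 2 := by
    rw [angle, Real.arccos_le_pi_div_two]; positivity
  have hsin : Real.sin (angle a b) * (‖a‖ * ‖b‖) ≤ ‖a - b‖ * ‖b‖ := by
    rw [sin_angle_mul_norm_mul_norm]
    refine Real.sqrt_le_iff.2 ⟨by positivity, ?_⟩
    have e : a = b + (a - b) := by abel
    have e2 : ‖a‖ ^ 2 = ‖b‖ ^ 2 + 2 * inner ℝ (a - b) b + ‖a - b‖ ^ 2 := by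
      conv_lhs => rw [e]
      rw [norm_add_sq_real, real_inner_comm]
    rw [real_inner_self_eq_norm_sq, real_inner_self_eq_norm_sq, hsplit, e2]
    nlinarith [sq_nonneg (inner ℝ (a - b) b)]
  have hs2 : Real.sin (angle a b) ≤ 2 * ε := by
    have : Real.sin (angle a b) * ‖a‖ ≤ ‖a - b‖ := by
      rw [← mul_assoc] at hsin
      exact le_of_mul_le_mul_right hsin hbp
    have hsn : 0 ≤ Real.sin (angle a b) := sin_angle_nonneg _ _
    nlinarith
  have := Real.mul_le_sin (angle_nonneg a b) hang
  have hpi := Real.pi_lt_four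
  rw [div_mul_eq_mul_div, div_le_iff₀ Real.pi_pos] at this
  nlinarith

/-- A relative perturbation by a small multiple of the cap angle stays in the fattened cone. -/
lemma mem_cone_of_near {κ ξ ξ' : E2} {l : ℕ} {t : ℝ} (hκ : ‖κ‖ = 1) (hξ0 : ξ ≠ 0) (ht : 0 < t)
    (hξ' : ξ' ≠ 0) (hξ : ξ ∈ cone κ (3 / 2 * capAngle l))
    (h : ‖ξ' - t • ξ‖ ≤ (2 : ℝ) ^ (-(l : ℤ)) / 16 * ‖t • ξ‖) : ξ' ∈ cone κ (2 * capAngle l) := by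
  obtain ⟨b1, b2, b3, b4⟩ := capAngle_bounds l
  have hu1 : (2 : ℝ) ^ (-(l : ℤ)) ≤ 1 := zpow_le_one_of_nonpos₀ (by norm_num) (by omega)
  rw [mem_cone_iff hκ hξ0 (by linarith) (by linarith)] at hξ
  rw [mem_cone_iff hκ hξ' (by linarith) (by linarith)]
  have h1 := angle_le_of_norm_sub_le (by linarith) h (smul_ne_zero ht.ne' hξ0)
  have h2 := angle_le_angle_add_angle ξ' (t • ξ) κ
  rw [angle_smul_left_of_pos _ _ ht] at h2
  linarith

lemma norm_sub_le_of_mem_cone {κ e : E2} {φ : ℝ} (hκ : ‖κ‖ = 1) (he : ‖e‖ = 1) (hφ : 0 ≤ φ)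
    (h : e ∈ cone κ φ) : ‖e - κ‖ ≤ φ := by
  rw [cone, mem_ofPred_eq, he, one_mul] at h
  have h1 := Real.one_sub_sq_div_two_le_cos (x := φ)
  have h2 : ‖e - κ‖ ^ 2 ≤ φ ^ 2 := by
    rw [norm_sub_sq_real, hκ, he]; linarith
  exact (sq_le_sq₀ (norm_nonneg _) hφ).1 h2

lemma smul_mem_cone {κ ξ : E2} {φ a : ℝ} (ha : 0 ≤ a) (h : ξ ∈ cone κ φ) : a • ξ ∈ cone κ φ := by
  rw [cone, mem_ofPred_eq] at h ⊢
  rw [norm_smul, Real.norm_of_nonneg ha, inner_smul_left, mul_assoc]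
  exact mul_le_mul_of_nonneg_left h ha

/-- If `ω` has distance at most `8·2^(-l)` from a cap, it has distance at most `11·2^(-l)` from all
directions of the fattened cap. -/
lemma norm_sub_direction_le {κ ω ξ : E2} {l : ℕ} (hκ : ‖κ‖ = 1) (hξ : ξ ≠ 0)
    (hmem : ξ ∈ cone κ (3 / 2 * capAngle l))
    (hα : Metric.infDist ω (cap l κ) ≤ 8 * (2 : ℝ) ^ (-(l : ℤ))) :
    ‖ω - ‖ξ‖⁻¹ • ξ‖ ≤ 11 * (2 : ℝ) ^ (-(l : ℤ)) := by
  obtain ⟨b1, b2, b3, b4⟩ := capAngle_bounds l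
  have hu : (0 : ℝ) < (2 : ℝ) ^ (-(l : ℤ)) := by positivity
  have hne : (cap l κ).Nonempty := by
    refine ⟨κ, ?_, by simpa using hκ⟩
    rw [cone, mem_ofPred_eq, hκ, real_inner_self_eq_norm_sq, hκ]
    simpa using Real.cos_le_one _
  obtain ⟨p, ⟨hp1, hp2⟩, hp3⟩ := (Metric.infDist_lt_iff hne).1
    (hα.trans_lt (by linarith : _ < (17 / 2) * (2 : ℝ) ^ (-(l : ℤ))))
  have hp : ‖p‖ = 1 := by simpa using hp2
  have h1 := norm_sub_le_of_mem_cone hκ hp b3.le hp1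
  have h2 := norm_sub_le_of_mem_cone hκ (norm_smul_inv_norm hξ) (by linarith)
    (smul_mem_cone (inv_nonneg.2 (norm_nonneg ξ)) hmem)
  rw [dist_eq_norm] at hp3
  have e : ω - ‖ξ‖⁻¹ • ξ = (ω - p) + (p - κ) - (‖ξ‖⁻¹ • ξ - κ) := by abel
  rw [e]
  refine (norm_sub_le _ _).trans ?_
  have := norm_add_le (ω - p) (p - κ)
  simp only [RCLike.ofReal_real_eq_id, id_eq] at h2
  linarith

/-! ### The admissible speeds -/

/-- For `λ = (1 + μ⁻²)^(-1/2)` one has `1 - λ² = 1/(1 + μ²)`; here `μ` is comparable with `1/V`. -/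
lemma lam_bounds_of_slope {μ V : ℝ} (hV : 0 < V) (hV1 : V ≤ 1) (h1 : V⁻¹ / 8 ≤ μ)
    (h2 : μ ≤ 8 * V⁻¹) : 0 ≤ 1 / Real.sqrt (1 + (μ ^ 2)⁻¹) ∧
      1 - (1 / Real.sqrt (1 + (μ ^ 2)⁻¹)) ^ 2 ≤ 64 * V ^ 2 ∧
      V ^ 2 / 128 ≤ 1 - (1 / Real.sqrt (1 + (μ ^ 2)⁻¹)) ^ 2 := by
  have hμ : 0 < μ := lt_of_lt_of_le (by positivity) h1
  have e : 1 - (1 / Real.sqrt (1 + (μ ^ 2)⁻¹)) ^ 2 = 1 / (1 + μ ^ 2) := by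
    rw [div_pow, Real.sq_sqrt (by positivity)]; field_simp; ring
  have h3 : 1 ≤ 8 * (V * μ) := by
    have := mul_le_mul_of_nonneg_left h1 hV.le
    rw [← mul_div_assoc, mul_inv_cancel₀ hV.ne'] at this; linarith
  have h4 : V * μ ≤ 8 := by
    have := mul_le_mul_of_nonneg_left h2 hV.le
    rwa [mul_left_comm, mul_inv_cancel₀ hV.ne', mul_one] at this
  refine ⟨by positivity, ?_, ?_⟩
  · rw [e, div_le_iff₀ (by positivity)]
    have : 1 ≤ 64 * (V * μ) ^ 2 := by nlinarith
    nlinarith [sq_nonneg V]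
  · rw [e, le_div_iff₀ (by positivity)]
    have : (V * μ) ^ 2 ≤ 64 := by nlinarith [mul_pos hV hμ]
    nlinarith

/-- At frequency `2^j` the admissible `λ` satisfy `1 - λ² ∼ 2^(-2j)`. -/
lemma lamSet_high {r : ℕ} {j : ℤ} {lam : ℝ} (h : lam ∈ lamSet r j) (hj : 100 ≤ j) :
    0 ≤ lam ∧ 1 - lam ^ 2 ≤ 64 * ((2 : ℝ) ^ (-j)) ^ 2 ∧
      ((2 : ℝ) ^ (-j)) ^ 2 / 128 ≤ 1 - lam ^ 2 := by
  have hV1 : (2 : ℝ) ^ (-j) ≤ 1 := zpow_le_one_of_nonpos₀ (by norm_num) (by omega)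
  have hinv : ((2 : ℝ) ^ (-j))⁻¹ = 2 ^ j := by rw [zpow_neg, inv_inv]
  rcases h with ⟨h1, -⟩ | ⟨-, -, μ, -, h1, h2, rfl⟩ | ⟨-, -, rfl⟩
  · omega
  · refine lam_bounds_of_slope (by positivity) hV1 ?_ ?_
    · rw [hinv]; rw [zpow_sub₀ two_ne_zero] at h1; norm_num at h1 ⊢; exact h1
    · rw [hinv]; rw [zpow_add₀ two_ne_zero] at h2; norm_num at h2 ⊢; linarith
  · have e : (2 : ℝ) ^ (-2 * j) = (((2 : ℝ) ^ j) ^ 2)⁻¹ := by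
      rw [← zpow_natCast, ← zpow_mul, ← zpow_neg]; congr 1; push_cast; ring
    have hp : (0 : ℝ) < 2 ^ j := by positivity
    rw [e]
    refine lam_bounds_of_slope (by positivity) hV1 ?_ ?_ <;> rw [hinv] <;> linarith

/-- At every admissible frequency `1 - λ` is bounded below on the scale `2^(-2j)`, also at `j = 99`,
where `λ` may be close to zero or negative. -/
lemma lamSet_low {r : ℕ} {j : ℤ} {lam : ℝ} (h : lam ∈ lamSet r j) (hj : 99 ≤ j) :
    lam ^ 2 ≤ 1 ∧ ((2 : ℝ) ^ (-j)) ^ 2 / 2 ^ 8 ≤ 1 - lam := by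
  have key : ((2 : ℝ) ^ (-j)) ^ 2 / 2 ^ 7 ≤ 1 - lam ^ 2 := by
    rcases le_or_gt 100 j with h100 | h100
    · have := (lamSet_high h h100).2.2
      norm_num at this ⊢; exact this
    · rcases h with ⟨-, i, rfl, hi⟩ | ⟨h1, -⟩ | ⟨h1, -⟩
      · set V := (2 : ℝ) ^ (-j)
        have hV1 : V ≤ 1 := zpow_le_one_of_nonpos₀ (by norm_num) (by omega)
        have hV0 : 0 < V := by positivity
        have e : (2 : ℝ) ^ (-2 * j - 4) = V ^ 2 / 16 := by
          rw [zpow_sub₀ two_ne_zero, ← zpow_natCast V, ← zpow_mul]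
          norm_num; ring_nf
        rw [e] at hi
        have hsq : ((i : ℝ) * (2 : ℝ) ^ (-(r : ℤ))) ^ 2 ≤ 1 / (1 + V ^ 2 / 16) := by
          have h1 : |(i : ℝ) * (2 : ℝ) ^ (-(r : ℤ))| ≤ 1 / Real.sqrt (1 + V ^ 2 / 16) := by
            rw [abs_mul, abs_of_pos (by positivity : (0 : ℝ) < (2 : ℝ) ^ (-(r : ℤ))), zpow_neg,
              zpow_natCast, ← div_eq_mul_inv, div_le_iff₀ (by positivity)]
            refine hi.trans_eq ?_
            ring
          rw [← sq_abs]
          calc _ ≤ (1 / Real.sqrt (1 + V ^ 2 / 16)) ^ 2 := by gcongr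
            _ = _ := by rw [div_pow, Real.sq_sqrt (by positivity), one_pow]
        have h2 : 1 / (1 + V ^ 2 / 16) ≤ 1 - V ^ 2 / 2 ^ 7 := by
          rw [div_le_iff₀ (by positivity)]
          have hV2 : V ^ 2 ≤ 1 := by nlinarith
          have hV3 : 0 ≤ V ^ 2 * (1 - V ^ 2) := mul_nonneg (sq_nonneg V) (by linarith)
          nlinarith [sq_nonneg V]
        linarith
      · omega
      · omega
  have hV : 0 < ((2 : ℝ) ^ (-j)) ^ 2 := by positivity
  have h1 : lam ^ 2 ≤ 1 := by linarith
  have h2 : lam ≤ 1 := by nlinarith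
  refine ⟨h1, ?_⟩
  nlinarith

/-! ### Transversality of the characteristic frame -/

lemma jb_le (ξ : E2) : jb ξ ≤ 1 + ‖ξ‖ :=
  Real.sqrt_le_iff.2 ⟨by positivity, by nlinarith [norm_nonneg ξ]⟩

section

variable {ω : E2} (hω : ‖ω‖ = 1)

include hω

lemma inner_le_jb (ξ : E2) : inner ℝ ω ξ ≤ jb ξ := by
  have := real_inner_le_norm ω ξ
  rw [hω, one_mul] at this
  exact this.trans (norm_le_jb ξ)

lemma jb_add_smul_sq (ξ : E2) (s : ℝ) :
    jb (ξ + s • ω) ^ 2 = jb ξ ^ 2 + 2 * s * inner ℝ ω ξ + s ^ 2 := by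
  rw [jb_sq, jb_sq, norm_add_sq_real, norm_smul, inner_smul_right, hω, mul_one, Real.norm_eq_abs,
    sq_abs, real_inner_comm]
  ring

lemma inner_add_smul (ξ : E2) (s : ℝ) : inner ℝ ω (ξ + s • ω) = inner ℝ ω ξ + s := by
  rw [inner_add_right, inner_smul_right, real_inner_self_eq_norm_sq, hω]; ring

/-- The quantity `⟨ξ⟩ - ω·ξ` changes little when `ξ` moves by a small fraction of its size in the
direction `ω`, however small it is. -/
lemma charDefect_shift {ξ : E2} {s K : ℝ} (hK : 2 ^ 20 ≤ K) (h1 : K / 2 ≤ ‖ξ‖)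
    (hs : |s| ≤ K / 2 ^ 16) :
    99 / 100 * (jb ξ - inner ℝ ω ξ) ≤ jb (ξ + s • ω) - inner ℝ ω (ξ + s • ω) ∧
    jb (ξ + s • ω) - inner ℝ ω (ξ + s • ω) ≤ 101 / 100 * (jb ξ - inner ℝ ω ξ) ∧
    99 / 100 * ‖ξ‖ ≤ jb (ξ + s • ω) ∧ jb (ξ + s • ω) ≤ 102 / 100 * ‖ξ‖ := by
  have a1 := inner_le_jb hω ξ
  have a2 := inner_le_jb hω (ξ + s • ω)
  have a3 := jb_add_smul_sq hω ξ s
  have a4 := inner_add_smul hω ξ s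
  have a5 := norm_le_jb ξ
  have a6 := jb_pos (ξ + s • ω)
  have a7 := jb_le ξ
  have a8 := abs_real_inner_le_norm ω ξ
  rw [hω, one_mul] at a8
  obtain ⟨s1, s2⟩ := abs_le.1 hs
  obtain ⟨i1, i2⟩ := abs_le.1 a8
  set J := jb ξ
  set J' := jb (ξ + s • ω)
  set Y := inner ℝ ω ξ
  rw [a4] at a2 ⊢
  have hrel : (J' - (Y + s)) * (J + J' + s) = (J - Y) * (J + J' - s) := by
    linear_combination a3
  have hS : K / 2 ≤ J + J' := by linarith
  have hsS : |s| ≤ (J + J') / 2 ^ 15 := by linarith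
  obtain ⟨t1, t2⟩ := abs_le.1 hsS
  have hSp : 0 < J + J' := by linarith
  have b1 : 0 ≤ J - Y := by linarith
  have b2 : 0 ≤ J' - (Y + s) := by linarith
  refine ⟨?_, ?_, ?_, ?_⟩
  · have c1 : (J - Y) * ((1 - 1 / 2 ^ 15) * (J + J')) ≤ (J - Y) * (J + J' - s) :=
      mul_le_mul_of_nonneg_left (by linarith) b1
    have c2 : (J' - (Y + s)) * (J + J' + s) ≤ (J' - (Y + s)) * ((1 + 1 / 2 ^ 15) * (J + J')) :=
      mul_le_mul_of_nonneg_left (by linarith) b2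
    have c3 : (J - Y) * (1 - 1 / 2 ^ 15) ≤ (J' - (Y + s)) * (1 + 1 / 2 ^ 15) := by
      refine le_of_mul_le_mul_right ?_ hSp
      linarith
    linarith
  · have c1 : (J - Y) * (J + J' - s) ≤ (J - Y) * ((1 + 1 / 2 ^ 15) * (J + J')) :=
      mul_le_mul_of_nonneg_left (by linarith) b1
    have c2 : (J' - (Y + s)) * ((1 - 1 / 2 ^ 15) * (J + J')) ≤ (J' - (Y + s)) * (J + J' + s) :=
      mul_le_mul_of_nonneg_left (by linarith) b2
    have c3 : (J' - (Y + s)) * (1 - 1 / 2 ^ 15) ≤ (J - Y) * (1 + 1 / 2 ^ 15) := by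
      refine le_of_mul_le_mul_right ?_ hSp
      linarith
    linarith
  · have := norm_le_jb (ξ + s • ω)
    have h2 := norm_sub_norm_le ξ (-(s • ω))
    rw [sub_neg_eq_add, norm_neg, norm_smul, hω, mul_one, Real.norm_eq_abs] at h2
    linarith
  · have := jb_le (ξ + s • ω)
    have h2 := norm_add_le ξ (s • ω)
    rw [norm_smul, hω, mul_one, Real.norm_eq_abs] at h2
    linarith

/-- The characteristic defect `⟨ξ⟩ - ω·ξ` dominates `1 - λ`. -/
lemma charNormal_lower_of_large {ξ : E2} {s K b lam : ℝ} (hK : 2 ^ 20 ≤ K) (h1 : K / 2 ≤ ‖ξ‖)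
    (hs : |s| ≤ K / 2 ^ 16) (hlam : 0 ≤ lam) (hlam1 : lam ^ 2 ≤ 1) (hb : 1 - lam ^ 2 ≤ b / 128)
    (hX : ‖ξ‖ * b ≤ jb ξ - inner ℝ ω ξ) :
    b / 2 * jb (ξ + s • ω) ≤ |lam * jb (ξ + s • ω) - inner ℝ ω (ξ + s • ω)| ∧
    2 * (K / 2 ^ 16) * (1 - lam ^ 2) ≤ |lam * jb (ξ + s • ω) - inner ℝ ω (ξ + s • ω)| := by
  obtain ⟨c1, -, c3, c4⟩ := charDefect_shift hω hK h1 hs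
  set J' := jb (ξ + s • ω)
  set Y' := inner ℝ ω (ξ + s • ω)
  have hd : 1 - lam ≤ b / 128 := by nlinarith
  have hb0 : 0 ≤ b := by nlinarith
  have hJ' : 0 < J' := jb_pos _
  have e1 : (1 - lam) * J' ≤ b / 128 * (102 / 100 * ‖ξ‖) :=
    mul_le_mul hd c4 hJ'.le (by positivity)
  have hbR : 0 ≤ b * ‖ξ‖ := by positivity
  have e2 : 9 / 10 * (b * ‖ξ‖) ≤ lam * J' - Y' := by linarith
  have e3 : b * J' ≤ 102 / 100 * (b * ‖ξ‖) := by
    have := mul_le_mul_of_nonneg_left c4 hb0; linarith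
  rw [abs_of_nonneg (by linarith)]
  refine ⟨by linarith, ?_⟩
  have e4 : K / 2 ^ 16 * (1 - lam ^ 2) ≤ K / 2 ^ 16 * (b / 128) :=
    mul_le_mul_of_nonneg_left hb (by positivity)
  have e5 : b * (K / 2) ≤ b * ‖ξ‖ := mul_le_mul_of_nonneg_left h1 hb0
  have e6 : 0 ≤ b * K := mul_nonneg hb0 (by linarith)
  linarith

/-- The number `1 - λ` dominates the characteristic defect. -/
lemma charNormal_lower_of_small {ξ : E2} {s K lam : ℝ} (hK : 2 ^ 20 ≤ K) (h1 : K / 2 ≤ ‖ξ‖)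
    (hs : |s| ≤ K / 2 ^ 16) (hlam1 : lam ^ 2 ≤ 1)
    (hX : jb ξ - inner ℝ ω ξ ≤ ‖ξ‖ * (1 - lam) / 64) :
    (1 - lam) / 2 * jb (ξ + s • ω) ≤ |lam * jb (ξ + s • ω) - inner ℝ ω (ξ + s • ω)| ∧
    2 * (K / 2 ^ 16) * (1 - lam ^ 2) ≤ |lam * jb (ξ + s • ω) - inner ℝ ω (ξ + s • ω)| := by
  obtain ⟨-, c2, c3, c4⟩ := charDefect_shift hω hK h1 hs
  set J' := jb (ξ + s • ω)
  set Y' := inner ℝ ω (ξ + s • ω)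
  have hl : lam ≤ 1 := by nlinarith
  have hd0 : 0 ≤ 1 - lam := by linarith
  have e1 : (1 - lam) * (99 / 100 * ‖ξ‖) ≤ (1 - lam) * J' := mul_le_mul_of_nonneg_left c3 hd0
  have e0 : 0 ≤ (1 - lam) * ‖ξ‖ := by positivity
  have e2 : (1 - lam) / 2 * J' ≤ Y' - lam * J' := by linarith
  have e5 : (1 - lam) * (K / 2) ≤ (1 - lam) * ‖ξ‖ := mul_le_mul_of_nonneg_left h1 hd0
  have e6 : 0 ≤ (1 - lam) * K := mul_nonneg hd0 (by linarith)
  rw [abs_sub_comm, abs_of_nonneg (by linarith)]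
  refine ⟨by linarith, ?_⟩
  have e7 : 1 - lam ^ 2 ≤ 2 * (1 - lam) := by nlinarith
  have e4 : K / 2 ^ 16 * (1 - lam ^ 2) ≤ K / 2 ^ 16 * (2 * (1 - lam)) :=
    mul_le_mul_of_nonneg_left e7 (by positivity)
  linarith

/-- The characteristic defect in terms of the angle between `ω` and `ξ`. -/
lemma charDefect_eq {ξ : E2} (hξ : ξ ≠ 0) : jb ξ - inner ℝ ω ξ =
    1 / (jb ξ + ‖ξ‖) + ‖ξ‖ * (‖ω - ‖ξ‖⁻¹ • ξ‖ ^ 2 / 2) := by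
  have hR : 0 < ‖ξ‖ := norm_pos_iff.2 hξ
  have hJ := jb_pos ξ
  have e1 : jb ξ - ‖ξ‖ = 1 / (jb ξ + ‖ξ‖) := by
    rw [eq_div_iff (by positivity)]; linear_combination jb_sq ξ
  have e2 : ‖ω - ‖ξ‖⁻¹ • ξ‖ ^ 2 = 2 - 2 * (‖ξ‖⁻¹ * inner ℝ ω ξ) := by
    rw [norm_sub_sq_real, norm_smul, inner_smul_right, hω, norm_inv, norm_norm,
      inv_mul_cancel₀ hR.ne']
    ring
  rw [← e1, e2]
  field_simp
  ring

end

/-! ### Verification of transversality -/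

lemma zpow_two_sq (a : ℤ) : (2 : ℝ) ^ (2 * a) = ((2 : ℝ) ^ a) ^ 2 := by
  rw [← zpow_natCast, ← zpow_mul]; congr 1; push_cast; ring

/-- The modulation of the spectral set is at most `2^(k-2l-30)`. -/
lemma modulation_le {k : ℤ} {l c : ℕ} (hc : 30 < c) :
    (2 : ℝ) ^ (k - 2 * (l : ℤ) - (c : ℤ) + 1) ≤
      (2 : ℝ) ^ k * ((2 : ℝ) ^ (-(l : ℤ))) ^ 2 / 2 ^ 30 := by
  calc (2 : ℝ) ^ (k - 2 * (l : ℤ) - (c : ℤ) + 1) ≤ (2 : ℝ) ^ (k + 2 * (-(l : ℤ)) - 30) :=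
        zpow_le_zpow_right₀ (by norm_num) (by omega)
    _ = _ := by
        rw [zpow_sub₀ two_ne_zero, zpow_add₀ two_ne_zero, zpow_two_sq]; norm_cast

section

variable {ρ : ℝ → ℝ} (hρ : IsCutoff ρ) {S : AngularSystem} {k : ℤ} {l : ℕ} {κ ω : E2}
  (hκ : κ ∈ S.K l) (hω : ‖ω‖ = 1) (hk : 99 ≤ k)

include hρ in
lemma size_of_mem_setA {ξ : E2} (hξ : ξ ∈ setA ρ S k l κ) :
    (2 : ℝ) ^ k / 2 ≤ ‖ξ‖ ∧ ‖ξ‖ ≤ 2 * (2 : ℝ) ^ k := by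
  have h := norm_of_mem_setA hρ hξ
  rw [zpow_sub₀ two_ne_zero, zpow_add₀ two_ne_zero, zpow_one] at h
  exact ⟨h.1, by linarith [h.2]⟩

include hk in
lemma two_zpow_large : (2 : ℝ) ^ 20 ≤ (2 : ℝ) ^ k := by
  rw [← zpow_natCast]
  exact zpow_le_zpow_right₀ (by norm_num) (by push_cast; omega)

include hρ hκ hω hk

/-- The frequencies of `A` can be moved by `2^(k-16)` in the characteristic direction within the
fattened localization. -/
lemma mem_setAt_add_smul {ξ : E2} (hξ : ξ ∈ setA ρ S k l κ)
    (hdir : ‖ω - ‖ξ‖⁻¹ • ξ‖ ≤ 11 * (2 : ℝ) ^ (-(l : ℤ))) {s : ℝ} (hs : |s| ≤ (2 : ℝ) ^ k / 2 ^ 16) :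
    ξ + s • ω ∈ setAt ρ S k l κ := by
  obtain ⟨r1, r2⟩ := size_of_mem_setA hρ hξ
  have hK := two_zpow_large hk
  set K := (2 : ℝ) ^ k
  have hR : 0 < ‖ξ‖ := by linarith
  have hξ0 : ξ ≠ 0 := norm_pos_iff.1 hR
  have hs' : ‖s • ω‖ = |s| := by rw [norm_smul, hω, mul_one, Real.norm_eq_abs]
  have n1 := norm_add_le ξ (s • ω)
  have n2 := norm_sub_norm_le ξ (-(s • ω))
  rw [sub_neg_eq_add, norm_neg] at n2
  rw [hs'] at n1 n2
  have hne : ξ + s • ω ≠ 0 := norm_pos_iff.1 (by linarith)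
  obtain ⟨s1, s2⟩ := abs_le.1 hs
  have ht : 0 < 1 + s / ‖ξ‖ := by
    have : -1 < s / ‖ξ‖ := by rw [lt_div_iff₀ hR]; linarith
    linarith
  refine mem_setAt hρ hκ hξ (mem_cone_of_near (S.unit l κ hκ) hξ0 ht hne
    (mem_cone_of_mem_setA hκ hξ) ?_) (by linarith) (by linarith)
  have e1 : ξ + s • ω - (1 + s / ‖ξ‖) • ξ = s • (ω - ‖ξ‖⁻¹ • ξ) := by
    rw [add_smul, one_smul, smul_sub, smul_smul, div_eq_mul_inv]; abel
  have e2 : ‖(1 + s / ‖ξ‖) • ξ‖ = ‖ξ‖ + s := by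
    rw [norm_smul, Real.norm_of_nonneg ht.le]; field_simp
  rw [e1, e2, norm_smul, Real.norm_eq_abs]
  have hu : (0 : ℝ) < (2 : ℝ) ^ (-(l : ℤ)) := by positivity
  calc |s| * ‖ω - ‖ξ‖⁻¹ • ξ‖ ≤ K / 2 ^ 16 * (11 * (2 : ℝ) ^ (-(l : ℤ))) :=
        mul_le_mul hs hdir (norm_nonneg _) (by positivity)
    _ = (2 : ℝ) ^ (-(l : ℤ)) / 16 * (K / 2 ^ 16 * 176) := by ring
    _ ≤ _ := by
        refine mul_le_mul_of_nonneg_left ?_ (by positivity)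
        linarith

/-- The hypotheses of `estimates_of_compact` for the characteristic frame, with chart length
`2^(k-16)`, from a lower bound `c₀` for the normal component. Since the
directions of `A` are within `11·2^(-l)` of `ω`, such moves stay in the fattened cone. -/
lemma frameT_conditions {lam c₀ β ε : ℝ} (hlam : lam ^ 2 ≤ 1)
    (hdir : ∀ ξ ∈ setA ρ S k l κ, ‖ω - ‖ξ‖⁻¹ • ξ‖ ≤ 11 * (2 : ℝ) ^ (-(l : ℤ)))
    (hQ : ∀ ξ ∈ setA ρ S k l κ, ∀ s, |s| ≤ (2 : ℝ) ^ k / 2 ^ 16 →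
      c₀ * jb (ξ + s • ω) ≤ |lam * jb (ξ + s • ω) - inner ℝ ω (ξ + s • ω)| ∧
      2 * ((2 : ℝ) ^ k / 2 ^ 16) * (1 - lam ^ 2) ≤
        |lam * jb (ξ + s • ω) - inner ℝ ω (ξ + s • ω)|)
    (hβ : β ^ 2 ≤ 2 ^ 15 * c₀) (hε : ε ≤ (2 : ℝ) ^ k * ((2 : ℝ) ^ (-(l : ℤ))) ^ 2 / 2 ^ 30)
    (hc₀ : ((2 : ℝ) ^ (-(l : ℤ))) ^ 2 ≤ 2 ^ 12 * c₀) :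
    (∀ ξ ∈ setA ρ S k l κ, ∀ s, |s| ≤ (2 : ℝ) ^ k / 2 ^ 16 →
      ξ + s • (frameT lam hω).e0.2 ∈ setAt ρ S k l κ ∧
      4 * ((2 : ℝ) ^ k / 2 ^ 16) ≤ jb (ξ + s • (frameT lam hω).e0.2) ∧
      2 * ((2 : ℝ) ^ k / 2 ^ 16) * |(frameT lam hω).mink| ≤
        |(frameT lam hω).nu (ξ + s • (frameT lam hω).e0.2)| ∧
      β ^ 2 * jb (ξ + s • (frameT lam hω).e0.2) ≤
        2 ^ 16 * |(frameT lam hω).nu (ξ + s • (frameT lam hω).e0.2)|) ∧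
    ∀ ξ ∈ setA ρ S k l κ, 2 * ε * jb ξ ≤ (2 : ℝ) ^ k / 2 ^ 16 * |(frameT lam hω).nu ξ| := by
  have hK := two_zpow_large hk
  set K := (2 : ℝ) ^ k
  set n := (Real.sqrt (1 + lam ^ 2))⁻¹ with hn
  have hn2 : n ^ 2 * (1 + lam ^ 2) = 1 := by
    rw [hn, inv_pow, Real.sq_sqrt (by positivity), inv_mul_cancel₀ (by positivity)]
  have hn0 : 0 < n := by positivity
  have hn1 : n ≤ 1 := by nlinarith [sq_nonneg lam]
  have hnh : 1 / 2 ≤ n := by nlinarith [sq_nonneg lam]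
  have e1 : (frameT lam hω).e0.1 = n * lam := by rw [frameT_e0]; rfl
  have e2 : (frameT lam hω).e0.2 = n • ω := by rw [frameT_e0]; rfl
  have hnu : ∀ ξ, |(frameT lam hω).nu ξ| = n * |lam * jb ξ - inner ℝ ω ξ| := by
    intro ξ
    rw [Frame.nu, e1, e2, inner_smul_left, ← abs_of_pos hn0, ← abs_mul, abs_of_pos hn0]
    simp only [conj_trivial]; congr 1; ring
  have hmink : |(frameT lam hω).mink| = n * n * (1 - lam ^ 2) := by
    rw [Frame.mink, e1, e2, norm_smul, hω, Real.norm_of_nonneg hn0.le, abs_sub_comm, abs_of_nonneg]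
    · ring
    · nlinarith
  constructor
  · intro ξ hξ s hs
    have hs' : |s * n| ≤ K / 2 ^ 16 := by
      rw [abs_mul, abs_of_pos hn0]
      exact (mul_le_of_le_one_right (abs_nonneg _) hn1).trans hs
    obtain ⟨q1, q2⟩ := hQ ξ hξ _ hs'
    rw [hnu, hmink, e2, smul_smul]
    obtain ⟨r1, r2⟩ := size_of_mem_setA hρ hξ
    obtain ⟨-, -, d3, -⟩ := charDefect_shift hω hK r1 hs'
    refine ⟨mem_setAt_add_smul hρ hκ hω hk hξ (hdir ξ hξ) hs', by linarith, ?_, ?_⟩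
    · set Q := |lam * jb (ξ + (s * n) • ω) - inner ℝ ω (ξ + (s * n) • ω)|
      have hw : 0 ≤ 2 * (K / 2 ^ 16) * (1 - lam ^ 2) := mul_nonneg (by positivity) (by linarith)
      calc 2 * (K / 2 ^ 16) * (n * n * (1 - lam ^ 2))
          = n * (n * (2 * (K / 2 ^ 16) * (1 - lam ^ 2))) := by ring
        _ ≤ n * (1 * (2 * (K / 2 ^ 16) * (1 - lam ^ 2))) := by gcongr
        _ ≤ n * Q := by rw [one_mul]; gcongr
    · have hj := jb_pos (ξ + (s * n) • ω)
      have p1 : β ^ 2 * jb (ξ + (s * n) • ω) ≤ 2 ^ 15 * c₀ * jb (ξ + (s * n) • ω) := by gcongr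
      have p2 := mul_le_mul_of_nonneg_right hnh
        (abs_nonneg (lam * jb (ξ + (s * n) • ω) - inner ℝ ω (ξ + (s * n) • ω)))
      linarith
  · intro ξ hξ
    obtain ⟨q1, -⟩ := hQ ξ hξ 0 (by rw [abs_zero]; positivity)
    rw [zero_smul, add_zero] at q1
    rw [hnu]
    have hj := jb_pos ξ
    have p2 := mul_le_mul_of_nonneg_right hnh (abs_nonneg (lam * jb ξ - inner ℝ ω ξ))
    have p3 : ε ≤ K * (2 ^ 12 * c₀) / 2 ^ 30 := hε.trans (by gcongr)
    have p4 : ε * jb ξ ≤ K * (2 ^ 12 * c₀) / 2 ^ 30 * jb ξ := by gcongr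
    have p5 : K / 2 ^ 16 * (1 / 2 * (c₀ * jb ξ)) ≤
        K / 2 ^ 16 * (n * |lam * jb ξ - inner ℝ ω ξ|) :=
      mul_le_mul_of_nonneg_left (by linarith) (by positivity)
    have p6 : 0 ≤ K * (c₀ * jb ξ) := by
      have : 0 ≤ c₀ := by nlinarith [sq_nonneg β]
      positivity
    linarith

/-- The hypotheses of `estimates_of_compact` for the lateral frame, with chart length `2^(k-l-20)`: the
normal component is at least `2^(k-l-5)`, and moves by a small fraction of `2^(k-l)` preserve this
bound and the fattened cone. -/
lemma frameX_conditions {lam β ε : ℝ} (hu1 : (2 : ℝ) ^ (-(l : ℤ)) ≤ 1)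
    (h₁ : ∀ ξ ∈ setA ρ S k l κ, (2 : ℝ) ^ (-(l : ℤ)) / 8 ≤ ‖ω - ‖ξ‖⁻¹ • ξ‖)
    (h₂ : ∀ ξ ∈ setA ρ S k l κ, (2 : ℝ) ^ (-(l : ℤ)) / 8 ≤ ‖ω + ‖ξ‖⁻¹ • ξ‖)
    (hβ : β ^ 2 ≤ 8 * (2 : ℝ) ^ (-(l : ℤ)))
    (hε : ε ≤ (2 : ℝ) ^ k * ((2 : ℝ) ^ (-(l : ℤ))) ^ 2 / 2 ^ 30) :
    (∀ ξ ∈ setA ρ S k l κ, ∀ s, |s| ≤ (2 : ℝ) ^ k * (2 : ℝ) ^ (-(l : ℤ)) / 2 ^ 20 →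
      ξ + s • (frameX lam hω).e0.2 ∈ setAt ρ S k l κ ∧
      4 * ((2 : ℝ) ^ k * (2 : ℝ) ^ (-(l : ℤ)) / 2 ^ 20) ≤ jb (ξ + s • (frameX lam hω).e0.2) ∧
      2 * ((2 : ℝ) ^ k * (2 : ℝ) ^ (-(l : ℤ)) / 2 ^ 20) * |(frameX lam hω).mink| ≤
        |(frameX lam hω).nu (ξ + s • (frameX lam hω).e0.2)| ∧
      β ^ 2 * jb (ξ + s • (frameX lam hω).e0.2) ≤
        2 ^ 16 * |(frameX lam hω).nu (ξ + s • (frameX lam hω).e0.2)|) ∧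
    ∀ ξ ∈ setA ρ S k l κ, 2 * ε * jb ξ ≤
      (2 : ℝ) ^ k * (2 : ℝ) ^ (-(l : ℤ)) / 2 ^ 20 * |(frameX lam hω).nu ξ| := by
  have hK := two_zpow_large hk
  set K := (2 : ℝ) ^ k
  set u := (2 : ℝ) ^ (-(l : ℤ)) with hu
  have hu0 : 0 < u := by positivity
  have hKu : K * u ≤ K := mul_le_of_le_one_right (by linarith) hu1
  have hKu0 : 0 < K * u := by positivity
  have e1 : (frameX lam hω).e0.1 = 0 := by rw [frameX_e0]; rfl
  have e2 : (frameX lam hω).e0.2 = perp ω := by rw [frameX_e0]; rfl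
  have hp1 : ‖perp ω‖ = 1 := by rw [norm_perp, hω]
  have hnu : ∀ ξ, |(frameX lam hω).nu ξ| = |inner ℝ (perp ω) ξ| := by
    intro ξ; rw [Frame.nu, e1, e2, zero_mul, zero_sub, abs_neg]
  have hmink : |(frameX lam hω).mink| = 1 := by
    rw [Frame.mink, e1, e2, hp1]; norm_num
  -- the sine of the angle between `ω` and `ξ`, from the distances of `ξ/|ξ|` to `ω` and to `-ω`
  have hsin : ∀ ξ ∈ setA ρ S k l κ, K * u / 32 ≤ |inner ℝ (perp ω) ξ| := by
    intro ξ hξ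
    obtain ⟨r1, r2⟩ := size_of_mem_setA hρ hξ
    have hR : 0 < ‖ξ‖ := by linarith
    have hpyth : inner ℝ (perp ω) ξ ^ 2 + inner ℝ ω ξ ^ 2 = ‖ξ‖ ^ 2 := by
      have hω2 : ω 0 * ω 0 + ω 1 * ω 1 = 1 := by
        rw [← inner_E2, real_inner_self_eq_norm_sq, hω]; norm_num
      have hξ2 : ‖ξ‖ ^ 2 = ξ 0 * ξ 0 + ξ 1 * ξ 1 := by
        rw [← inner_E2, real_inner_self_eq_norm_sq]
      rw [hξ2, inner_E2, inner_E2]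
      simp only [perp, PiLp.toLp_apply, Matrix.cons_val_zero, Matrix.cons_val_one]
      linear_combination (ξ 0 * ξ 0 + ξ 1 * ξ 1) * hω2
    set c := ‖ξ‖⁻¹ * inner ℝ ω ξ with hc
    have hcR : inner ℝ ω ξ = ‖ξ‖ * c := by rw [hc, mul_inv_cancel_left₀ hR.ne']
    have m1 : ‖ω - ‖ξ‖⁻¹ • ξ‖ ^ 2 = 2 - 2 * c := by
      rw [norm_sub_sq_real, norm_smul, inner_smul_right, hω, norm_inv, norm_norm,
        inv_mul_cancel₀ hR.ne']
      ring
    have m2 : ‖ω + ‖ξ‖⁻¹ • ξ‖ ^ 2 = 2 + 2 * c := by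
      rw [norm_add_sq_real, norm_smul, inner_smul_right, hω, norm_inv, norm_norm,
        inv_mul_cancel₀ hR.ne']
      ring
    have m3 : u ^ 2 / 64 ≤ 2 - 2 * c := by
      rw [← m1]; have := h₁ ξ hξ; nlinarith
    have m4 : u ^ 2 / 64 ≤ 2 + 2 * c := by
      rw [← m2]; have := h₂ ξ hξ; nlinarith
    have m5 : u ^ 2 / 256 ≤ 1 - c ^ 2 := by
      rcases le_total 0 c with h0 | h0 <;> nlinarith [sq_nonneg u]
    have m6 : (K * u / 32) ^ 2 ≤ inner ℝ (perp ω) ξ ^ 2 := by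
      have : inner ℝ (perp ω) ξ ^ 2 = ‖ξ‖ ^ 2 * (1 - c ^ 2) := by
        rw [hcR] at hpyth; linear_combination hpyth
      rw [this]
      calc (K * u / 32) ^ 2 = (K / 2) ^ 2 * (u ^ 2 / 256) := by ring
        _ ≤ _ := by gcongr
    have := Real.sqrt_le_sqrt m6
    rwa [Real.sqrt_sq (by positivity), Real.sqrt_sq_eq_abs] at this
  constructor
  · intro ξ hξ s hs
    obtain ⟨r1, r2⟩ := size_of_mem_setA hρ hξ
    have hR : 0 < ‖ξ‖ := by linarith
    have hξ0 : ξ ≠ 0 := norm_pos_iff.1 hR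
    rw [hnu, hmink, e2]
    have hs' : ‖s • perp ω‖ = |s| := by rw [norm_smul, hp1, mul_one, Real.norm_eq_abs]
    have n1 := norm_add_le ξ (s • perp ω)
    have n2 := norm_sub_norm_le ξ (-(s • perp ω))
    rw [sub_neg_eq_add, norm_neg] at n2
    rw [hs'] at n1 n2
    have hne : ξ + s • perp ω ≠ 0 := norm_pos_iff.1 (by linarith)
    have j1 := norm_le_jb (ξ + s • perp ω)
    have j2 := jb_le (ξ + s • perp ω)
    have q0 := hsin ξ hξ
    have q1 : K * u / 64 ≤ |inner ℝ (perp ω) (ξ + s • perp ω)| := by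
      rw [inner_add_right, inner_smul_right, real_inner_self_eq_norm_sq, hp1]
      have := abs_sub_abs_le_abs_sub (inner ℝ (perp ω) ξ) (-(s * 1 ^ 2))
      rw [sub_neg_eq_add, abs_neg, one_pow, mul_one] at this
      rw [one_pow, mul_one]
      linarith
    refine ⟨?_, by linarith, by linarith, ?_⟩
    · refine mem_setAt hρ hκ hξ (mem_cone_of_near (S.unit l κ hκ) hξ0 one_pos hne
        (mem_cone_of_mem_setA hκ hξ) ?_) (by linarith) (by linarith)
      rw [one_smul, add_sub_cancel_left, hs', ← hu]
      have := mul_le_mul_of_nonneg_left r1 hu0.le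
      linarith
    · have j3 : jb (ξ + s • perp ω) ≤ 4 * K := by linarith
      have : β ^ 2 * jb (ξ + s • perp ω) ≤ 8 * u * (4 * K) :=
        mul_le_mul hβ j3 (jb_pos _).le (by positivity)
      linarith
  · intro ξ hξ
    obtain ⟨r1, r2⟩ := size_of_mem_setA hρ hξ
    rw [hnu]
    have j2 := jb_le ξ
    have j0 := jb_pos ξ
    calc 2 * ε * jb ξ ≤ 2 * (K * u ^ 2 / 2 ^ 30) * (4 * K) :=
          mul_le_mul (by linarith) (by linarith) j0.le (by positivity)
      _ ≤ K * u / 2 ^ 20 * (K * u / 32) := by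
          have : 0 ≤ (K * u) ^ 2 := by positivity
          linarith
      _ ≤ _ := by gcongr; exact hsin ξ hξ

end

/-- In the range of the estimates in `t_Θ`, the normal component of the hyperboloid along `Θ` is
bounded below: either the angle between `ω` and the frequencies or the mass dominates `1 - λ`, or
else `1 - λ` dominates both. -/
lemma exists_charNormal_lower {ρ : ℝ → ℝ} (hρ : IsCutoff ρ) {S : AngularSystem} {r : ℕ}
    {j k m : ℤ} {l : ℕ} {κ ω : E2} {lam α α' : ℝ} (hκ : κ ∈ S.K l) (hω : ‖ω‖ = 1)
    (hm : m = min j k) (hm99 : 99 ≤ m) (hlam : lam ∈ lamSet r j)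
    (hα : α = Metric.infDist ω (cap l κ)) (hα' : α' = max α ((2 : ℝ) ^ (-m)))
    (hpos : (100 ≤ j ∧ (l : ℤ) ≤ m + 9 ∧
        (2 : ℝ) ^ (-3 - (l : ℤ)) ≤ α ∧ α ≤ (2 : ℝ) ^ (3 - (l : ℤ)) ∧
        ∀ ξ ∈ setA ρ S k l κ, (2 : ℝ) ^ (-3 - (l : ℤ)) ≤ ‖ω - ‖ξ‖⁻¹ • ξ‖) ∨
      ((l : ℤ) = m + 10 ∧ α ≤ (2 : ℝ) ^ (3 - (l : ℤ))))
    (hR : (l : ℤ) ≤ m - 10 ∨ ((l : ℤ) = m + 10 ∧ 10 ≤ |j - k|)) :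
    ∃ c₀ : ℝ, lam ^ 2 ≤ 1 ∧
      (∀ ξ ∈ setA ρ S k l κ, ‖ω - ‖ξ‖⁻¹ • ξ‖ ≤ 11 * (2 : ℝ) ^ (-(l : ℤ))) ∧
      (∀ ξ ∈ setA ρ S k l κ, ∀ s, |s| ≤ (2 : ℝ) ^ k / 2 ^ 16 →
        c₀ * jb (ξ + s • ω) ≤ |lam * jb (ξ + s • ω) - inner ℝ ω (ξ + s • ω)| ∧
        2 * ((2 : ℝ) ^ k / 2 ^ 16) * (1 - lam ^ 2) ≤
          |lam * jb (ξ + s • ω) - inner ℝ ω (ξ + s • ω)|) ∧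
      α' ^ 2 ≤ 2 ^ 15 * c₀ ∧ ((2 : ℝ) ^ (-(l : ℤ))) ^ 2 ≤ 2 ^ 12 * c₀ := by
  have hj : 99 ≤ j := hm99.trans (hm.trans_le (min_le_left _ _))
  have hk : 99 ≤ k := hm99.trans (hm.trans_le (min_le_right _ _))
  have hK := two_zpow_large hk
  obtain ⟨hlam1, hlamd⟩ := lamSet_low hlam hj
  have e1 : (2 : ℝ) ^ (-3 - (l : ℤ)) = (2 : ℝ) ^ (-(l : ℤ)) / 8 := by
    rw [sub_eq_add_neg, zpow_add₀ two_ne_zero]; norm_num; ring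
  have e2 : (2 : ℝ) ^ (3 - (l : ℤ)) = 8 * (2 : ℝ) ^ (-(l : ℤ)) := by
    rw [sub_eq_add_neg, zpow_add₀ two_ne_zero]; norm_num
  rw [e1, e2] at hpos
  have hα8 : α ≤ 8 * (2 : ℝ) ^ (-(l : ℤ)) := by
    rcases hpos with ⟨-, -, -, h, -⟩ | ⟨-, h⟩ <;> exact h
  have hα0 : 0 ≤ α := by rw [hα]; exact Metric.infDist_nonneg
  have hne : ∀ ξ ∈ setA ρ S k l κ, ξ ≠ 0 := fun ξ hξ =>
    norm_pos_iff.1 (by linarith [(size_of_mem_setA hρ hξ).1])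
  have hdir : ∀ ξ ∈ setA ρ S k l κ, ‖ω - ‖ξ‖⁻¹ • ξ‖ ≤ 11 * (2 : ℝ) ^ (-(l : ℤ)) := fun ξ hξ =>
    norm_sub_direction_le (S.unit l κ hκ) (hne ξ hξ) (mem_cone_of_mem_setA hκ hξ)
      (hα ▸ hα8)
  set K := (2 : ℝ) ^ k with hKdef
  set u := (2 : ℝ) ^ (-(l : ℤ)) with hu
  set V := (2 : ℝ) ^ (-j) with hV
  set M := (2 : ℝ) ^ (-m) with hM
  have hu0 : 0 < u := by positivity
  have hV0 : 0 < V := by positivity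
  have hM0 : 0 < M := by positivity
  have hscale : ∀ {a b : ℤ}, a + 10 ≤ b → (2 : ℝ) ^ (-b) ≤ (2 : ℝ) ^ (-a) / 2 ^ 10 := by
    intro a b hab
    calc (2 : ℝ) ^ (-b) ≤ (2 : ℝ) ^ (-a - 10) := zpow_le_zpow_right₀ (by norm_num) (by omega)
      _ = _ := by rw [zpow_sub₀ two_ne_zero]; norm_cast
  rcases hR with hl | ⟨hl, hjk⟩
  · -- the angle dominates: `1 - λ²` is small against `2^(-2l)`
    obtain ⟨hj100, h3, h5⟩ : 100 ≤ j ∧ u / 8 ≤ α ∧ ∀ ξ ∈ setA ρ S k l κ, u / 8 ≤ ‖ω - ‖ξ‖⁻¹ • ξ‖ := by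
      rcases hpos with ⟨a1, -, a2, -, a3⟩ | ⟨a1, -⟩
      · exact ⟨a1, a2, a3⟩
      · omega
    obtain ⟨g1, g2, -⟩ := lamSet_high hlam hj100
    have hVu : V ≤ u / 2 ^ 10 := hscale (by omega)
    have hMu : M ≤ u / 2 ^ 10 := hscale (by omega)
    have hα'8 : α' ≤ 8 * u := by rw [hα']; exact max_le hα8 (by linarith)
    have hα'0 : 0 ≤ α' := by rw [hα']; exact hα0.trans (le_max_left _ _)
    refine ⟨u ^ 2 / 128 / 2, hlam1, hdir, fun ξ hξ s hs => ?_, ?_, ?_⟩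
    · obtain ⟨r1, r2⟩ := size_of_mem_setA hρ hξ
      refine charNormal_lower_of_large hω hK r1 hs g1 hlam1 ?_ ?_
      · have : V ^ 2 ≤ (u / 2 ^ 10) ^ 2 := by gcongr
        have : 0 ≤ u ^ 2 := sq_nonneg u
        linarith
      · rw [charDefect_eq hω (hne ξ hξ)]
        have i1 : 0 ≤ 1 / (jb ξ + ‖ξ‖) := by have := jb_pos ξ; positivity
        have i2 : (u / 8) ^ 2 ≤ ‖ω - ‖ξ‖⁻¹ • ξ‖ ^ 2 := by gcongr; exact h5 ξ hξ
        have i3 : ‖ξ‖ * (u ^ 2 / 128) ≤ ‖ξ‖ * (‖ω - ‖ξ‖⁻¹ • ξ‖ ^ 2 / 2) := by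
          exact mul_le_mul_of_nonneg_left (by linarith) (norm_nonneg ξ)
        linarith
    · have := pow_le_pow_left₀ hα'0 hα'8 2
      linarith [sq_nonneg u]
    · linarith [sq_nonneg u]
  · have huM : u = M / 2 ^ 10 := by
      rw [hu, hl, hM, neg_add, ← sub_eq_add_neg, zpow_sub₀ two_ne_zero]; norm_cast
    have hα'M : α' = M := by rw [hα']; exact max_eq_right (by linarith)
    have hR0 : ∀ ξ ∈ setA ρ S k l κ, K / 2 ≤ ‖ξ‖ ∧ ‖ξ‖ ≤ 2 * K := fun ξ hξ =>
      size_of_mem_setA hρ hξ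
    have hKinv : K * (2 : ℝ) ^ (-k) = 1 := by
      rw [hKdef, ← zpow_add₀ two_ne_zero]; simp
    rcases le_or_gt (k + 10) j with hjk' | hjk'
    · -- the mass dominates: `j` exceeds `k = m`, so that `1 - λ` is small against `2^(-2k)`
      have hmk : m = k := by omega
      obtain ⟨g1, g2, -⟩ := lamSet_high hlam (by omega)
      have hVM : V ≤ M / 2 ^ 10 := hscale (by omega)
      have hKM : K * M = 1 := by rw [hM, hmk]; exact hKinv
      refine ⟨M ^ 2 / 9 / 2, hlam1, hdir, fun ξ hξ s hs => ?_, ?_, ?_⟩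
      · obtain ⟨r1, r2⟩ := hR0 ξ hξ
        refine charNormal_lower_of_large hω hK r1 hs g1 hlam1 ?_ ?_
        · have : V ^ 2 ≤ (M / 2 ^ 10) ^ 2 := by gcongr
          have : 0 ≤ M ^ 2 := sq_nonneg M
          linarith
        · rw [charDefect_eq hω (hne ξ hξ)]
          have hRp : 0 < ‖ξ‖ := by linarith
          have i1 : 0 ≤ ‖ξ‖ * (‖ω - ‖ξ‖⁻¹ • ξ‖ ^ 2 / 2) := by positivity
          have i2 : ‖ξ‖ * (M ^ 2 / 9) ≤ 1 / (jb ξ + ‖ξ‖) := by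
            have hJ := jb_pos ξ
            rw [le_div_iff₀ (by positivity)]
            have hJ2 := jb_le ξ
            have i3 : ‖ξ‖ * M ≤ 2 := by
              calc ‖ξ‖ * M ≤ 2 * K * M := by gcongr
                _ = 2 := by rw [mul_assoc, hKM, mul_one]
            have i4 : M ≤ 1 / 2 ^ 20 := by
              rw [le_div_iff₀ (by positivity)]; nlinarith
            have i5 : (jb ξ + ‖ξ‖) * M ≤ 4 + 1 / 2 ^ 20 := by nlinarith
            calc ‖ξ‖ * (M ^ 2 / 9) * (jb ξ + ‖ξ‖) = (‖ξ‖ * M) * ((jb ξ + ‖ξ‖) * M) / 9 := by ring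
              _ ≤ 2 * (4 + 1 / 2 ^ 20) / 9 := by gcongr
              _ ≤ 1 := by norm_num
          linarith
      · rw [hα'M]; linarith [sq_nonneg M]
      · rw [huM]; linarith [sq_nonneg M]
    · -- the difference `1 - λ` dominates: `j = m`, the mass term is of the order `2^(-2k)`, and the
      -- angle is at most `11·2^(-m-10)`
      have hjk2 : j + 10 ≤ k := by
        rcases abs_cases (j - k) with ⟨h, -⟩ | ⟨h, -⟩ <;> omega
      have hmj : m = j := by omega
      have hVM : V = M := by rw [hV, hM, hmj]
      rw [hVM] at hlamd
      have hKM : (2 : ℝ) ^ (-k) ≤ M / 2 ^ 10 := hscale (by omega)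
      refine ⟨(1 - lam) / 2, hlam1, hdir, fun ξ hξ s hs => ?_, ?_, ?_⟩
      · obtain ⟨r1, r2⟩ := hR0 ξ hξ
        refine charNormal_lower_of_small hω hK r1 hs hlam1 ?_
        rw [charDefect_eq hω (hne ξ hξ)]
        have hRp : 0 < ‖ξ‖ := by linarith
        have hJ := norm_le_jb ξ
        have i1 : 1 / (jb ξ + ‖ξ‖) ≤ ‖ξ‖ * (2 * (M / 2 ^ 10) ^ 2) := by
          rw [div_le_iff₀ (by linarith)]
          have i2 : 1 / 2 ≤ ‖ξ‖ * (M / 2 ^ 10) := by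
            calc (1 : ℝ) / 2 = K / 2 * (2 : ℝ) ^ (-k) := by linarith
              _ ≤ _ := by gcongr
          have i3 : 1 ≤ (jb ξ + ‖ξ‖) * (M / 2 ^ 10) := by nlinarith
          calc (1 : ℝ) = 2 * (1 / 2) * 1 := by norm_num
            _ ≤ 2 * (‖ξ‖ * (M / 2 ^ 10)) * ((jb ξ + ‖ξ‖) * (M / 2 ^ 10)) :=
                mul_le_mul (by linarith) i3 zero_le_one (by positivity)
            _ = _ := by ring
        have i4 : ‖ω - ‖ξ‖⁻¹ • ξ‖ ^ 2 ≤ (11 * (M / 2 ^ 10)) ^ 2 := by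
          rw [← huM]
          exact pow_le_pow_left₀ (norm_nonneg _) (hdir ξ hξ) 2
        have i5 : ‖ξ‖ * (‖ω - ‖ξ‖⁻¹ • ξ‖ ^ 2 / 2) ≤ ‖ξ‖ * ((11 * (M / 2 ^ 10)) ^ 2 / 2) :=
          mul_le_mul_of_nonneg_left (by linarith) (norm_nonneg ξ)
        have i6 : ‖ξ‖ * (M ^ 2 / 2 ^ 8) ≤ ‖ξ‖ * (1 - lam) :=
          mul_le_mul_of_nonneg_left hlamd (norm_nonneg ξ)
        have i7 : 0 ≤ ‖ξ‖ * M ^ 2 := by positivity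
        linarith
      · rw [hα'M]; linarith [sq_nonneg M]
      · rw [huM]; linarith [sq_nonneg M]

end HalfKG

end

open HalfKG in
theorem theorem2p3 (ρ : ℝ → ℝ) (hρ : IsCutoff ρ) (S : AngularSystem) (c : ℕ) (hc : 30 < c) :
    ∃ C : ℝ, 0 < C ∧ ∀ (r : ℕ) (j k m : ℤ) (l : ℕ) (κ ω : E2) (lam α α' : ℝ),
      m = min j k → 99 ≤ m → (l : ℤ) ≤ m + 10 → κ ∈ S.K l → ‖ω‖ = 1 →
      (lam, ω) ∈ LambdaSet r j ω →
      α = Metric.infDist ω (cap l κ) → α' = max α ((2 : ℝ) ^ (-m)) →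
      -- the angular position of `ω`
      ((100 ≤ j ∧ (l : ℤ) ≤ m + 9 ∧
          (2 : ℝ) ^ (-3 - (l : ℤ)) ≤ α ∧ α ≤ (2 : ℝ) ^ (3 - (l : ℤ)) ∧
          ∀ ξ ∈ setA ρ S k l κ, (2 : ℝ) ^ (-3 - (l : ℤ)) ≤ ‖ω - ‖ξ‖⁻¹ • ξ‖) ∨
        ((l : ℤ) = m + 10 ∧ α ≤ (2 : ℝ) ^ (3 - (l : ℤ)))) →
      -- the estimates in `t_Θ`
      (((l : ℤ) ≤ m - 10 ∨ ((l : ℤ) = m + 10 ∧ 10 ≤ |j - k|)) →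
        (∀ f : L2, HatSuppIn f (setA ρ S k l κ) →
          ENNReal.ofReal α' * normLinfT lam ω (freeWave f) ≤ ENNReal.ofReal (C * ‖f‖)) ∧
        (∀ g : ℝ → E2 → ℂ,
          AEStronglyMeasurable (fun p : ℝ × E2 => g p.1 p.2) volume →
          normL1T lam ω g < ⊤ → FourierSuppIn g (setB ρ S c k l κ) →
          (∃ u, IsSolution g u) ∧
          ∀ u, IsSolution g u →
            ENNReal.ofReal α' * normLinfT lam ω u ≤
              ENNReal.ofReal (C * α'⁻¹) * normL1T lam ω g ∧
            ∃ (v₀ : L2) (v : ℝ → L2),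
              IsTruncatedSuperposition (tTheta lam ω) (setAt ρ S k l κ) u v₀ v ∧
              ENNReal.ofReal (‖v₀‖ + ∫ s, ‖v s‖) ≤
                ENNReal.ofReal (C * α'⁻¹) * normL1T lam ω g)) ∧
      -- the estimates in `x²_Θ`
      ((l : ℤ) ≤ m + 9 →
        (∀ ξ ∈ setA ρ S k l κ, (2 : ℝ) ^ (-3 - (l : ℤ)) ≤ ‖ω + ‖ξ‖⁻¹ • ξ‖) →
        (∀ f : L2, HatSuppIn f (setA ρ S k l κ) →
          ENNReal.ofReal (Real.sqrt α) * normLinfX lam ω (freeWave f) ≤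
            ENNReal.ofReal (C * ‖f‖)) ∧
        (∀ g : ℝ → E2 → ℂ,
          AEStronglyMeasurable (fun p : ℝ × E2 => g p.1 p.2) volume →
          normL1X lam ω g < ⊤ → FourierSuppIn g (setB ρ S c k l κ) →
          (∃ u, IsSolution g u) ∧
          ∀ u, IsSolution g u →
            ENNReal.ofReal (Real.sqrt α) * normLinfX lam ω u ≤
              ENNReal.ofReal (C * (Real.sqrt α)⁻¹) * normL1X lam ω g ∧
            ∃ (v₀ : L2) (v : ℝ → L2),
              IsTruncatedSuperposition (x2Theta ω) (setAt ρ S k l κ) u v₀ v ∧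
              ENNReal.ofReal (‖v₀‖ + ∫ s, ‖v s‖) ≤
                ENNReal.ofReal (C * (Real.sqrt α)⁻¹) * normL1X lam ω g)) := by
  obtain ⟨C, hC, hest⟩ := estimates_of_compact hρ
  refine ⟨C, hC, fun r j k m l κ ω lam α α' hm hm99 hlm hκ hω hlam hα hα' hpos => ⟨fun hR => ?_,
    fun hl h₂ => ?_⟩⟩
  · have hlam' : lam ∈ lamSet r j := hlam.1
    have hk : 99 ≤ k := hm99.trans (hm.trans_le (min_le_right _ _))
    obtain ⟨c₀, hlam1, hdir, hQ, hβ, hc₀⟩ := exists_charNormal_lower hρ hκ hω hm hm99 hlam' hα hα' hpos hR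
    obtain ⟨t1, t2⟩ := frameT_conditions hρ hκ hω hk hlam1 hdir hQ hβ (modulation_le hc) hc₀
    have hα'0 : 0 < α' := by rw [hα']; exact lt_max_of_lt_right (by positivity)
    have h := hest (frameT lam hω) _ _ _ _ _ α' hα'0 (by positivity) (isCompact_setA hρ)
      (isClosed_tsupport _) (fun z hz => of_mem_setB hρ hz) t1 t2
    simp only [slice_frameT, pr_frameT_e0] at h
    exact h
  · have hk : 99 ≤ k := hm99.trans (hm.trans_le (min_le_right _ _))
    rcases hpos with ⟨-, -, h3, h4, h5⟩ | ⟨h6, -⟩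
    · have hu1 : (2 : ℝ) ^ (-(l : ℤ)) ≤ 1 := zpow_le_one_of_nonpos₀ (by norm_num) (by omega)
      have e1 : (2 : ℝ) ^ (-3 - (l : ℤ)) = (2 : ℝ) ^ (-(l : ℤ)) / 8 := by
        rw [sub_eq_add_neg, zpow_add₀ two_ne_zero]; norm_num; ring
      have e2 : (2 : ℝ) ^ (3 - (l : ℤ)) = 8 * (2 : ℝ) ^ (-(l : ℤ)) := by
        rw [sub_eq_add_neg, zpow_add₀ two_ne_zero]; norm_num
      have hα0 : 0 < α := lt_of_lt_of_le (by positivity) h3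
      rw [e1] at h5 h₂
      rw [e2] at h4
      obtain ⟨t1, t2⟩ := frameX_conditions (lam := lam) (β := Real.sqrt α) hρ hκ hω hk hu1 h5 h₂
        (by rwa [Real.sq_sqrt hα0.le]) (modulation_le hc)
      have h := hest (frameX lam hω) _ _ _ _ _ (Real.sqrt α) (Real.sqrt_pos.2 hα0) (by positivity)
        (isCompact_setA hρ) (isClosed_tsupport _) (fun z hz => of_mem_setB hρ hz) t1 t2
      simp only [slice_frameX, pr_frameX_e0] at h
      exact h
    · omega
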